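/- Let $G$ be a locally compact (Hausdorff) group and let $\sigma=(\mathbb T\stackrel{\iota}{\hookrightarrow}G_\sigma\stackrel{q}{\twoheadrightarrow}G)$ be a twist for $G$, i.e. a central extension of $G$ by the circle group $\mathbb T$ with $G_\sigma$ locally compact. For $\tilde g\in G_\sigma$ write $g=q(\tilde g)$. Let $dg$ be a (regular, left) Haar measure on $G$, $\Delta$ the modular function of $G$, and normalize the Haar measure of $G_\sigma$ so that $q$ is measure preserving (equivalently, $\mathbb T$ has mass one). Let * $C_0(G)\rtimes_{\mathrm{rt}}G$ be the (full) crossed product for the right translation action $(\mathrm{rt}_gf)(t)=f(tg)$; * $C_0(G)\rtimes_{(\mathrm{rt},\iota^\sigma)}G$ be the (full) Green-twisted crossed product for the inflation of $\mathrm{rt}$ to $G_\sigma$ and the twist $\iota^\sigma(z)=z1$, i.e. the enveloping $C^*$-algebra of $\{f\in C_c(G_\sigma,C_0(G)): f(z\tilde g)=\bar zf(\tilde g)\}$ with $f*h(\tilde g)=\int_Gf(\tilde t)\,\mathrm{rt}_t(h(\tilde t^{-1}\tilde g))\,dt$ and $f^*(\tilde g)=\Delta(g^{-1})\,\mathrm{rt}_g(f(\tilde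 g^{-1}))^*$; * $C_0(G_\sigma,\bar\iota)=\{f\in C_0(G_\sigma): f(\tilde gz)=\bar zf(\tilde g)\}$, a $C_0(G)$–$C_0(G)$ imprimitivity bimodule under pointwise operations, with linking algebra $L=\left(\begin{smallmatrix}C_0(G)&C_0(G_\sigma,\bar\iota)\\ C_0(G_\sigma,\bar\iota)^*&C_0(G)\end{smallmatrix}\right)$, on which $(G_\sigma,\mathbb T)$ acts by the twisted action $(\mathrm{Rt},\tau)$, where $\mathrm{Rt}$ is right translation in all entries and $\tau_z=\mathrm{diag}(1,z)$; * $C_0(G_\sigma,\bar\iota)\rtimes_{\mathrm{rt}^\sigma}G$ be the upper right corner of the Green-twisted crossed product $L\rtimes_{(\mathrm{Rt},\tau)}G$, i.e. the closure in it of $\{f\in C_c(G_\sigma,C_0(G_\sigma,\bar\iota)): f(z\tilde g)=\bar zf(\tilde g)\}$; * $L^2(G_\sigma,\iota)=\{\xi\in L^2(G_\sigma):\xi(\tilde gz)=z\xi(\tilde g)\}$, and $$(M(f)\xi)(t)=f(t)\xi(t),\quad(\rho_g\xi)(t)=\Delta(g)^{1/2}\xi(tg)\quad\text{on }L^2(G),$$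 $$(M^\sigma(f)\eta)(\tilde t)=f(t)\eta(\tilde t),\quad(\rho^\sigma_{\tilde g}\eta)(\tilde t)=\Delta(g)^{1/2}\eta(\tilde t\tilde g)\quad\text{on }L^2(G_\sigma,\iota).$$ Then, for $f\in C_0(G_\sigma,\bar\iota)$, the formula $(L^\sigma(f)\eta)(g)=f(\tilde g)\eta(\tilde g)$ defines a bounded operator $L^\sigma(f):L^2(G_\sigma,\iota)\to L^2(G)$. The algebras $C_0(G)\rtimes_{\mathrm{rt}}G$ and $C_0(G)\rtimes_{(\mathrm{rt},\iota^\sigma)}G$ are (via the canonical maps) the diagonal corners of $L\rtimes_{(\mathrm{Rt},\tau)}G$; $C_0(G_\sigma,\bar\iota)\rtimes_{\mathrm{rt}^\sigma}G$ is a $C_0(G)\rtimes_{\mathrm{rt}}G$–$C_0(G)\rtimes_{(\mathrm{rt},\iota^\sigma)}G$ imprimitivity bimodule with the actions and inner products given by the multiplication and involution of $L\rtimes_{(\mathrm{Rt},\tau)}G$; and there is a representation $$(M\rtimes\rho,\;L^\sigma\rtimes\rho^\sigma,\;M^\sigma\rtimes\rho^\sigma)$$ of this imprimitivity bimodule on the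 pair of Hilbert spaces $(L^2(G),L^2(G_\sigma,\iota))$ (two $*$-homomorphisms and a linear map into $\mathcal B(L^2(G))$, $\mathcal B(L^2(G_\sigma,\iota),L^2(G))$, $\mathcal B(L^2(G_\sigma,\iota))$, compatible with the actions and inner products) which is given on continuous compactly supported functions by $(M\rtimes\rho)(f)=\int_GM(f(g))\rho_g\,dg$, $(L^\sigma\rtimes\rho^\sigma)(f)=\int_{G}L^\sigma(f(\tilde g))\rho^\sigma_{\tilde g}\,dg$ and $(M^\sigma\rtimes\rho^\sigma)(f)=\int_{G}M^\sigma(f(\tilde g))\rho^\sigma_{\tilde g}\,dg$. The three maps are injective and their ranges are exactly the compact operators $\mathcal K(L^2(G))$, $\mathcal K(L^2(G_\sigma,\iota),L^2(G))$ and $\mathcal K(L^2(G_\sigma,\iota))$; so the triple identifies $C_0(G_\sigma,\bar\iota)\rtimes_{\mathrm{rt}^\sigma}G$ with the $\mathcal K(L^2(G))$–$\mathcal K(L^2(G_\sigma,\iota))$ imprimitivity bimodule $\mathcal K(L^2(G_\sigma,\iota),L^2(G))$. Moreover, the triple extends to an isomorphism of multiplier bimodules $${}_{\mathcal M(C_0(G)\rtimes_{\mathrm{rt}}G)}\mathcal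 M\big(C_0(G_\sigma,\bar\iota)\rtimes_{\mathrm{rt}^\sigma}G\big)_{\mathcal M(C_0(G)\rtimes_{(\mathrm{rt},\iota^\sigma)}G)}\;\cong\;{}_{\mathcal B(L^2(G))}\mathcal B\big(L^2(G_\sigma,\iota),L^2(G)\big)_{\mathcal B(L^2(G_\sigma,\iota))},$$ i.e. to two $*$-isomorphisms and a linear bijection compatible with the actions and the inner products. Here the multiplier bimodule $\mathcal M(X)$ of an $A$–$B$ imprimitivity bimodule $X$ consists of the pairs $(m_A,m_B)$ of an $A$-linear map $m_A:A\to X$ and a $B$-linear map $m_B:B\to X$ with $m_A(a)\cdot b=a\cdot m_B(b)$ for all $a\in A$, $b\in B$. -/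

import Mathlib

set_option linter.unusedSectionVars false

noncomputable section

namespace TwistCP

open UniformSpace MeasureTheory MeasureTheory.Measure Topology Filter
open scoped MultiplierAlgebra ZeroAtInfty Matrix.Norms.L2Operator InnerProductSpace

/-! ## The enveloping C*-algebra of a seminormed *-algebra -/

section Envelope

variable {𝒜 : Type*} [NonUnitalRing 𝒜] [StarRing 𝒜] [Module ℂ 𝒜]

/-- C*-seminorms on a complex *-algebra. -/
structure IsCStarSeminorm (p : Seminorm ℂ 𝒜) : Prop where
  mul_le : ∀ x y, p (x * y) ≤ p x * p y
  star_mul_self : ∀ x, p (star x * x) = p x ^ 2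

theorem IsCStarSeminorm.star_eq {p : Seminorm ℂ 𝒜} (hp : IsCStarSeminorm p) (x : 𝒜) :
    p (star x) = p x := by
  have key : ∀ y : 𝒜, p y ≤ p (star y) := by
    intro y
    by_contra! h
    have h0 : 0 < p y := lt_of_le_of_lt (apply_nonneg p _) h
    have h1 := hp.star_mul_self y
    have h2 := hp.mul_le (star y) y
    nlinarith
  have := key (star x)
  rw [star_star] at this
  exact le_antisymm this (key x)

/-- The largest C*-seminorm dominated by `N` (for the crossed products, `N` is the `L¹`-norm;
see `envSeminorm_isCStar` and `le_envSeminorm`). -/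
def envSeminorm (N : Seminorm ℂ 𝒜) : Seminorm ℂ 𝒜 :=
  sSup {p | IsCStarSeminorm p ∧ p ≤ N}

variable {N : Seminorm ℂ 𝒜}

theorem bddAbove_env : BddAbove {p : Seminorm ℂ 𝒜 | IsCStarSeminorm p ∧ p ≤ N} :=
  ⟨N, fun _ hp => hp.2⟩

theorem le_envSeminorm {p : Seminorm ℂ 𝒜} (hp : IsCStarSeminorm p) (hN : p ≤ N) :
    p ≤ envSeminorm N := le_csSup bddAbove_env ⟨hp, hN⟩

theorem env_nonempty : {p : Seminorm ℂ 𝒜 | IsCStarSeminorm p ∧ p ≤ N}.Nonempty :=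
  ⟨0, ⟨by simp, by simp⟩, fun x => by simp⟩

theorem envSeminorm_le : envSeminorm N ≤ N := csSup_le env_nonempty fun _ hp => hp.2

theorem envSeminorm_le_of {x : 𝒜} {c : ℝ}
    (h : ∀ p : Seminorm ℂ 𝒜, IsCStarSeminorm p → p ≤ N → p x ≤ c) : envSeminorm N x ≤ c := by
  rw [envSeminorm, Seminorm.sSup_apply bddAbove_env]
  have := env_nonempty (N := N).to_subtype
  exact ciSup_le fun p => h p.1 p.2.1 p.2.2

theorem envSeminorm_isCStar : IsCStarSeminorm (envSeminorm N) where
  mul_le x y := envSeminorm_le_of fun p hp hN => (hp.mul_le x y).trans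
    (mul_le_mul (le_envSeminorm hp hN x) (le_envSeminorm hp hN y) (apply_nonneg _ _)
      (apply_nonneg _ _))
  star_mul_self x := by
    apply le_antisymm
    · refine envSeminorm_le_of fun p hp hN => ?_
      rw [hp.star_mul_self]
      exact pow_le_pow_left₀ (apply_nonneg _ _) (le_envSeminorm hp hN x) 2
    · have : envSeminorm N x ≤ √(envSeminorm N (star x * x)) := by
        refine envSeminorm_le_of fun p hp hN => Real.le_sqrt_of_sq_le ?_
        rw [← hp.star_mul_self]
        exact le_envSeminorm hp hN _
      calc envSeminorm N x ^ 2 ≤ √(envSeminorm N (star x * x)) ^ 2 :=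
            pow_le_pow_left₀ (apply_nonneg _ _) this 2
        _ = _ := Real.sq_sqrt (apply_nonneg _ _)

/-- The *-algebra `𝒜`, regarded as a seminormed space with the seminorm `envSeminorm N`. -/
def PreEnv (_N : Seminorm ℂ 𝒜) : Type _ := 𝒜

namespace PreEnv

instance instNonUnitalRing : NonUnitalRing (PreEnv N) := inferInstanceAs (NonUnitalRing 𝒜)
instance : StarRing (PreEnv N) := inferInstanceAs (StarRing 𝒜)
instance instModule : Module ℂ (PreEnv N) := inferInstanceAs (Module ℂ 𝒜)
instance [h : StarModule ℂ 𝒜] : StarModule ℂ (PreEnv N) := h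
instance [h : IsScalarTower ℂ 𝒜 𝒜] : IsScalarTower ℂ (PreEnv N) (PreEnv N) := h
instance [h : SMulCommClass ℂ 𝒜 𝒜] : SMulCommClass ℂ (PreEnv N) (PreEnv N) := h

instance : Norm (PreEnv N) := ⟨fun x => envSeminorm N x⟩

instance instPseudoMetricSpace : PseudoMetricSpace (PreEnv N) :=
  (envSeminorm N).toAddGroupSeminorm.toSeminormedAddGroup.toPseudoMetricSpace

instance instNonUnitalSeminormedRing : NonUnitalSeminormedRing (PreEnv N) where
  toNonUnitalRing := instNonUnitalRing
  toPseudoMetricSpace := instPseudoMetricSpace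
  dist_eq x y := (envSeminorm N).toAddGroupSeminorm.toSeminormedAddGroup.dist_eq x y
  norm_mul_le x y := envSeminorm_isCStar.mul_le x y

theorem norm_def (x : PreEnv N) : ‖x‖ = envSeminorm N x := rfl

instance instNormedSpace : NormedSpace ℂ (PreEnv N) where
  toModule := instModule
  norm_smul_le c x := (map_smul_eq_mul (envSeminorm N) c x).le

instance : NormedStarGroup (PreEnv N) where
  norm_star_le x := (envSeminorm_isCStar.star_eq x).le

theorem norm_star_mul_self' (x : PreEnv N) : ‖star x * x‖ = ‖x‖ * ‖x‖ := by
  rw [← sq]; exact envSeminorm_isCStar.star_mul_self x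

end PreEnv

/-- The enveloping C*-algebra: the Hausdorff completion of `𝒜` with respect to the largest
C*-seminorm dominated by `N`. -/
def Env (N : Seminorm ℂ 𝒜) : Type _ := Completion (PreEnv N)

namespace Env

instance instNormedAddCommGroup : NormedAddCommGroup (Env N) :=
  inferInstanceAs (NormedAddCommGroup (Completion (PreEnv N)))
instance instNormedSpace : NormedSpace ℂ (Env N) := inferInstanceAs (NormedSpace ℂ (Completion (PreEnv N)))
instance instCompleteSpace : CompleteSpace (Env N) := inferInstanceAs (CompleteSpace (Completion (PreEnv N)))

/-- The canonical continuous linear map of the seminormed *-algebra into its completion. -/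
def coeL (N : Seminorm ℂ 𝒜) : PreEnv N →L[ℂ] Env N := Completion.toComplL

theorem norm_coeL (x : PreEnv N) : ‖coeL N x‖ = ‖x‖ := Completion.norm_coe (E := PreEnv N) x

theorem isDenseInducing_coeL : IsDenseInducing (coeL N) :=
  Completion.isDenseInducing_coe (α := PreEnv N)

theorem denseRange_coeL : DenseRange (coeL N) := isDenseInducing_coeL.dense

instance : Mul (Env N) := ⟨fun x y =>
  (isDenseInducing_coeL.prodMap isDenseInducing_coeL).extend
    (fun p : PreEnv N × PreEnv N => coeL N (p.1 * p.2)) (x, y)⟩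

theorem coeL_mul (x y : PreEnv N) : coeL N (x * y) = coeL N x * coeL N y :=
  ((isDenseInducing_coeL.prodMap isDenseInducing_coeL).extend_eq
    ((coeL N).continuous.comp continuous_mul) (x, y)).symm

instance : ContinuousMul (Env N) where
  continuous_mul := by
    let m := (AddMonoidHom.mul : PreEnv N →+ PreEnv N →+ PreEnv N).compr₂
      ((coeL N : PreEnv N →ₗ[ℂ] Env N).toAddMonoidHom)
    have : Continuous fun p : PreEnv N × PreEnv N => m p.1 p.2 :=
      (coeL N).continuous.comp continuous_mul
    have di : IsDenseInducing ((coeL N : PreEnv N →ₗ[ℂ] Env N).toAddMonoidHom) :=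
      isDenseInducing_coeL
    exact (di.extend_Z_bilin di this :)

instance : Star (Env N) := ⟨isDenseInducing_coeL.extend (fun x => coeL N (star x))⟩

theorem coeL_star (x : PreEnv N) : coeL N (star x) = star (coeL N x) :=
  (isDenseInducing_coeL.extend_eq ((coeL N).continuous.comp continuous_star) x).symm

instance : ContinuousStar (Env N) where
  continuous_star := by
    have hu : UniformContinuous (fun x : PreEnv N => coeL N (star x)) := by
      refine AddMonoidHomClass.uniformContinuous_of_bound
        ((coeL N : PreEnv N →ₗ[ℂ] Env N).toAddMonoidHom.comp
          (starAddEquiv (R := PreEnv N)).toAddMonoidHom) 1 fun x => ?_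
      change ‖coeL N (star x)‖ ≤ _
      rw [norm_coeL, norm_star, one_mul]
    have hi : IsUniformInducing (coeL N) := Completion.isUniformInducing_coe (PreEnv N)
    exact (uniformContinuous_uniformly_extend hi denseRange_coeL hu).continuous

@[elab_as_elim]
theorem induction₁ {P : Env N → Prop} (x : Env N) (hc : IsClosed {x | P x})
    (h : ∀ x, P (coeL N x)) : P x := isClosed_property denseRange_coeL hc h x

@[elab_as_elim]
theorem induction₂ {P : Env N → Env N → Prop} (x y : Env N)
    (hc : IsClosed {p : Env N × Env N | P p.1 p.2})
    (h : ∀ x y, P (coeL N x) (coeL N y)) : P x y :=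
  isClosed_property2 denseRange_coeL hc h x y

@[elab_as_elim]
theorem induction₃ {P : Env N → Env N → Env N → Prop} (x y z : Env N)
    (hc : IsClosed {p : Env N × Env N × Env N | P p.1 p.2.1 p.2.2})
    (h : ∀ x y z, P (coeL N x) (coeL N y) (coeL N z)) : P x y z :=
  isClosed_property3 denseRange_coeL hc h x y z

instance instNonUnitalRing : NonUnitalRing (Env N) :=
  { NormedAddCommGroup.toAddCommGroup (E := Env N), (inferInstance : Mul (Env N)) with
    zero_mul := fun x => induction₁ x (isClosed_eq (by fun_prop) (by fun_prop)) fun x => by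
      rw [← map_zero (coeL N), ← coeL_mul, zero_mul]
    mul_zero := fun x => induction₁ x (isClosed_eq (by fun_prop) (by fun_prop)) fun x => by
      rw [← map_zero (coeL N), ← coeL_mul, mul_zero]
    mul_assoc := fun x y z => induction₃ x y z (isClosed_eq (by fun_prop) (by fun_prop))
      fun x y z => by simp only [← coeL_mul, mul_assoc]
    left_distrib := fun x y z => induction₃ x y z (isClosed_eq (by fun_prop) (by fun_prop))
      fun x y z => by simp only [← coeL_mul, ← map_add, mul_add]
    right_distrib := fun x y z => induction₃ x y z (isClosed_eq (by fun_prop) (by fun_prop))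
      fun x y z => by simp only [← coeL_mul, ← map_add, add_mul] }

instance instNonUnitalNormedRing : NonUnitalNormedRing (Env N) where
  toNonUnitalRing := instNonUnitalRing
  toMetricSpace := instNormedAddCommGroup.toMetricSpace
  dist_eq := instNormedAddCommGroup.dist_eq
  norm_mul_le x y := induction₂ x y (isClosed_le (by fun_prop) (by fun_prop)) fun x y => by
    rw [← coeL_mul, norm_coeL, norm_coeL, norm_coeL]; exact norm_mul_le x y

instance instStarRing : StarRing (Env N) where
  star_involutive x := induction₁ x (isClosed_eq (by fun_prop) (by fun_prop))
    fun x => by rw [← coeL_star, ← coeL_star, star_star]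
  star_mul x y := induction₂ x y (isClosed_eq (by fun_prop) (by fun_prop))
    fun x y => by simp only [← coeL_star, ← coeL_mul, star_mul]
  star_add x y := induction₂ x y (isClosed_eq (by fun_prop) (by fun_prop))
    fun x y => by simp only [← coeL_star, ← map_add, star_add]

instance instCStarRing : CStarRing (Env N) where
  norm_mul_self_le x := induction₁ x (isClosed_le (by fun_prop) (by fun_prop)) fun x => by
    rw [← coeL_star, ← coeL_mul, norm_coeL, norm_coeL, PreEnv.norm_star_mul_self']

variable [StarModule ℂ 𝒜] [IsScalarTower ℂ 𝒜 𝒜] [SMulCommClass ℂ 𝒜 𝒜]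

theorem continuous_smul' (c : ℂ) : Continuous fun x : Env N => c • x :=
  Completion.continuous_map (α := PreEnv N)

theorem smul_coeL (c : ℂ) (x : PreEnv N) : c • coeL N x = coeL N (c • x) :=
  ((coeL N).map_smul c x).symm

instance instIsScalarTower : IsScalarTower ℂ (Env N) (Env N) where
  smul_assoc c x y := by
    refine induction₂ x y (isClosed_eq ?_ ?_) fun x y => ?_
    · exact ((continuous_smul' c).comp continuous_fst).mul continuous_snd
    · exact (continuous_smul' c).comp continuous_mul
    · rw [smul_coeL, smul_eq_mul, smul_eq_mul, ← coeL_mul, ← coeL_mul, smul_coeL,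
        smul_mul_assoc]

instance instSMulCommClass : SMulCommClass ℂ (Env N) (Env N) where
  smul_comm c x y := by
    refine induction₂ x y (isClosed_eq ?_ ?_) fun x y => ?_
    · exact (continuous_smul' c).comp continuous_mul
    · exact continuous_fst.mul ((continuous_smul' c).comp continuous_snd)
    · rw [smul_coeL, smul_eq_mul, smul_eq_mul, ← coeL_mul, ← coeL_mul, smul_coeL,
        mul_smul_comm]

instance instStarModule : StarModule ℂ (Env N) where
  star_smul c x := by
    refine induction₁ x (isClosed_eq ?_ ?_) fun x => ?_
    · exact continuous_star.comp (continuous_smul' c)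
    · exact (continuous_smul' (star c)).comp continuous_star
    · rw [smul_coeL, ← coeL_star, ← coeL_star, smul_coeL, star_smul]

instance instNonUnitalCStarAlgebra : NonUnitalCStarAlgebra (Env N) where

/-- The canonical *-homomorphism of `𝒜` into its enveloping C*-algebra. -/
def of (N : Seminorm ℂ 𝒜) : 𝒜 →⋆ₙₐ[ℂ] Env N where
  toFun x := coeL N x
  map_smul' c x := (coeL N).map_smul c x
  map_zero' := (coeL N).map_zero
  map_add' x y := (coeL N).map_add x y
  map_mul' x y := coeL_mul x y
  map_star' x := coeL_star x

theorem norm_of (x : 𝒜) : ‖of N x‖ = envSeminorm N x := norm_coeL x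

theorem denseRange_of : DenseRange (of N) := denseRange_coeL

variable {ℬ : Type*} [NonUnitalRing ℬ] [StarRing ℬ] [Module ℂ ℬ] [StarModule ℂ ℬ]
  [IsScalarTower ℂ ℬ ℬ] [SMulCommClass ℂ ℬ ℬ] {N' : Seminorm ℂ ℬ}

theorem envSeminorm_map_le (φ : 𝒜 →⋆ₙₐ[ℂ] ℬ) (hφ : ∀ x, N' (φ x) ≤ N x) (x : 𝒜) :
    envSeminorm N' (φ x) ≤ envSeminorm N x := by
  let p : Seminorm ℂ 𝒜 := (envSeminorm N').comp (φ : 𝒜 →ₗ[ℂ] ℬ)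
  have hp : ∀ x, p x = envSeminorm N' (φ x) := fun x => rfl
  rw [← hp]
  refine le_envSeminorm ⟨fun x y => ?_, fun x => ?_⟩ (fun x => ?_) x
  · rw [hp, hp, hp, map_mul]; exact envSeminorm_isCStar.mul_le _ _
  · rw [hp, hp, map_mul, map_star]; exact envSeminorm_isCStar.star_mul_self _
  · exact (envSeminorm_le (φ x)).trans (hφ x)

/-- A contractive *-homomorphism `𝒜 → ℬ`, as a continuous linear map between the seminormed
*-algebras. -/
def preMap (φ : 𝒜 →⋆ₙₐ[ℂ] ℬ) (hφ : ∀ x, N' (φ x) ≤ N x) : PreEnv N →L[ℂ] PreEnv N' :=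
  LinearMap.mkContinuous
    { toFun := fun x => φ x
      map_add' := fun x y => map_add φ x y
      map_smul' := fun c x => map_smul φ c x } 1
    fun x => by rw [one_mul]; exact envSeminorm_map_le φ hφ x

/-- Functoriality of the enveloping C*-algebra: the *-homomorphism which extends a contractive
*-homomorphism `φ`. -/
def map (φ : 𝒜 →⋆ₙₐ[ℂ] ℬ) (hφ : ∀ x, N' (φ x) ≤ N x) : Env N →⋆ₙₐ[ℂ] Env N' :=
  let F : Env N →L[ℂ] Env N' := ((coeL N').comp (preMap φ hφ)).extend (coeL N)
  have hF : ∀ x, F (coeL N x) = coeL N' (preMap φ hφ x) := fun x =>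
    ContinuousLinearMap.extend_eq _ denseRange_coeL
      (Completion.isUniformInducing_coe (PreEnv N)) x
  { toFun := F
    map_smul' := fun c x => F.map_smul c x
    map_zero' := F.map_zero
    map_add' := F.map_add
    map_mul' := fun x y => induction₂ x y (isClosed_eq (by fun_prop) (by fun_prop))
      fun x y => by
        rw [← coeL_mul, hF, hF, hF, ← coeL_mul]
        congr 1; exact map_mul φ x y
    map_star' := fun x => induction₁ x (isClosed_eq (by fun_prop) (by fun_prop))
      fun x => by
        rw [← coeL_star, hF, hF, ← coeL_star]
        congr 1; exact map_star φ x }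

theorem map_of (φ : 𝒜 →⋆ₙₐ[ℂ] ℬ) (hφ : ∀ x, N' (φ x) ≤ N x) (x : 𝒜) :
    map φ hφ (of N x) = of N' (φ x) :=
  ContinuousLinearMap.extend_eq ((coeL N').comp (preMap φ hφ)) denseRange_coeL
    (Completion.isUniformInducing_coe (PreEnv N)) x

end Env
end Envelope

/-! ## The convolution algebra of a C*-dynamical system -/

section Modular

variable {H : Type*} [TopologicalSpace H] [Group H] [IsTopologicalGroup H] [LocallyCompactSpace H]

/-- The modular function, normalized by `∫ f(ts) dt = Δ(s)⁻¹ ∫ f(t) dt` for left Haar measure `dt`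
(Mathlib's `modularCharacter` is its inverse). -/
def modularΔ (s : H) : ℝ := modularCharacter s⁻¹

theorem modularΔ_inv (s : H) : modularΔ s⁻¹ = (modularCharacter s : ℝ) := by
  rw [modularΔ, inv_inv]

theorem modularΔ_one : modularΔ (1 : H) = 1 := by simp [modularΔ]

theorem modularΔ_mul (s t : H) : modularΔ (s * t) = modularΔ s * modularΔ t := by
  simp only [modularΔ, mul_inv_rev, map_mul, NNReal.coe_mul]; ring

theorem modularΔ_pos (s : H) : 0 < modularΔ s := by
  simpa [modularΔ, modularCharacter] using modularCharacterFun_pos s⁻¹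

theorem modularCharacter_mul_integral [MeasurableSpace H] [BorelSpace H] (μ : Measure H)
    [IsHaarMeasure μ] {f : H → ℝ} (hf : Continuous f) (h'f : HasCompactSupport f) (s : H) :
    (modularCharacter s : ℝ) * ∫ x, f x ∂μ = ∫ x, f (x * s) ∂μ := by
  have h : (modularCharacter s) = haarScalarFactor (map (· * s) μ) μ :=
    modularCharacterFun_eq_haarScalarFactor μ s
  have := integral_isMulLeftInvariant_eq_smul_of_hasCompactSupport (map (· * s) μ) μ hf h'f
  rw [integral_smul_nnreal_measure, ← h, integral_map (by fun_prop)
    hf.aestronglyMeasurable] at this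
  rw [this]; rfl

theorem continuous_modularΔ : Continuous (modularΔ : H → ℝ) := by
  borelize H
  let μ : Measure H := haar
  obtain ⟨f, hf, f0, f1⟩ := exists_continuous_nonneg_pos (1 : H)
  have hpos : ∫ x, f x ∂μ ≠ 0 :=
    (f.continuous.integral_pos_of_hasCompactSupport_nonneg_nonzero hf f0 f1).ne'
  have key : ∀ s : H, modularΔ s = (∫ x, f (x * s⁻¹) ∂μ) / ∫ x, f x ∂μ := fun s => by
    rw [← modularCharacter_mul_integral μ f.continuous hf, modularΔ, mul_div_cancel_right₀ _ hpos]
  rw [show (modularΔ : H → ℝ) = _ from funext key]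
  refine Continuous.div_const ?_ _
  refine continuous_iff_continuousAt.2 fun s₀ => ?_
  obtain ⟨t, t_comp, ht⟩ : ∃ t, IsCompact t ∧ t ∈ 𝓝 s₀ := exists_compact_mem_nhds s₀
  have A : ContinuousOn (fun s : H => ∫ x, f (x * s⁻¹) ∂μ) t := by
    have hk : IsCompact ((fun p : H × H => p.1 * p.2) '' (tsupport f ×ˢ t)) :=
      (hf.prod t_comp).image continuous_mul
    refine continuousOn_integral_of_compact_support hk (f := fun s x => f (x * s⁻¹)) ?_ ?_
    · exact (f.continuous.comp (continuous_snd.mul continuous_fst.inv)).continuousOn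
    · intro s x hs hx
      by_contra h
      exact hx ⟨(x * s⁻¹, s), ⟨subset_tsupport _ h, hs⟩, by simp⟩
  exact A.continuousAt ht

end Modular

/-- A (strongly continuous) action of a topological group on a C*-algebra by *-automorphisms. -/
structure CStarAction (H A : Type*) [TopologicalSpace H] [Group H] [NonUnitalCStarAlgebra A] where
  /-- The action; since `H` is a group, every `act h` is a *-automorphism. -/
  act : H →* (A →⋆ₙₐ[ℂ] A)
  continuous_act : ∀ a, Continuous fun h => act h a

namespace CStarAction

variable {H A : Type*} [TopologicalSpace H] [Group H] [NonUnitalCStarAlgebra A]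
  (α : CStarAction H A)

theorem act_mul (s t : H) (a : A) : α.act (s * t) a = α.act s (α.act t a) := by
  rw [map_mul]; rfl

theorem act_one (a : A) : α.act 1 a = a := by rw [map_one]; rfl

/-- The automorphism `act h` as a continuous linear map. -/
def actL (h : H) : A →L[ℂ] A :=
  LinearMap.mkContinuous
    { toFun := fun a => α.act h a
      map_add' := fun a b => map_add (α.act h) a b
      map_smul' := fun c a => map_smul (α.act h) c a } 1
    fun a => by rw [one_mul]; exact NonUnitalStarAlgHom.norm_apply_le (α.act h) a

theorem actL_apply (h : H) (a : A) : α.actL h a = α.act h a := rfl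

theorem continuous_uncurry : Continuous fun p : H × A => α.act p.1 p.2 := by
  refine continuous_iff_continuousAt.2 fun ⟨h₀, a₀⟩ => ?_
  have h1 : Filter.Tendsto (fun p : H × A => α.act p.1 a₀) (𝓝 (h₀, a₀)) (𝓝 (α.act h₀ a₀)) :=
    ((α.continuous_act a₀).comp continuous_fst).tendsto _
  have h2 : Filter.Tendsto (fun p : H × A => α.act p.1 (p.2 - a₀)) (𝓝 (h₀, a₀)) (𝓝 0) := by
    refine squeeze_zero_norm (fun p => NonUnitalStarAlgHom.norm_apply_le (α.act p.1) _) ?_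
    have : Continuous fun p : H × A => ‖p.2 - a₀‖ := by fun_prop
    simpa using this.tendsto (h₀, a₀)
  have h3 := h1.add h2
  simp only [map_sub, add_sub_cancel, add_zero] at h3
  exact h3

theorem continuous_comp {X : Type*} [TopologicalSpace X] {f : X → H} {g : X → A}
    (hf : Continuous f) (hg : Continuous g) : Continuous fun x => α.act (f x) (g x) :=
  α.continuous_uncurry.comp (hf.prodMk hg)

end CStarAction

/-- Continuous compactly supported functions. -/
def ccSubmodule (H A : Type*) [TopologicalSpace H] [NormedAddCommGroup A] [NormedSpace ℂ A] :
    Submodule ℂ (H → A) where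
  carrier := {f | Continuous f ∧ HasCompactSupport f}
  zero_mem' := ⟨continuous_const, HasCompactSupport.zero⟩
  add_mem' hf hg := ⟨hf.1.add hg.1, hf.2.add hg.2⟩
  smul_mem' c _ hf := ⟨hf.1.const_smul c, hf.2.smul_left (f := fun _ => c)⟩

section Conv

variable {H A : Type*} [TopologicalSpace H] [Group H] [IsTopologicalGroup H]
  [LocallyCompactSpace H] [T2Space H] [MeasurableSpace H] [BorelSpace H] [NonUnitalCStarAlgebra A]

/-- The convolution *-algebra `C_c(H, A)` of the system `(A, H, α)`, with respect to the Haar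
measure `μ`. -/
def Conv (_α : CStarAction H A) (_μ : Measure H) : Type _ := ccSubmodule H A

namespace Conv

variable {α : CStarAction H A} {μ : Measure H}

instance instAddCommGroup : AddCommGroup (Conv α μ) :=
  inferInstanceAs (AddCommGroup (ccSubmodule H A))
instance instModule : Module ℂ (Conv α μ) := inferInstanceAs (Module ℂ (ccSubmodule H A))

/-- The underlying function. -/
def toFun (f : Conv α μ) : H → A := Subtype.val (p := fun f => f ∈ ccSubmodule H A) f

instance : CoeFun (Conv α μ) (fun _ => H → A) := ⟨toFun⟩

theorem ext {f g : Conv α μ} (h : ∀ s, f s = g s) : f = g := Subtype.ext (funext h)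

/-- The element of the convolution algebra given by a function. -/
def mk (f : H → A) (hf : Continuous f) (hc : HasCompactSupport f) : Conv α μ := ⟨f, hf, hc⟩

@[simp] theorem mk_apply (f : H → A) (hf : Continuous f) (hc : HasCompactSupport f) (s : H) :
    (mk f hf hc : Conv α μ) s = f s := rfl

theorem continuous (f : Conv α μ) : Continuous f := f.2.1
theorem hasCompactSupport (f : Conv α μ) : HasCompactSupport f := f.2.2

@[simp] theorem add_apply (f g : Conv α μ) (s : H) : (f + g) s = f s + g s := rfl
@[simp] theorem zero_apply (s : H) : (0 : Conv α μ) s = 0 := rfl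
@[simp] theorem smul_apply (c : ℂ) (f : Conv α μ) (s : H) : (c • f) s = c • f s := rfl

theorem continuous_integrand (f g : Conv α μ) :
    Continuous fun p : H × H => f p.2 * α.act p.2 (g (p.2⁻¹ * p.1)) :=
  (f.continuous.comp continuous_snd).mul
    (α.continuous_comp continuous_snd
      (g.continuous.comp (continuous_snd.inv.mul continuous_fst)))

theorem integrand_eq_zero (f g : Conv α μ) (s : H) {t : H} (ht : t ∉ tsupport f) :
    f t * α.act t (g (t⁻¹ * s)) = 0 := by
  rw [image_eq_zero_of_notMem_tsupport ht, zero_mul]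

theorem hasCompactSupport_integrand (f g : Conv α μ) (s : H) :
    HasCompactSupport fun t => f t * α.act t (g (t⁻¹ * s)) :=
  HasCompactSupport.intro f.hasCompactSupport fun _ ht => integrand_eq_zero f g s ht

theorem integrable_integrand [IsHaarMeasure μ] (f g : Conv α μ) (s : H) :
    Integrable (fun t => f t * α.act t (g (t⁻¹ * s))) μ :=
  ((continuous_integrand f g).comp (continuous_const.prodMk continuous_id)
    ).integrable_of_hasCompactSupport (hasCompactSupport_integrand f g s)

variable [IsHaarMeasure μ]

/-- Convolution: `(f * g)(s) = ∫ f(t) α_t(g(t⁻¹s)) dt`. -/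
instance instMul : Mul (Conv α μ) := ⟨fun f g =>
  mk (fun s => ∫ t, f t * α.act t (g (t⁻¹ * s)) ∂μ)
    (by
      rw [← continuousOn_univ]
      exact continuousOn_integral_of_compact_support f.hasCompactSupport
        (f := fun s t => f t * α.act t (g (t⁻¹ * s)))
        (continuous_integrand f g).continuousOn fun s t _ ht => integrand_eq_zero f g s ht)
    (by
      have hk : IsCompact ((fun p : H × H => p.1 * p.2) '' (tsupport f ×ˢ tsupport g)) :=
        (f.hasCompactSupport.prod g.hasCompactSupport).image continuous_mul
      refine HasCompactSupport.intro hk fun s hs => ?_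
      rw [← integral_zero H A]
      congr 1 with t
      by_contra h
      have h1 : t ∈ tsupport f := by
        by_contra ht; exact h (integrand_eq_zero f g s ht)
      have h2 : t⁻¹ * s ∈ tsupport g := by
        by_contra ht
        apply h
        rw [image_eq_zero_of_notMem_tsupport ht, map_zero, mul_zero]
      exact hs ⟨(t, t⁻¹ * s), ⟨h1, h2⟩, by simp⟩)⟩

theorem mul_apply (f g : Conv α μ) (s : H) :
    (f * g) s = ∫ t, f t * α.act t (g (t⁻¹ * s)) ∂μ := rfl

/-- Involution: `f*(s) = Δ(s⁻¹) α_s(f(s⁻¹)*)`. -/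
instance instStar : Star (Conv α μ) := ⟨fun f =>
  mk (fun s => (modularΔ s⁻¹ : ℂ) • α.act s (star (f s⁻¹)))
    ((Complex.continuous_ofReal.comp (continuous_modularΔ.comp continuous_inv)).smul
      (α.continuous_comp continuous_id (f.continuous.comp continuous_inv).star))
    (by
      refine HasCompactSupport.intro (f.hasCompactSupport.image continuous_inv) fun s hs => ?_
      have : f s⁻¹ = 0 := by
        by_contra h
        exact hs ⟨s⁻¹, subset_tsupport _ h, by simp⟩
      rw [this, star_zero, map_zero, smul_zero])⟩

theorem star_apply (f : Conv α μ) (s : H) :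
    (star f) s = (modularΔ s⁻¹ : ℂ) • α.act s (star (f s⁻¹)) := rfl

theorem mul_assoc' (f g h : Conv α μ) : f * g * h = f * (g * h) := by
  refine ext fun s => ?_
  let F : H → H → A := fun t r => f r * α.act r (g (r⁻¹ * t)) * α.act t (h (t⁻¹ * s))
  have hF : Continuous (Function.uncurry F) := by
    refine ((continuous_integrand f g)).mul ?_
    exact α.continuous_comp continuous_fst (h.continuous.comp (by fun_prop))
  have hFc : HasCompactSupport (Function.uncurry F) := by
    have hk : IsCompact ((fun p : H × H => (p.1 * p.2, p.1)) '' (tsupport f ×ˢ tsupport g)) :=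
      (f.hasCompactSupport.prod g.hasCompactSupport).image (by fun_prop)
    refine HasCompactSupport.intro hk fun ⟨t, r⟩ hs => ?_
    by_contra hne
    have h1 : r ∈ tsupport f := by
      by_contra ht
      exact hne (by simp [F, image_eq_zero_of_notMem_tsupport ht])
    have h2 : r⁻¹ * t ∈ tsupport g := by
      by_contra ht
      exact hne (by simp [F, image_eq_zero_of_notMem_tsupport ht])
    exact hs ⟨(r, r⁻¹ * t), ⟨h1, h2⟩, by simp⟩
  calc (f * g * h) s = ∫ t, (∫ r, f r * α.act r (g (r⁻¹ * t)) ∂μ) * α.act t (h (t⁻¹ * s)) ∂μ := rfl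
    _ = ∫ t, (∫ r, F t r ∂μ) ∂μ := by
      congr 1 with t
      exact ((ContinuousLinearMap.mul ℂ A).flip (α.act t (h (t⁻¹ * s)))).integral_comp_comm
        (integrable_integrand f g t) |>.symm
    _ = ∫ r, (∫ t, F t r ∂μ) ∂μ := integral_integral_swap_of_hasCompactSupport hF hFc
    _ = ∫ r, f r * α.act r ((g * h) (r⁻¹ * s)) ∂μ := by
      congr 1 with r
      rw [mul_apply, ← α.actL_apply, ← (α.actL r).integral_comp_comm (integrable_integrand g h _)]
      rw [← ContinuousLinearMap.mul_apply' ℂ A, ← (ContinuousLinearMap.mul ℂ A (f r)).integral_comp_comm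
        ((α.actL r).integrable_comp (integrable_integrand g h _))]
      rw [← integral_mul_left_eq_self _ r]
      congr 1 with t
      simp only [F, ContinuousLinearMap.mul_apply', CStarAction.actL_apply, map_mul,
        inv_mul_cancel_left, ← α.act_mul, mul_assoc, mul_inv_rev]
    _ = (f * (g * h)) s := rfl

instance instNonUnitalRing : NonUnitalRing (Conv α μ) :=
  { instAddCommGroup, instMul with
    zero_mul := fun f => ext fun s => by simp [mul_apply]
    mul_zero := fun f => ext fun s => by simp [mul_apply]
    mul_assoc := mul_assoc'
    left_distrib := fun f g h => ext fun s => by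
      rw [add_apply, mul_apply, mul_apply, mul_apply, ← integral_add (integrable_integrand f g s)
        (integrable_integrand f h s)]
      congr 1 with t
      rw [add_apply, map_add, mul_add]
    right_distrib := fun f g h => ext fun s => by
      rw [add_apply, mul_apply, mul_apply, mul_apply, ← integral_add (integrable_integrand f h s)
        (integrable_integrand g h s)]
      congr 1 with t
      rw [add_apply, add_mul] }

instance : IsScalarTower ℂ (Conv α μ) (Conv α μ) where
  smul_assoc c f g := ext fun s => by
    simp only [smul_eq_mul, smul_apply, mul_apply, smul_mul_assoc, integral_smul]

instance : SMulCommClass ℂ (Conv α μ) (Conv α μ) where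
  smul_comm c f g := ext fun s => by
    simp only [smul_eq_mul, smul_apply, mul_apply, mul_smul_comm, integral_smul, map_smul]

theorem star_mul' (f g : Conv α μ) : star (f * g) = star g * star f := by
  refine ext fun s => ?_
  rw [star_apply, mul_apply, mul_apply]
  have h1 : α.act s (star (∫ t, f t * α.act t (g (t⁻¹ * s⁻¹)) ∂μ)) =
      ∫ t, α.act s (star (f t * α.act t (g (t⁻¹ * s⁻¹)))) ∂μ := by
    let T : A →L[ℝ] A := ((α.actL s).restrictScalars ℝ).comp
      ((starL' ℝ : A ≃L[ℝ] A) : A →L[ℝ] A)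
    exact (T.integral_comp_comm (integrable_integrand f g s⁻¹)).symm
  rw [h1, ← integral_smul, ← integral_mul_left_eq_self (fun t => (star g) t * _) s]
  congr 1 with t
  have h4 : ∀ a b : A, α.act s (a * b) = α.act s a * α.act s b := fun a b => map_mul _ a b
  have h5 : (s * t)⁻¹ * s = t⁻¹ := by group
  have h6 : s * t * t⁻¹ = s := by group
  have h7 : (modularΔ t : ℂ) * modularΔ t⁻¹ = 1 := by
    rw [← Complex.ofReal_mul, ← modularΔ_mul, mul_inv_cancel, modularΔ_one, Complex.ofReal_one]
  rw [star_apply, star_apply, h5, star_mul, h4, ← map_star (α.act t), ← α.act_mul, map_smul,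
    ← α.act_mul, h6, inv_inv, smul_mul_assoc, mul_smul_comm, smul_smul, mul_inv_rev,
    modularΔ_mul, Complex.ofReal_mul, mul_assoc]
  rw [show (modularΔ t⁻¹ : ℂ) * (modularΔ s⁻¹ * modularΔ t) = modularΔ s⁻¹ by
    linear_combination (modularΔ s⁻¹ : ℂ) * h7]

instance instStarRing : StarRing (Conv α μ) where
  star_involutive f := ext fun s => by
    have h3 : modularΔ s * modularΔ s⁻¹ = 1 := by
      rw [← modularΔ_mul, mul_inv_cancel, modularΔ_one]
    rw [star_apply, star_apply, star_smul, map_smul, smul_smul, ← map_star (α.act s⁻¹),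
      ← α.act_mul, mul_inv_cancel, α.act_one, star_star, inv_inv]
    rw [Complex.star_def, Complex.conj_ofReal, ← Complex.ofReal_mul, mul_comm, h3,
      Complex.ofReal_one, one_smul]
  star_mul := star_mul'
  star_add f g := ext fun s => by
    simp only [star_apply, add_apply, star_add, map_add, smul_add]

instance : StarModule ℂ (Conv α μ) where
  star_smul c f := ext fun s => by
    simp only [star_apply, smul_apply, star_smul, map_smul, smul_smul]
    rw [mul_comm]

/-- The `L¹`-norm on `C_c(H, A)`. -/
def l1Norm (α : CStarAction H A) (μ : Measure H) [IsHaarMeasure μ] : Seminorm ℂ (Conv α μ) :=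
  Seminorm.of (fun f => ∫ t, ‖f t‖ ∂μ)
    (fun f g => by
      have hi : ∀ f : Conv α μ, Integrable (fun t => ‖f t‖) μ := fun f =>
        (f.continuous.integrable_of_hasCompactSupport f.hasCompactSupport).norm
      rw [← integral_add (hi f) (hi g)]
      exact integral_mono (hi (f + g)) ((hi f).add (hi g)) fun t => norm_add_le _ _)
    (fun c f => by simp only [smul_apply, norm_smul, integral_const_mul])

theorem integrable_norm (f : Conv α μ) : Integrable (fun t => ‖f t‖) μ :=
  (f.continuous.integrable_of_hasCompactSupport f.hasCompactSupport).norm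

theorem l1Norm_apply (f : Conv α μ) : l1Norm α μ f = ∫ t, ‖f t‖ ∂μ := rfl

end Conv

/-- The (maximal) crossed product `A ⋊_α H`: the enveloping C*-algebra of the convolution
*-algebra `C_c(H, A)` with its `L¹`-norm. -/
abbrev CrossedProduct (α : CStarAction H A) (μ : Measure H) [IsHaarMeasure μ] : Type _ :=
  Env (Conv.l1Norm α μ)

/-! ## Green-twisted actions and their crossed products -/

/-- A central (continuous) copy `ι : 𝕋 → H` of the circle group. -/
structure CentralCircle (H : Type*) [TopologicalSpace H] [Group H] where
  ι : Circle →* H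
  continuous_ι : Continuous ι
  central : ∀ z s, ι z * s = s * ι z

/-- A Green-twisted action of `(H, 𝕋)` on `A`, where `ι : 𝕋 → H` has central image: an action `α`
of `H` on `A` and a strictly continuous unitary homomorphism `τ : 𝕋 → U𝓜(A)` with
`α_{ι(z)} = Ad τ_z` and `α_s(τ_z) = τ_z (= τ_{s z s⁻¹})`. -/
structure TwistedAction (c : CentralCircle H) (A : Type*) [NonUnitalCStarAlgebra A] extends
    CStarAction H A where
  τ : Circle →* 𝓜(ℂ, A)
  star_τ : ∀ z, star (τ z) = τ z⁻¹
  continuous_τ : ∀ a, Continuous fun z => (τ z).fst a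
  act_ι : ∀ z a, act (c.ι z) a = (τ z).fst ((star (τ z)).snd a)
  act_τ : ∀ s z a, act s ((τ z).fst a) = (τ z).fst (act s a)

namespace TwistedAction

variable {c : CentralCircle H} (α : TwistedAction c A) (μ : Measure H)

theorem snd_eq_star (z : Circle) (a : A) :
    (α.τ z).snd a = star ((α.τ z⁻¹).fst (star a)) := by
  rw [← α.star_τ, DoubleCentralizer.star_fst, star_star, star_star]

theorem act_τ_snd (s : H) (z : Circle) (a : A) :
    α.act s ((α.τ z).snd a) = (α.τ z).snd (α.act s a) := by
  rw [snd_eq_star, snd_eq_star, map_star, act_τ, map_star]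

theorem mul_snd (z : Circle) (a b : A) : (α.τ z).snd (a * b) = a * (α.τ z).snd b := by
  have h : ∀ c, ((α.τ z).snd (a * b) - a * (α.τ z).snd b) * c = 0 := fun c => by
    rw [sub_mul, (α.τ z).central, mul_assoc, mul_assoc, (α.τ z).central, sub_self]
  exact sub_eq_zero.1 (CStarRing.mul_star_self_eq_zero_iff _ |>.1 (h (star _)))

theorem modularΔ_ι (c : CentralCircle H) (z : Circle) : modularΔ (c.ι z) = 1 := by
  have hle : ∀ w : Circle, modularΔ (c.ι w) ≤ 1 := by
    intro w
    by_contra! h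
    obtain ⟨C, hC⟩ := (isCompact_range (continuous_modularΔ.comp c.continuous_ι)).bddAbove
    obtain ⟨n, hn⟩ := pow_unbounded_of_one_lt C h
    have hpow : ∀ n : ℕ, modularΔ (c.ι (w ^ n)) = modularΔ (c.ι w) ^ n := by
      intro n
      induction n with
      | zero => simp [modularΔ_one]
      | succ k ih => rw [pow_succ, map_mul, modularΔ_mul, ih, pow_succ]
    have := hC ⟨w ^ n, rfl⟩
    simp only [Function.comp_apply, hpow] at this
    linarith
  have h1 : modularΔ (c.ι z) * modularΔ (c.ι z⁻¹) = 1 := by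
    rw [← modularΔ_mul, ← map_mul, mul_inv_cancel, map_one, modularΔ_one]
  have := hle z
  have := hle z⁻¹
  have := modularΔ_pos (c.ι z)
  have := modularΔ_pos (c.ι z⁻¹)
  nlinarith

/-- The twisted convolution algebra `C_c(H, A, τ)`: functions in `C_c(H, A)` with
`f(ι(z)s) = f(s) τ_z⁻¹`.  These functions are, up to the twist, functions on `H/𝕋`; if `μ` is
the Haar measure on `H` for which `H → H/𝕋` is measure preserving, then the
integrals over `H/𝕋` in the usual formulas for convolution and involution are integrals
over `H`. -/
def twistedConv [IsHaarMeasure μ] :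
    NonUnitalStarSubalgebra ℂ (Conv α.toCStarAction μ) where
  carrier := {f | ∀ z s, f (c.ι z * s) = (α.τ z⁻¹).snd (f s)}
  zero_mem' z s := by simp
  add_mem' {f g} hf hg z s := by
    simp only [Set.mem_ofPred_eq] at hf hg
    rw [Conv.add_apply, Conv.add_apply, hf, hg, map_add]
  smul_mem' k f hf z s := by
    simp only [Set.mem_ofPred_eq] at hf
    rw [Conv.smul_apply, Conv.smul_apply, hf, map_smul]
  mul_mem' {f g} hf hg z s := by
    simp only [Set.mem_ofPred_eq] at hf hg
    rw [Conv.mul_apply, Conv.mul_apply,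
      ← (α.τ z⁻¹).snd.integral_comp_comm (Conv.integrable_integrand f g s)]
    congr 1 with t
    rw [α.mul_snd, ← α.act_τ_snd, ← hg, ← mul_assoc, ← c.central, mul_assoc]
  star_mem' {f} hf z s := by
    simp only [Set.mem_ofPred_eq] at hf
    have h1 : (c.ι z * s)⁻¹ = c.ι z⁻¹ * s⁻¹ := by rw [mul_inv_rev, map_inv, ← map_inv, c.central]
    have h2 : ∀ a, (α.τ z⁻¹).fst ((α.τ z).fst a) = a := fun a => by
      change ((α.τ z⁻¹).fst * (α.τ z).fst) a = a
      rw [← DoubleCentralizer.mul_fst, ← map_mul, inv_mul_cancel, map_one]; rfl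
    rw [Conv.star_apply, Conv.star_apply, h1, hf, inv_inv, α.snd_eq_star, star_star,
      α.act_mul, α.act_τ, α.act_τ, α.act_ι, h2, α.star_τ, map_smul, modularΔ_mul,
      modularΔ_ι, one_mul]

/-- The `L¹`-norm on the twisted convolution algebra. -/
def l1Norm [IsHaarMeasure μ] : Seminorm ℂ (α.twistedConv μ) :=
  (Conv.l1Norm α.toCStarAction μ).comp (α.twistedConv μ).toSubmodule.subtype

theorem l1Norm_apply [IsHaarMeasure μ] (f : α.twistedConv μ) :
    α.l1Norm μ f = Conv.l1Norm α.toCStarAction μ f := rfl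

end TwistedAction

/-- The (maximal) Green-twisted crossed product `A ⋊_{(α,τ)} (H/𝕋)`: the enveloping C*-algebra of
the twisted convolution *-algebra `C_c(H, A, τ)` with its `L¹`-norm. -/
abbrev TwistedCrossedProduct {c : CentralCircle H} (α : TwistedAction c A) (μ : Measure H)
    [IsHaarMeasure μ] : Type _ :=
  Env (α.l1Norm μ)

end Conv

section Pullback

variable {G H A A' : Type*}
  [TopologicalSpace G] [Group G] [IsTopologicalGroup G] [LocallyCompactSpace G] [T2Space G]
  [MeasurableSpace G] [BorelSpace G]
  [TopologicalSpace H] [Group H] [IsTopologicalGroup H] [LocallyCompactSpace H] [T2Space H]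
  [MeasurableSpace H] [BorelSpace H] [NonUnitalCStarAlgebra A] [NonUnitalCStarAlgebra A']

theorem modularΔ_comp {ν : Measure G} {μ : Measure H} [IsHaarMeasure ν] [IsHaarMeasure μ]
    (q : H →* G) (hq : Continuous q) (hc : Tendsto q (cocompact H) (cocompact G))
    (hm : MeasurePreserving q μ ν) (s : H) : modularΔ (q s) = modularΔ s := by
  obtain ⟨f, hf, f0, f1⟩ := exists_continuous_nonneg_pos (1 : G)
  have hpos : ∫ x, f x ∂ν ≠ 0 :=
    (f.continuous.integral_pos_of_hasCompactSupport_nonneg_nonzero hf f0 f1).ne'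
  have hfq : HasCompactSupport (fun x => f (q x)) := by
    rw [hasCompactSupport_iff_eventuallyEq] at hf ⊢
    rw [coclosedCompact_eq_cocompact] at hf ⊢
    exact hc.eventually hf
  have hint : ∀ g : G → ℝ, Continuous g → ∫ x, g x ∂ν = ∫ x, g (q x) ∂μ := fun g hg => by
    rw [← hm.map_eq, integral_map hq.aemeasurable hg.aestronglyMeasurable]
  have h1 := modularCharacter_mul_integral ν f.continuous hf (q s⁻¹)
  have h2 := modularCharacter_mul_integral μ (f.continuous.comp hq) hfq s⁻¹
  simp only [Function.comp_apply, map_mul] at h2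
  rw [hint _ f.continuous] at hpos h1
  rw [hint _ (by fun_prop), ← h2] at h1
  rw [modularΔ, modularΔ, ← map_inv]
  exact mul_right_cancel₀ hpos h1

/-- Pull-back of functions along a proper measure preserving homomorphism `q : H → G`, combined
with an equivariant *-homomorphism `φ : A → A'`: `f ↦ φ ∘ f ∘ q`. -/
def Conv.pullback {α : CStarAction G A} {α' : CStarAction H A'} {ν : Measure G} {μ : Measure H}
    [IsHaarMeasure ν] [IsHaarMeasure μ] (q : H →* G) (hq : Continuous q)
    (hc : Tendsto q (cocompact H) (cocompact G)) (hm : MeasurePreserving q μ ν)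
    (φ : A →⋆ₙₐ[ℂ] A') (hφ : ∀ s a, φ (α.act (q s) a) = α'.act s (φ a)) :
    Conv α ν →⋆ₙₐ[ℂ] Conv α' μ where
  toFun f := Conv.mk (fun s => φ (f (q s)))
    ((AddMonoidHomClass.continuous_of_bound φ 1
      (by simpa only [one_mul] using NonUnitalStarAlgHom.norm_apply_le φ)).comp
        (f.continuous.comp hq))
    (by
      have hf := f.hasCompactSupport
      rw [hasCompactSupport_iff_eventuallyEq] at hf ⊢
      rw [coclosedCompact_eq_cocompact] at hf ⊢
      filter_upwards [hc.eventually hf] with x hx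
      simp only [hx, Pi.zero_apply, map_zero])
  map_smul' c f := Conv.ext fun s => by simp
  map_zero' := Conv.ext fun s => by simp
  map_add' f g := Conv.ext fun s => by simp
  map_mul' f g := Conv.ext fun s => by
    let T : A →L[ℂ] A' := LinearMap.mkContinuous
      { toFun := fun a => φ a
        map_add' := fun a b => map_add φ a b
        map_smul' := fun c a => map_smul φ c a } 1
      fun a => by rw [one_mul]; exact NonUnitalStarAlgHom.norm_apply_le φ a
    have hT : ∀ a, φ a = T a := fun a => rfl
    rw [Conv.mk_apply, Conv.mul_apply, Conv.mul_apply, hT,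
      ← T.integral_comp_comm (Conv.integrable_integrand f g (q s)), ← hm.map_eq,
      integral_map hq.aemeasurable]
    · congr 1 with t
      simp only [← hT, Conv.mk_apply, map_mul φ, hφ, map_mul q, map_inv q]
    · rw [hm.map_eq]
      exact (T.integrable_comp (Conv.integrable_integrand f g (q s))).aestronglyMeasurable
  map_star' f := Conv.ext fun s => by
    simp only [Conv.star_apply, Conv.mk_apply, map_smul, hφ, map_star, ← map_inv,
      modularΔ_comp q hq hc hm]

theorem Conv.l1Norm_pullback {α : CStarAction G A} {α' : CStarAction H A'} {ν : Measure G}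
    {μ : Measure H} [IsHaarMeasure ν] [IsHaarMeasure μ] (q : H →* G) (hq : Continuous q)
    (hc : Tendsto q (cocompact H) (cocompact G)) (hm : MeasurePreserving q μ ν)
    (φ : A →⋆ₙₐ[ℂ] A') (hφ : ∀ s a, φ (α.act (q s) a) = α'.act s (φ a)) (f : Conv α ν) :
    Conv.l1Norm α' μ (Conv.pullback q hq hc hm φ hφ f) ≤ Conv.l1Norm α ν f := by
  have hi := Conv.integrable_norm f
  have hi' := Conv.integrable_norm (Conv.pullback (μ := μ) q hq hc hm φ hφ f)
  have key : ∫ t, ‖f t‖ ∂ν = ∫ t, ‖f (q t)‖ ∂μ := by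
    have := integral_map (μ := μ) hq.aemeasurable (f := fun t => ‖f t‖)
      (by rw [hm.map_eq]; exact hi.aestronglyMeasurable)
    rwa [hm.map_eq] at this
  rw [Conv.l1Norm_apply, Conv.l1Norm_apply, key]
  refine integral_mono hi' (hm.integrable_comp_of_integrable hi) fun t => ?_
  exact NonUnitalStarAlgHom.norm_apply_le φ (f (q t))

end Pullback

section Translation

variable (H E : Type*) [TopologicalSpace H] [Group H] [IsTopologicalGroup H]
  [NonUnitalCStarAlgebra E]

/-- Right translation by `g` on `C₀(H, E)`: `(rt_g f)(t) = f(tg)`. -/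
def rtHom (g : H) : C₀(H, E) →⋆ₙₐ[ℂ] C₀(H, E) where
  toFun f := ⟨⟨fun t => f (t * g), by fun_prop⟩,
    (zero_at_infty f).comp (Homeomorph.mulRight g).isClosedEmbedding.tendsto_cocompact⟩
  map_smul' c f := rfl
  map_zero' := rfl
  map_add' f g := rfl
  map_mul' f g := rfl
  map_star' f := rfl

variable {H E}

@[simp] theorem rtHom_apply (g t : H) (f : C₀(H, E)) : rtHom H E g f t = f (t * g) := rfl

theorem continuous_rtHom (f : C₀(H, E)) : Continuous fun g => rtHom H E g f := by
  refine continuous_iff_continuousAt.2 fun g₀ => ?_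
  let _ := IsTopologicalGroup.leftUniformSpace H
  have hu : UniformContinuous f := ZeroAtInftyContinuousMap.uniformContinuous f
  rw [ContinuousAt, Metric.tendsto_nhds]
  intro ε hε
  have h2 : ∀ᶠ p in comap (fun p : H × H => p.1⁻¹ * p.2) (𝓝 (1 : H)), dist (f p.1) (f p.2) < ε / 2 :=
    hu (Metric.dist_mem_uniformity (half_pos hε))
  rw [eventually_comap] at h2
  have h3 : Tendsto (fun g : H => g⁻¹ * g₀) (𝓝 g₀) (𝓝 1) := by
    have : Continuous fun g : H => g⁻¹ * g₀ := by fun_prop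
    simpa using this.tendsto g₀
  filter_upwards [h3.eventually h2] with g hg
  refine lt_of_le_of_lt ?_ (half_lt_self hε)
  rw [← ZeroAtInftyContinuousMap.dist_toBCF_eq_dist]
  refine (BoundedContinuousFunction.dist_le (half_pos hε).le).2 fun t => ?_
  exact (hg (t * g, t * g₀) (by simp [mul_assoc])).le

variable (H E)

/-- The right translation action `rt` of `H` on `C₀(H, E)`. -/
def rtAction : CStarAction H C₀(H, E) where
  act :=
    { toFun := rtHom H E
      map_one' := by ext f t; simp
      map_mul' := fun g h => by
        ext f t
        change f (t * (g * h)) = f (t * g * h)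
        rw [mul_assoc] }
  continuous_act := continuous_rtHom

@[simp] theorem rtAction_act (g t : H) (f : C₀(H, E)) :
    (rtAction H E).act g f t = f (t * g) := rfl

end Translation

/-- Inflation of an action of `G` along a continuous homomorphism `H → G`. -/
def CStarAction.inflate {G H A : Type*} [TopologicalSpace G] [Group G] [TopologicalSpace H]
    [Group H] [NonUnitalCStarAlgebra A] (α : CStarAction G A) (q : H →* G) (hq : Continuous q) :
    CStarAction H A where
  act := α.act.comp q
  continuous_act a := (α.continuous_act a).comp hq

/-! ## Twists and the linking algebra of `C₀(G_σ, ῑ)` -/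

/-- A twist `σ = (𝕋 →ι G_σ →q G)`: a central extension of `G` by the circle group. -/
structure Twist (G Gσ : Type*) [TopologicalSpace G] [Group G] [TopologicalSpace Gσ] [Group Gσ]
    extends CentralCircle Gσ where
  injective_ι : Function.Injective ι
  q : Gσ →* G
  isOpenQuotientMap_q : IsOpenQuotientMap q
  ker_q : q.ker = ι.range

namespace Twist

variable {G Gσ : Type*}
  [TopologicalSpace G] [Group G] [IsTopologicalGroup G] [LocallyCompactSpace G] [T2Space G]
  [TopologicalSpace Gσ] [Group Gσ] [IsTopologicalGroup Gσ] [LocallyCompactSpace Gσ] [T2Space Gσ]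
  (σ : Twist G Gσ)

theorem continuous_q : Continuous σ.q := σ.isOpenQuotientMap_q.continuous

theorem q_ι (z : Circle) : σ.q (σ.ι z) = 1 := by
  have : σ.ι z ∈ σ.q.ker := by rw [σ.ker_q]; exact ⟨z, rfl⟩
  exact this

theorem tendsto_q : Tendsto σ.q (cocompact Gσ) (cocompact G) := by
  refine hasBasis_cocompact.tendsto_right_iff.2 fun K hK => ?_
  have hopen := σ.isOpenQuotientMap_q.isOpenMap
  choose C hC hCn using fun s : Gσ => exists_compact_mem_nhds s
  obtain ⟨t, ht⟩ := hK.elim_finite_subcover (fun s : Gσ => σ.q '' (interior (C s)))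
    (fun s => hopen _ isOpen_interior) (fun g _ => by
      obtain ⟨s, rfl⟩ := σ.isOpenQuotientMap_q.surjective g
      exact Set.mem_iUnion.2 ⟨s, s, mem_interior_iff_mem_nhds.2 (hCn s), rfl⟩)
  have hD : IsCompact (⋃ s ∈ t, C s) := t.isCompact_biUnion fun s _ => hC s
  have hDT : IsCompact ((fun p : Gσ × Circle => p.1 * σ.ι p.2) '' ((⋃ s ∈ t, C s) ×ˢ Set.univ)) :=
    (hD.prod isCompact_univ).image
      (continuous_fst.mul (σ.continuous_ι.comp continuous_snd))
  filter_upwards [hDT.compl_mem_cocompact] with s hs hsK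
  apply hs
  have h1 := ht hsK
  simp only [Set.mem_iUnion] at h1
  obtain ⟨i, hi, r, hr, hrs⟩ := h1
  have h2 : r⁻¹ * s ∈ σ.q.ker := by
    rw [MonoidHom.mem_ker, map_mul, map_inv, hrs, inv_mul_cancel]
  rw [σ.ker_q] at h2
  obtain ⟨z, hz⟩ := h2
  exact ⟨(r, z), ⟨Set.mem_biUnion hi (interior_subset hr), Set.mem_univ _⟩, by simp [hz]⟩

/-- `C₀(G_σ, ῑ)`: the functions `f ∈ C₀(G_σ)` with `f(sz) = z̄ f(s)`. -/
def C0iota : Submodule ℂ C₀(Gσ, ℂ) where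
  carrier := {f | ∀ s z, f (s * σ.ι z) = star (z : ℂ) * f s}
  zero_mem' s z := by simp
  add_mem' {f g} hf hg s z := by
    simp only [Set.mem_ofPred_eq] at hf hg
    simp [hf, hg, mul_add]
  smul_mem' c f hf s z := by
    simp only [Set.mem_ofPred_eq] at hf
    simp [hf, mul_left_comm]

/-- The diagonal matrix `diag(1, z)`. -/
def diagMat (z : ℂ) : Matrix (Fin 2) (Fin 2) ℂ := Matrix.diagonal ![1, z]

theorem star_diagMat (z : ℂ) : star (diagMat z) = diagMat (star z) := by
  rw [diagMat, Matrix.star_eq_conjTranspose, Matrix.diagonal_conjTranspose, diagMat]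
  congr 1; ext i; fin_cases i <;> simp

theorem diagMat_mul (z w : ℂ) : diagMat z * diagMat w = diagMat (z * w) := by
  rw [diagMat, diagMat, Matrix.diagonal_mul_diagonal, diagMat]
  congr 1; ext i; fin_cases i <;> simp

theorem diagMat_one : diagMat 1 = 1 := by
  rw [diagMat, ← Matrix.diagonal_one]
  congr 1; ext i; fin_cases i <;> simp

theorem star_mul_circle (z : Circle) : star (z : ℂ) * z = 1 := by
  have : ((z⁻¹ : Circle) : ℂ) * z = 1 := by
    rw [← Circle.coe_mul, inv_mul_cancel, Circle.coe_one]
  rwa [Circle.coe_inv_eq_conj] at this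

/-- The linking algebra of the `C₀(G)`–`C₀(G)` imprimitivity bimodule `C₀(G_σ, ῑ)`, realized as
an algebra of `2 × 2`-matrices of functions on `G_σ` with pointwise operations: the
functions `F = (a x; y* b) ∈ C₀(G_σ, M₂(ℂ))` with `a, b` constant on `𝕋`-cosets (i.e. in
`C₀(G)`), `x(sz) = z̄ x(s)` and `y*(sz) = z y*(s)`. -/
def linking : NonUnitalStarSubalgebra ℂ C₀(Gσ, Matrix (Fin 2) (Fin 2) ℂ) where
  carrier := {F | ∀ (s : Gσ) (z : Circle), F (s * σ.ι z) = diagMat z * F s * star (diagMat z)}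
  zero_mem' s z := by simp
  add_mem' {f g} hf hg s z := by
    simp only [Set.mem_ofPred_eq] at hf hg
    simp [hf, hg, mul_add, add_mul]
  smul_mem' c f hf s z := by
    simp only [Set.mem_ofPred_eq] at hf
    simp [hf]
  mul_mem' {f g} hf hg s z := by
    simp only [Set.mem_ofPred_eq] at hf hg
    have h : star (diagMat z) * diagMat z = 1 := by
      rw [star_diagMat, diagMat_mul, star_mul_circle, diagMat_one]
    calc (f * g) (s * σ.ι z) = f (s * σ.ι z) * g (s * σ.ι z) := rfl
      _ = diagMat z * f s * (star (diagMat z) * diagMat z) * g s * star (diagMat z) := by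
        rw [hf, hg]; simp only [mul_assoc]
      _ = diagMat z * (f * g) s * star (diagMat z) := by
        rw [h, mul_one]; simp only [mul_assoc, ZeroAtInftyContinuousMap.mul_apply]
  star_mem' {f} hf s z := by
    simp only [Set.mem_ofPred_eq] at hf
    simp [ZeroAtInftyContinuousMap.star_apply, hf, mul_assoc]

theorem mem_linking {F : C₀(Gσ, Matrix (Fin 2) (Fin 2) ℂ)} : F ∈ σ.linking ↔
    ∀ (s : Gσ) (z : Circle), F (s * σ.ι z) = diagMat z * F s * star (diagMat z) := Iff.rfl

theorem continuous_eval_C0 {E : Type*} [NormedAddCommGroup E] (s : Gσ) :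
    Continuous fun F : C₀(Gσ, E) => F s := by
  have h : Continuous fun F : C₀(Gσ, E) => F.toBCF :=
    ZeroAtInftyContinuousMap.isometry_toBCF.continuous
  exact (BoundedContinuousFunction.lipschitz_eval_const s).continuous.comp h

instance : IsClosed (σ.linking : Set C₀(Gσ, Matrix (Fin 2) (Fin 2) ℂ)) := by
  have : (σ.linking : Set C₀(Gσ, Matrix (Fin 2) (Fin 2) ℂ)) = ⋂ (s : Gσ) (z : Circle),
      {F | F (s * σ.ι z) = diagMat z * F s * star (diagMat z)} := by
    ext F; simp [mem_linking]
  rw [this]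
  refine isClosed_iInter fun s => isClosed_iInter fun z => isClosed_eq ?_ ?_
  · exact continuous_eval_C0 _
  · exact (continuous_const.mul (continuous_eval_C0 s)).mul continuous_const

instance : NonUnitalCStarAlgebra σ.linking :=
  NonUnitalStarSubalgebra.nonUnitalCStarAlgebra σ.linking

instance : IsClosed (σ.C0iota : Set C₀(Gσ, ℂ)) := by
  have : (σ.C0iota : Set C₀(Gσ, ℂ)) = ⋂ (s : Gσ) (z : Circle),
      {f | f (s * σ.ι z) = star (z : ℂ) * f s} := by
    ext F; simp [C0iota]
  rw [this]
  refine isClosed_iInter fun s => isClosed_iInter fun z => isClosed_eq ?_ ?_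
  · exact continuous_eval_C0 _
  · exact continuous_const.mul (continuous_eval_C0 s)

/-- The action `Rt` of `G_σ` on the linking algebra: right translation in all entries. -/
def linkingAction : CStarAction Gσ σ.linking where
  act :=
    { toFun := fun g => NonUnitalStarAlgHom.codRestrict
        ((rtHom Gσ (Matrix (Fin 2) (Fin 2) ℂ) g).comp (NonUnitalStarSubalgebraClass.subtype σ.linking))
        σ.linking (fun F s z => by
          have := F.2 (s * g) z
          change (F : C₀(Gσ, Matrix (Fin 2) (Fin 2) ℂ)) (s * σ.ι z * g) = _
          rw [mul_assoc, σ.central, ← mul_assoc]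
          exact this)
      map_one' := by
        ext F : 2
        exact (rtAction Gσ (Matrix (Fin 2) (Fin 2) ℂ)).act_one F
      map_mul' := fun g h => by
        ext F : 2
        exact (rtAction Gσ (Matrix (Fin 2) (Fin 2) ℂ)).act_mul g h F }
  continuous_act F := (continuous_rtHom (F : C₀(Gσ, Matrix (Fin 2) (Fin 2) ℂ))).subtype_mk _

theorem linkingAction_apply (g t : Gσ) (F : σ.linking) :
    (σ.linkingAction.act g F : C₀(Gσ, Matrix (Fin 2) (Fin 2) ℂ)) t = F.1 (t * g) := rfl

theorem norm_le_C0 {E : Type*} [NormedAddCommGroup E] {F : C₀(Gσ, E)} {C : ℝ} (hC : 0 ≤ C)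
    (h : ∀ s, ‖F s‖ ≤ C) : ‖F‖ ≤ C := by
  rw [← ZeroAtInftyContinuousMap.norm_toBCF_eq_norm]
  exact (BoundedContinuousFunction.norm_le hC).2 h

theorem norm_apply_le_C0 {E : Type*} [NormedAddCommGroup E] (F : C₀(Gσ, E)) (s : Gσ) :
    ‖F s‖ ≤ ‖F‖ := by
  rw [← ZeroAtInftyContinuousMap.norm_toBCF_eq_norm]
  exact F.toBCF.norm_coe_le_norm s

/-- Left and right multiplication by the constant matrix `diag(1, z)`: the unitary multiplier
`diag(1, z)` of the linking algebra. -/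
def diagMul (z : Circle) : 𝓜(ℂ, σ.linking) where
  fst := LinearMap.mkContinuous
    { toFun := fun F => ⟨⟨⟨fun s => diagMat z * F.1 s, by fun_prop⟩, by
        simpa using (zero_at_infty F.1).const_mul (diagMat z)⟩, fun s w => by
        have := F.2 s w
        change diagMat z * F.1 _ = diagMat w * (diagMat z * F.1 s) * _
        rw [this, ← mul_assoc (diagMat w), diagMat_mul, mul_comm (w : ℂ), ← diagMat_mul]
        simp only [mul_assoc]⟩
      map_add' := fun F K => by
        apply Subtype.ext; ext1 s; exact mul_add (diagMat z) (F.1 s) (K.1 s)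
      map_smul' := fun c F => by
        apply Subtype.ext; ext1 s; exact mul_smul_comm c (diagMat z) (F.1 s) } ‖diagMat z‖
    fun F => norm_le_C0 (by positivity) fun s => (norm_mul_le _ _).trans
      (mul_le_mul_of_nonneg_left (norm_apply_le_C0 F.1 s) (norm_nonneg _))
  snd := LinearMap.mkContinuous
    { toFun := fun F => ⟨⟨⟨fun s => F.1 s * diagMat z, by fun_prop⟩, by
        simpa using (zero_at_infty F.1).mul_const (diagMat z)⟩, fun s w => by
        have := F.2 s w
        change F.1 _ * diagMat z = diagMat w * (F.1 s * diagMat z) * _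
        rw [this, star_diagMat, mul_assoc, diagMat_mul, mul_comm (star (w : ℂ)), ← diagMat_mul]
        simp only [mul_assoc]⟩
      map_add' := fun F K => by
        apply Subtype.ext; ext1 s; exact add_mul (F.1 s) (K.1 s) (diagMat z)
      map_smul' := fun c F => by
        apply Subtype.ext; ext1 s; exact smul_mul_assoc c (F.1 s) (diagMat z) } ‖diagMat z‖
    fun F => norm_le_C0 (by positivity) fun s => (norm_mul_le _ _).trans (by
      rw [mul_comm]
      exact mul_le_mul_of_nonneg_left (norm_apply_le_C0 F.1 s) (norm_nonneg _))
  central F K := by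
    apply Subtype.ext; ext1 s; exact mul_assoc (F.1 s) (diagMat z) (K.1 s)

theorem diagMul_fst (z : Circle) (F : σ.linking) (s : Gσ) :
    ((σ.diagMul z).fst F).1 s = diagMat z * F.1 s := rfl

theorem diagMul_snd (z : Circle) (F : σ.linking) (s : Gσ) :
    ((σ.diagMul z).snd F).1 s = F.1 s * diagMat z := rfl

theorem linking_ext {F K : σ.linking} (h : ∀ s, F.1 s = K.1 s) : F = K :=
  Subtype.ext (DFunLike.ext _ _ h)

theorem mult_ext {A : Type*} [NonUnitalCStarAlgebra A] {k l : 𝓜(ℂ, A)}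
    (h1 : ∀ a, k.fst a = l.fst a) (h2 : ∀ a, k.snd a = l.snd a) : k = l :=
  DoubleCentralizer.ext (𝕜 := ℂ) (A := A) _ _
    (Prod.ext (ContinuousLinearMap.ext h1) (ContinuousLinearMap.ext h2))

theorem coe_star_linking (F : σ.linking) (s : Gσ) : (star F).1 s = star (F.1 s) := rfl

theorem star_diagMat_circle (z : Circle) :
    star (diagMat (z : ℂ)) = diagMat ((z⁻¹ : Circle) : ℂ) := by
  rw [star_diagMat, Circle.coe_inv_eq_conj]; rfl

theorem star_fst_apply {A : Type*} [NonUnitalCStarAlgebra A] (k : 𝓜(ℂ, A)) (a : A) :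
    (star k).fst a = star (k.snd (star a)) := rfl

theorem star_snd_apply {A : Type*} [NonUnitalCStarAlgebra A] (k : 𝓜(ℂ, A)) (a : A) :
    (star k).snd a = star (k.fst (star a)) := rfl

theorem star_diagMul (z : Circle) : star (σ.diagMul z) = σ.diagMul z⁻¹ := by
  refine mult_ext (fun F => ?_) (fun F => ?_)
  · rw [star_fst_apply]
    refine σ.linking_ext fun s => ?_
    rw [coe_star_linking, diagMul_snd, coe_star_linking, star_mul, star_star,
      star_diagMat_circle, diagMul_fst]
  · rw [star_snd_apply]
    refine σ.linking_ext fun s => ?_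
    rw [coe_star_linking, diagMul_fst, coe_star_linking, star_mul, star_star,
      star_diagMat_circle, diagMul_snd]

theorem continuous_diagMat : Continuous diagMat := by
  unfold diagMat
  refine Continuous.matrix_diagonal ?_
  refine continuous_pi fun i => ?_
  fin_cases i
  · exact continuous_const
  · exact continuous_id

theorem continuous_diagMul (F : σ.linking) : Continuous fun z => (σ.diagMul z).fst F := by
  rw [continuous_iff_continuousAt]
  intro w
  rw [ContinuousAt, tendsto_iff_norm_sub_tendsto_zero]
  have hle : ∀ z : Circle, ‖(σ.diagMul z).fst F - (σ.diagMul w).fst F‖ ≤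
      ‖diagMat (z : ℂ) - diagMat (w : ℂ)‖ * ‖F‖ := fun z => by
    refine norm_le_C0 (by positivity) fun s => ?_
    have : ((σ.diagMul z).fst F - (σ.diagMul w).fst F : σ.linking).1 s =
        (diagMat (z : ℂ) - diagMat (w : ℂ)) * F.1 s := by rw [sub_mul]; rfl
    refine (congrArg norm this).le.trans ((norm_mul_le _ _).trans ?_)
    exact mul_le_mul_of_nonneg_left (norm_apply_le_C0 F.1 s) (norm_nonneg _)
  refine squeeze_zero (fun _ => norm_nonneg _) hle ?_
  have h1 : Continuous fun z : Circle => ‖diagMat (z : ℂ) - diagMat (w : ℂ)‖ * ‖F‖ := by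
    have := continuous_diagMat.comp (continuous_induced_dom (f := ((↑) : Circle → ℂ)))
    exact ((this.sub continuous_const).norm).mul continuous_const
  simpa using h1.tendsto w

/-- The twisted action `(Rt, τ)` of `(G_σ, 𝕋)` on the linking algebra, with
`τ_z = diag(1, z)`. -/
def linkingTwisted : TwistedAction σ.toCentralCircle σ.linking where
  toCStarAction := σ.linkingAction
  τ :=
    { toFun := σ.diagMul
      map_one' := by
        refine mult_ext (fun F => σ.linking_ext fun s => ?_) (fun F => σ.linking_ext fun s => ?_)
        · rw [diagMul_fst, Circle.coe_one, diagMat_one, one_mul]; rfl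
        · rw [diagMul_snd, Circle.coe_one, diagMat_one, mul_one]; rfl
      map_mul' := fun z w => by
        refine mult_ext (fun F => σ.linking_ext fun s => ?_) (fun F => σ.linking_ext fun s => ?_)
        · rw [diagMul_fst, Circle.coe_mul, ← diagMat_mul, mul_assoc]; rfl
        · rw [diagMul_snd, Circle.coe_mul, ← diagMat_mul, ← mul_assoc]; rfl }
  star_τ z := σ.star_diagMul z
  continuous_τ F := σ.continuous_diagMul F
  act_ι z F := by
    change _ = (σ.diagMul z).fst ((star (σ.diagMul z)).snd F)
    rw [σ.star_diagMul]
    refine σ.linking_ext fun s => ?_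
    rw [diagMul_fst, diagMul_snd, linkingAction_apply, F.2 s z, star_diagMat_circle, mul_assoc]
  act_τ g z F := σ.linking_ext fun s => rfl

/-- The twisted action `(rt, ι^σ)` of `(G_σ, 𝕋)` on `C₀(G)`: the inflation of `rt`, with the
scalar twist `τ_z = z`. -/
def rtTwisted : TwistedAction σ.toCentralCircle C₀(G, ℂ) where
  toCStarAction := (rtAction G ℂ).inflate σ.q σ.continuous_q
  τ := ((algebraMap ℂ 𝓜(ℂ, C₀(G, ℂ)) : ℂ →+* 𝓜(ℂ, C₀(G, ℂ))) : ℂ →* 𝓜(ℂ, C₀(G, ℂ))).comp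
    Circle.coeHom
  star_τ z := by
    change star (algebraMap ℂ 𝓜(ℂ, C₀(G, ℂ)) z) = algebraMap ℂ 𝓜(ℂ, C₀(G, ℂ)) (z⁻¹ : Circle)
    rw [← algebraMap_star_comm, Circle.coe_inv_eq_conj]; rfl
  continuous_τ a := by
    have h : ∀ z : Circle, ((algebraMap ℂ 𝓜(ℂ, C₀(G, ℂ)) z)).fst a = (z : ℂ) • a := fun z => by
      rw [DoubleCentralizer.algebraMap_fst]; simp [Algebra.algebraMap_eq_smul_one]
    change Continuous fun z : Circle => ((algebraMap ℂ 𝓜(ℂ, C₀(G, ℂ)) z)).fst a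
    simp only [h]
    fun_prop
  act_ι z a := by
    change (rtAction G ℂ).act (σ.q (σ.ι z)) a = (algebraMap ℂ 𝓜(ℂ, C₀(G, ℂ)) z).fst
      ((star (algebraMap ℂ 𝓜(ℂ, C₀(G, ℂ)) z)).snd a)
    have h2 : ∀ w : ℂ, ∀ b, ((algebraMap ℂ 𝓜(ℂ, C₀(G, ℂ)) w)).fst b = w • b := fun w b => by
      rw [DoubleCentralizer.algebraMap_fst]; simp [Algebra.algebraMap_eq_smul_one]
    rw [star_snd_apply, h2, h2, star_smul, star_star, smul_smul, mul_comm, star_mul_circle,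
      one_smul, σ.q_ι, (rtAction G ℂ).act_one]
  act_τ g z a := by
    have h2 : ∀ w : ℂ, ∀ b, ((algebraMap ℂ 𝓜(ℂ, C₀(G, ℂ)) w)).fst b = w • b := fun w b => by
      rw [DoubleCentralizer.algebraMap_fst]; simp [Algebra.algebraMap_eq_smul_one]
    change (rtAction G ℂ).act (σ.q g) ((algebraMap ℂ 𝓜(ℂ, C₀(G, ℂ)) z).fst a) =
      (algebraMap ℂ 𝓜(ℂ, C₀(G, ℂ)) z).fst ((rtAction G ℂ).act (σ.q g) a)
    rw [h2, h2, map_smul]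

end Twist

namespace Twist

/-! ## The crossed product of the linking algebra and its corners -/

variable {G Gσ : Type*}
  [TopologicalSpace G] [Group G] [IsTopologicalGroup G] [LocallyCompactSpace G] [T2Space G]
  [TopologicalSpace Gσ] [Group Gσ] [IsTopologicalGroup Gσ] [LocallyCompactSpace Gσ] [T2Space Gσ]
  (σ : Twist G Gσ)

theorem continuous_single (i j : Fin 2) :
    Continuous fun c : ℂ => (Matrix.single i j c : Matrix (Fin 2) (Fin 2) ℂ) :=
  (Matrix.singleLinearMap ℂ i j : ℂ →ₗ[ℂ] Matrix (Fin 2) (Fin 2) ℂ).continuous_of_finiteDimensional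

theorem diagMat_mul_single (i j : Fin 2) (z c : ℂ) :
    diagMat z * Matrix.single i j c = Matrix.single i j (![1, z] i * c) := by
  ext k l
  rw [diagMat, Matrix.diagonal_mul, Matrix.single_apply, Matrix.single_apply]
  split_ifs with h
  · rw [h.1]
  · rw [mul_zero]

theorem single_mul_diagMat (i j : Fin 2) (z c : ℂ) :
    Matrix.single i j c * diagMat z = Matrix.single i j (c * ![1, z] j) := by
  ext k l
  rw [diagMat, Matrix.mul_diagonal, Matrix.single_apply, Matrix.single_apply]
  split_ifs with h
  · rw [h.2]
  · rw [zero_mul]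

theorem single_conj (i j : Fin 2) (z c : ℂ) :
    diagMat z * Matrix.single i j c * star (diagMat z) =
      Matrix.single i j (![1, z] i * c * ![1, star z] j) := by
  rw [star_diagMat, diagMat_mul_single, single_mul_diagMat]

/-- The diagonal embeddings of `C₀(G)` into the linking algebra: `a ↦ (a 0; 0 0)` for `i = 0` and
`a ↦ (0 0; 0 a)` for `i = 1`. -/
def corner (i : Fin 2) : C₀(G, ℂ) →⋆ₙₐ[ℂ] σ.linking where
  toFun a := ⟨⟨⟨fun s => Matrix.single i i (a (σ.q s)),
      (continuous_single i i).comp (a.continuous.comp σ.continuous_q)⟩, by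
        have h : Tendsto (fun s => Matrix.single i i (a (σ.q s))) (cocompact Gσ)
            (𝓝 (Matrix.single i i (0 : ℂ))) :=
          ((continuous_single i i).tendsto 0).comp ((zero_at_infty a).comp σ.tendsto_q)
        rwa [Matrix.single_zero] at h⟩, fun s z => by
    change Matrix.single i i (a (σ.q (s * σ.ι z))) =
      diagMat z * Matrix.single i i (a (σ.q s)) * star (diagMat z)
    have h : (![1, (z : ℂ)] i) * ![1, star (z : ℂ)] i = 1 := by
      fin_cases i
      · exact mul_one 1
      · exact (mul_comm _ _).trans (star_mul_circle z)
    rw [single_conj, map_mul, σ.q_ι, mul_one, mul_right_comm, h, one_mul]⟩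
  map_smul' c a := σ.linking_ext fun s => (Matrix.smul_single c i i (a (σ.q s))).symm
  map_zero' := σ.linking_ext fun s => Matrix.single_zero i i
  map_add' a b := σ.linking_ext fun s => Matrix.single_add i i (a (σ.q s)) (b (σ.q s))
  map_mul' a b := σ.linking_ext fun s =>
    (Matrix.single_mul_single_same (i := i) (j := i) (k := i) (c := a (σ.q s)) (b (σ.q s))).symm
  map_star' a := σ.linking_ext fun s => (Matrix.conjTranspose_single i i (a (σ.q s))).symm

theorem corner_apply (i : Fin 2) (a : C₀(G, ℂ)) (s : Gσ) :
    (σ.corner i a).1 s = Matrix.single i i (a (σ.q s)) := rfl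

theorem corner_act (i : Fin 2) (s : Gσ) (a : C₀(G, ℂ)) :
    σ.corner i ((rtAction G ℂ).act (σ.q s) a) = σ.linkingTwisted.act s (σ.corner i a) :=
  σ.linking_ext fun t => by
    change Matrix.single i i (a (σ.q t * σ.q s)) = Matrix.single i i (a (σ.q (t * s)))
    rw [σ.q.map_mul]

/-- The off-diagonal embedding of `C₀(G_σ, ῑ)` into the linking algebra: `x ↦ (0 x; 0 0)`. -/
def offCornerₗ : σ.C0iota →ₗ[ℂ] σ.linking where
  toFun x := ⟨⟨⟨fun s => Matrix.single 0 1 (x.1 s),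
      (continuous_single 0 1).comp x.1.continuous⟩, by
        have h : Tendsto (fun s => (Matrix.single 0 1 (x.1 s) : Matrix (Fin 2) (Fin 2) ℂ))
            (cocompact Gσ) (𝓝 (Matrix.single 0 1 (0 : ℂ))) :=
          ((continuous_single 0 1).tendsto 0).comp (zero_at_infty x.1)
        rwa [Matrix.single_zero] at h⟩, fun s z => by
    change Matrix.single 0 1 (x.1 (s * σ.ι z)) =
      diagMat z * Matrix.single 0 1 (x.1 s) * star (diagMat z)
    have hx : x.1 (s * σ.ι z) = star (z : ℂ) * x.1 s := x.2 s z
    rw [single_conj, hx, mul_right_comm]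
    simp⟩
  map_add' x y := σ.linking_ext fun s => Matrix.single_add 0 1 (x.1 s) (y.1 s)
  map_smul' c x := σ.linking_ext fun s => (Matrix.smul_single c 0 1 (x.1 s)).symm

theorem offCornerₗ_apply (x : σ.C0iota) (s : Gσ) :
    (σ.offCornerₗ x).1 s = Matrix.single 0 1 (x.1 s) := rfl

theorem exists_norm_single_le : ∃ C : ℝ, 0 ≤ C ∧ ∀ c : ℂ,
    ‖(Matrix.single 0 1 c : Matrix (Fin 2) (Fin 2) ℂ)‖ ≤ C * ‖c‖ := by
  let T := LinearMap.toContinuousLinearMap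
    (Matrix.singleLinearMap ℂ 0 1 : ℂ →ₗ[ℂ] Matrix (Fin 2) (Fin 2) ℂ)
  exact ⟨‖T‖, norm_nonneg _, fun c => T.le_opNorm c⟩

theorem continuous_offCornerₗ : Continuous σ.offCornerₗ := by
  obtain ⟨C, hC, h⟩ := exists_norm_single_le
  refine AddMonoidHomClass.continuous_of_bound σ.offCornerₗ C fun x => ?_
  refine norm_le_C0 (F := (σ.offCornerₗ x).1) (mul_nonneg hC (norm_nonneg x)) fun s => ?_
  rw [offCornerₗ_apply]
  exact (h _).trans (mul_le_mul_of_nonneg_left (norm_apply_le_C0 x.1 s) hC)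

/-- The off-diagonal embedding as a continuous linear map. -/
def offCorner : σ.C0iota →L[ℂ] σ.linking := ⟨σ.offCornerₗ, σ.continuous_offCornerₗ⟩

theorem offCorner_apply (x : σ.C0iota) (s : Gσ) :
    (σ.offCorner x).1 s = Matrix.single 0 1 (x.1 s) := rfl

variable [MeasurableSpace G] [BorelSpace G] [MeasurableSpace Gσ] [BorelSpace Gσ]
  (μ : Measure Gσ) [IsHaarMeasure μ] (ν : Measure G) [IsHaarMeasure ν]

/-- The Green-twisted crossed product `L ⋊_{(Rt,τ)} G` of the linking algebra `L` of
`C₀(G_σ, ῑ)`. -/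
abbrev LinkingCP : Type _ := TwistedCrossedProduct σ.linkingTwisted μ

/-- The twisted crossed product `C₀(G) ⋊_{(rt,ι^σ)} G`. -/
abbrev TwistedCP : Type _ := TwistedCrossedProduct σ.rtTwisted μ

/-- The canonical homomorphism of `C₀(G) ⋊_rt G` into the upper left corner of `L ⋊ G`, on the
level of functions `f ∈ C_c(G, C₀(G))`: `f ↦ (f ∘ q 0; 0 0)`. -/
def jAConv (hq : MeasurePreserving σ.q μ ν) :
    Conv (rtAction G ℂ) ν →⋆ₙₐ[ℂ] σ.linkingTwisted.twistedConv μ :=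
  NonUnitalStarAlgHom.codRestrict
    (Conv.pullback (α' := σ.linkingTwisted.toCStarAction) σ.q σ.continuous_q σ.tendsto_q hq
      (σ.corner 0) (σ.corner_act 0))
    (σ.linkingTwisted.twistedConv μ) (fun f z s => by
      change σ.corner 0 (f (σ.q (σ.ι z * s))) = (σ.diagMul z⁻¹).snd (σ.corner 0 (f (σ.q s)))
      rw [map_mul, σ.q_ι, one_mul]
      refine σ.linking_ext fun t => ?_
      rw [diagMul_snd, corner_apply, single_mul_diagMat]
      simp)

/-- The canonical homomorphism `C₀(G) ⋊_rt G → L ⋊ G` onto the upper left corner. -/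
def jA (hq : MeasurePreserving σ.q μ ν) :
    CrossedProduct (rtAction G ℂ) ν →⋆ₙₐ[ℂ] σ.LinkingCP μ :=
  Env.map (σ.jAConv μ ν hq) fun f => Conv.l1Norm_pullback σ.q σ.continuous_q σ.tendsto_q hq
    (σ.corner 0) (σ.corner_act 0) f

theorem rtTwisted_τ_snd (z : Circle) (a : C₀(G, ℂ)) : (σ.rtTwisted.τ z).snd a = (z : ℂ) • a := by
  change (algebraMap ℂ 𝓜(ℂ, C₀(G, ℂ)) z).snd a = _
  rw [DoubleCentralizer.algebraMap_snd]; simp [Algebra.algebraMap_eq_smul_one]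

/-- The canonical homomorphism of `C₀(G) ⋊_{(rt,ι^σ)} G` into the lower right corner of `L ⋊ G`,
on the level of functions: `f ↦ (0 0; 0 f)`. -/
def jBConv : σ.rtTwisted.twistedConv μ →⋆ₙₐ[ℂ] σ.linkingTwisted.twistedConv μ :=
  NonUnitalStarAlgHom.codRestrict
    ((Conv.pullback (α := σ.rtTwisted.toCStarAction) (α' := σ.linkingTwisted.toCStarAction)
      (MonoidHom.id Gσ) continuous_id tendsto_id (MeasurePreserving.id μ)
      (σ.corner 1) (σ.corner_act 1)).comp (NonUnitalStarSubalgebraClass.subtype (σ.rtTwisted.twistedConv μ)))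
    (σ.linkingTwisted.twistedConv μ) (fun f z s => by
      change σ.corner 1 (f.1 (σ.ι z * s)) = (σ.diagMul z⁻¹).snd (σ.corner 1 (f.1 s))
      have h : f.1 (σ.ι z * s) = (σ.rtTwisted.τ z⁻¹).snd (f.1 s) := f.2 z s
      rw [h, rtTwisted_τ_snd, map_smul]
      refine σ.linking_ext fun t => ?_
      rw [diagMul_snd, corner_apply, single_mul_diagMat]
      change ((z⁻¹ : Circle) : ℂ) • Matrix.single 1 1 (f.1 s (σ.q t)) = _
      rw [Matrix.smul_single]
      simp [mul_comm])

/-- The canonical homomorphism `C₀(G) ⋊_{(rt,ι^σ)} G → L ⋊ G` onto the lower right corner. -/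
def jB : σ.TwistedCP μ →⋆ₙₐ[ℂ] σ.LinkingCP μ :=
  Env.map (σ.jBConv μ) fun f => Conv.l1Norm_pullback (α := σ.rtTwisted.toCStarAction)
    (MonoidHom.id Gσ) continuous_id tendsto_id (MeasurePreserving.id μ) (σ.corner 1)
    (σ.corner_act 1) f.1

instance : NormedAddCommGroup σ.C0iota := Submodule.normedAddCommGroup _

instance : NormedSpace ℂ σ.C0iota := Submodule.normedSpace _

/-- `C_c(G_σ, C₀(G_σ, ῑ))` with the twist: the continuous compactly supported functions
`f : G_σ → C₀(G_σ, ῑ)` with `f(zs) = z̄ f(s)`. -/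
def ccIota : Submodule ℂ (Gσ → σ.C0iota) where
  carrier := {f | Continuous f ∧ HasCompactSupport f ∧
    ∀ (z : Circle) (s : Gσ), f (σ.ι z * s) = star (z : ℂ) • f s}
  zero_mem' := ⟨continuous_const, HasCompactSupport.zero, fun z s => by simp⟩
  add_mem' {f g} hf hg := ⟨hf.1.add hg.1, hf.2.1.add hg.2.1, fun z s => by
    simp [hf.2.2 z s, hg.2.2 z s]⟩
  smul_mem' c f hf := ⟨hf.1.const_smul c, hf.2.1.smul_left (f := fun _ => c), fun z s => by
    simp only [Pi.smul_apply, hf.2.2 z s]; rw [smul_comm]⟩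

/-- The inclusion of `C_c(G_σ, C₀(G_σ, ῑ))` into the twisted convolution algebra of the linking
algebra, as upper right corner: `f ↦ (0 f; 0 0)`. -/
def jXConv : σ.ccIota →ₗ[ℂ] σ.linkingTwisted.twistedConv μ where
  toFun f := ⟨Conv.mk (fun s => σ.offCorner (f.1 s)) (σ.offCorner.continuous.comp f.2.1)
    (f.2.2.1.comp_left (map_zero σ.offCorner)), fun z s => by
      change σ.offCorner (f.1 (σ.ι z * s)) = (σ.diagMul z⁻¹).snd (σ.offCorner (f.1 s))
      rw [f.2.2.2 z s, map_smul]
      refine σ.linking_ext fun t => ?_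
      rw [diagMul_snd, offCorner_apply, single_mul_diagMat]
      change star (z : ℂ) • Matrix.single 0 1 ((f.1 s).1 t) = _
      rw [Matrix.smul_single, Circle.coe_inv_eq_conj]
      simp [mul_comm]⟩
  map_add' f g := Subtype.ext (Conv.ext fun s => map_add σ.offCorner (f.1 s) (g.1 s))
  map_smul' c f := Subtype.ext (Conv.ext fun s => map_smul σ.offCorner c (f.1 s))

/-- The map of `C_c(G_σ, C₀(G_σ, ῑ))` into the crossed product `L ⋊ G`. -/
def jX : σ.ccIota →ₗ[ℂ] σ.LinkingCP μ :=
  (Env.of (σ.linkingTwisted.l1Norm μ) : σ.linkingTwisted.twistedConv μ →ₗ[ℂ] σ.LinkingCP μ) ∘ₗ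
    σ.jXConv μ

/-- The crossed product `C₀(G_σ, ῑ) ⋊_{rt^σ} G`: the upper right corner of `L ⋊ G`, i.e. the
closure of `C_c(G_σ, C₀(G_σ, ῑ))` in `L ⋊ G`. -/
def bimoduleCP : Submodule ℂ (σ.LinkingCP μ) := (LinearMap.range (σ.jX μ)).topologicalClosure

/-- `C_c(G_σ, C₀(G_σ, ῑ))` as a dense subspace of `C₀(G_σ, ῑ) ⋊ G`. -/
def ofX : σ.ccIota →ₗ[ℂ] σ.bimoduleCP μ :=
  (σ.jX μ).codRestrict (σ.bimoduleCP μ)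
    fun f => Submodule.le_topologicalClosure _ (LinearMap.mem_range_self _ f)

end Twist

/-! ## Multiplication and translation operators -/

section Operators

variable {H : Type*} [TopologicalSpace H] [Group H] [IsTopologicalGroup H]
  [LocallyCompactSpace H] [T2Space H] [MeasurableSpace H] [BorelSpace H]

theorem memLp_mul (μ : Measure H) (f : C₀(H, ℂ)) (ξ : Lp ℂ 2 μ) :
    MemLp (fun s => f s * ξ s) 2 μ := by
  refine (Lp.memLp ξ).of_le_mul (c := ‖f‖)
    (f.continuous.aestronglyMeasurable.mul (Lp.aestronglyMeasurable ξ)) ?_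
  refine Eventually.of_forall fun s => ?_
  rw [norm_mul]
  refine mul_le_mul_of_nonneg_right ?_ (norm_nonneg _)
  rw [← ZeroAtInftyContinuousMap.norm_toBCF_eq_norm]
  exact f.toBCF.norm_coe_le_norm s

/-- The multiplication operator `ξ ↦ fξ` on `L²(H)`, for `f ∈ C₀(H)`. -/
def mulOp (μ : Measure H) (f : C₀(H, ℂ)) : Lp ℂ 2 μ →L[ℂ] Lp ℂ 2 μ :=
  LinearMap.mkContinuous
    { toFun := fun ξ => (memLp_mul μ f ξ).toLp _
      map_add' := fun ξ η => by
        rw [← MemLp.toLp_add]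
        refine MemLp.toLp_congr _ _ ?_
        filter_upwards [Lp.coeFn_add ξ η] with s hs
        simp only [hs, Pi.add_apply, mul_add]
      map_smul' := fun c ξ => by
        rw [RingHom.id_apply, ← MemLp.toLp_const_smul]
        refine MemLp.toLp_congr _ _ ?_
        filter_upwards [Lp.coeFn_smul c ξ] with s hs
        simp only [hs, Pi.smul_apply, smul_eq_mul, mul_left_comm] } ‖f‖
    fun ξ => by
      refine Lp.norm_le_mul_norm_of_ae_le_mul ?_
      filter_upwards [MemLp.coeFn_toLp (memLp_mul μ f ξ)] with s hs
      change ‖((memLp_mul μ f ξ).toLp _) s‖ ≤ _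
      rw [hs, norm_mul]
      refine mul_le_mul_of_nonneg_right ?_ (norm_nonneg _)
      rw [← ZeroAtInftyContinuousMap.norm_toBCF_eq_norm]
      exact f.toBCF.norm_coe_le_norm s

theorem mulOp_ae (μ : Measure H) (f : C₀(H, ℂ)) (ξ : Lp ℂ 2 μ) :
    mulOp μ f ξ =ᵐ[μ] fun s => f s * ξ s := MemLp.coeFn_toLp (memLp_mul μ f ξ)

variable (μ : Measure H) [IsHaarMeasure μ] [μ.Regular]

theorem map_mul_right_eq (s : H) : map (· * s) μ = modularCharacter s • μ := by
  have h : (modularCharacter s) = haarScalarFactor (map (· * s) μ) μ :=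
    modularCharacterFun_eq_haarScalarFactor μ s
  have : (map (· * s) μ).Regular := Regular.map (Homeomorph.mulRight s)
  rw [h]
  exact isMulLeftInvariant_eq_smul_of_regular (map (· * s) μ) μ

theorem quasiMeasurePreserving_mul_right' (s : H) : QuasiMeasurePreserving (· * s) μ μ :=
  ⟨by fun_prop, by
    rw [map_mul_right_eq]
    exact Measure.AbsolutelyContinuous.smul_left Measure.AbsolutelyContinuous.rfl _⟩

theorem memLp_translate (s : H) (ξ : Lp ℂ 2 μ) :
    MemLp (fun t => ((modularΔ s ^ (1 / 2 : ℝ) : ℝ) : ℂ) * ξ (t * s)) 2 μ := by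
  have h1 : MemLp (ξ : H → ℂ) 2 (map (· * s) μ) := by
    rw [map_mul_right_eq]
    exact (Lp.memLp ξ).smul_measure (c := (modularCharacter s : ENNReal)) ENNReal.coe_ne_top
  have h2 := (memLp_map_measure_iff h1.1 (by fun_prop)).1 h1
  exact h2.const_mul _

theorem norm_translate (s : H) (ξ : Lp ℂ 2 μ) : ‖(memLp_translate μ s ξ).toLp _‖ = ‖ξ‖ := by
  have hm : AEStronglyMeasurable (ξ : H → ℂ) (map (· * s) μ) :=
    (Lp.aestronglyMeasurable ξ).mono_ac (quasiMeasurePreserving_mul_right' μ s).absolutelyContinuous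
  have h1 : eLpNorm (fun t => ξ (t * s)) 2 μ =
      ((modularCharacter s ^ (1 / 2 : ℝ) : NNReal) : ENNReal) * eLpNorm ξ 2 μ := by
    have := eLpNorm_map_measure (p := 2) hm (f := (· * s)) (μ := μ) (by fun_prop)
    rw [map_mul_right_eq, eLpNorm_smul_measure_of_ne_top' (by simp)] at this
    refine this.symm.trans ?_
    rw [ENNReal.smul_def, smul_eq_mul]
    norm_num
  rw [Lp.norm_toLp, Lp.norm_def]
  change (eLpNorm ((((modularΔ s ^ (1 / 2 : ℝ) : ℝ) : ℂ)) • fun t => ξ (t * s)) 2 μ).toReal = _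
  rw [eLpNorm_const_smul, h1, ENNReal.toReal_mul, ENNReal.toReal_mul, ← mul_assoc]
  convert one_mul _
  have hpos : 0 < modularΔ s := modularΔ_pos s
  rw [toReal_enorm, Complex.norm_real, Real.norm_of_nonneg (by positivity), ENNReal.coe_toReal,
    NNReal.coe_rpow, ← modularΔ_inv, ← Real.mul_rpow hpos.le (modularΔ_pos _).le, ← modularΔ_mul,
    mul_inv_cancel, modularΔ_one, Real.one_rpow]

/-- The right regular representation `ρ` of `H` on `L²(H)`:
`(ρ_s ξ)(t) = Δ(s)^{1/2} ξ(ts)`. -/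
def rho (s : H) : Lp ℂ 2 μ →L[ℂ] Lp ℂ 2 μ :=
  LinearMap.mkContinuous
    { toFun := fun ξ => (memLp_translate μ s ξ).toLp _
      map_add' := fun ξ η => by
        rw [← MemLp.toLp_add]
        refine MemLp.toLp_congr _ _ ?_
        filter_upwards [(quasiMeasurePreserving_mul_right' μ s).ae (Lp.coeFn_add ξ η)] with t ht
        simp only [ht, Pi.add_apply, mul_add]
      map_smul' := fun c ξ => by
        rw [RingHom.id_apply, ← MemLp.toLp_const_smul]
        refine MemLp.toLp_congr _ _ ?_
        filter_upwards [(quasiMeasurePreserving_mul_right' μ s).ae (Lp.coeFn_smul c ξ)] with t ht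
        simp only [ht, Pi.smul_apply, smul_eq_mul, mul_left_comm] } 1
    fun ξ => by rw [one_mul]; exact (norm_translate μ s ξ).le

theorem rho_ae (s : H) (ξ : Lp ℂ 2 μ) :
    rho μ s ξ =ᵐ[μ] fun t => ((modularΔ s ^ (1 / 2 : ℝ) : ℝ) : ℂ) * ξ (t * s) :=
  MemLp.coeFn_toLp (memLp_translate μ s ξ)

end Operators

namespace Twist

variable {G Gσ : Type*}
  [TopologicalSpace G] [Group G] [IsTopologicalGroup G] [LocallyCompactSpace G] [T2Space G]
  [TopologicalSpace Gσ] [Group Gσ] [IsTopologicalGroup Gσ] [LocallyCompactSpace Gσ] [T2Space Gσ]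
  (σ : Twist G Gσ)
  [MeasurableSpace G] [BorelSpace G] [MeasurableSpace Gσ] [BorelSpace Gσ]
  (μ : Measure Gσ) [IsHaarMeasure μ] [μ.Regular] (ν : Measure G) [IsHaarMeasure ν] [ν.Regular]

/-- `L²(G_σ, ι)`: the elements `ξ ∈ L²(G_σ)` with `ξ(sz) = z ξ(s)`. -/
def L2iota : Submodule ℂ (Lp ℂ 2 μ) where
  carrier := {ξ | ∀ z : Circle, (fun s => ξ (s * σ.ι z)) =ᵐ[μ] fun s => (z : ℂ) * ξ s}
  zero_mem' z := by
    filter_upwards [Lp.coeFn_zero ℂ 2 μ,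
      (quasiMeasurePreserving_mul_right' μ (σ.ι z)).ae (Lp.coeFn_zero ℂ 2 μ)] with s h1 h2
    rw [h1, h2]; simp
  add_mem' {ξ η} hξ hη z := by
    filter_upwards [Lp.coeFn_add ξ η, hξ z, hη z,
      (quasiMeasurePreserving_mul_right' μ (σ.ι z)).ae (Lp.coeFn_add ξ η)] with s h1 h2 h3 h4
    rw [h1, h4, Pi.add_apply, Pi.add_apply, h2, h3, mul_add]
  smul_mem' c ξ hξ z := by
    filter_upwards [Lp.coeFn_smul c ξ, hξ z,
      (quasiMeasurePreserving_mul_right' μ (σ.ι z)).ae (Lp.coeFn_smul c ξ)] with s h1 h2 h3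
    rw [h1, h3, Pi.smul_apply, Pi.smul_apply, h2, smul_eq_mul, smul_eq_mul, mul_left_comm]

theorem mem_L2iota {ξ : Lp ℂ 2 μ} : ξ ∈ σ.L2iota μ ↔
    ∀ z : Circle, (fun s => ξ (s * σ.ι z)) =ᵐ[μ] fun s => (z : ℂ) * ξ s := Iff.rfl

theorem mem_L2iota_iff {ξ : Lp ℂ 2 μ} :
    ξ ∈ σ.L2iota μ ↔ ∀ z : Circle, rho μ (σ.ι z) ξ = (z : ℂ) • ξ := by
  rw [mem_L2iota]
  refine forall_congr' fun z => ?_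
  rw [Lp.ext_iff]
  have h1 : rho μ (σ.ι z) ξ =ᵐ[μ] fun t => ξ (t * σ.ι z) := by
    filter_upwards [rho_ae μ (σ.ι z) ξ] with t ht
    rw [ht, TwistedAction.modularΔ_ι σ.toCentralCircle, Real.one_rpow, Complex.ofReal_one, one_mul]
  have h2 : ((z : ℂ) • ξ : Lp ℂ 2 μ) =ᵐ[μ] fun t => (z : ℂ) * ξ t := Lp.coeFn_smul _ _
  exact ⟨fun h => h1.trans (h.trans h2.symm), fun h => h1.symm.trans (h.trans h2)⟩

theorem isClosed_L2iota : IsClosed (σ.L2iota μ : Set (Lp ℂ 2 μ)) := by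
  have : (σ.L2iota μ : Set (Lp ℂ 2 μ)) =
      ⋂ z : Circle, {ξ | rho μ (σ.ι z) ξ = (z : ℂ) • ξ} := by
    ext ξ
    simp only [SetLike.mem_coe, mem_L2iota_iff, Set.mem_iInter, Set.mem_ofPred_eq]
  rw [this]
  exact isClosed_iInter fun z => isClosed_eq (rho μ (σ.ι z)).continuous (continuous_const_smul _)

instance : CompleteSpace (σ.L2iota μ) := (σ.isClosed_L2iota μ).completeSpace_coe

/-- The function `f ∘ q ∈ C₀(G_σ)`, for `f ∈ C₀(G)`. -/
def pull (f : C₀(G, ℂ)) : C₀(Gσ, ℂ) :=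
  ⟨⟨fun s => f (σ.q s), f.continuous.comp σ.continuous_q⟩, (zero_at_infty f).comp σ.tendsto_q⟩

/-- The representation `M^σ` of `C₀(G)` on `L²(G_σ, ι)`: `(M^σ(f)ξ)(s) = f(q(s)) ξ(s)`. -/
def Msigma (f : C₀(G, ℂ)) : σ.L2iota μ →L[ℂ] σ.L2iota μ :=
  (mulOp μ (σ.pull f)).restrict fun ξ hξ z => by
    filter_upwards [mulOp_ae μ (σ.pull f) ξ, hξ z,
      (quasiMeasurePreserving_mul_right' μ (σ.ι z)).ae (mulOp_ae μ (σ.pull f) ξ)] with s h1 h2 h3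
    have h4 : σ.pull f (s * σ.ι z) = σ.pull f s := by
      change f (σ.q (s * σ.ι z)) = f (σ.q s)
      rw [map_mul, σ.q_ι, mul_one]
    rw [h1, h3, h2, h4, mul_left_comm]

/-- The representation `ρ^σ` of `G_σ` on `L²(G_σ, ι)`: `(ρ^σ_s ξ)(t) = Δ(s)^{1/2} ξ(ts)`. (Here
`Δ` is the modular function of `G_σ`, which coincides with that of `G`, composed with `q`.) -/
def rhoSigma (s : Gσ) : σ.L2iota μ →L[ℂ] σ.L2iota μ :=
  (rho μ s).restrict fun ξ hξ z => by
    filter_upwards [rho_ae μ s ξ, (quasiMeasurePreserving_mul_right' μ s).ae (hξ z),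
      (quasiMeasurePreserving_mul_right' μ (σ.ι z)).ae (rho_ae μ s ξ)] with t h1 h2 h3
    have h4 : t * σ.ι z * s = t * s * σ.ι z := by rw [mul_assoc, σ.central, ← mul_assoc]
    rw [h1, h3, h4, h2, mul_left_comm]

/-- The map `L^σ : C₀(G_σ, ῑ) → 𝓑(L²(G_σ, ι), L²(G))`, `(L^σ(f)ξ)(q(s)) = f(s) ξ(s)`: since `fξ` is
constant on `𝕋`-cosets, it lies in the range of the isometry `L²(G) → L²(G_σ)`, `η ↦ η ∘ q`, and is
mapped back to `L²(G)` by the adjoint of that isometry. -/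
def Lsigma (hq : MeasurePreserving σ.q μ ν) (f : σ.C0iota) : σ.L2iota μ →L[ℂ] Lp ℂ 2 ν :=
  (Lp.compMeasurePreservingₗᵢ ℂ σ.q hq : Lp ℂ 2 ν →ₗᵢ[ℂ] Lp ℂ 2 μ).toContinuousLinearMap.adjoint ∘L
    mulOp μ f.1 ∘L (σ.L2iota μ).subtypeL

end Twist

/-! ## Imprimitivity bimodules, their representations and multipliers -/

section Bimodule

variable (A X B : Type*) [NonUnitalCStarAlgebra A] [NormedAddCommGroup X] [NormedSpace ℂ X]
  [CompleteSpace X] [NonUnitalCStarAlgebra B]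

/-- `A`–`B` imprimitivity bimodules. The left inner product is linear in the first
variable, the right inner product is linear in the second variable. -/
structure ImprimitivityBimodule where
  /-- The left action `a · x`. -/
  lsmul : A →ₗ[ℂ] X →ₗ[ℂ] X
  /-- The right action `x · b`. -/
  rsmul : X →ₗ[ℂ] B →ₗ[ℂ] X
  /-- The `A`-valued inner product. -/
  linner : X → X → A
  /-- The `B`-valued inner product. -/
  rinner : X → X → B
  mul_lsmul : ∀ a a' x, lsmul (a * a') x = lsmul a (lsmul a' x)
  rsmul_mul : ∀ x b b', rsmul x (b * b') = rsmul (rsmul x b) b'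
  lsmul_rsmul : ∀ a x b, rsmul (lsmul a x) b = lsmul a (rsmul x b)
  linner_add : ∀ x x' y, linner (x + x') y = linner x y + linner x' y
  linner_smul : ∀ (c : ℂ) x y, linner (c • x) y = c • linner x y
  linner_lsmul : ∀ a x y, linner (lsmul a x) y = a * linner x y
  star_linner : ∀ x y, star (linner x y) = linner y x
  linner_self_nonneg : ∀ x, ∃ a, linner x x = star a * a
  rinner_add : ∀ x y y', rinner x (y + y') = rinner x y + rinner x y'
  rinner_smul : ∀ (c : ℂ) x y, rinner x (c • y) = c • rinner x y
  rinner_rsmul : ∀ x y b, rinner x (rsmul y b) = rinner x y * b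
  star_rinner : ∀ x y, star (rinner x y) = rinner y x
  rinner_self_nonneg : ∀ x, ∃ b, rinner x x = star b * b
  linner_lsmul_eq : ∀ x y z, lsmul (linner x y) z = rsmul x (rinner y z)
  norm_linner_self : ∀ x, ‖linner x x‖ = ‖x‖ ^ 2
  norm_rinner_self : ∀ x, ‖rinner x x‖ = ‖x‖ ^ 2
  linner_full : Dense (Submodule.span ℂ {a | ∃ x y, a = linner x y} : Set A)
  rinner_full : Dense (Submodule.span ℂ {b | ∃ x y, b = rinner x y} : Set B)

namespace ImprimitivityBimodule

variable {A X B} (𝒳 : ImprimitivityBimodule A X B)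

/-- The multiplier bimodule `𝓜(X)`: pairs `m = (m_A, m_B)` of linear maps `m_A : A → X` (`A`-linear)
and `m_B : B → X` (`B`-linear) with `m_A(a) · b = a · m_B(b)`; think of `m_A(a) = a · m` and
`m_B(b) = m · b`. -/
def Multiplier : Submodule ℂ ((A →ₗ[ℂ] X) × (B →ₗ[ℂ] X)) where
  carrier := {m | (∀ a a', m.1 (a * a') = 𝒳.lsmul a (m.1 a')) ∧
    (∀ b b', m.2 (b * b') = 𝒳.rsmul (m.2 b) b') ∧
    ∀ a b, 𝒳.rsmul (m.1 a) b = 𝒳.lsmul a (m.2 b)}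
  zero_mem' := by simp
  add_mem' {m n} hm hn := ⟨fun a a' => by simp [hm.1, hn.1], fun b b' => by simp [hm.2.1, hn.2.1],
    fun a b => by simp [hm.2.2, hn.2.2]⟩
  smul_mem' c m hm := ⟨fun a a' => by simp [hm.1], fun b b' => by simp [hm.2.1],
    fun a b => by simp [hm.2.2]⟩

/-- The inclusion `X → 𝓜(X)`, `x ↦ (a ↦ a · x, b ↦ x · b)`. -/
def toMultiplier (x : X) : 𝒳.Multiplier :=
  ⟨(𝒳.lsmul.flip x, 𝒳.rsmul x), fun a a' => 𝒳.mul_lsmul a a' x, fun b b' => 𝒳.rsmul_mul x b b',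
    fun a b => 𝒳.lsmul_rsmul a x b⟩

/-- `m' = k · m` for `k ∈ 𝓜(A)` and `m, m' ∈ 𝓜(X)`, i.e. `a · m' = (ak) · m` for all `a ∈ A`. -/
def IsLeftProduct (k : 𝓜(ℂ, A)) (m m' : 𝒳.Multiplier) : Prop :=
  ∀ a, m'.1.1 a = m.1.1 (k.snd a)

/-- `m' = m · l` for `l ∈ 𝓜(B)` and `m, m' ∈ 𝓜(X)`, i.e. `m' · b = m · (lb)` for all `b ∈ B`. -/
def IsRightProduct (m : 𝒳.Multiplier) (l : 𝓜(ℂ, B)) (m' : 𝒳.Multiplier) : Prop :=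
  ∀ b, m'.1.2 b = m.1.2 (l.fst b)

/-- `k ∈ 𝓜(A)` is the `𝓜(A)`-valued inner product of `m, n ∈ 𝓜(X)`, i.e.
`⟪a · m, a' · n⟫ = a k a'*` for all `a, a' ∈ A`. -/
def IsLeftInner (m n : 𝒳.Multiplier) (k : 𝓜(ℂ, A)) : Prop :=
  ∀ a a', 𝒳.linner (m.1.1 a) (n.1.1 a') = k.snd a * star a'

/-- `l ∈ 𝓜(B)` is the `𝓜(B)`-valued inner product of `m, n ∈ 𝓜(X)`, i.e.
`⟪m · b, n · b'⟫ = b* l b'` for all `b, b' ∈ B`. -/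
def IsRightInner (m n : 𝒳.Multiplier) (l : 𝓜(ℂ, B)) : Prop :=
  ∀ b b', 𝒳.rinner (m.1.2 b) (n.1.2 b') = star b * l.fst b'

variable (H H' : Type*) [NormedAddCommGroup H] [InnerProductSpace ℂ H] [CompleteSpace H]
  [NormedAddCommGroup H'] [InnerProductSpace ℂ H'] [CompleteSpace H']

/-- A representation of the imprimitivity bimodule `X` on the pair of Hilbert spaces `(H, H')`. -/
structure Rep where
  πA : A →⋆ₙₐ[ℂ] (H →L[ℂ] H)
  πX : X →ₗ[ℂ] (H' →L[ℂ] H)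
  πB : B →⋆ₙₐ[ℂ] (H' →L[ℂ] H')
  map_lsmul : ∀ a x, πX (𝒳.lsmul a x) = πA a ∘L πX x
  map_rsmul : ∀ x b, πX (𝒳.rsmul x b) = πX x ∘L πB b
  map_linner : ∀ x y, πA (𝒳.linner x y) = πX x ∘L (πX y).adjoint
  map_rinner : ∀ x y, πB (𝒳.rinner x y) = (πX x).adjoint ∘L πX y

variable {𝒳 H H'}

/-- The representation is an isomorphism of the `A`–`B` bimodule `X` onto the
`𝓚(H)`–`𝓚(H')` imprimitivity bimodule `𝓚(H', H)` of compact operators. -/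
structure Rep.IsIsoCompacts (R : 𝒳.Rep H H') : Prop where
  injective_A : Function.Injective R.πA
  injective_X : Function.Injective R.πX
  injective_B : Function.Injective R.πB
  range_A : Set.range R.πA = {T : H →L[ℂ] H | IsCompactOperator T}
  range_X : Set.range R.πX = {T : H' →L[ℂ] H | IsCompactOperator T}
  range_B : Set.range R.πB = {T : H' →L[ℂ] H' | IsCompactOperator T}

/-- The representation extends to an isomorphism of the `𝓜(A)`–`𝓜(B)` multiplier bimodule `𝓜(X)` onto
the `𝓑(H)`–`𝓑(H')` bimodule `𝓑(H', H)`, compatible with both actions and both inner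
products. -/
def Rep.ExtendsToMultipliers (R : 𝒳.Rep H H') : Prop :=
  ∃ (ΦA : 𝓜(ℂ, A) ≃⋆ₐ[ℂ] (H →L[ℂ] H)) (ΦX : 𝒳.Multiplier ≃ₗ[ℂ] (H' →L[ℂ] H))
    (ΦB : 𝓜(ℂ, B) ≃⋆ₐ[ℂ] (H' →L[ℂ] H')),
    (∀ a : A, ΦA (a : 𝓜(ℂ, A)) = R.πA a) ∧
    (∀ x : X, ΦX (𝒳.toMultiplier x) = R.πX x) ∧
    (∀ b : B, ΦB (b : 𝓜(ℂ, B)) = R.πB b) ∧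
    (∀ k m m', 𝒳.IsLeftProduct k m m' ↔ ΦX m' = ΦA k ∘L ΦX m) ∧
    (∀ m l m', 𝒳.IsRightProduct m l m' ↔ ΦX m' = ΦX m ∘L ΦB l) ∧
    (∀ m n k, 𝒳.IsLeftInner m n k ↔ ΦA k = ΦX m ∘L (ΦX n).adjoint) ∧
    (∀ m n l, 𝒳.IsRightInner m n l ↔ ΦB l = (ΦX m).adjoint ∘L ΦX n)

end ImprimitivityBimodule
end Bimodule

namespace Twist

variable {G Gσ : Type*}
  [TopologicalSpace G] [Group G] [IsTopologicalGroup G] [LocallyCompactSpace G] [T2Space G]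
  [TopologicalSpace Gσ] [Group Gσ] [IsTopologicalGroup Gσ] [LocallyCompactSpace Gσ] [T2Space Gσ]
  (σ : Twist G Gσ)
  [MeasurableSpace G] [BorelSpace G] [MeasurableSpace Gσ] [BorelSpace Gσ]
  (μ : Measure Gσ) [IsHaarMeasure μ] (ν : Measure G) [IsHaarMeasure ν]

instance : CompleteSpace (σ.bimoduleCP μ) :=
  (Submodule.isClosed_topologicalClosure _).completeSpace_coe

/-- The bimodule operations on `C₀(G_σ, ῑ) ⋊ G` are those of the upper right corner of the
C*-algebra `L ⋊ G`, whose diagonal corners are `C₀(G) ⋊_rt G` and `C₀(G) ⋊_{(rt,ι^σ)} G`: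
all actions and inner products are products in `L ⋊ G`. -/
structure IsCornerBimodule (hq : MeasurePreserving σ.q μ ν)
    (𝒳 : ImprimitivityBimodule (CrossedProduct (rtAction G ℂ) ν) (σ.bimoduleCP μ)
      (σ.TwistedCP μ)) : Prop where
  coe_lsmul : ∀ a x, (𝒳.lsmul a x : σ.LinkingCP μ) = σ.jA μ ν hq a * x
  coe_rsmul : ∀ x b, (𝒳.rsmul x b : σ.LinkingCP μ) = x * σ.jB μ b
  jA_linner : ∀ x y, σ.jA μ ν hq (𝒳.linner x y) = (x : σ.LinkingCP μ) * star (y : σ.LinkingCP μ)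
  jB_rinner : ∀ x y, σ.jB μ (𝒳.rinner x y) = star (x : σ.LinkingCP μ) * (y : σ.LinkingCP μ)
  injective_jA : Function.Injective (σ.jA μ ν hq)
  injective_jB : Function.Injective (σ.jB μ)
  exists_eq : ∀ e : σ.LinkingCP μ, ∃ a x y b,
    e = σ.jA μ ν hq a + (x : σ.bimoduleCP μ) + star ((y : σ.bimoduleCP μ) : σ.LinkingCP μ) +
      σ.jB μ b

end Twist

end TwistCP

end

set_option linter.unusedSectionVars false

noncomputable section

namespace TwistCP

open UniformSpace MeasureTheory MeasureTheory.Measure Topology Filter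
open scoped MultiplierAlgebra ZeroAtInfty Matrix.Norms.L2Operator InnerProductSpace

/-! ## C*-seminorms and algebras of finite rank operators -/

section RankOne

open InnerProductSpace

/-! This is the Stone–von Neumann theorem, proved for the linking algebra `L` so that both diagonal
crossed products and the bimodule between them are handled at once. Let `L` act on `L²(G_σ) ⊕
L²(G_σ)` by matrix multiplication and let `G_σ` act by right translation. For pairs `ξ, η` of
continuous compactly supported functions with `ξ₀(sz) = ξ₀(s)` and `ξ₁(sz) = z ξ₁(s)`, the function
`e(ξ, η)(g)(t) = Δ(g)^{-1/2} ξ(t) η(tg)*` lies in the twisted convolution algebra and is represented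
by the rank one operator of `ξ` and `η`. The relations `e(ξ, η)* = e(η, ξ)` and `e(ξ, η) e(ξ', η') =
⟨η, ξ'⟩ e(ξ, η')` hold already in the convolution algebra (`rankOneSystem`).

Two facts then determine the full crossed product. On the span of the `e(ξ, η)` every C*-seminorm is
at most the operator norm (`RankOneSystem.seminorm_le`): for fixed `x` the sandwich `x* y x` depends
on `y` only through finitely many matrix coefficients, so its seminorm is at most `C ‖π y‖`, and
suitable words `y` in `x` and `x*` remove the constant. Moreover this span is dense for the
`L¹`-norm (`dense_span_rankConv`): an element `f` is an integral kernel `K(t, u)`, which is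
approximated by sums of products `φ(t) K(p, u)` through a partition of unity averaged over the
circle. Hence the universal norm is the operator norm, and `L ⋊ G` is faithfully represented by
compact operators.

Keeping a single matrix entry sends `e(ξ, η)` to an element of the same kind, so both facts hold for
each diagonal corner as an algebra in its own right (`corner_envSeminorm_eq`). The universal norms
of `C₀(G) ⋊ G` and of its twisted version therefore agree with the norm of `L ⋊ G`, and the
canonical maps `jA` and `jB` are isometric.

The equivariant vectors in the two summands are copies of `L²(G)`, embedded by `η ↦ η ∘ q`, and of
`L²(G_σ, ι)`. Compression to them identifies the three corners with all compact operators between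
these spaces (`IsCompactCorner`, `compactTriple`). The bimodule structure is transported from
operators, and injectivity of the representation of `L ⋊ G` shows that it is the one given by
products in `L ⋊ G`. Finally, a multiplier of a bimodule of compact operators is composition with an
operator, whose boundedness comes from the closed graph theorem (`exists_intertwiner`). This gives
the statement about multiplier bimodules. -/

theorem le_of_mul_pow_le {a b C : ℝ} (hb : 0 ≤ b) (n : ℕ → ℕ) (hn : ∀ m, m ≤ n m)
    (h : ∀ m, a ^ 2 * a ^ n m ≤ C * b ^ n m) : a ≤ b := by
  by_contra! hab
  have ha : 0 < a := hb.trans_lt hab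
  -- If `b < a`, dividing the hypothesis by `a ^ n m` bounds `a ^ 2` by `C (b / a) ^ n m`, which
  -- tends to zero.
  have hlim : Tendsto (fun m => C * (b / a) ^ n m) atTop (𝓝 (C * 0)) :=
    ((tendsto_pow_atTop_nhds_zero_of_lt_one (by positivity) ((div_lt_one ha).2 hab)).comp
      (tendsto_atTop_mono hn tendsto_id)).const_mul C
  have hle : a ^ 2 ≤ C * 0 := ge_of_tendsto' hlim fun m => by
    rw [div_pow, mul_div_assoc', le_div_iff₀ (by positivity)]
    exact h m
  nlinarith [pow_pos ha 2]

variable {𝒜 : Type*} [NonUnitalRing 𝒜] [StarRing 𝒜] [Module ℂ 𝒜] [StarModule ℂ 𝒜]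
  [IsScalarTower ℂ 𝒜 𝒜] [SMulCommClass ℂ 𝒜 𝒜]
  {K : Type*} [NormedAddCommGroup K] [InnerProductSpace ℂ K] [CompleteSpace K]

/-- The pulled back norm is itself a C*-seminorm below `N`, hence a member of the family whose
supremum is `envSeminorm N`. -/
theorem Env.norm_map_le_envSeminorm {N : Seminorm ℂ 𝒜} {C : Type*} [NonUnitalCStarAlgebra C]
    (π : 𝒜 →⋆ₙₐ[ℂ] C) (hπ : ∀ x, ‖π x‖ ≤ N x) (x : 𝒜) :
    ‖π x‖ ≤ envSeminorm N x := by
  let p : Seminorm ℂ 𝒜 := (normSeminorm ℂ C).comp (π : 𝒜 →ₗ[ℂ] C)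
  have hp : ∀ x, p x = ‖π x‖ := fun x => rfl
  rw [← hp]
  refine le_envSeminorm ⟨fun x y => ?_, fun x => ?_⟩ hπ x
  · rw [hp, hp, hp, map_mul]; exact norm_mul_le _ _
  · rw [hp, hp, map_mul, map_star, CStarRing.norm_star_mul_self, sq]

/-- A system of elements of a represented *-algebra that multiply like, and are represented by,
the rank one operators of a family of vectors. -/
structure RankOneSystem (π : 𝒜 →⋆ₙₐ[ℂ] (K →L[ℂ] K)) {V : Type*} (j : V → K) (e : V → V → 𝒜) :
    Prop where
  star_eq : ∀ ξ η, star (e ξ η) = e η ξ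
  mul_eq : ∀ ξ η ξ' η', e ξ η * e ξ' η' = inner ℂ (j η) (j ξ') • e ξ η'
  map_eq : ∀ ξ η, π (e ξ η) = rankOne ℂ (j ξ) (j η)

namespace RankOneSystem

variable {π : 𝒜 →⋆ₙₐ[ℂ] (K →L[ℂ] K)} {V : Type*} {j : V → K} {e : V → V → 𝒜}

/-- The span of the elements of the system. -/
def span (e : V → V → 𝒜) : Submodule ℂ 𝒜 := Submodule.span ℂ (Set.range fun p : V × V => e p.1 p.2)

theorem mem_span (ξ η : V) : e ξ η ∈ span e := Submodule.subset_span ⟨(ξ, η), rfl⟩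

theorem span_induction {P : 𝒜 → Prop} (hbase : ∀ ξ η, P (e ξ η)) (hzero : P 0)
    (hadd : ∀ x y, P x → P y → P (x + y)) (hsmul : ∀ (c : ℂ) x, P x → P (c • x)) {x : 𝒜}
    (hx : x ∈ span e) : P x := by
  refine Submodule.span_induction (p := fun x _ => P x) ?_ hzero (fun x y _ _ => hadd x y)
    (fun c x _ => hsmul c x) hx
  rintro _ ⟨⟨ξ, η⟩, rfl⟩
  exact hbase ξ η

variable (h : RankOneSystem π j e)
include h

theorem mul_mem {x y : 𝒜} (hx : x ∈ span e) (hy : y ∈ span e) : x * y ∈ span e := by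
  refine span_induction (P := fun x => x * y ∈ span e) (fun ξ η => ?_) (by simp)
    (fun x x' hx hx' => ?_) (fun c x hx => ?_) hx
  · refine span_induction (P := fun y => e ξ η * y ∈ span e) (fun ξ' η' => ?_) (by simp)
      (fun x x' hx hx' => ?_) (fun c x hx => ?_) hy
    · rw [h.mul_eq]; exact Submodule.smul_mem _ _ (mem_span _ _)
    · rw [mul_add]; exact add_mem hx hx'
    · rw [mul_smul_comm]; exact Submodule.smul_mem _ _ hx
  · rw [add_mul]; exact add_mem hx hx'
  · rw [smul_mul_assoc]; exact Submodule.smul_mem _ _ hx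

theorem star_mem {x : 𝒜} (hx : x ∈ span e) : star x ∈ span e := by
  refine span_induction (P := fun x => star x ∈ span e) (fun ξ η => ?_) (by simp)
    (fun x x' hx hx' => ?_) (fun c x hx => ?_) hx
  · rw [h.star_eq]; exact mem_span _ _
  · rw [star_add]; exact add_mem hx hx'
  · rw [star_smul]; exact Submodule.smul_mem _ _ hx

/-- The multiplication rule collapses a sandwich between two rank one elements to one matrix
coefficient, so `y` enters only through the operator `π y`. This is what brings the operator norm
into play for a seminorm that has no a priori relation to `π`. -/
theorem mul_mul_eq {y : 𝒜} (hy : y ∈ span e) (ξ η ξ' η' : V) :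
    e ξ η * y * e ξ' η' = inner ℂ (j η) (π y (j ξ')) • e ξ η' := by
  refine span_induction (P := fun y => e ξ η * y * e ξ' η' =
    inner ℂ (j η) (π y (j ξ')) • e ξ η') (fun ξ₂ η₂ => ?_) (by simp)
    (fun x x' hx hx' => ?_) (fun c x hx => ?_) hy
  · rw [h.mul_eq, smul_mul_assoc, h.mul_eq, h.map_eq, rankOne_apply, inner_smul_right, smul_smul,
      mul_comm]
  · rw [mul_add, add_mul, hx, hx', map_add, _root_.add_apply, inner_add_right,
      add_smul]
  · rw [mul_smul_comm, smul_mul_assoc, hx, map_smul, _root_.smul_apply,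
      inner_smul_right, smul_smul]

/-- By bilinearity in `x` and `x'` it suffices to treat rank one elements, where `mul_mul_eq` and
the Cauchy–Schwarz inequality apply. The constant depends on `x`, `x'` and `p`, but not on `y`. -/
theorem exists_bound {p : Seminorm ℂ 𝒜} {x x' : 𝒜} (hx : x ∈ span e) (hx' : x' ∈ span e) :
    ∃ C : ℝ, ∀ y ∈ span e, p (x * y * x') ≤ C * ‖π y‖ := by
  refine span_induction (P := fun x => ∃ C : ℝ, ∀ y ∈ span e, p (x * y * x') ≤ C * ‖π y‖)
    (fun ξ η => ?_) ⟨0, by simp⟩ ?_ ?_ hx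
  · refine span_induction
      (P := fun x' => ∃ C : ℝ, ∀ y ∈ span e, p (e ξ η * y * x') ≤ C * ‖π y‖)
      (fun ξ' η' => ⟨‖j η‖ * ‖j ξ'‖ * p (e ξ η'), fun y hy => ?_⟩) ⟨0, by simp⟩ ?_ ?_ hx'
    · rw [h.mul_mul_eq hy, map_smul_eq_mul]
      calc _ ≤ ‖j η‖ * (‖π y‖ * ‖j ξ'‖) * p (e ξ η') := by
            gcongr
            exact (norm_inner_le_norm _ _).trans (by gcongr; exact (π y).le_opNorm _)
        _ = _ := by ring
    · rintro a b ⟨C, hC⟩ ⟨D, hD⟩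
      refine ⟨C + D, fun y hy => ?_⟩
      rw [mul_add, add_mul]
      exact (map_add_le_add p _ _).trans (add_le_add (hC y hy) (hD y hy))
    · rintro c a ⟨C, hC⟩
      refine ⟨‖c‖ * C, fun y hy => ?_⟩
      rw [mul_smul_comm, map_smul_eq_mul, mul_assoc ‖c‖ C]
      exact mul_le_mul_of_nonneg_left (hC y hy) (norm_nonneg c)
  · rintro a b ⟨C, hC⟩ ⟨D, hD⟩
    refine ⟨C + D, fun y hy => ?_⟩
    rw [add_mul, add_mul, add_mul]
    exact (map_add_le_add p _ _).trans (add_le_add (hC y hy) (hD y hy))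
  · rintro c a ⟨C, hC⟩
    refine ⟨‖c‖ * C, fun y hy => ?_⟩
    rw [smul_mul_assoc, smul_mul_assoc, map_smul_eq_mul, mul_assoc ‖c‖ C]
    exact mul_le_mul_of_nonneg_left (hC y hy) (norm_nonneg c)

/-- On the span of the system, every C*-seminorm is dominated by the operator norm. -/
theorem seminorm_le {p : Seminorm ℂ 𝒜} (hp : IsCStarSeminorm p) {x : 𝒜} (hx : x ∈ span e) :
    p x ≤ ‖π x‖ := by
  have hxs := h.star_mem hx
  obtain ⟨C, hC⟩ := h.exists_bound (p := p) hxs hx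
  -- The elements `star x * y * x` are powers of `star x * x`, obtained by repeated squaring, so the
  -- C*-identity computes their seminorm exactly. Since `y` has two factors less, this gives `p x ^
  -- (n + 2) ≤ |C| ‖π x‖ ^ n` with `n` arbitrarily large. Squaring replaces `n + 2` by `2 (n + 2)`,
  -- whence the recursion `2 * n + 2`.
  have key : ∀ m : ℕ, ∃ n, m ≤ n ∧ ∃ y ∈ span e, star (star x * y * x) = star x * y * x ∧
      p (star x * y * x) = p x ^ (n + 2) ∧ ‖π y‖ ≤ ‖π x‖ ^ n := by
    intro m
    induction m with
    | zero =>
      refine ⟨2, by omega, x * star x, h.mul_mem hx hxs, by simp [mul_assoc], ?_, ?_⟩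
      · have : star x * (x * star x) * x = star (star x * x) * (star x * x) := by
          simp [mul_assoc]
        rw [this, hp.star_mul_self, hp.star_mul_self]; ring
      · rw [map_mul, map_star, sq]
        exact (norm_mul_le _ _).trans (by rw [norm_star])
    | succ m ih =>
      obtain ⟨n, hmn, y, hy, hsa, hpe, hle⟩ := ih
      have heq : star x * (y * (x * star x) * y) * x =
          star (star x * y * x) * (star x * y * x) := by
        rw [hsa]; simp only [mul_assoc]
      refine ⟨2 * n + 2, by omega, y * (x * star x) * y,
        h.mul_mem (h.mul_mem hy (h.mul_mem hx hxs)) hy, ?_, ?_, ?_⟩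
      · rw [heq, star_mul, star_star]
      · rw [heq, hp.star_mul_self, hpe, ← pow_mul]; ring_nf
      · rw [map_mul, map_mul, map_mul, map_star]
        calc _ ≤ ‖π y‖ * (‖π x‖ * ‖π x‖) * ‖π y‖ := by
              refine (norm_mul_le _ _).trans ?_
              gcongr
              refine (norm_mul_le _ _).trans ?_
              gcongr
              exact (norm_mul_le _ _).trans (by rw [norm_star])
          _ ≤ ‖π x‖ ^ n * (‖π x‖ * ‖π x‖) * ‖π x‖ ^ n := by gcongr
          _ = _ := by ring
  choose n hmn y hy _ hpe hle using key
  refine le_of_mul_pow_le (C := |C|) (norm_nonneg _) n hmn fun m => ?_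
  rw [← pow_add, add_comm 2, ← hpe]
  refine (hC _ (hy m)).trans ?_
  exact mul_le_mul (le_abs_self C) (hle m) (norm_nonneg _) (abs_nonneg C)

/-- Every competing C*-seminorm and the operator norm are dominated by `N`, so the comparison on the
`N`-dense span passes to all elements. -/
theorem envSeminorm_eq {N : Seminorm ℂ 𝒜} (hN : ∀ x, ‖π x‖ ≤ N x)
    (hd : ∀ x, ∀ ε > 0, ∃ y ∈ span e, N (x - y) < ε) (x : 𝒜) : envSeminorm N x = ‖π x‖ := by
  apply le_antisymm
  · refine envSeminorm_le_of fun p hp hpN => le_of_forall_pos_le_add fun ε hε => ?_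
    obtain ⟨y, hy, hxy⟩ := hd x (ε / 2) (half_pos hε)
    have h1 : p x ≤ p (x - y) + p y := by
      simpa using map_add_le_add p (x - y) y
    have h2 : ‖π y‖ ≤ ‖π (x - y)‖ + ‖π x‖ := by
      rw [map_sub, ← norm_neg (π x - π y)]
      simpa using norm_add_le (-(π x - π y)) (π x)
    have := h.seminorm_le hp hy
    have := hpN (x - y)
    have := hN (x - y)
    linarith
  · exact Env.norm_map_le_envSeminorm π hN x

end RankOneSystem

namespace Env

variable {N : Seminorm ℂ 𝒜} {C : Type*} [NonUnitalCStarAlgebra C]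

/-- A contractive *-homomorphism into a C*-algebra, as a continuous linear map of the seminormed
*-algebra. -/
def preLift (π : 𝒜 →⋆ₙₐ[ℂ] C) (hπ : ∀ x, ‖π x‖ ≤ N x) : PreEnv N →L[ℂ] C :=
  LinearMap.mkContinuous
    { toFun := fun x => π x
      map_add' := fun x y => map_add π x y
      map_smul' := fun c x => map_smul π c x } 1
    fun x => by rw [one_mul]; exact norm_map_le_envSeminorm π hπ x

/-- The universal property of the enveloping C*-algebra: extension of a contractive
*-homomorphism into a C*-algebra. -/
def lift (π : 𝒜 →⋆ₙₐ[ℂ] C) (hπ : ∀ x, ‖π x‖ ≤ N x) : Env N →⋆ₙₐ[ℂ] C :=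
  let F : Env N →L[ℂ] C := (preLift π hπ).extend (coeL N)
  have hF : ∀ x, F (coeL N x) = preLift π hπ x := fun x =>
    ContinuousLinearMap.extend_eq _ denseRange_coeL
      (Completion.isUniformInducing_coe (PreEnv N)) x
  { toFun := F
    map_smul' := fun c x => F.map_smul c x
    map_zero' := F.map_zero
    map_add' := F.map_add
    map_mul' := fun x y => induction₂ x y (isClosed_eq (by fun_prop) (by fun_prop))
      fun x y => by
        rw [← coeL_mul, hF, hF, hF]
        exact map_mul π x y
    map_star' := fun x => induction₁ x (isClosed_eq (by fun_prop) (by fun_prop))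
      fun x => by
        rw [← coeL_star, hF, hF]
        exact map_star π x }

theorem lift_of (π : 𝒜 →⋆ₙₐ[ℂ] C) (hπ : ∀ x, ‖π x‖ ≤ N x) (x : 𝒜) :
    lift π hπ (of N x) = π x :=
  ContinuousLinearMap.extend_eq (preLift π hπ) denseRange_coeL
    (Completion.isUniformInducing_coe (PreEnv N)) x

theorem continuous_starHom {A C : Type*} [NonUnitalCStarAlgebra A] [NonUnitalCStarAlgebra C]
    (φ : A →⋆ₙₐ[ℂ] C) : Continuous φ :=
  AddMonoidHomClass.continuous_of_bound φ 1
    (by simpa only [one_mul] using NonUnitalStarAlgHom.norm_apply_le φ)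

theorem norm_lift (π : 𝒜 →⋆ₙₐ[ℂ] C) (hπ : ∀ x, ‖π x‖ ≤ N x)
    (h : ∀ x, envSeminorm N x = ‖π x‖) (x : Env N) : ‖lift π hπ x‖ = ‖x‖ :=
  isClosed_property (denseRange_of (N := N))
    (isClosed_eq (continuous_starHom (lift π hπ)).norm continuous_norm)
    (fun x => by rw [lift_of, norm_of, h]) x

end Env

end RankOne

/-! ## Compact operators and their multipliers -/

section Compact

open InnerProductSpace

variable {H H' : Type*} [NormedAddCommGroup H] [InnerProductSpace ℂ H] [CompleteSpace H]
  [NormedAddCommGroup H'] [InnerProductSpace ℂ H'] [CompleteSpace H']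

theorem isCompactOperator_rankOne (x : H) (y : H') :
    IsCompactOperator (rankOne ℂ x y : H' →L[ℂ] H) := by
  have h : IsCompactOperator (innerSL ℂ y : H' →L[ℂ] ℂ) :=
    isCompactOperator_of_locallyCompactSpace_dom _
  exact h.clm_comp (ContinuousLinearMap.toSpanSingleton ℂ x)

theorem eq_zero_of_rankOne_comp (T : H' →L[ℂ] H) (h : ∀ x : H, (rankOne ℂ x x) ∘L T = 0) :
    T = 0 := by
  ext y
  have := congrArg (fun S => inner ℂ (T y) (S y)) (h (T y))
  simpa [inner_smul_right] using this

/-- A closed space of operators containing the rank one operators of total families of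
vectors contains all compact operators. -/
theorem mem_of_isCompactOperator {S : Submodule ℂ (H' →L[ℂ] H)}
    (hS : IsClosed (S : Set (H' →L[ℂ] H))) {D : Set H} {D' : Set H'}
    (hD : Dense (Submodule.span ℂ D : Set H)) (hD' : Dense (Submodule.span ℂ D' : Set H'))
    (h : ∀ x ∈ D, ∀ y ∈ D', rankOne ℂ x y ∈ S) {T : H' →L[ℂ] H} (hT : IsCompactOperator T) :
    T ∈ S := by
  have h1 : ∀ x, ∀ y ∈ D', rankOne ℂ x y ∈ S := fun x y hy => by
    let R : H →L[ℂ] (H' →L[ℂ] H) :=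
      ((rankOne ℂ : H →L[ℂ] H' →L⋆[ℂ] H' →L[ℂ] H).flip y)
    have hc : IsClosed (S.comap (R : H →ₗ[ℂ] (H' →L[ℂ] H)) : Set H) := hS.preimage R.continuous
    have hle : Submodule.span ℂ D ≤ S.comap (R : H →ₗ[ℂ] (H' →L[ℂ] H)) :=
      Submodule.span_le.2 fun x hx => h x hx y hy
    exact hc.closure_subset_iff.2 hle (hD x)
  have h2 : ∀ x y, rankOne ℂ x y ∈ S := fun x y => by
    let R : H' →L⋆[ℂ] (H' →L[ℂ] H) := rankOne ℂ x
    have hc : IsClosed (S.comap (R : H' →ₗ⋆[ℂ] (H' →L[ℂ] H)) : Set H') := hS.preimage R.continuous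
    have hle : Submodule.span ℂ D' ≤ S.comap (R : H' →ₗ⋆[ℂ] (H' →L[ℂ] H)) :=
      Submodule.span_le.2 fun y hy => h1 x y hy
    exact hc.closure_subset_iff.2 hle (hD' y)
  refine hS.closure_subset_iff.2 (Set.Subset.refl _) (Metric.mem_closure_iff.2 fun ε hε => ?_)
  -- Project onto the span `W` of a finite net of the image of the ball of radius 2, which contains
  -- all unit vectors. The projection moves `T x` by at most its distance to the net, and the
  -- projection followed from `T` is a finite sum of rank one operators.
  obtain ⟨t, htf, ht⟩ := Metric.totallyBounded_iff.1
    ((hT.isCompact_closure_image_ball (f := (T : H' →ₗ[ℂ] H)) 2).totallyBounded.subset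
      subset_closure) (ε / 2) (half_pos hε)
  let W : Submodule ℂ H := Submodule.span ℂ t
  have : FiniteDimensional ℂ W := FiniteDimensional.span_of_finite ℂ htf
  refine ⟨W.starProjection ∘L T, ?_, ?_⟩
  · rw [(stdOrthonormalBasis ℂ W).starProjection_eq_sum_rankOne]
    have : (∑ i, rankOne ℂ ((stdOrthonormalBasis ℂ W) i : H) ((stdOrthonormalBasis ℂ W) i : H)) ∘L
        T = ∑ i, rankOne ℂ ((stdOrthonormalBasis ℂ W) i : H)
          (T.adjoint ((stdOrthonormalBasis ℂ W) i : H)) := by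
      rw [ContinuousLinearMap.finsetSum_comp]
      exact Finset.sum_congr rfl fun i _ => rankOne_comp _ _ _
    rw [this]
    exact Submodule.sum_mem _ fun i _ => h2 _ _
  · rw [dist_eq_norm]
    refine lt_of_le_of_lt ?_ (half_lt_self hε)
    refine ContinuousLinearMap.opNorm_le_of_unit_norm (half_pos hε).le fun x hx => ?_
    have hxt := ht ⟨x, by simp [hx], rfl⟩
    simp only [Set.mem_iUnion] at hxt
    obtain ⟨w, hw, hxw⟩ := hxt
    have h3 : ‖T x - W.starProjection (T x)‖ ≤ ‖T x - w‖ := by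
      rw [Submodule.starProjection_minimal]
      exact ciInf_le ⟨0, by rintro _ ⟨z, rfl⟩; exact norm_nonneg _⟩
        (⟨w, Submodule.subset_span hw⟩ : W)
    refine h3.trans ?_
    rw [← dist_eq_norm]
    exact (Metric.mem_ball.1 hxw).le

/-- The square root is formed inside `A` by the continuous functional calculus, which commutes with
`φ`. Positivity is needed only for `φ a`: there `√x · √x = x` on the quasispectrum, and injectivity
carries the identity back to `A`. -/
theorem exists_eq_star_mul_self {A : Type*} [NonUnitalCStarAlgebra A]
    (φ : A →⋆ₙₐ[ℂ] (H →L[ℂ] H)) (hφ : Function.Injective φ) {a : A} (ha : star a = a)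
    (h : (φ a).IsPositive) : ∃ c, a = star c * c := by
  have hs : IsSelfAdjoint a := ha
  have hs' : IsSelfAdjoint (φ a) := hs.map φ
  have hc : IsSelfAdjoint (cfcₙ Real.sqrt a) := cfcₙ_predicate _ _
  refine ⟨cfcₙ Real.sqrt a, hφ ?_⟩
  have hφc : φ (cfcₙ Real.sqrt a) = cfcₙ Real.sqrt (φ a) :=
    NonUnitalStarAlgHomClass.map_cfcₙ (R := ℝ) (S := ℂ) φ Real.sqrt a
      (by exact Real.continuous_sqrt.continuousOn) (by simp) (Env.continuous_starHom φ) hs hs'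
  rw [hc.star_eq, map_mul, hφc, ← cfcₙ_mul Real.sqrt Real.sqrt (φ a)
    (by exact Real.continuous_sqrt.continuousOn) (by simp)
    (by exact Real.continuous_sqrt.continuousOn) (by simp)]
  have h0 : 0 ≤ φ a := (ContinuousLinearMap.nonneg_iff_isPositive _).2 h
  conv_lhs => rw [← cfcₙ_id ℝ (φ a)]
  refine cfcₙ_congr fun x hx => ?_
  exact (Real.mul_self_sqrt (quasispectrum_nonneg_of_nonneg _ h0 x hx)).symm

end Compact

/-! ## Imprimitivity bimodules of compact operators -/

section CompactTriple

open InnerProductSpace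

/-- An isometric identification of a triple `(A, X, B)` of two C*-algebras and a Banach space
with the compact operators `(𝓚(H), 𝓚(H', H), 𝓚(H'))`. -/
structure CompactTriple (A X B H H' : Type*) [NonUnitalCStarAlgebra A] [NormedAddCommGroup X]
    [NormedSpace ℂ X] [CompleteSpace X] [NonUnitalCStarAlgebra B]
    [NormedAddCommGroup H] [InnerProductSpace ℂ H] [CompleteSpace H]
    [NormedAddCommGroup H'] [InnerProductSpace ℂ H'] [CompleteSpace H'] where
  πA : A →⋆ₙₐ[ℂ] (H →L[ℂ] H)
  πX : X →ₗ[ℂ] (H' →L[ℂ] H)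
  πB : B →⋆ₙₐ[ℂ] (H' →L[ℂ] H')
  injective_A : Function.Injective πA
  norm_X : ∀ x, ‖πX x‖ = ‖x‖
  injective_B : Function.Injective πB
  range_A : Set.range πA = {T : H →L[ℂ] H | IsCompactOperator T}
  range_X : Set.range πX = {T : H' →L[ℂ] H | IsCompactOperator T}
  range_B : Set.range πB = {T : H' →L[ℂ] H' | IsCompactOperator T}

variable {A X B H H' : Type*} [NonUnitalCStarAlgebra A] [NormedAddCommGroup X]
  [NormedSpace ℂ X] [CompleteSpace X] [NonUnitalCStarAlgebra B]
  [NormedAddCommGroup H] [InnerProductSpace ℂ H] [CompleteSpace H]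
  [NormedAddCommGroup H'] [InnerProductSpace ℂ H'] [CompleteSpace H']

/-- The linear isometry given by an injective *-homomorphism. -/
def isometryOfInjective (π : A →⋆ₙₐ[ℂ] (H →L[ℂ] H)) (hπ : Function.Injective π) :
    A →ₗᵢ[ℂ] (H →L[ℂ] H) where
  toFun := π
  map_add' := map_add π
  map_smul' c a := map_smul π c a
  norm_map' := NonUnitalStarAlgHom.norm_map π hπ

/-- Factorization of a continuous linear map through an isometry. -/
def isometryLift {E F Y : Type*} [NormedAddCommGroup E] [NormedSpace ℂ E] [NormedAddCommGroup F]
    [NormedSpace ℂ F] [NormedAddCommGroup Y] [NormedSpace ℂ Y] (I : E →ₗᵢ[ℂ] F) (T : Y →L[ℂ] F)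
    (hT : ∀ y, ∃ x, I x = T y) : Y →L[ℂ] E :=
  (I.equivRange.symm : _ →L[ℂ] E) ∘L T.codRestrict I.range fun y => hT y

theorem isometryLift_spec {E F Y : Type*} [NormedAddCommGroup E] [NormedSpace ℂ E]
    [NormedAddCommGroup F] [NormedSpace ℂ F] [NormedAddCommGroup Y] [NormedSpace ℂ Y]
    (I : E →ₗᵢ[ℂ] F) (T : Y →L[ℂ] F) (hT : ∀ y, ∃ x, I x = T y) (y : Y) :
    I (isometryLift I T hT y) = T y := by
  have := congrArg Subtype.val (I.equivRange.apply_symm_apply (T.codRestrict I.range hT y))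
  exact this

/-! ### Multipliers of the compact operators as bounded operators -/

section Multiplier

variable (πA : A →⋆ₙₐ[ℂ] (H →L[ℂ] H)) (πB : B →⋆ₙₐ[ℂ] (H' →L[ℂ] H'))
  (range_A : Set.range πA = {T : H →L[ℂ] H | IsCompactOperator T})
  (range_B : Set.range πB = {T : H' →L[ℂ] H' | IsCompactOperator T})

include range_A in
-- The range of `πA` contains the rank one projections, so composing with it loses no information.
-- This nondegeneracy gives all uniqueness statements about implementing operators.
theorem eq_of_comp_left {T T' : H' →L[ℂ] H} (h : ∀ a, πA a ∘L T = πA a ∘L T') : T = T' := by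
  refine sub_eq_zero.1 (eq_zero_of_rankOne_comp _ fun x => ?_)
  obtain ⟨a, ha⟩ : rankOne ℂ x x ∈ Set.range πA := by
    rw [range_A]; exact isCompactOperator_rankOne x x
  rw [← ha, ContinuousLinearMap.comp_sub, h, sub_self]

include range_B in
theorem eq_of_comp_right {T T' : H' →L[ℂ] H} (h : ∀ b, T ∘L πB b = T' ∘L πB b) : T = T' := by
  apply ContinuousLinearMap.adjoint.injective
  refine eq_of_comp_left πB range_B fun b => ?_
  have h1 : πB b = ContinuousLinearMap.adjoint (πB (star b)) := by
    rw [map_star, ContinuousLinearMap.star_eq_adjoint, ContinuousLinearMap.adjoint_adjoint]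
  rw [h1, ← ContinuousLinearMap.adjoint_comp, ← ContinuousLinearMap.adjoint_comp, h]

include range_A range_B in
/-- A pair of maps `a ↦ a · m`, `b ↦ m · b` with `(a · m) b = a (m · b)` into the operators
`H' → H` is implemented by an operator. -/
theorem exists_intertwiner (mA : A → (H' →L[ℂ] H)) (mB : B →ₗ[ℂ] (H' →L[ℂ] H))
    (h : ∀ a b, mA a ∘L πB b = πA a ∘L mB b) :
    ∃ T : H' →L[ℂ] H, (∀ a, mA a = πA a ∘L T) ∧ ∀ b, mB b = T ∘L πB b := by
  rcases subsingleton_or_nontrivial H' with hH | hH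
  · exact ⟨0, fun a => Subsingleton.elim _ _, fun b => Subsingleton.elim _ _⟩
  -- If `mB b = T ∘ πB b`, then evaluating at a unit vector `v`, with `πB b` the rank one operator
  -- of `y` and `v`, gives `T y`. This forces the definition `T y = mB (b y) v`.
  obtain ⟨v, hv⟩ := exists_norm_eq H' (zero_le_one' ℝ)
  have hvv : inner ℂ v v = (1 : ℂ) := by rw [inner_self_eq_norm_sq_to_K, hv]; simp
  have key : ∀ S : H' →L[ℂ] H, (∀ a, mA a = πA a ∘L S) → ∀ b, mB b = S ∘L πB b := fun S hS b =>
    eq_of_comp_left πA range_A fun a => by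
      rw [← h, hS, ContinuousLinearMap.comp_assoc]
  have hsurj : ∀ y : H', ∃ b, πB b = rankOne ℂ y v := fun y => by
    have : rankOne ℂ y v ∈ Set.range πB := by rw [range_B]; exact isCompactOperator_rankOne y v
    exact this
  choose b hb using hsurj
  have hfun : ∀ a y, mA a y = πA a (mB (b y) v) := fun a y => by
    have := congrArg (fun S => S v) (h a (b y))
    rw [hb] at this
    simpa only [ContinuousLinearMap.comp_apply, rankOne_apply, hvv, one_smul] using this
  -- The operators `πA a` separate vectors. Since `πA a (T y) = mA a y` is linear in `y`, the map
  -- `T` is linear although the `b y` are arbitrary choices.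
  have hsep : ∀ x x' : H, (∀ a, πA a x = πA a x') → x = x' := fun x x' hx => by
    have h1 : ContinuousLinearMap.toSpanSingleton ℂ x = ContinuousLinearMap.toSpanSingleton ℂ x' :=
      eq_of_comp_left πA range_A fun a => by ext; simpa using hx a
    simpa using congrArg (fun S => S (1 : ℂ)) h1
  let T₀ : H' →ₗ[ℂ] H :=
    { toFun := fun y => mB (b y) v
      map_add' := fun y y' => hsep _ _ fun a => by
        rw [map_add, ← hfun, ← hfun, ← hfun, map_add]
      map_smul' := fun c y => hsep _ _ fun a => by
        rw [RingHom.id_apply, map_smul, ← hfun, ← hfun, map_smul] }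
  have hT₀ : ∀ a y, πA a (T₀ y) = mA a y := fun a y => (hfun a y).symm
  -- No boundedness of `mB` is assumed: each `πA a ∘ T₀` equals the continuous operator `mA a`, and
  -- separation makes the graph of `T₀` closed.
  have hcont : Continuous T₀ := by
    refine T₀.continuous_of_seq_closed_graph fun u x y hu hy => hsep _ _ fun a => ?_
    refine tendsto_nhds_unique (((πA a).continuous.tendsto y).comp hy) ?_
    have h2 : (πA a) ∘ (T₀ ∘ u) = fun n => mA a (u n) := funext fun n => hT₀ a (u n)
    rw [h2, hT₀]
    exact ((mA a).continuous.tendsto x).comp hu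
  have h3 : ∀ a, mA a = πA a ∘L (⟨T₀, hcont⟩ : H' →L[ℂ] H) := fun a => by
    ext y; exact (hT₀ a y).symm
  exact ⟨⟨T₀, hcont⟩, h3, key _ h3⟩

include range_A in
-- This is `exists_intertwiner` for `A` as a bimodule over itself: the hypothesis is the double
-- centralizer relation.
theorem exists_multiplierOp (k : 𝓜(ℂ, A)) : ∃ T : H →L[ℂ] H,
    (∀ a, πA (k.snd a) = πA a ∘L T) ∧ ∀ a, πA (k.fst a) = T ∘L πA a := by
  let mB : A →ₗ[ℂ] (H →L[ℂ] H) := (πA : A →ₗ[ℂ] (H →L[ℂ] H)) ∘ₗ (k.fst : A →ₗ[ℂ] A)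
  refine exists_intertwiner πA πA range_A range_A (fun a => πA (k.snd a)) mB fun a b => ?_
  change πA (k.snd a) * πA b = πA a * πA (k.fst b)
  rw [← map_mul, ← map_mul, k.central]

/-- The operator that implements a multiplier of `A ≅ 𝓚(H)`. -/
def multiplierOp (k : 𝓜(ℂ, A)) : H →L[ℂ] H := (exists_multiplierOp πA range_A k).choose

theorem multiplierOp_snd (k : 𝓜(ℂ, A)) (a : A) :
    πA (k.snd a) = πA a ∘L multiplierOp πA range_A k :=
  (exists_multiplierOp πA range_A k).choose_spec.1 a

theorem multiplierOp_fst (k : 𝓜(ℂ, A)) (a : A) :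
    πA (k.fst a) = multiplierOp πA range_A k ∘L πA a :=
  (exists_multiplierOp πA range_A k).choose_spec.2 a

theorem multiplierOp_eq {k : 𝓜(ℂ, A)} {T : H →L[ℂ] H} (h : ∀ a, πA (k.fst a) = T ∘L πA a) :
    multiplierOp πA range_A k = T :=
  eq_of_comp_right πA range_A fun a => by rw [← multiplierOp_fst, h]

variable (injective_A : Function.Injective πA)

include range_A in
theorem exists_isometry_eq {T : H →L[ℂ] H} (hT : IsCompactOperator T) :
    ∃ a, isometryOfInjective πA injective_A a = T := by
  have : T ∈ Set.range πA := by rw [range_A]; exact hT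
  exact this

include range_A in
theorem isCompactOperator_map (a : A) : IsCompactOperator (πA a) := by
  have : πA a ∈ Set.range πA := ⟨a, rfl⟩
  rw [range_A] at this
  exact this

/-- The multiplier of `A ≅ 𝓚(H)` given by an operator. -/
def multiplierOfOp (T : H →L[ℂ] H) : 𝓜(ℂ, A) where
  fst := isometryLift (isometryOfInjective πA injective_A)
    (ContinuousLinearMap.compL ℂ H H H T ∘L
      (isometryOfInjective πA injective_A).toContinuousLinearMap)
    fun a => exists_isometry_eq πA range_A injective_A
      ((isCompactOperator_map πA range_A a).clm_comp T)
  snd := isometryLift (isometryOfInjective πA injective_A)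
    ((ContinuousLinearMap.compL ℂ H H H).flip T ∘L
      (isometryOfInjective πA injective_A).toContinuousLinearMap)
    fun a => exists_isometry_eq πA range_A injective_A
      ((isCompactOperator_map πA range_A a).comp_clm T)
  central a b := by
    apply injective_A
    rw [map_mul, map_mul]
    have h1 := isometryLift_spec (isometryOfInjective πA injective_A)
      ((ContinuousLinearMap.compL ℂ H H H).flip T ∘L
      (isometryOfInjective πA injective_A).toContinuousLinearMap)
      (fun a => exists_isometry_eq πA range_A injective_A
      ((isCompactOperator_map πA range_A a).comp_clm T)) a
    have h2 := isometryLift_spec (isometryOfInjective πA injective_A)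
      (ContinuousLinearMap.compL ℂ H H H T ∘L
      (isometryOfInjective πA injective_A).toContinuousLinearMap)
      (fun a => exists_isometry_eq πA range_A injective_A
      ((isCompactOperator_map πA range_A a).clm_comp T)) b
    refine (congrArg (· * πA b) h1).trans (Eq.trans ?_ (congrArg (πA a * ·) h2).symm)
    exact mul_assoc (πA a) T (πA b)

theorem multiplierOfOp_fst (T : H →L[ℂ] H) (a : A) :
    πA ((multiplierOfOp πA range_A injective_A T).fst a) = T ∘L πA a :=
  isometryLift_spec (isometryOfInjective πA injective_A) _ _ a

theorem multiplierOfOp_snd (T : H →L[ℂ] H) (a : A) :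
    πA ((multiplierOfOp πA range_A injective_A T).snd a) = πA a ∘L T :=
  isometryLift_spec (isometryOfInjective πA injective_A) _ _ a

/-- The isomorphism `𝓜(A) ≅ 𝓑(H)`, if `A ≅ 𝓚(H)`. -/
def multiplierEquiv : 𝓜(ℂ, A) ≃⋆ₐ[ℂ] (H →L[ℂ] H) where
  toFun := multiplierOp πA range_A
  invFun := multiplierOfOp πA range_A injective_A
  left_inv k := Twist.mult_ext
    (fun a => injective_A (by rw [multiplierOfOp_fst, multiplierOp_fst πA range_A]))
    (fun a => injective_A (by rw [multiplierOfOp_snd, multiplierOp_snd πA range_A]))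
  right_inv T := multiplierOp_eq πA range_A fun a => multiplierOfOp_fst πA range_A injective_A T a
  map_mul' k l := multiplierOp_eq πA range_A fun a => by
    rw [DoubleCentralizer.mul_fst]
    change πA (k.fst (l.fst a)) = _
    rw [multiplierOp_fst πA range_A, multiplierOp_fst πA range_A]; rfl
  map_add' k l := multiplierOp_eq πA range_A fun a => by
    rw [DoubleCentralizer.add_fst, _root_.add_apply, map_add, multiplierOp_fst πA range_A,
      multiplierOp_fst πA range_A, ContinuousLinearMap.add_comp]
  map_star' k := multiplierOp_eq πA range_A fun a => by
    rw [DoubleCentralizer.star_fst, map_star, multiplierOp_snd πA range_A, map_star]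
    change star (star (πA a) * multiplierOp πA range_A k) = _
    rw [star_mul, star_star]; rfl
  map_smul' c k := multiplierOp_eq πA range_A fun a => by
    rw [DoubleCentralizer.smul_fst, _root_.smul_apply, map_smul, multiplierOp_fst πA range_A,
      ContinuousLinearMap.smul_comp]

theorem multiplierEquiv_coe (a : A) :
    multiplierEquiv πA range_A injective_A (a : 𝓜(ℂ, A)) = πA a :=
  multiplierOp_eq πA range_A fun b => by
    rw [DoubleCentralizer.coe_fst, ContinuousLinearMap.mul_apply', map_mul]; rfl

end Multiplier

/-! ### The transported imprimitivity bimodule and its multipliers -/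

namespace CompactTriple

variable (t : CompactTriple A X B H H')

theorem injective_X : Function.Injective t.πX := by
  intro x y h
  rw [← sub_eq_zero, ← norm_eq_zero, ← t.norm_X, map_sub, h, sub_self, norm_zero]

theorem isCompact_A (a : A) : IsCompactOperator (t.πA a) := isCompactOperator_map t.πA t.range_A a
theorem isCompact_B (b : B) : IsCompactOperator (t.πB b) := isCompactOperator_map t.πB t.range_B b

theorem isCompact_X (x : X) : IsCompactOperator (t.πX x) := by
  have : t.πX x ∈ Set.range t.πX := ⟨x, rfl⟩
  rw [t.range_X] at this
  exact this

theorem exists_A (T : H →L[ℂ] H) (hT : IsCompactOperator T) : ∃ a, t.πA a = T := by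
  have : T ∈ Set.range t.πA := by rw [t.range_A]; exact hT
  exact this

theorem exists_B (T : H' →L[ℂ] H') (hT : IsCompactOperator T) : ∃ b, t.πB b = T := by
  have : T ∈ Set.range t.πB := by rw [t.range_B]; exact hT
  exact this

theorem exists_X (T : H' →L[ℂ] H) (hT : IsCompactOperator T) : ∃ x, t.πX x = T := by
  have : T ∈ Set.range t.πX := by rw [t.range_X]; exact hT
  exact this

/-- The left action, given by composition of operators. -/
def lsmul (a : A) (x : X) : X :=
  (t.exists_X (t.πA a ∘L t.πX x) ((t.isCompact_X x).clm_comp (t.πA a))).choose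

theorem πX_lsmul (a : A) (x : X) : t.πX (t.lsmul a x) = t.πA a ∘L t.πX x :=
  (t.exists_X (t.πA a ∘L t.πX x) ((t.isCompact_X x).clm_comp (t.πA a))).choose_spec

/-- The right action, given by composition of operators. -/
def rsmul (x : X) (b : B) : X :=
  (t.exists_X (t.πX x ∘L t.πB b) ((t.isCompact_X x).comp_clm (t.πB b))).choose

theorem πX_rsmul (x : X) (b : B) : t.πX (t.rsmul x b) = t.πX x ∘L t.πB b :=
  (t.exists_X (t.πX x ∘L t.πB b) ((t.isCompact_X x).comp_clm (t.πB b))).choose_spec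

/-- The left inner product `x y*`. -/
def linner (x y : X) : A :=
  (t.exists_A (t.πX x ∘L (t.πX y).adjoint) ((t.isCompact_X x).comp_clm (t.πX y).adjoint)).choose

theorem πA_linner (x y : X) : t.πA (t.linner x y) = t.πX x ∘L (t.πX y).adjoint :=
  (t.exists_A (t.πX x ∘L (t.πX y).adjoint)
    ((t.isCompact_X x).comp_clm (t.πX y).adjoint)).choose_spec

/-- The right inner product `x* y`. -/
def rinner (x y : X) : B :=
  (t.exists_B ((t.πX x).adjoint ∘L t.πX y) ((t.isCompact_X y).clm_comp (t.πX x).adjoint)).choose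

theorem πB_rinner (x y : X) : t.πB (t.rinner x y) = (t.πX x).adjoint ∘L t.πX y :=
  (t.exists_B ((t.πX x).adjoint ∘L t.πX y)
    ((t.isCompact_X y).clm_comp (t.πX x).adjoint)).choose_spec

theorem star_linner (x y : X) : star (t.linner x y) = t.linner y x := by
  apply t.injective_A
  rw [map_star, πA_linner, πA_linner, ContinuousLinearMap.star_eq_adjoint,
    ContinuousLinearMap.adjoint_comp, ContinuousLinearMap.adjoint_adjoint]

theorem star_rinner (x y : X) : star (t.rinner x y) = t.rinner y x := by
  apply t.injective_B
  rw [map_star, πB_rinner, πB_rinner, ContinuousLinearMap.star_eq_adjoint,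
    ContinuousLinearMap.adjoint_comp, ContinuousLinearMap.adjoint_adjoint]

theorem norm_A (a : A) : ‖a‖ = ‖t.πA a‖ := (NonUnitalStarAlgHom.norm_map t.πA t.injective_A a).symm
theorem norm_B (b : B) : ‖b‖ = ‖t.πB b‖ := (NonUnitalStarAlgHom.norm_map t.πB t.injective_B b).symm

/-- With a unit vector `v` of `H'`, the rank one operator of `x` and `y` is the product of that of
`x, v` with the adjoint of that of `y, v`, so the inner products already contain all rank one
operators. Without such a `v` the bimodule would be zero and could not be full. -/
theorem linner_full [Nontrivial H'] :
    Dense (Submodule.span ℂ {a | ∃ x y, a = t.linner x y} : Set A) := by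
  let I := isometryOfInjective t.πA t.injective_A
  let S := (Submodule.span ℂ {a | ∃ x y, a = t.linner x y}).topologicalClosure
  have hS : IsClosed (S.map (I : A →ₗ[ℂ] (H →L[ℂ] H)) : Set (H →L[ℂ] H)) :=
    I.isometry.isClosedEmbedding.isClosedMap _ (Submodule.isClosed_topologicalClosure _)
  obtain ⟨v, hv⟩ := exists_norm_eq H' (zero_le_one' ℝ)
  have hvv : inner ℂ v v = (1 : ℂ) := by rw [inner_self_eq_norm_sq_to_K, hv]; simp
  intro a
  have := mem_of_isCompactOperator hS (D := Set.univ) (D' := Set.univ)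
    (by simp) (by simp) (fun x _ y _ => ?_) (t.isCompact_A a)
  · obtain ⟨a', ha', haa⟩ := this
    rwa [← t.injective_A haa]
  · obtain ⟨x', hx⟩ := t.exists_X _ (isCompactOperator_rankOne x v)
    obtain ⟨y', hy⟩ := t.exists_X _ (isCompactOperator_rankOne y v)
    refine ⟨t.linner x' y',
      Submodule.le_topologicalClosure _ (Submodule.subset_span ⟨_, _, rfl⟩), ?_⟩
    refine (t.πA_linner x' y').trans ?_
    rw [hx, hy, adjoint_rankOne, rankOne_comp_rankOne, hvv, one_smul]

theorem rinner_full [Nontrivial H] :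
    Dense (Submodule.span ℂ {b | ∃ x y, b = t.rinner x y} : Set B) := by
  let I := isometryOfInjective t.πB t.injective_B
  let S := (Submodule.span ℂ {b | ∃ x y, b = t.rinner x y}).topologicalClosure
  have hS : IsClosed (S.map (I : B →ₗ[ℂ] (H' →L[ℂ] H')) : Set (H' →L[ℂ] H')) :=
    I.isometry.isClosedEmbedding.isClosedMap _ (Submodule.isClosed_topologicalClosure _)
  obtain ⟨v, hv⟩ := exists_norm_eq H (zero_le_one' ℝ)
  have hvv : inner ℂ v v = (1 : ℂ) := by rw [inner_self_eq_norm_sq_to_K, hv]; simp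
  intro b
  have := mem_of_isCompactOperator hS (D := Set.univ) (D' := Set.univ)
    (by simp) (by simp) (fun x _ y _ => ?_) (t.isCompact_B b)
  · obtain ⟨a', ha', haa⟩ := this
    rwa [← t.injective_B haa]
  · obtain ⟨x', hx⟩ := t.exists_X _ (isCompactOperator_rankOne v x)
    obtain ⟨y', hy⟩ := t.exists_X _ (isCompactOperator_rankOne v y)
    refine ⟨t.rinner x' y',
      Submodule.le_topologicalClosure _ (Submodule.subset_span ⟨_, _, rfl⟩), ?_⟩
    refine (t.πB_rinner x' y').trans ?_
    rw [hx, hy, adjoint_rankOne, rankOne_comp_rankOne, hvv, one_smul]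

/-- The imprimitivity bimodule structure transported from `𝓚(H', H)`. -/
def bimodule [Nontrivial H] [Nontrivial H'] : ImprimitivityBimodule A X B where
  lsmul := LinearMap.mk₂ ℂ t.lsmul
    (fun a a' x => t.injective_X (by
      rw [map_add, πX_lsmul, πX_lsmul, πX_lsmul, map_add, ContinuousLinearMap.add_comp]))
    (fun c a x => t.injective_X (by
      rw [map_smul, πX_lsmul, πX_lsmul, map_smul, ContinuousLinearMap.smul_comp]))
    (fun a x x' => t.injective_X (by
      rw [map_add, πX_lsmul, πX_lsmul, πX_lsmul, map_add, ContinuousLinearMap.comp_add]))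
    (fun c a x => t.injective_X (by
      rw [map_smul, πX_lsmul, πX_lsmul, map_smul, ContinuousLinearMap.comp_smul]))
  rsmul := LinearMap.mk₂ ℂ t.rsmul
    (fun x x' b => t.injective_X (by
      rw [map_add, πX_rsmul, πX_rsmul, πX_rsmul, map_add, ContinuousLinearMap.add_comp]))
    (fun c x b => t.injective_X (by
      rw [map_smul, πX_rsmul, πX_rsmul, map_smul, ContinuousLinearMap.smul_comp]))
    (fun x b b' => t.injective_X (by
      rw [map_add, πX_rsmul, πX_rsmul, πX_rsmul, map_add, ContinuousLinearMap.comp_add]))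
    (fun c x b => t.injective_X (by
      rw [map_smul, πX_rsmul, πX_rsmul, map_smul, ContinuousLinearMap.comp_smul]))
  linner := t.linner
  rinner := t.rinner
  mul_lsmul a a' x := t.injective_X (by
    simp only [LinearMap.mk₂_apply, πX_lsmul, map_mul]; rfl)
  rsmul_mul x b b' := t.injective_X (by
    simp only [LinearMap.mk₂_apply, πX_rsmul, map_mul]; rfl)
  lsmul_rsmul a x b := t.injective_X (by
    simp only [LinearMap.mk₂_apply, πX_rsmul, πX_lsmul, ContinuousLinearMap.comp_assoc])
  linner_add x x' y := t.injective_A (by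
    rw [map_add, πA_linner, πA_linner, πA_linner, map_add, ContinuousLinearMap.add_comp])
  linner_smul c x y := t.injective_A (by
    rw [map_smul, πA_linner, πA_linner, map_smul, ContinuousLinearMap.smul_comp])
  linner_lsmul a x y := t.injective_A (by
    rw [LinearMap.mk₂_apply, map_mul, πA_linner, πA_linner, πX_lsmul]; rfl)
  star_linner := t.star_linner
  linner_self_nonneg x := exists_eq_star_mul_self t.πA t.injective_A (t.star_linner x x) (by
    rw [πA_linner]; exact ContinuousLinearMap.isPositive_self_comp_adjoint _)
  rinner_add x y y' := t.injective_B (by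
    rw [map_add, πB_rinner, πB_rinner, πB_rinner, map_add, ContinuousLinearMap.comp_add])
  rinner_smul c x y := t.injective_B (by
    rw [map_smul, πB_rinner, πB_rinner, map_smul, ContinuousLinearMap.comp_smul])
  rinner_rsmul x y b := t.injective_B (by
    rw [LinearMap.mk₂_apply, map_mul, πB_rinner, πB_rinner, πX_rsmul]; rfl)
  star_rinner := t.star_rinner
  rinner_self_nonneg x := exists_eq_star_mul_self t.πB t.injective_B (t.star_rinner x x) (by
    rw [πB_rinner]; exact ContinuousLinearMap.isPositive_adjoint_comp_self _)
  linner_lsmul_eq x y z := t.injective_X (by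
    simp only [LinearMap.mk₂_apply, πX_rsmul, πX_lsmul, πA_linner, πB_rinner,
      ContinuousLinearMap.comp_assoc])
  norm_linner_self x := by
    have h := ContinuousLinearMap.norm_adjoint_comp_self (t.πX x).adjoint
    rw [ContinuousLinearMap.adjoint_adjoint, LinearIsometryEquiv.norm_map] at h
    rw [norm_A t, πA_linner, h, t.norm_X, sq]
  norm_rinner_self x := by
    rw [norm_B t, πB_rinner, ContinuousLinearMap.norm_adjoint_comp_self, t.norm_X, sq]
  linner_full := t.linner_full
  rinner_full := t.rinner_full

variable [Nontrivial H] [Nontrivial H']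

/-- The tautological representation of the transported bimodule. -/
def rep : t.bimodule.Rep H H' where
  πA := t.πA
  πX := t.πX
  πB := t.πB
  map_lsmul := t.πX_lsmul
  map_rsmul := t.πX_rsmul
  map_linner := t.πA_linner
  map_rinner := t.πB_rinner

theorem isIsoCompacts_rep : t.rep.IsIsoCompacts :=
  ⟨t.injective_A, t.injective_X, t.injective_B, t.range_A, t.range_X, t.range_B⟩

/-- The defining relation `m_A(a) · b = a · m_B(b)` becomes, after applying `πX`, the hypothesis of
`exists_intertwiner`. -/
theorem exists_multOp (m : t.bimodule.Multiplier) : ∃ T : H' →L[ℂ] H,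
    (∀ a, t.πX (m.1.1 a) = t.πA a ∘L T) ∧ ∀ b, t.πX (m.1.2 b) = T ∘L t.πB b :=
  exists_intertwiner t.πA t.πB t.range_A t.range_B (fun a => t.πX (m.1.1 a)) (t.πX ∘ₗ m.1.2)
    fun a b => by
      have h := congrArg t.πX (m.2.2.2 a b)
      exact (t.πX_rsmul _ _).symm.trans (h.trans (t.πX_lsmul _ _))

/-- The operator `H' → H` that implements a multiplier of the bimodule. -/
def multOp (m : t.bimodule.Multiplier) : H' →L[ℂ] H := (t.exists_multOp m).choose

theorem multOp_left (m : t.bimodule.Multiplier) (a : A) :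
    t.πX (m.1.1 a) = t.πA a ∘L t.multOp m := (t.exists_multOp m).choose_spec.1 a

theorem multOp_right (m : t.bimodule.Multiplier) (b : B) :
    t.πX (m.1.2 b) = t.multOp m ∘L t.πB b := (t.exists_multOp m).choose_spec.2 b

theorem multOp_eq {m : t.bimodule.Multiplier} {T : H' →L[ℂ] H}
    (h : ∀ a, t.πX (m.1.1 a) = t.πA a ∘L T) : t.multOp m = T :=
  eq_of_comp_left t.πA t.range_A fun a => by rw [← multOp_left, h]

/-- The multiplier of the bimodule given by an operator `H' → H`. -/
def multOfOp (T : H' →L[ℂ] H) : t.bimodule.Multiplier := by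
  let mA : A → X := fun a => (t.exists_X (t.πA a ∘L T) ((t.isCompact_A a).comp_clm T)).choose
  let mB : B → X := fun b => (t.exists_X (T ∘L t.πB b) ((t.isCompact_B b).clm_comp T)).choose
  have hA : ∀ a, t.πX (mA a) = t.πA a ∘L T := fun a =>
    (t.exists_X (t.πA a ∘L T) ((t.isCompact_A a).comp_clm T)).choose_spec
  have hB : ∀ b, t.πX (mB b) = T ∘L t.πB b := fun b =>
    (t.exists_X (T ∘L t.πB b) ((t.isCompact_B b).clm_comp T)).choose_spec
  exact ⟨({ toFun := mA
            map_add' := fun a a' => t.injective_X (by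
              rw [hA, map_add, map_add, hA, hA, ContinuousLinearMap.add_comp])
            map_smul' := fun c a => t.injective_X (by
              rw [hA, map_smul, RingHom.id_apply, map_smul, hA, ContinuousLinearMap.smul_comp]) },
          { toFun := mB
            map_add' := fun a a' => t.injective_X (by
              rw [hB, map_add, map_add, hB, hB, ContinuousLinearMap.comp_add])
            map_smul' := fun c a => t.injective_X (by
              rw [hB, map_smul, RingHom.id_apply, map_smul, hB,
                ContinuousLinearMap.comp_smul]) }),
    fun a a' => t.injective_X (by
      refine (hA _).trans (Eq.trans ?_ (t.πX_lsmul _ _).symm)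
      rw [map_mul]; exact congrArg (t.πA a ∘L ·) (hA a').symm),
    fun b b' => t.injective_X (by
      refine (hB _).trans (Eq.trans ?_ (t.πX_rsmul _ _).symm)
      rw [map_mul]; exact congrArg (· ∘L t.πB b') (hB b).symm),
    fun a b => t.injective_X (by
      refine (t.πX_rsmul _ _).trans (Eq.trans ?_ (t.πX_lsmul _ _).symm)
      refine (congrArg (· ∘L t.πB b) (hA a)).trans (Eq.trans ?_
        (congrArg (t.πA a ∘L ·) (hB b)).symm)
      exact ContinuousLinearMap.comp_assoc _ _ _)⟩

theorem multOfOp_left (T : H' →L[ℂ] H) (a : A) :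
    t.πX ((t.multOfOp T).1.1 a) = t.πA a ∘L T :=
  (t.exists_X (t.πA a ∘L T) ((t.isCompact_A a).comp_clm T)).choose_spec

theorem multOfOp_right (T : H' →L[ℂ] H) (b : B) :
    t.πX ((t.multOfOp T).1.2 b) = T ∘L t.πB b :=
  (t.exists_X (T ∘L t.πB b) ((t.isCompact_B b).clm_comp T)).choose_spec

/-- The isomorphism of the multiplier bimodule with `𝓑(H', H)`. -/
def multEquiv : t.bimodule.Multiplier ≃ₗ[ℂ] (H' →L[ℂ] H) where
  toFun := t.multOp
  map_add' m n := t.multOp_eq fun a => by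
    rw [ContinuousLinearMap.comp_add, ← multOp_left, ← multOp_left, ← map_add]; rfl
  map_smul' c m := t.multOp_eq fun a => by
    rw [RingHom.id_apply, ContinuousLinearMap.comp_smul, ← multOp_left, ← map_smul]; rfl
  invFun := t.multOfOp
  left_inv m := by
    refine Subtype.ext (Prod.ext (LinearMap.ext fun a => t.injective_X ?_)
      (LinearMap.ext fun b => t.injective_X ?_))
    · rw [multOfOp_left, multOp_left]
    · rw [multOfOp_right, multOp_right]
  right_inv T := t.multOp_eq fun a => t.multOfOp_left T a

/-- Each multiplier relation, once represented, is an identity between operators sandwiched by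
compact ones. One direction of each equivalence cancels these factors by nondegeneracy, the other
uses injectivity of the representation. -/
theorem extendsToMultipliers_rep : t.rep.ExtendsToMultipliers := by
  refine ⟨multiplierEquiv t.πA t.range_A t.injective_A, t.multEquiv,
    multiplierEquiv t.πB t.range_B t.injective_B, multiplierEquiv_coe t.πA t.range_A t.injective_A,
    fun x => t.multOp_eq fun a => t.πX_lsmul a x,
    multiplierEquiv_coe t.πB t.range_B t.injective_B, fun k m m' => ?_, fun m l m' => ?_,
    fun m n k => ?_, fun m n l => ?_⟩
  · change (∀ a, m'.1.1 a = m.1.1 (k.snd a)) ↔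
      t.multOp m' = multiplierOp t.πA t.range_A k ∘L t.multOp m
    refine ⟨fun h => t.multOp_eq fun a => ?_, fun h a => t.injective_X ?_⟩
    · rw [h, multOp_left, multiplierOp_snd t.πA t.range_A, ContinuousLinearMap.comp_assoc]
    · rw [multOp_left, multOp_left, h, multiplierOp_snd t.πA t.range_A,
        ContinuousLinearMap.comp_assoc]
  · change (∀ b, m'.1.2 b = m.1.2 (l.fst b)) ↔
      t.multOp m' = t.multOp m ∘L multiplierOp t.πB t.range_B l
    refine ⟨fun h => eq_of_comp_right t.πB t.range_B fun b => ?_, fun h b => t.injective_X ?_⟩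
    · rw [← multOp_right, h, multOp_right, multiplierOp_fst t.πB t.range_B,
        ContinuousLinearMap.comp_assoc]
    · rw [multOp_right, multOp_right, h, multiplierOp_fst t.πB t.range_B,
        ContinuousLinearMap.comp_assoc]
  · change (∀ a a', t.linner (m.1.1 a) (n.1.1 a') = k.snd a * star a') ↔
      multiplierOp t.πA t.range_A k = t.multOp m ∘L (t.multOp n).adjoint
    have e : ∀ a a', t.πA (t.linner (m.1.1 a) (n.1.1 a')) =
        (t.πA a ∘L t.multOp m ∘L (t.multOp n).adjoint) ∘L t.πA (star a') := fun a a' => by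
      rw [πA_linner, multOp_left, multOp_left, ContinuousLinearMap.adjoint_comp, map_star]; rfl
    have e' : ∀ a a', t.πA (k.snd a * star a') =
        (t.πA a ∘L multiplierOp t.πA t.range_A k) ∘L t.πA (star a') := fun a a' => by
      rw [map_mul, multiplierOp_snd t.πA t.range_A]; rfl
    refine ⟨fun h => eq_of_comp_left t.πA t.range_A fun a =>
      eq_of_comp_right t.πA t.range_A fun a' => ?_, fun h a a' => t.injective_A ?_⟩
    -- The relation contains `star a'`, so it is used at `star a'` to obtain a right factor `πA a'`.
    · have h1 := congrArg t.πA (h a (star a'))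
      rw [e, e', star_star] at h1
      exact h1.symm
    · rw [e, e', h]
  · change (∀ b b', t.rinner (m.1.2 b) (n.1.2 b') = star b * l.fst b') ↔
      multiplierOp t.πB t.range_B l = (t.multOp m).adjoint ∘L t.multOp n
    have e : ∀ b b', t.πB (t.rinner (m.1.2 b) (n.1.2 b')) =
        t.πB (star b) ∘L ((t.multOp m).adjoint ∘L t.multOp n) ∘L t.πB b' := fun b b' => by
      rw [πB_rinner, multOp_right, multOp_right, ContinuousLinearMap.adjoint_comp, map_star]; rfl
    have e' : ∀ b b', t.πB (star b * l.fst b') =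
        t.πB (star b) ∘L (multiplierOp t.πB t.range_B l) ∘L t.πB b' := fun b b' => by
      rw [map_mul, multiplierOp_fst t.πB t.range_B]; rfl
    refine ⟨fun h => eq_of_comp_right t.πB t.range_B fun b' =>
      eq_of_comp_left t.πB t.range_B fun b => ?_, fun h a a' => t.injective_B ?_⟩
    · have h1 := congrArg t.πB (h (star b) b')
      rw [e, e', star_star] at h1
      exact h1.symm
    · rw [e, e', h]

end CompactTriple

end CompactTriple

/-! ## Integrated forms of covariant representations -/

section Integrated

variable {H A : Type*} [TopologicalSpace H] [Group H] [IsTopologicalGroup H]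
  [LocallyCompactSpace H] [T2Space H] [MeasurableSpace H] [BorelSpace H] [NonUnitalCStarAlgebra A]
  {K : Type*} [NormedAddCommGroup K] [InnerProductSpace ℂ K] [CompleteSpace K]

/-- Weil's argument: multiply by `∫ g ≠ 0` and transform the double integral of `g(t) k(s⁻¹t)`,
where `k = Δ h`, by left translations and two exchanges of the order of integration. The Haar
measure need not be σ-finite, so the exchanges rely on compact support. -/
theorem integral_modularΔ_inv (μ : Measure H) [IsHaarMeasure μ] {E : Type*} [NormedAddCommGroup E]
    [NormedSpace ℝ E] [CompleteSpace E] {h : H → E} (hh : Continuous h) (hc : HasCompactSupport h) :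
    ∫ s, modularΔ s⁻¹ • h s⁻¹ ∂μ = ∫ s, h s ∂μ := by
  obtain ⟨g, hg, g0, g1⟩ := exists_continuous_nonneg_pos (1 : H)
  have hpos : ∫ x, g x ∂μ ≠ 0 :=
    (g.continuous.integral_pos_of_hasCompactSupport_nonneg_nonzero hg g0 g1).ne'
  let k : H → E := fun s => modularΔ s • h s
  have hk : Continuous k := continuous_modularΔ.smul hh
  have hkc : HasCompactSupport k := hc.smul_left (f := modularΔ)
  -- Substituting `s ↦ ts` on the right turns `s⁻¹t` into `s⁻¹`.
  have h1 : ∀ t, ∫ s, k s⁻¹ ∂μ = ∫ s, k (s⁻¹ * t) ∂μ := fun t => by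
    rw [← integral_mul_left_eq_self (fun s => k (s⁻¹ * t)) t]
    congr 1 with s; simp
  refine smul_right_injective E hpos ?_
  calc (∫ x, g x ∂μ) • ∫ s, k s⁻¹ ∂μ = ∫ t, ∫ s, g t • k (s⁻¹ * t) ∂μ ∂μ := by
        rw [← integral_smul_const]
        congr 1 with t
        rw [integral_smul, h1 t]
    _ = ∫ s, ∫ t, g t • k (s⁻¹ * t) ∂μ ∂μ := by
        refine integral_integral_swap_of_hasCompactSupport
          (f := fun t s => g t • k (s⁻¹ * t)) (by fun_prop) ?_
        have hK : IsCompact ((fun p : H × H => (p.1, p.1 * p.2⁻¹)) '' (tsupport g ×ˢ tsupport k)) :=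
          (hg.prod hkc).image (by fun_prop)
        refine HasCompactSupport.intro hK fun ⟨t, s⟩ hs => ?_
        by_contra hne
        have h2 : t ∈ tsupport g := by
          by_contra ht
          exact hne (by simp [image_eq_zero_of_notMem_tsupport ht])
        have h3 : s⁻¹ * t ∈ tsupport k := by
          by_contra ht
          exact hne (by simp [image_eq_zero_of_notMem_tsupport ht])
        exact hs ⟨(t, s⁻¹ * t), ⟨h2, h3⟩, by simp⟩
    _ = ∫ s, ∫ t, g (s * t) • k t ∂μ ∂μ := by
        congr 1 with s
        rw [← integral_mul_left_eq_self _ s]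
        simp
    _ = ∫ t, ∫ s, g (s * t) • k t ∂μ ∂μ := by
        refine integral_integral_swap_of_hasCompactSupport
          (f := fun s t => g (s * t) • k t) (by fun_prop) ?_
        have hK : IsCompact ((fun p : H × H => (p.1 * p.2⁻¹, p.2)) '' (tsupport g ×ˢ tsupport k)) :=
          (hg.prod hkc).image (by fun_prop)
        refine HasCompactSupport.intro hK fun ⟨s, t⟩ hs => ?_
        by_contra hne
        have h2 : s * t ∈ tsupport g := by
          by_contra ht
          exact hne (by simp [image_eq_zero_of_notMem_tsupport ht])
        have h3 : t ∈ tsupport k := by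
          by_contra ht
          exact hne (by simp [image_eq_zero_of_notMem_tsupport ht])
        exact hs ⟨(s * t, t), ⟨h2, h3⟩, by simp⟩
    _ = ∫ t, (∫ x, g x ∂μ) • h t ∂μ := by
        congr 1 with t
        -- Right translation of `g` by `t` produces the factor `Δ(t⁻¹)`, which cancels the `Δ(t)` in
        -- `k`.
        rw [integral_smul_const, ← modularCharacter_mul_integral μ g.continuous hg, ← modularΔ_inv,
          smul_smul, mul_right_comm, ← modularΔ_mul, inv_mul_cancel, modularΔ_one, one_mul]
    _ = (∫ x, g x ∂μ) • ∫ s, h s ∂μ := integral_smul _ _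

/-- A covariant representation of a C*-dynamical system on a Hilbert space. -/
structure CovariantRep (α : CStarAction H A) (K : Type*) [NormedAddCommGroup K]
    [InnerProductSpace ℂ K] [CompleteSpace K] where
  M : A →⋆ₙₐ[ℂ] (K →L[ℂ] K)
  U : H →* (K →L[ℂ] K)
  norm_U : ∀ s ξ, ‖U s ξ‖ = ‖ξ‖
  continuous_U : ∀ ξ, Continuous fun s => U s ξ
  covariant : ∀ s a ξ, U s (M a ξ) = M (α.act s a) (U s ξ)

namespace CovariantRep

variable {α : CStarAction H A} (R : CovariantRep α K) {μ : Measure H}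

theorem star_U (s : H) : star (R.U s) = R.U s⁻¹ := by
  have h1 : star (R.U s) * R.U s = 1 :=
    (ContinuousLinearMap.norm_map_iff_adjoint_comp_self (R.U s)).1 (R.norm_U s)
  calc star (R.U s) = star (R.U s) * (R.U s * R.U s⁻¹) := by
        rw [← map_mul, mul_inv_cancel, map_one, mul_one]
    _ = R.U s⁻¹ := by rw [← mul_assoc, h1, one_mul]

theorem continuous_M : Continuous R.M := Env.continuous_starHom R.M

theorem continuous_integrand (f : Conv α μ) (ξ : K) : Continuous fun s => R.M (f s) (R.U s ξ) :=
  (R.continuous_M.comp f.continuous).clm_apply (R.continuous_U ξ)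

theorem integrable_integrand [IsHaarMeasure μ] (f : Conv α μ) (ξ : K) :
    Integrable (fun s => R.M (f s) (R.U s ξ)) μ :=
  (R.continuous_integrand f ξ).integrable_of_hasCompactSupport
    (HasCompactSupport.intro f.hasCompactSupport fun s hs => by
      rw [image_eq_zero_of_notMem_tsupport hs, map_zero, _root_.zero_apply])

theorem norm_integrand_le (f : Conv α μ) (s : H) (ξ : K) :
    ‖R.M (f s) (R.U s ξ)‖ ≤ ‖f s‖ * ‖ξ‖ := by
  refine ((R.M (f s)).le_opNorm _).trans ?_
  rw [R.norm_U]
  exact mul_le_mul_of_nonneg_right (NonUnitalStarAlgHom.norm_apply_le R.M _) (norm_nonneg _)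

variable [IsHaarMeasure μ]

/-- The operator `∫ M(f(s)) U_s ds`. -/
def intOp (f : Conv α μ) : K →L[ℂ] K :=
  LinearMap.mkContinuous
    { toFun := fun ξ => ∫ s, R.M (f s) (R.U s ξ) ∂μ
      map_add' := fun ξ η => by
        rw [← integral_add (R.integrable_integrand f ξ) (R.integrable_integrand f η)]
        simp only [map_add]
      map_smul' := fun c ξ => by
        rw [RingHom.id_apply, ← integral_smul]
        simp only [map_smul] } (Conv.l1Norm α μ f)
    fun ξ => by
      change ‖∫ s, R.M (f s) (R.U s ξ) ∂μ‖ ≤ _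
      rw [Conv.l1Norm_apply, ← integral_mul_const]
      exact norm_integral_le_of_norm_le (f.integrable_norm.mul_const _)
        (Eventually.of_forall fun s => R.norm_integrand_le f s ξ)

theorem intOp_apply (f : Conv α μ) (ξ : K) : R.intOp f ξ = ∫ s, R.M (f s) (R.U s ξ) ∂μ := rfl

theorem norm_intOp_le (f : Conv α μ) : ‖R.intOp f‖ ≤ Conv.l1Norm α μ f :=
  LinearMap.mkContinuous_norm_le _ (apply_nonneg _ _) _

/-- After exchanging the integrals and substituting `s ↦ ts`, covariance `U_t M(a) = M(α_t a) U_t`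
separates the two factors. -/
theorem intOp_mul (f g : Conv α μ) : R.intOp (f * g) = R.intOp f * R.intOp g := by
  ext ξ
  let T : H → (A →L[ℂ] K) := fun s =>
    (ContinuousLinearMap.apply ℂ K (R.U s ξ)) ∘L (⟨(R.M : A →ₗ[ℂ] (K →L[ℂ] K)), R.continuous_M⟩)
  have hT : ∀ s a, T s a = R.M a (R.U s ξ) := fun s a => rfl
  let F : H → H → K := fun s t => R.M (f t * α.act t (g (t⁻¹ * s))) (R.U s ξ)
  have hF : Continuous (Function.uncurry F) :=
    (R.continuous_M.comp (Conv.continuous_integrand f g)).clm_apply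
      ((R.continuous_U ξ).comp continuous_fst)
  have hFc : HasCompactSupport (Function.uncurry F) := by
    have hk : IsCompact ((fun p : H × H => (p.1 * p.2, p.1)) '' (tsupport f ×ˢ tsupport g)) :=
      (f.hasCompactSupport.prod g.hasCompactSupport).image (by fun_prop)
    refine HasCompactSupport.intro hk fun ⟨s, t⟩ hs => ?_
    by_contra hne
    have h1 : t ∈ tsupport f := by
      by_contra ht
      exact hne (by simp [F, image_eq_zero_of_notMem_tsupport ht])
    have h2 : t⁻¹ * s ∈ tsupport g := by
      by_contra ht
      exact hne (by simp [F, image_eq_zero_of_notMem_tsupport ht])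
    exact hs ⟨(t, t⁻¹ * s), ⟨h1, h2⟩, by simp⟩
  change R.intOp (f * g) ξ = R.intOp f (R.intOp g ξ)
  rw [intOp_apply, intOp_apply]
  calc ∫ s, R.M ((f * g) s) (R.U s ξ) ∂μ = ∫ s, ∫ t, F s t ∂μ ∂μ := by
        congr 1 with s
        rw [Conv.mul_apply, ← hT, ← (T s).integral_comp_comm (Conv.integrable_integrand f g s)]
        rfl
    _ = ∫ t, ∫ s, F s t ∂μ ∂μ := integral_integral_swap_of_hasCompactSupport hF hFc
    _ = ∫ t, R.M (f t) (R.U t (R.intOp g ξ)) ∂μ := by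
        congr 1 with t
        rw [← integral_mul_left_eq_self _ t, intOp_apply,
          ← (R.U t).integral_comp_comm (R.integrable_integrand g ξ),
          ← (R.M (f t)).integral_comp_comm
            ((R.U t).integrable_comp (R.integrable_integrand g ξ))]
        congr 1 with s
        simp only [F, inv_mul_cancel_left, map_mul, R.covariant]
        rfl

/-- The function is `U_{s⁻¹} M(f(s)*) ξ`. Taking adjoints does not preserve strong continuity in
general. Here the unitaries are strongly continuous under inversion as well, and being isometric
they do not enlarge the variation of `M(f(s)*) ξ`. -/
theorem continuous_star_integrand (f : Conv α μ) (ξ : K) :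
    Continuous fun s => star (R.M (f s) * R.U s) ξ := by
  simp only [star_mul, R.star_U, ← map_star]
  refine continuous_iff_continuousAt.2 fun s₀ => ?_
  have hm : Continuous fun s => R.M (star (f s)) ξ :=
    (R.continuous_M.comp f.continuous.star).clm_apply continuous_const
  have ha : Tendsto (fun s => R.U s⁻¹ (R.M (star (f s₀)) ξ)) (𝓝 s₀)
      (𝓝 (R.U s₀⁻¹ (R.M (star (f s₀)) ξ))) :=
    ((R.continuous_U _).comp continuous_inv).tendsto s₀
  have hb : Tendsto (fun s => R.U s⁻¹ (R.M (star (f s)) ξ - R.M (star (f s₀)) ξ)) (𝓝 s₀)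
      (𝓝 0) := by
    rw [tendsto_zero_iff_norm_tendsto_zero]
    simp only [R.norm_U]
    have := (hm.sub continuous_const).norm (f := fun s =>
      R.M (star (f s)) ξ - R.M (star (f s₀)) ξ)
    simpa using this.tendsto s₀
  have hab := ha.add hb
  simp only [map_sub, add_sub_cancel, add_zero] at hab
  exact hab

theorem hasCompactSupport_star_integrand (f : Conv α μ) (ξ : K) :
    HasCompactSupport fun s => star (R.M (f s) * R.U s) ξ :=
  HasCompactSupport.intro f.hasCompactSupport fun s hs => by
    rw [image_eq_zero_of_notMem_tsupport hs, map_zero, zero_mul, star_zero, _root_.zero_apply]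

/-- By covariance `M(f*(s)) U_s` is `Δ(s⁻¹)` times the adjoint of `M(f(s⁻¹)) U_{s⁻¹}`. The factor
`Δ(s⁻¹)` is the one that makes inversion preserve the integral. -/
theorem intOp_star (f : Conv α μ) : R.intOp (star f) = star (R.intOp f) := by
  have hc := R.continuous_star_integrand f
  have hs := R.hasCompactSupport_star_integrand f
  have h1 : ∀ ξ, R.intOp (star f) ξ = ∫ s, star (R.M (f s) * R.U s) ξ ∂μ := fun ξ => by
    rw [← integral_modularΔ_inv μ (hc ξ) (hs ξ), intOp_apply]
    congr 1 with s
    rw [Conv.star_apply, map_smul, star_mul, R.star_U, inv_inv, ← map_star]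
    change (modularΔ s⁻¹ : ℂ) • R.M (α.act s (star (f s⁻¹))) (R.U s ξ) = _
    rw [← R.covariant]
    rfl
  rw [ContinuousLinearMap.star_eq_adjoint, ContinuousLinearMap.eq_adjoint_iff]
  intro ξ η
  rw [h1, intOp_apply, ← integral_inner (R.integrable_integrand f η), ← inner_conj_symm,
    ← integral_inner ((hc ξ).integrable_of_hasCompactSupport (hs ξ)), ← integral_conj]
  congr 1 with s
  rw [inner_conj_symm, ContinuousLinearMap.star_eq_adjoint,
    ContinuousLinearMap.adjoint_inner_left]
  rfl

/-- The integrated form of a covariant representation. -/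
def integrated (μ : Measure H) [IsHaarMeasure μ] : Conv α μ →⋆ₙₐ[ℂ] (K →L[ℂ] K) where
  toFun := R.intOp
  map_smul' c f := by
    ext ξ
    change R.intOp (c • f) ξ = c • R.intOp f ξ
    simp only [intOp_apply, Conv.smul_apply, map_smul, _root_.smul_apply, integral_smul]
  map_zero' := by
    ext ξ
    simp only [intOp_apply, Conv.zero_apply, map_zero, _root_.zero_apply, integral_zero]
  map_add' f g := by
    ext ξ
    change R.intOp (f + g) ξ = R.intOp f ξ + R.intOp g ξ
    simp only [intOp_apply]
    rw [← integral_add (R.integrable_integrand f ξ) (R.integrable_integrand g ξ)]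
    simp only [Conv.add_apply, map_add, _root_.add_apply]
  map_mul' := R.intOp_mul
  map_star' := R.intOp_star

theorem norm_integrated_le (f : Conv α μ) : ‖R.integrated μ f‖ ≤ Conv.l1Norm α μ f :=
  R.norm_intOp_le f

end CovariantRep
end Integrated

/-! ## The regular representation on `L²` -/

section Regular

variable {H : Type*} [TopologicalSpace H] [Group H] [IsTopologicalGroup H]
  [LocallyCompactSpace H] [T2Space H] [MeasurableSpace H] [BorelSpace H]
  (μ : Measure H) [IsHaarMeasure μ]

/-- The representation of `C₀(H)` on `L²(H)` by multiplication operators. -/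
def mulHom : C₀(H, ℂ) →⋆ₙₐ[ℂ] (Lp ℂ 2 μ →L[ℂ] Lp ℂ 2 μ) where
  toFun := mulOp μ
  map_smul' c f := by
    ext1 ξ
    refine Lp.ext ?_
    filter_upwards [mulOp_ae μ (c • f) ξ, mulOp_ae μ f ξ,
      Lp.coeFn_smul c (mulOp μ f ξ)] with s h1 h2 h3
    rw [MonoidHom.id_apply, _root_.smul_apply, h1, h3, Pi.smul_apply, h2, ZeroAtInftyContinuousMap.smul_apply,
      smul_mul_assoc]
  map_zero' := by
    ext1 ξ
    refine Lp.ext ?_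
    filter_upwards [mulOp_ae μ 0 ξ, Lp.coeFn_zero ℂ 2 μ] with s h1 h2
    rw [_root_.zero_apply, h1, h2]; simp
  map_add' f g := by
    ext1 ξ
    refine Lp.ext ?_
    filter_upwards [mulOp_ae μ (f + g) ξ, mulOp_ae μ f ξ, mulOp_ae μ g ξ,
      Lp.coeFn_add (mulOp μ f ξ) (mulOp μ g ξ)] with s h1 h2 h3 h4
    rw [_root_.add_apply, h1, h4, Pi.add_apply, h2, h3, ZeroAtInftyContinuousMap.add_apply, add_mul]
  map_mul' f g := by
    ext1 ξ
    refine Lp.ext ?_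
    filter_upwards [mulOp_ae μ (f * g) ξ, mulOp_ae μ f (mulOp μ g ξ), mulOp_ae μ g ξ] with s h1 h2 h3
    rw [h1]
    refine Eq.trans ?_ h2.symm
    rw [h3, ZeroAtInftyContinuousMap.mul_apply, mul_assoc]
  map_star' f := by
    rw [ContinuousLinearMap.star_eq_adjoint, ContinuousLinearMap.eq_adjoint_iff]
    intro ξ η
    rw [L2.inner_def, L2.inner_def]
    refine integral_congr_ae ?_
    filter_upwards [mulOp_ae μ (star f) ξ, mulOp_ae μ f η] with s h1 h2
    rw [h1, h2, ZeroAtInftyContinuousMap.star_apply, RCLike.inner_apply, RCLike.inner_apply, map_mul]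
    simp only [Complex.star_def, Complex.conj_conj]
    ring

theorem mulHom_apply (f : C₀(H, ℂ)) : mulHom μ f = mulOp μ f := rfl

theorem memLp_cc (φ : ccSubmodule H ℂ) : MemLp φ.1 2 μ :=
  φ.2.1.memLp_of_hasCompactSupport φ.2.2

/-- The class in `L²(H)` of a continuous compactly supported function. -/
def ccL2 : ccSubmodule H ℂ →ₗ[ℂ] Lp ℂ 2 μ where
  toFun φ := (memLp_cc μ φ).toLp φ.1
  map_add' _ _ := rfl
  map_smul' _ _ := rfl

theorem ccL2_ae (φ : ccSubmodule H ℂ) : ccL2 μ φ =ᵐ[μ] φ.1 :=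
  MemLp.coeFn_toLp (memLp_cc μ φ)

theorem inner_ccL2 (φ ψ : ccSubmodule H ℂ) :
    inner ℂ (ccL2 μ φ) (ccL2 μ ψ) = ∫ s, star (φ.1 s) * ψ.1 s ∂μ := by
  rw [L2.inner_def]
  refine integral_congr_ae ?_
  filter_upwards [ccL2_ae μ φ, ccL2_ae μ ψ] with s h1 h2
  rw [h1, h2, RCLike.inner_apply, mul_comm]; rfl

theorem hasCompactSupport_ofReal {H : Type*} [TopologicalSpace H] {f : H → ℝ}
    (hf : HasCompactSupport f) : HasCompactSupport fun s => (f s : ℂ) :=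
  (hf.comp_left Complex.ofReal_zero : HasCompactSupport (Complex.ofReal ∘ f))

/-- For an indicator of a set of finite measure, regularity squeezes the set between a compact `s`
and an open `V`. A Urysohn function for this pair differs from the indicator only on `V \ s`, whose
measure is small. -/
theorem exists_cc_eLpNorm_sub_le [μ.Regular] {f : H → ℂ} (hf : MemLp f 2 μ) {ε : ENNReal}
    (hε : ε ≠ 0) : ∃ g : H → ℂ, eLpNorm (f - g) 2 μ ≤ ε ∧ g ∈ ccSubmodule H ℂ := by
  refine hf.induction_dense (by simp) (fun g => g ∈ ccSubmodule H ℂ) (fun c t ht htμ ε hε => ?_)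
    (fun f g hf hg => add_mem hf hg) (fun f hf => hf.1.aestronglyMeasurable) hε
  obtain ⟨η, ηpos, hη⟩ : ∃ η : NNReal, 0 < η ∧ ∀ s : Set H, μ s ≤ η →
      eLpNorm (s.indicator fun _ => c) 2 μ ≤ ε := exists_eLpNorm_indicator_le (by simp) c hε
  have hη2 : ((η / 2 : NNReal) : ENNReal) ≠ 0 := by simpa using ηpos.ne'
  obtain ⟨s, st, s_compact, s_closed, μs⟩ := ht.exists_isCompact_isClosed_sdiff_lt htμ.ne hη2
  obtain ⟨V, tV, V_open, -, μV⟩ := ht.exists_isOpen_sdiff_lt htμ.ne hη2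
  obtain ⟨g, g1, g0, gc, gI⟩ := exists_continuous_one_zero_of_isCompact s_compact
    V_open.isClosed_compl (Set.disjoint_compl_right_iff_subset.2 (st.trans tV))
  refine ⟨fun x => (g x : ℂ) * c, ?_, by fun_prop, HasCompactSupport.mul_right
    (hasCompactSupport_ofReal gc)⟩
  have hμ : μ (V \ s) ≤ η := by
    have hsub : V \ s ⊆ (V \ t) ∪ (t \ s) := fun x hx => by
      by_cases hxt : x ∈ t
      · exact Or.inr ⟨hxt, hx.2⟩
      · exact Or.inl ⟨hx.1, hxt⟩
    refine (measure_mono hsub).trans ((measure_union_le _ _).trans ?_)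
    refine (add_le_add μV.le μs.le).trans (le_of_eq ?_)
    rw [← ENNReal.coe_add, add_halves]
  refine (eLpNorm_mono fun x => ?_).trans (hη _ hμ)
  have hgx := gI x
  rw [Pi.sub_apply]
  by_cases hxs : x ∈ s
  · have h1 : g x = 1 := g1 hxs
    rw [Set.indicator_of_mem (st hxs), h1]
    simp
  · by_cases hxV : x ∈ V
    · have hVs : x ∈ V \ s := ⟨hxV, hxs⟩
      rw [Set.indicator_of_mem hVs]
      by_cases hxt : x ∈ t
      · rw [Set.indicator_of_mem hxt, ← sub_one_mul, norm_mul]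
        refine mul_le_of_le_one_left (norm_nonneg _) ?_
        rw [← Complex.ofReal_one, ← Complex.ofReal_sub, Complex.norm_real, Real.norm_eq_abs, abs_le]
        constructor <;> linarith [hgx.1, hgx.2]
      · rw [Set.indicator_of_notMem hxt, sub_zero, norm_mul]
        refine mul_le_of_le_one_left (norm_nonneg _) ?_
        rw [Complex.norm_real, Real.norm_eq_abs, abs_le]
        constructor <;> linarith [hgx.1, hgx.2]
    · have h1 : g x = 0 := g0 hxV
      rw [Set.indicator_of_notMem (fun h => hxV (tV h)), h1]
      simp

theorem denseRange_ccL2 [μ.Regular] : DenseRange (ccL2 μ) := by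
  intro ξ
  refine Metric.mem_closure_iff.2 fun ε hε => ?_
  obtain ⟨g, hle, hgc, hg⟩ := exists_cc_eLpNorm_sub_le μ (Lp.memLp ξ)
    (ε := ENNReal.ofReal (ε / 2)) (by simpa using hε)
  refine ⟨_, ⟨⟨g, hgc, hg⟩, rfl⟩, ?_⟩
  rw [dist_eq_norm, Lp.norm_def]
  refine lt_of_le_of_lt ?_ (half_lt_self hε)
  refine ENNReal.toReal_le_of_le_ofReal (half_pos hε).le (le_trans (le_of_eq ?_) hle)
  refine eLpNorm_congr_ae ?_
  filter_upwards [Lp.coeFn_sub ξ (ccL2 μ ⟨g, hgc, hg⟩), ccL2_ae μ ⟨g, hgc, hg⟩] with s h1 h2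
  rw [h1, Pi.sub_apply, h2, Pi.sub_apply]

/-- A continuous compactly supported function, as an element of `C₀(H)`. -/
def ccC0 {E : Type*} [NormedAddCommGroup E] (φ : H → E) (hφ : Continuous φ)
    (hc : HasCompactSupport φ) : C₀(H, E) :=
  ⟨⟨φ, hφ⟩, by
    rw [hasCompactSupport_iff_eventuallyEq, coclosedCompact_eq_cocompact] at hc
    exact tendsto_const_nhds.congr' hc.symm⟩

@[simp] theorem ccC0_apply {E : Type*} [NormedAddCommGroup E] (φ : H → E) (hφ : Continuous φ)
    (hc : HasCompactSupport φ) (s : H) : ccC0 φ hφ hc s = φ s := rfl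

theorem mulOp_ccL2 (f : C₀(H, ℂ)) (φ ψ : ccSubmodule H ℂ) (h : ∀ s, ψ.1 s = f s * φ.1 s) :
    mulOp μ f (ccL2 μ φ) = ccL2 μ ψ := by
  refine Lp.ext ?_
  filter_upwards [mulOp_ae μ f (ccL2 μ φ), ccL2_ae μ φ, ccL2_ae μ ψ] with s h1 h2 h3
  rw [h1, h2, h3, h]

variable [μ.Regular]

theorem rho_mul (s t : H) (ξ : Lp ℂ 2 μ) : rho μ (s * t) ξ = rho μ s (rho μ t ξ) := by
  refine Lp.ext ?_
  filter_upwards [rho_ae μ (s * t) ξ, rho_ae μ s (rho μ t ξ),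
    (quasiMeasurePreserving_mul_right' μ s).ae (rho_ae μ t ξ)] with r h1 h2 h3
  rw [h1, h2, h3, modularΔ_mul, Real.mul_rpow (modularΔ_pos s).le (modularΔ_pos t).le,
    Complex.ofReal_mul, mul_assoc, mul_assoc]

theorem rho_one (ξ : Lp ℂ 2 μ) : rho μ 1 ξ = ξ := by
  refine Lp.ext ?_
  filter_upwards [rho_ae μ 1 ξ] with r h1
  rw [h1, modularΔ_one, Real.one_rpow, Complex.ofReal_one, one_mul, mul_one]

theorem norm_rho (s : H) (ξ : Lp ℂ 2 μ) : ‖rho μ s ξ‖ = ‖ξ‖ := norm_translate μ s ξ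

theorem rho_mulOp (s : H) (f : C₀(H, ℂ)) (ξ : Lp ℂ 2 μ) :
    rho μ s (mulOp μ f ξ) = mulOp μ (rtHom H ℂ s f) (rho μ s ξ) := by
  refine Lp.ext ?_
  filter_upwards [rho_ae μ s (mulOp μ f ξ), mulOp_ae μ (rtHom H ℂ s f) (rho μ s ξ),
    rho_ae μ s ξ, (quasiMeasurePreserving_mul_right' μ s).ae (mulOp_ae μ f ξ)] with r h1 h2 h3 h4
  rw [h1, h2, h3, h4, rtHom_apply, mul_left_comm]

/-- Right translation of compactly supported functions. -/
def ccTranslate (s : H) (φ : ccSubmodule H ℂ) : ccSubmodule H ℂ :=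
  ⟨fun t => ((modularΔ s ^ (1 / 2 : ℝ) : ℝ) : ℂ) * φ.1 (t * s),
    continuous_const.mul (φ.2.1.comp (continuous_mul_const s)),
    HasCompactSupport.mul_left (φ.2.2.comp_homeomorph (Homeomorph.mulRight s))⟩

theorem rho_ccL2 (s : H) (φ : ccSubmodule H ℂ) :
    rho μ s (ccL2 μ φ) = ccL2 μ (ccTranslate s φ) := by
  refine Lp.ext ?_
  filter_upwards [rho_ae μ s (ccL2 μ φ), ccL2_ae μ (ccTranslate s φ),
    (quasiMeasurePreserving_mul_right' μ s).ae (ccL2_ae μ φ)] with t h1 h2 h3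
  rw [h1, h2, h3]; rfl

theorem continuous_rpow_modularΔ (r : ℝ) : Continuous fun s : H => modularΔ s ^ r :=
  continuous_modularΔ.rpow_const fun s => Or.inl (modularΔ_pos s).ne'

theorem exists_cutoff {k : Set H} (hk : IsCompact k) :
    ∃ χ : ccSubmodule H ℂ, ∀ t ∈ k, χ.1 t = 1 := by
  obtain ⟨χ, h1, -, hc, -⟩ := exists_continuous_one_zero_of_isCompact hk isClosed_empty
    (Set.disjoint_empty k)
  refine ⟨⟨fun t => (χ t : ℂ), by fun_prop, hasCompactSupport_ofReal hc⟩,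
    fun t ht => ?_⟩
  simp [h1 ht]

/-- Because each `ρ_s` is isometric, it suffices to treat the dense set of compactly supported
functions, where continuity follows from the sup-norm continuity of translation on `C₀(H)`. -/
theorem continuous_rho (ξ : Lp ℂ 2 μ) : Continuous fun s => rho μ s ξ := by
  have hcc : ∀ φ : ccSubmodule H ℂ, Continuous fun s => rho μ s (ccL2 μ φ) := fun φ => by
    refine continuous_iff_continuousAt.2 fun s₀ => ?_
    obtain ⟨k, hk, hks⟩ := exists_compact_mem_nhds s₀
    -- For `s` in the compact neighbourhood `k` of `s₀`, all translates of `φ` are supported where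
    -- `χ = 1`. So `ρ_s φ` is, up to `Δ(s)^{1/2}`, the multiplication operator of the translated
    -- function applied to the fixed vector `χ`.
    obtain ⟨χ, hχ⟩ := exists_cutoff (((φ.2.2 : IsCompact (tsupport φ.1)).prod hk).image
      (f := fun p : H × H => p.1 * p.2⁻¹) (by fun_prop))
    have hcont : Continuous fun s => (modularΔ s ^ (1 / 2 : ℝ) : ℝ) •
        mulHom μ (rtHom H ℂ s (ccC0 φ.1 φ.2.1 φ.2.2)) (ccL2 μ χ) :=
      (continuous_rpow_modularΔ _).smul (((Env.continuous_starHom (mulHom μ)).comp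
        (continuous_rtHom _)).clm_apply continuous_const)
    refine hcont.continuousAt.congr ?_
    filter_upwards [hks] with s hs
    refine Lp.ext ?_
    filter_upwards [rho_ae μ s (ccL2 μ φ), mulOp_ae μ (rtHom H ℂ s (ccC0 φ.1 φ.2.1 φ.2.2)) (ccL2 μ χ),
      (quasiMeasurePreserving_mul_right' μ s).ae (ccL2_ae μ φ), ccL2_ae μ χ,
      Lp.coeFn_smul (modularΔ s ^ (1 / 2 : ℝ) : ℝ)
        (mulHom μ (rtHom H ℂ s (ccC0 φ.1 φ.2.1 φ.2.2)) (ccL2 μ χ))] with t h1 h2 h3 h4 h5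
    rw [h5, h1, h3, Pi.smul_apply, mulHom_apply, h2, h4, rtHom_apply, ccC0_apply,
      Complex.real_smul]
    by_cases h0 : φ.1 (t * s) = 0
    · rw [h0, zero_mul]
    · rw [hχ t ⟨(t * s, s), ⟨subset_tsupport _ h0, hs⟩, by simp⟩, mul_one]
  refine continuous_iff_continuousAt.2 fun s₀ => ?_
  rw [ContinuousAt, Metric.tendsto_nhds]
  intro ε hε
  obtain ⟨_, ⟨φ, rfl⟩, hφ⟩ := Metric.mem_closure_iff.1 (denseRange_ccL2 μ ξ) (ε / 3) (by positivity)
  filter_upwards [Metric.tendsto_nhds.1 ((hcc φ).tendsto s₀) (ε / 3) (by positivity)] with s hs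
  have h1 : ∀ r, dist (rho μ r ξ) (rho μ r (ccL2 μ φ)) < ε / 3 := fun r => by
    rw [dist_eq_norm, ← map_sub, norm_rho, ← dist_eq_norm]; exact hφ
  have h2 := h1 s
  have h3 := h1 s₀
  rw [dist_comm] at h3
  calc dist (rho μ s ξ) (rho μ s₀ ξ) ≤ dist (rho μ s ξ) (rho μ s (ccL2 μ φ)) +
        dist (rho μ s (ccL2 μ φ)) (rho μ s₀ (ccL2 μ φ)) +
        dist (rho μ s₀ (ccL2 μ φ)) (rho μ s₀ ξ) := dist_triangle4 _ _ _ _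
    _ < ε := by linarith

end Regular

/-! ## The representation of matrix valued functions on `L² ⊕ L²` -/

section Block

variable {E : Type*} [NormedAddCommGroup E] [InnerProductSpace ℂ E] [CompleteSpace E]

/-- The operator on `E ⊕ E` with a given matrix of operators. -/
def blockOp (T : Fin 2 → Fin 2 → E →L[ℂ] E) :
    PiLp 2 (fun _ : Fin 2 => E) →L[ℂ] PiLp 2 (fun _ : Fin 2 => E) :=
  ((PiLp.continuousLinearEquiv 2 ℂ (fun _ : Fin 2 => E)).symm :
    (Fin 2 → E) →L[ℂ] PiLp 2 (fun _ : Fin 2 => E)) ∘L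
    ContinuousLinearMap.pi fun i => ∑ j, T i j ∘L PiLp.proj 2 (fun _ : Fin 2 => E) j

theorem blockOp_apply (T : Fin 2 → Fin 2 → E →L[ℂ] E) (ξ : PiLp 2 (fun _ : Fin 2 => E))
    (i : Fin 2) : blockOp T ξ i = ∑ j, T i j (ξ j) := by
  simp [blockOp]

theorem blockOp_adjoint (T : Fin 2 → Fin 2 → E →L[ℂ] E) :
    blockOp (fun i j => (T j i).adjoint) = (blockOp T).adjoint := by
  rw [ContinuousLinearMap.eq_adjoint_iff]
  intro ξ η
  simp only [PiLp.inner_apply, blockOp_apply, sum_inner, inner_sum,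
    ContinuousLinearMap.adjoint_inner_left]
  exact Finset.sum_comm

theorem blockOp_mul (T S : Fin 2 → Fin 2 → E →L[ℂ] E) :
    blockOp T * blockOp S = blockOp fun i j => ∑ k, T i k * S k j := by
  ext1 ξ
  refine PiLp.ext fun i => ?_
  rw [_root_.mul_apply_eq_comp, blockOp_apply, blockOp_apply]
  simp only [blockOp_apply, _root_.map_sum, _root_.sum_apply, _root_.mul_apply_eq_comp]
  exact Finset.sum_comm

/-- The diagonal operator `T ⊕ T` on `E ⊕ E`. -/
def diagOp (T : E →L[ℂ] E) :
    PiLp 2 (fun _ : Fin 2 => E) →L[ℂ] PiLp 2 (fun _ : Fin 2 => E) :=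
  blockOp fun i j => if i = j then T else 0

theorem diagOp_apply (T : E →L[ℂ] E) (ξ : PiLp 2 (fun _ : Fin 2 => E)) (i : Fin 2) :
    diagOp T ξ i = T (ξ i) := by
  rw [diagOp, blockOp_apply, Finset.sum_eq_single i (fun j _ hj => by rw [if_neg hj.symm]; simp)
    (by simp), if_pos rfl]

theorem diagOp_mul (T S : E →L[ℂ] E) : diagOp T * diagOp S = diagOp (T * S) := by
  ext1 ξ
  refine PiLp.ext fun i => ?_
  rw [_root_.mul_apply_eq_comp, diagOp_apply, diagOp_apply, diagOp_apply]
  rfl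

end Block

section MatrixRep

variable {H : Type*} [TopologicalSpace H] [Group H] [IsTopologicalGroup H]
  [LocallyCompactSpace H] [T2Space H] [MeasurableSpace H] [BorelSpace H]
  (μ : Measure H) [IsHaarMeasure μ]

/-- The Hilbert space `L²(H) ⊕ L²(H)`. -/
abbrev L2Pair : Type _ := PiLp 2 (fun _ : Fin 2 => Lp ℂ 2 μ)

/-- The entries of a matrix valued function. -/
def entry (i j : Fin 2) (F : C₀(H, Matrix (Fin 2) (Fin 2) ℂ)) : C₀(H, ℂ) :=
  ⟨⟨fun s => F s i j, F.continuous.matrix_elem i j⟩, by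
    have h : Continuous fun A : Matrix (Fin 2) (Fin 2) ℂ => A i j := continuous_id.matrix_elem i j
    exact (h.tendsto 0).comp (zero_at_infty F)⟩

@[simp] theorem entry_apply (i j : Fin 2) (F : C₀(H, Matrix (Fin 2) (Fin 2) ℂ)) (s : H) :
    entry i j F s = F s i j := rfl

/-- The representation of `C₀(H, M₂)` on `L²(H) ⊕ L²(H)` by multiplication. -/
def matMul : C₀(H, Matrix (Fin 2) (Fin 2) ℂ) →⋆ₙₐ[ℂ] (L2Pair μ →L[ℂ] L2Pair μ) where
  toFun F := blockOp fun i j => mulHom μ (entry i j F)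
  map_smul' c F := by
    ext1 ξ
    refine PiLp.ext fun i => ?_
    rw [blockOp_apply, _root_.smul_apply, PiLp.smul_apply, blockOp_apply, Finset.smul_sum]
    refine Finset.sum_congr rfl fun j _ => ?_
    rw [MonoidHom.id_apply, show entry i j (c • F) = c • entry i j F from rfl, map_smul]; rfl
  map_zero' := by
    ext1 ξ
    refine PiLp.ext fun i => ?_
    rw [blockOp_apply, _root_.zero_apply, PiLp.zero_apply]
    refine Finset.sum_eq_zero fun j _ => ?_
    rw [show entry i j (0 : C₀(H, Matrix (Fin 2) (Fin 2) ℂ)) = 0 from rfl, map_zero]; rfl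
  map_add' F F' := by
    ext1 ξ
    refine PiLp.ext fun i => ?_
    rw [blockOp_apply, _root_.add_apply, PiLp.add_apply, blockOp_apply, blockOp_apply,
      ← Finset.sum_add_distrib]
    refine Finset.sum_congr rfl fun j _ => ?_
    rw [show entry i j (F + F') = entry i j F + entry i j F' from rfl, map_add]; rfl
  map_mul' F F' := by
    rw [blockOp_mul]
    congr 1
    ext1 i; ext1 j
    have h : entry i j (F * F') = ∑ k, entry i k F * entry k j F' := by
      ext s
      simp only [Fin.sum_univ_two]
      simp [Matrix.mul_apply]
    rw [h, _root_.map_sum]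
    exact Finset.sum_congr rfl fun k _ => map_mul _ _ _
  map_star' F := by
    rw [ContinuousLinearMap.star_eq_adjoint, ← blockOp_adjoint]
    congr 1
    ext1 i; ext1 j
    rw [← ContinuousLinearMap.star_eq_adjoint, ← map_star]
    congr 1

theorem matMul_apply (F : C₀(H, Matrix (Fin 2) (Fin 2) ℂ)) (ξ : L2Pair μ) (i : Fin 2) :
    matMul μ F ξ i = ∑ j, mulOp μ (entry i j F) (ξ j) := blockOp_apply _ _ _

/-- Pairs of continuous compactly supported functions. -/
abbrev CcPair (H : Type*) [TopologicalSpace H] : Type _ := Fin 2 → ccSubmodule H ℂ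

/-- The class in `L²(H) ⊕ L²(H)` of a pair of continuous compactly supported functions. -/
def pairL2 (φ : CcPair H) : L2Pair μ := WithLp.toLp 2 fun k => ccL2 μ (φ k)

@[simp] theorem pairL2_apply (φ : CcPair H) (k : Fin 2) : pairL2 μ φ k = ccL2 μ (φ k) := rfl

theorem denseRange_pairL2 [μ.Regular] : DenseRange (pairL2 μ : CcPair H → L2Pair μ) := by
  have h : DenseRange (Pi.map fun _ : Fin 2 => (ccL2 μ : ccSubmodule H ℂ → Lp ℂ 2 μ)) :=
    DenseRange.piMap fun _ => denseRange_ccL2 μ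
  exact (PiLp.continuousLinearEquiv 2 ℂ (fun _ : Fin 2 => Lp ℂ 2 μ)).symm.surjective.denseRange.comp
    h (PiLp.continuousLinearEquiv 2 ℂ (fun _ : Fin 2 => Lp ℂ 2 μ)).symm.continuous

/-- The pointwise inner product of two pairs of functions. -/
def pairInner (φ ψ : CcPair H) (s : H) : ℂ := ∑ k, star ((φ k).1 s) * (ψ k).1 s

theorem continuous_pairInner (φ ψ : CcPair H) : Continuous (pairInner φ ψ) :=
  continuous_finsetSum _ fun k _ => (φ k).2.1.star.mul (ψ k).2.1

theorem hasCompactSupport_pairInner (φ ψ : CcPair H) : HasCompactSupport (pairInner φ ψ) := by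
  have h : pairInner φ ψ = (fun s => star ((φ 0).1 s) * (ψ 0).1 s) +
      fun s => star ((φ 1).1 s) * (ψ 1).1 s := by
    ext s; simp [pairInner, Fin.sum_univ_two]
  rw [h]
  exact ((ψ 0).2.2.mul_left).add (ψ 1).2.2.mul_left

theorem inner_pairL2 (φ ψ : CcPair H) :
    inner ℂ (pairL2 μ φ) (pairL2 μ ψ) = ∫ s, pairInner φ ψ s ∂μ := by
  simp only [pairInner]
  rw [PiLp.inner_apply, integral_finsetSum]
  · exact Finset.sum_congr rfl fun k _ => inner_ccL2 μ _ _
  · intro k _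
    exact ((φ k).2.1.star.mul (ψ k).2.1).integrable_of_hasCompactSupport (ψ k).2.2.mul_left

variable [μ.Regular]

/-- The right regular representation on `L²(H) ⊕ L²(H)`. -/
def rhoPair : H →* (L2Pair μ →L[ℂ] L2Pair μ) where
  toFun s := diagOp (rho μ s)
  map_one' := by
    ext1 ξ
    refine PiLp.ext fun i => ?_
    rw [diagOp_apply, rho_one]; rfl
  map_mul' s t := by
    rw [diagOp_mul]
    congr 1
    ext1 ξ
    exact rho_mul μ s t ξ

theorem rhoPair_apply (s : H) (ξ : L2Pair μ) (i : Fin 2) : rhoPair μ s ξ i = rho μ s (ξ i) :=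
  diagOp_apply _ _ _

theorem norm_rhoPair (s : H) (ξ : L2Pair μ) : ‖rhoPair μ s ξ‖ = ‖ξ‖ := by
  simp only [PiLp.norm_eq_of_L2, rhoPair_apply, norm_rho]

theorem continuous_rhoPair (ξ : L2Pair μ) : Continuous fun s => rhoPair μ s ξ := by
  refine (PiLp.continuousLinearEquiv 2 ℂ (fun _ : Fin 2 => Lp ℂ 2 μ)).symm.continuous.comp
    (f := fun s i => rho μ s (ξ i)) (continuous_pi fun i => continuous_rho μ (ξ i)) |>.congr
      fun s => ?_
  refine PiLp.ext fun i => ?_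
  rw [rhoPair_apply]; rfl

theorem rhoPair_matMul (s : H) (F : C₀(H, Matrix (Fin 2) (Fin 2) ℂ)) (ξ : L2Pair μ) :
    rhoPair μ s (matMul μ F ξ) =
      matMul μ (rtHom H (Matrix (Fin 2) (Fin 2) ℂ) s F) (rhoPair μ s ξ) := by
  refine PiLp.ext fun i => ?_
  simp only [rhoPair_apply, matMul_apply, _root_.map_sum, rho_mulOp]
  rfl

end MatrixRep

/-! ### Rank one elements of the twisted convolution algebra of `L` -/

namespace Twist

variable {G Gσ : Type*}
  [TopologicalSpace G] [Group G] [IsTopologicalGroup G] [LocallyCompactSpace G] [T2Space G]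
  [TopologicalSpace Gσ] [Group Gσ] [IsTopologicalGroup Gσ] [LocallyCompactSpace Gσ] [T2Space Gσ]
  (σ : Twist G Gσ)
  [MeasurableSpace Gσ] [BorelSpace Gσ] (μ : Measure Gσ) [IsHaarMeasure μ]

/-- The equivariant pairs of functions: `ξ₀(sz) = ξ₀(s)` and `ξ₁(sz) = z ξ₁(s)`. -/
def equivPair : Submodule ℂ (CcPair Gσ) where
  carrier := {ξ | ∀ (k : Fin 2) (s : Gσ) (z : Circle),
    (ξ k).1 (s * σ.ι z) = ![1, (z : ℂ)] k * (ξ k).1 s}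
  zero_mem' k s z := by simp
  add_mem' {ξ η} hξ hη k s z := by
    simp only [Set.mem_ofPred_eq] at hξ hη
    simp [hξ k s z, hη k s z, mul_add]
  smul_mem' c ξ hξ k s z := by
    simp only [Set.mem_ofPred_eq] at hξ
    simp [hξ k s z, mul_left_comm]

/-- The matrix valued function with first column `ξ`. -/
def colC0 (ξ : CcPair Gσ) : C₀(Gσ, Matrix (Fin 2) (Fin 2) ℂ) :=
  ccC0 (fun s => Matrix.of fun k l => if l = 0 then (ξ k).1 s else 0)
    (continuous_matrix fun k l => by
      simp only [Matrix.of_apply]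
      split_ifs with h
      · exact (ξ k).2.1
      · exact continuous_const)
    (HasCompactSupport.intro ((ξ 0).2.2.union (ξ 1).2.2) fun s hs => by
      ext k l
      simp only [Matrix.of_apply, Matrix.zero_apply]
      split_ifs with h
      · refine image_eq_zero_of_notMem_tsupport fun h' => hs ?_
        fin_cases k
        · exact Or.inl h'
        · exact Or.inr h'
      · rfl)

/-- Only the first column is nonzero, so the matrix product is the outer product of the vectors
`ξ(t)` and `η(tg)`. This way continuity and decay are inherited from `C₀(G_σ, M₂)`. -/
theorem colC0_mul (ξ η : CcPair Gσ) (g t : Gσ) (k l : Fin 2) :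
    (colC0 ξ * rtHom Gσ (Matrix (Fin 2) (Fin 2) ℂ) g (star (colC0 η))) t k l =
      (ξ k).1 t * star ((η l).1 (t * g)) := by
  change ((colC0 ξ) t * star ((colC0 η) (t * g))) k l = _
  rw [Matrix.mul_apply, Fin.sum_univ_two, Matrix.star_eq_conjTranspose,
    Matrix.conjTranspose_apply, Matrix.conjTranspose_apply]
  simp [colC0]

/-- The element `t ↦ ξ(t) η(tg)*` of the linking algebra. -/
def rankLinking (ξ η : σ.equivPair) (g : Gσ) : σ.linking :=
  ⟨colC0 ξ.1 * rtHom Gσ (Matrix (Fin 2) (Fin 2) ℂ) g (star (colC0 η.1)), fun t z => by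
    ext k l
    have h1 : t * σ.ι z * g = t * g * σ.ι z := by rw [mul_assoc, σ.central, ← mul_assoc]
    rw [star_diagMat, diagMat, diagMat, Matrix.mul_diagonal, Matrix.diagonal_mul, colC0_mul,
      colC0_mul, ξ.2, h1, η.2, star_mul]
    have h2 : star (![1, (z : ℂ)] l) = ![1, star (z : ℂ)] l := by fin_cases l <;> simp
    rw [h2]; ring⟩

theorem rankLinking_apply (ξ η : σ.equivPair) (g t : Gσ) (k l : Fin 2) :
    (σ.rankLinking ξ η g).1 t k l = (ξ.1 k).1 t * star ((η.1 l).1 (t * g)) :=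
  colC0_mul ξ.1 η.1 g t k l

theorem continuous_rankLinking (ξ η : σ.equivPair) : Continuous (σ.rankLinking ξ η) :=
  (continuous_const.mul (continuous_rtHom (star (colC0 η.1)))).subtype_mk _

theorem hasCompactSupport_rankLinking (ξ η : σ.equivPair) :
    HasCompactSupport (σ.rankLinking ξ η) := by
  have hk : IsCompact ((fun p : Gσ × Gσ => p.1⁻¹ * p.2) ''
      ((tsupport (ξ.1 0).1 ∪ tsupport (ξ.1 1).1) ×ˢ
        (tsupport (η.1 0).1 ∪ tsupport (η.1 1).1))) :=
    (((ξ.1 0).2.2.union (ξ.1 1).2.2).prod ((η.1 0).2.2.union (η.1 1).2.2)).image (by fun_prop)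
  refine HasCompactSupport.intro hk fun g hg => ?_
  refine σ.linking_ext fun t => ?_
  ext k l
  refine (σ.rankLinking_apply ξ η g t k l).trans ?_
  change _ = (0 : ℂ)
  by_contra hne
  have h1 : (ξ.1 k).1 t ≠ 0 := left_ne_zero_of_mul hne
  have h2 : (η.1 l).1 (t * g) ≠ 0 := fun h => hne (by simp [h])
  refine hg ⟨(t, t * g), ⟨?_, ?_⟩, by simp⟩
  · fin_cases k
    · exact Or.inl (subset_tsupport _ h1)
    · exact Or.inr (subset_tsupport _ h1)
  · fin_cases l
    · exact Or.inl (subset_tsupport _ h2)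
    · exact Or.inr (subset_tsupport _ h2)

/-- The variable `g` occurs only in `η(tg)*`; since `ι(z)` is central it can be moved to the right
end, where equivariance of `η` applies. -/
theorem rankLinking_ι_mul (ξ η : σ.equivPair) (z : Circle) (s : Gσ) :
    σ.rankLinking ξ η (σ.ι z * s) = (σ.diagMul z⁻¹).snd (σ.rankLinking ξ η s) := by
  refine σ.linking_ext fun t => ?_
  ext k l
  have h1 : t * (σ.ι z * s) = t * s * σ.ι z := by rw [σ.central, ← mul_assoc]
  rw [diagMul_snd, diagMat, Matrix.mul_diagonal, rankLinking_apply, rankLinking_apply, h1, η.2,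
    star_mul, Circle.coe_inv_eq_conj]
  have h2 : star (![1, (z : ℂ)] l) = ![1, (starRingEnd ℂ) (z : ℂ)] l := by fin_cases l <;> simp
  rw [h2]; ring

/-- The function `e(ξ, η)(g)(t) = Δ(g)^{-1/2} ξ(t) η(tg)*`, which is represented by the rank one
operator `ξ ⊗ η*`. -/
def rankConv (ξ η : σ.equivPair) : σ.linkingTwisted.twistedConv μ :=
  ⟨Conv.mk (fun g => ((modularΔ g ^ (-1 / 2 : ℝ) : ℝ) : ℂ) • σ.rankLinking ξ η g)
    ((Complex.continuous_ofReal.comp (continuous_rpow_modularΔ _)).smul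
      (σ.continuous_rankLinking ξ η))
    ((σ.hasCompactSupport_rankLinking ξ η).smul_left
      (f := fun g => ((modularΔ g ^ (-1 / 2 : ℝ) : ℝ) : ℂ))),
  fun z s => by
    change ((modularΔ (σ.ι z * s) ^ (-1 / 2 : ℝ) : ℝ) : ℂ) • σ.rankLinking ξ η (σ.ι z * s) =
      (σ.diagMul z⁻¹).snd (((modularΔ s ^ (-1 / 2 : ℝ) : ℝ) : ℂ) • σ.rankLinking ξ η s)
    rw [map_smul, ← rankLinking_ι_mul, modularΔ_mul, TwistedAction.modularΔ_ι σ.toCentralCircle,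
      one_mul]⟩

theorem rankConv_apply (ξ η : σ.equivPair) (g t : Gσ) (k l : Fin 2) :
    ((σ.rankConv μ ξ η).1 g).1 t k l = ((modularΔ g ^ (-1 / 2 : ℝ) : ℝ) : ℂ) *
      ((ξ.1 k).1 t * star ((η.1 l).1 (t * g))) :=
  congrArg (((modularΔ g ^ (-1 / 2 : ℝ) : ℝ) : ℂ) * ·) (σ.rankLinking_apply ξ η g t k l)

/-- Evaluation of a matrix entry, as a continuous linear functional on the linking algebra. -/
def evalEntry (t : Gσ) (k l : Fin 2) : σ.linking →L[ℂ] ℂ where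
  toFun F := F.1 t k l
  map_add' _ _ := rfl
  map_smul' _ _ := rfl
  cont := ((continuous_eval_C0 t).comp continuous_subtype_val).matrix_elem k l

theorem evalEntry_apply (t : Gσ) (k l : Fin 2) (F : σ.linking) :
    σ.evalEntry t k l F = F.1 t k l := rfl

theorem twistedConv_ext {f g : σ.linkingTwisted.twistedConv μ}
    (h : ∀ s t k l, (f.1 s).1 t k l = (g.1 s).1 t k l) : f = g :=
  Subtype.ext (Conv.ext fun s => σ.linking_ext fun t => Matrix.ext (h s t))

theorem rpow_modularΔ_mul (s t : Gσ) (r : ℝ) :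
    modularΔ (s * t) ^ r = modularΔ s ^ r * modularΔ t ^ r := by
  rw [modularΔ_mul, Real.mul_rpow (modularΔ_pos s).le (modularΔ_pos t).le]

/-- The exponent `-1/2` is self-dual under the involution: `Δ(s⁻¹) Δ(s⁻¹)^{-1/2} = Δ(s)^{-1/2}`. -/
theorem star_rankConv (ξ η : σ.equivPair) : star (σ.rankConv μ ξ η) = σ.rankConv μ η ξ := by
  refine σ.twistedConv_ext μ fun s t k l => ?_
  have h1 : ((star (σ.rankConv μ ξ η)).1 s).1 t k l =
      (modularΔ s⁻¹ : ℂ) * star (((σ.rankConv μ ξ η).1 s⁻¹).1 (t * s) l k) := rfl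
  rw [h1, rankConv_apply, rankConv_apply, mul_inv_cancel_right, star_mul, star_mul, star_star]
  have h2 : star ((modularΔ s⁻¹ ^ (-1 / 2 : ℝ) : ℝ) : ℂ) = ((modularΔ s⁻¹ ^ (-1 / 2 : ℝ) : ℝ) : ℂ) :=
    Complex.conj_ofReal _
  have h3 : modularΔ s⁻¹ * modularΔ s⁻¹ ^ (-1 / 2 : ℝ) = modularΔ s ^ (-1 / 2 : ℝ) := by
    have hp := modularΔ_pos s
    have hinv : modularΔ s⁻¹ = (modularΔ s)⁻¹ :=
      eq_inv_of_mul_eq_one_left (by rw [← modularΔ_mul, inv_mul_cancel, modularΔ_one])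
    rw [hinv, Real.inv_rpow hp.le, ← Real.rpow_neg hp.le, ← Real.rpow_neg_one (modularΔ s),
      ← Real.rpow_add hp]
    norm_num
  rw [h2, ← h3, Complex.ofReal_mul]
  ring

/-- The matrix product in the integrand yields the pointwise inner product of `η` and `ξ'` at `rt`.
The modular factors combine because `Δ` is multiplicative, and left invariance removes the shift by
`r`. -/
theorem rankConv_mul (ξ η ξ' η' : σ.equivPair) :
    σ.rankConv μ ξ η * σ.rankConv μ ξ' η' =
      inner ℂ (pairL2 μ η.1) (pairL2 μ ξ'.1) • σ.rankConv μ ξ η' := by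
  refine σ.twistedConv_ext μ fun s r k l => ?_
  have h1 : ((inner ℂ (pairL2 μ η.1) (pairL2 μ ξ'.1) • σ.rankConv μ ξ η').1 s).1 r k l =
      inner ℂ (pairL2 μ η.1) (pairL2 μ ξ'.1) * ((σ.rankConv μ ξ η').1 s).1 r k l := rfl
  have h2 : ((σ.rankConv μ ξ η * σ.rankConv μ ξ' η').1 s).1 r k l =
      ∫ t, (((σ.rankConv μ ξ η).1 t).1 r * ((σ.rankConv μ ξ' η').1 (t⁻¹ * s)).1 (r * t)) k l ∂μ := by
    rw [← evalEntry_apply]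
    change σ.evalEntry r k l (((σ.rankConv μ ξ η).1 * (σ.rankConv μ ξ' η').1 :
      Conv σ.linkingTwisted.toCStarAction μ) s) = _
    rw [Conv.mul_apply, ← (σ.evalEntry r k l).integral_comp_comm
      (Conv.integrable_integrand _ _ s)]
    rfl
  rw [h1, h2, inner_pairL2, rankConv_apply, ← integral_mul_const,
    ← integral_mul_left_eq_self (fun t => pairInner η.1 ξ'.1 t * _) r]
  congr 1 with t
  simp only [Matrix.mul_apply, rankConv_apply, pairInner, Fin.sum_univ_two]
  have h3 : r * t * (t⁻¹ * s) = r * s := by group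
  have h4 : (modularΔ s ^ (-1 / 2 : ℝ)) =
      modularΔ t ^ (-1 / 2 : ℝ) * modularΔ (t⁻¹ * s) ^ (-1 / 2 : ℝ) := by
    rw [← rpow_modularΔ_mul, mul_inv_cancel_left]
  rw [h3, h4, Complex.ofReal_mul]
  ring

variable [μ.Regular]

/-- The covariant representation of the linking algebra on `L²(G_σ) ⊕ L²(G_σ)`. -/
def linkingRep : CovariantRep σ.linkingTwisted.toCStarAction (L2Pair μ) where
  M := (matMul μ).comp (NonUnitalStarSubalgebraClass.subtype σ.linking)
  U := rhoPair μ
  norm_U := norm_rhoPair μ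
  continuous_U := continuous_rhoPair μ
  covariant s F ξ := rhoPair_matMul μ s F.1 ξ

/-- The representation of the twisted convolution algebra of the linking algebra on
`L²(G_σ) ⊕ L²(G_σ)`. -/
def linkingHom : σ.linkingTwisted.twistedConv μ →⋆ₙₐ[ℂ] (L2Pair μ →L[ℂ] L2Pair μ) :=
  ((σ.linkingRep μ).integrated μ).comp
    (NonUnitalStarSubalgebraClass.subtype (σ.linkingTwisted.twistedConv μ))

theorem linkingHom_apply (f : σ.linkingTwisted.twistedConv μ) (ξ : L2Pair μ) :
    σ.linkingHom μ f ξ = ∫ s, matMul μ (f.1 s).1 (rhoPair μ s ξ) ∂μ := rfl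

theorem norm_linkingHom_le (f : σ.linkingTwisted.twistedConv μ) :
    ‖σ.linkingHom μ f‖ ≤ σ.linkingTwisted.l1Norm μ f := (σ.linkingRep μ).norm_integrated_le f.1

theorem integrable_linkingHom (f : σ.linkingTwisted.twistedConv μ) (ξ : L2Pair μ) :
    Integrable (fun s => matMul μ (f.1 s).1 (rhoPair μ s ξ)) μ :=
  (σ.linkingRep μ).integrable_integrand f.1 ξ

/-- The factor `Δ(s)^{-1/2}` of the rank one element cancels the `Δ(s)^{1/2}` of the right regular
representation, leaving `ξ(t) ⟨η, ζ⟩(ts)`. -/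
theorem matMul_rankConv (ξ η : σ.equivPair) (ζ : CcPair Gσ) (s : Gσ) :
    matMul μ ((σ.rankConv μ ξ η).1 s).1 (rhoPair μ s (pairL2 μ ζ)) =
      pairL2 μ fun k => ⟨fun t => (ξ.1 k).1 t * pairInner η.1 ζ (t * s),
        (ξ.1 k).2.1.mul ((continuous_pairInner η.1 ζ).comp (continuous_mul_const s)),
        (ξ.1 k).2.2.mul_right⟩ := by
  refine PiLp.ext fun k => ?_
  rw [matMul_apply, pairL2_apply, Fin.sum_univ_two, rhoPair_apply, rhoPair_apply, pairL2_apply,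
    pairL2_apply, rho_ccL2, rho_ccL2]
  have h : ∀ l, mulOp μ (entry k l ((σ.rankConv μ ξ η).1 s).1) (ccL2 μ (ccTranslate s (ζ l))) =
      ccL2 μ ⟨fun t => (ξ.1 k).1 t * (star ((η.1 l).1 (t * s)) * (ζ l).1 (t * s)),
        (ξ.1 k).2.1.mul (((η.1 l).2.1.star.mul (ζ l).2.1).comp (continuous_mul_const s)),
        (ξ.1 k).2.2.mul_right⟩ := fun l => by
    refine mulOp_ccL2 μ _ _ _ fun t => ?_
    rw [entry_apply, rankConv_apply]
    change _ = _ * (((modularΔ s ^ (1 / 2 : ℝ) : ℝ) : ℂ) * (ζ l).1 (t * s))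
    have h1 : ((modularΔ s ^ (-1 / 2 : ℝ) : ℝ) : ℂ) * ((modularΔ s ^ (1 / 2 : ℝ) : ℝ) : ℂ) = 1 := by
      rw [← Complex.ofReal_mul, ← Real.rpow_add (modularΔ_pos s)]
      norm_num
    linear_combination (-(ξ.1 k).1 t * star ((η.1 l).1 (t * s)) * (ζ l).1 (t * s)) * h1
  rw [h, h, ← map_add]
  congr 1
  ext t
  simp [pairInner, Fin.sum_univ_two, mul_add]

/-- Tested against compactly supported pairs `ζ` and `ω`, the operator gives a double integral in
`s` and `t`. Integrating `⟨η, ζ⟩(ts)` over `s` first yields a number independent of `t`, by left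
invariance. -/
theorem linkingHom_rankConv (ξ η : σ.equivPair) : σ.linkingHom μ (σ.rankConv μ ξ η) =
    InnerProductSpace.rankOne ℂ (pairL2 μ ξ.1) (pairL2 μ η.1) := by
  refine ContinuousLinearMap.ext_on (s := Set.range (pairL2 μ))
    ((denseRange_pairL2 μ).mono Submodule.subset_span) ?_
  rintro _ ⟨ζ, rfl⟩
  refine (denseRange_pairL2 μ).equalizer (g := fun ω => inner ℂ ω _) (h := fun ω => inner ℂ ω _)
    (by fun_prop) (by fun_prop) ?_ |> fun h => ext_inner_left ℂ fun ω => congrFun h ω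
  ext ω
  simp only [Function.comp_apply]
  rw [linkingHom_apply, ← integral_inner (σ.integrable_linkingHom μ _ _),
    InnerProductSpace.rankOne_apply, inner_smul_right, inner_pairL2, inner_pairL2]
  let F : Gσ → Gσ → ℂ := fun s t => pairInner ω ξ.1 t * pairInner η.1 ζ (t * s)
  have hF : Continuous (Function.uncurry F) :=
    ((continuous_pairInner _ _).comp continuous_snd).mul
      ((continuous_pairInner _ _).comp (continuous_snd.mul continuous_fst))
  have hFc : HasCompactSupport (Function.uncurry F) := by
    have hk : IsCompact ((fun p : Gσ × Gσ => (p.1⁻¹ * p.2, p.1)) ''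
        (tsupport (pairInner ω ξ.1) ×ˢ tsupport (pairInner η.1 ζ))) :=
      ((hasCompactSupport_pairInner _ _).prod (hasCompactSupport_pairInner _ _)).image (by fun_prop)
    refine HasCompactSupport.intro hk fun ⟨s, t⟩ hs => ?_
    by_contra hne
    exact hs ⟨(t, t * s), ⟨subset_tsupport _ (left_ne_zero_of_mul hne),
      subset_tsupport _ (right_ne_zero_of_mul hne)⟩, by simp⟩
  calc ∫ s, inner ℂ (pairL2 μ ω) (matMul μ ((σ.rankConv μ ξ η).1 s).1
        (rhoPair μ s (pairL2 μ ζ))) ∂μ = ∫ s, ∫ t, F s t ∂μ ∂μ := by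
        congr 1 with s
        rw [matMul_rankConv, inner_pairL2]
        congr 1 with t
        simp only [pairInner, F, Finset.sum_mul]
        exact Finset.sum_congr rfl fun k _ => by ring
    _ = ∫ t, ∫ s, F s t ∂μ ∂μ := integral_integral_swap_of_hasCompactSupport hF hFc
    _ = ∫ t, pairInner ω ξ.1 t * ∫ s, pairInner η.1 ζ s ∂μ ∂μ := by
        congr 1 with t
        rw [integral_const_mul, integral_mul_left_eq_self]
    _ = _ := by rw [integral_mul_const, mul_comm]

theorem rankOneSystem : RankOneSystem (σ.linkingHom μ) (fun ξ : σ.equivPair => pairL2 μ ξ.1)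
    (σ.rankConv μ) :=
  ⟨σ.star_rankConv μ, σ.rankConv_mul μ, σ.linkingHom_rankConv μ⟩

end Twist

/-! ## Averages over the circle -/

section CircleAverage

instance instMeasurableSpaceCircle : MeasurableSpace Circle := borel Circle

instance instBorelSpaceCircle : BorelSpace Circle := ⟨rfl⟩

/-- The normalized Haar measure of the circle group. -/
def circleHaar : Measure Circle := haarMeasure ⊤

instance : IsHaarMeasure circleHaar := inferInstanceAs (IsHaarMeasure (haarMeasure ⊤))

instance : IsProbabilityMeasure circleHaar :=
  ⟨by simpa [circleHaar] using haarMeasure_self (G := Circle) (K₀ := ⊤)⟩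

theorem continuous_char (k : Fin 2) : Continuous fun z : Circle => ![1, (z : ℂ)] k := by
  fin_cases k
  · exact continuous_const
  · exact continuous_induced_dom

theorem char_mul (k : Fin 2) (z w : Circle) :
    ![1, ((z * w : Circle) : ℂ)] k = ![1, (z : ℂ)] k * ![1, (w : ℂ)] k := by
  fin_cases k <;> simp

theorem norm_char (k : Fin 2) (z : Circle) : ‖![1, (z : ℂ)] k‖ = 1 := by
  fin_cases k
  · simp
  · exact Circle.norm_coe z

theorem star_char_mul (k : Fin 2) (z : Circle) :
    star (![1, (z : ℂ)] k) * ![1, (z : ℂ)] k = 1 := by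
  fin_cases k
  · simp
  · exact Twist.star_mul_circle z

end CircleAverage

namespace Twist

variable {G Gσ : Type*}
  [TopologicalSpace G] [Group G] [IsTopologicalGroup G] [LocallyCompactSpace G] [T2Space G]
  [TopologicalSpace Gσ] [Group Gσ] [IsTopologicalGroup Gσ] [LocallyCompactSpace Gσ] [T2Space Gσ]
  (σ : Twist G Gσ)

/-- The projection of `φ` onto the functions with `ψ(sz) = ψ(s)` (for `k = 0`) respectively
`ψ(sz) = z ψ(s)` (for `k = 1`). -/
def average (k : Fin 2) (φ : Gσ → ℂ) (t : Gσ) : ℂ :=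
  ∫ z : Circle, star (![1, (z : ℂ)] k) * φ (t * σ.ι z) ∂circleHaar

theorem continuous_average_integrand (k : Fin 2) {φ : Gσ → ℂ} (hφ : Continuous φ) :
    Continuous fun p : Gσ × Circle => star (![1, (p.2 : ℂ)] k) * φ (p.1 * σ.ι p.2) :=
  ((continuous_char k).comp continuous_snd).star.mul
    (hφ.comp (continuous_fst.mul (σ.continuous_ι.comp continuous_snd)))

theorem continuous_average (k : Fin 2) {φ : Gσ → ℂ} (hφ : Continuous φ) :
    Continuous (σ.average k φ) := by
  rw [← continuousOn_univ]
  exact continuousOn_integral_of_compact_support isCompact_univ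
    (f := fun t (z : Circle) => star (![1, (z : ℂ)] k) * φ (t * σ.ι z))
    (σ.continuous_average_integrand k hφ).continuousOn fun _ z _ hz => (hz (Set.mem_univ z)).elim

theorem isCompact_mul_ι {S : Set Gσ} (hS : IsCompact S) :
    IsCompact ((fun p : Gσ × Circle => p.1 * σ.ι p.2) '' (S ×ˢ Set.univ)) :=
  (hS.prod isCompact_univ).image (continuous_fst.mul (σ.continuous_ι.comp continuous_snd))

theorem hasCompactSupport_average (k : Fin 2) {φ : Gσ → ℂ} (hφ : HasCompactSupport φ) :
    HasCompactSupport (σ.average k φ) := by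
  refine HasCompactSupport.intro (σ.isCompact_mul_ι hφ) fun t ht => ?_
  refine integral_eq_zero_of_ae (Eventually.of_forall fun z => ?_)
  have h0 : φ (t * σ.ι z) = 0 := image_eq_zero_of_notMem_tsupport fun h =>
    ht ⟨(t * σ.ι z, z⁻¹), ⟨h, Set.mem_univ _⟩, by simp⟩
  simp only [h0, mul_zero, Pi.zero_apply]

/-- Translating the circle variable by `w` brings out the character value at `w`. -/
theorem average_mul_ι (k : Fin 2) (φ : Gσ → ℂ) (t : Gσ) (w : Circle) :
    σ.average k φ (t * σ.ι w) = ![1, (w : ℂ)] k * σ.average k φ t := by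
  rw [average, average, ← integral_const_mul,
    ← integral_mul_left_eq_self (fun z : Circle => _ * (star _ * φ (t * σ.ι z))) w]
  refine integral_congr_ae (Eventually.of_forall fun z => ?_)
  simp only [char_mul, star_mul, map_mul, ← mul_assoc t]
  linear_combination (-star (![1, (z : ℂ)] k) * φ (t * σ.ι w * σ.ι z)) * star_char_mul k w

/-- The average of a continuous compactly supported function. -/
def ccAverage (k : Fin 2) (φ : ccSubmodule Gσ ℂ) : ccSubmodule Gσ ℂ :=
  ⟨σ.average k φ.1, σ.continuous_average k φ.2.1, σ.hasCompactSupport_average k φ.2.2⟩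

theorem average_of_equivariant (k : Fin 2) {φ : Gσ → ℂ}
    (h : ∀ s z, φ (s * σ.ι z) = ![1, (z : ℂ)] k * φ s) (t : Gσ) : σ.average k φ t = φ t := by
  simp only [average, h, ← mul_assoc, star_char_mul, one_mul]
  simp

end Twist

/-! ## Density of the span of the rank one elements -/

namespace Twist

variable {G Gσ : Type*}
  [TopologicalSpace G] [Group G] [IsTopologicalGroup G] [LocallyCompactSpace G] [T2Space G]
  [TopologicalSpace Gσ] [Group Gσ] [IsTopologicalGroup Gσ] [LocallyCompactSpace Gσ] [T2Space Gσ]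
  (σ : Twist G Gσ)

theorem continuous_eval_uncurry_C0 {E : Type*} [NormedAddCommGroup E] :
    Continuous fun p : C₀(Gσ, E) × Gσ => p.1 p.2 := by
  have h : Continuous fun F : C₀(Gσ, E) => F.toBCF :=
    ZeroAtInftyContinuousMap.isometry_toBCF.continuous
  exact (h.comp continuous_fst).eval continuous_snd

variable [MeasurableSpace Gσ] [BorelSpace Gσ] (μ : Measure Gσ) [IsHaarMeasure μ]

theorem linking_mul_ι (F : σ.linking) (t : Gσ) (z : Circle) (k l : Fin 2) :
    F.1 (t * σ.ι z) k l = ![1, (z : ℂ)] k * F.1 t k l * star (![1, (z : ℂ)] l) := by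
  rw [F.2 t z, star_diagMat, diagMat, diagMat, Matrix.mul_diagonal, Matrix.diagonal_mul]
  congr 1
  fin_cases l <;> simp

theorem twistedConv_ι_mul (f : σ.linkingTwisted.twistedConv μ) (s t : Gσ) (z : Circle)
    (k l : Fin 2) :
    (f.1 (σ.ι z * s)).1 t k l = (f.1 s).1 t k l * star (![1, (z : ℂ)] l) := by
  have h : f.1 (σ.ι z * s) = (σ.diagMul z⁻¹).snd (f.1 s) := f.2 z s
  rw [h, diagMul_snd, diagMat, Matrix.mul_diagonal, Circle.coe_inv_eq_conj]
  congr 1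
  fin_cases l <;> simp

variable {μ}

/-- The integral kernel of the operator which represents `f`, up to a factor. -/
def kernel (f : σ.linkingTwisted.twistedConv μ) (k l : Fin 2) (t u : Gσ) : ℂ :=
  ((modularΔ (t⁻¹ * u) ^ (1 / 2 : ℝ) : ℝ) : ℂ) * (f.1 (t⁻¹ * u)).1 t k l

variable (f : σ.linkingTwisted.twistedConv μ)

theorem continuous_kernel (k l : Fin 2) :
    Continuous fun p : Gσ × Gσ => σ.kernel f k l p.1 p.2 := by
  refine (Complex.continuous_ofReal.comp ((continuous_rpow_modularΔ _).comp
    (continuous_fst.inv.mul continuous_snd))).mul ?_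
  have h : Continuous fun p : Gσ × Gσ => (f.1 (p.1⁻¹ * p.2)).1 p.1 :=
    continuous_eval_uncurry_C0.comp ((continuous_subtype_val.comp
      (f.1.continuous.comp (continuous_fst.inv.mul continuous_snd))).prodMk continuous_fst)
  exact h.matrix_elem k l

theorem kernel_eq_zero (k l : Fin 2) {t u : Gσ} (h : t⁻¹ * u ∉ tsupport f.1) :
    σ.kernel f k l t u = 0 := by
  rw [kernel, image_eq_zero_of_notMem_tsupport h]
  exact mul_zero _

/-- The element `z` enters twice: through `(tz)⁻¹u`, where the twist gives the `l`-th character, and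
through the evaluation point `tz`, where the linking condition gives the `k`-th character times the
conjugate of the `l`-th. The `l`-th characters cancel. -/
theorem kernel_mul_ι_left (k l : Fin 2) (t u : Gσ) (z : Circle) :
    σ.kernel f k l (t * σ.ι z) u = ![1, (z : ℂ)] k * σ.kernel f k l t u := by
  have h1 : (t * σ.ι z)⁻¹ * u = σ.ι z⁻¹ * (t⁻¹ * u) := by
    rw [mul_inv_rev, map_inv, mul_assoc]
  have h2 : star (![1, ((z⁻¹ : Circle) : ℂ)] l) = ![1, (z : ℂ)] l := by
    fin_cases l
    · simp
    · exact (congrArg star (Circle.coe_inv_eq_conj z)).trans (star_star (z : ℂ))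
  rw [kernel, kernel, h1, modularΔ_mul, TwistedAction.modularΔ_ι σ.toCentralCircle, one_mul,
    twistedConv_ι_mul, linking_mul_ι, h2]
  linear_combination (((modularΔ (t⁻¹ * u) ^ (1 / 2 : ℝ) : ℝ) : ℂ) * (f.1 (t⁻¹ * u)).1 t k l *
    ![1, (z : ℂ)] k) * star_char_mul l z

theorem kernel_mul_ι_right (k l : Fin 2) (t u : Gσ) (z : Circle) :
    σ.kernel f k l t (u * σ.ι z) = σ.kernel f k l t u * star (![1, (z : ℂ)] l) := by
  have h1 : t⁻¹ * (u * σ.ι z) = σ.ι z * (t⁻¹ * u) := by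
    rw [σ.central, mul_assoc]
  rw [kernel, kernel, h1, modularΔ_mul, TwistedAction.modularΔ_ι σ.toCentralCircle, one_mul,
    twistedConv_ι_mul, mul_assoc]

theorem hasCompactSupport_kernel (k l : Fin 2) (t : Gσ) : HasCompactSupport (σ.kernel f k l t) :=
  HasCompactSupport.intro ((f.1.hasCompactSupport : IsCompact _).image (continuous_const_mul t))
    fun u hu => σ.kernel_eq_zero f k l fun h => hu ⟨_, h, by simp⟩

/-- For `t` in `S` the kernel lives on the compact set `S · supp f` in the variable `u`, so it is
continuous in `t` uniformly in `u`. A finite cover of `S` by sets of small oscillation has a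
subordinate partition of unity. -/
theorem exists_kernel_partition {S : Set Gσ} (hS : IsCompact S) {ε : ℝ} (hε : 0 < ε) :
    ∃ (n : ℕ) (p : Fin n → Gσ) (φ : Fin n → C(Gσ, ℝ)), (∀ i, p i ∈ S) ∧
      (∀ i x, 0 ≤ φ i x) ∧ (∀ i, HasCompactSupport (φ i)) ∧ (∀ t ∈ S, ∑ i, φ i t = 1) ∧
      ∀ t ∈ S, ∀ u i k l, φ i t ≠ 0 → ‖σ.kernel f k l (p i) u - σ.kernel f k l t u‖ ≤ ε := by
  have hKu : IsCompact ((fun p : Gσ × Gσ => p.1 * p.2) '' (S ×ˢ tsupport f.1)) :=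
    (hS.prod f.1.hasCompactSupport).image continuous_mul
  have hW : ∀ t₀ ∈ S, {t | ∀ u ∈ (fun p : Gσ × Gσ => p.1 * p.2) '' (S ×ˢ tsupport f.1), ∀ k l,
      ‖σ.kernel f k l t₀ u - σ.kernel f k l t u‖ < ε} ∈ 𝓝 t₀ := fun t₀ _ => by
    refine hKu.eventually_forall_of_forall_eventually fun u _ => ?_
    refine eventually_all.2 fun k => eventually_all.2 fun l => ?_
    have hc : Continuous fun p : Gσ × Gσ => ‖σ.kernel f k l t₀ p.2 - σ.kernel f k l p.1 p.2‖ :=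
      (((σ.continuous_kernel f k l).comp (continuous_const.prodMk continuous_snd)).sub
        (σ.continuous_kernel f k l)).norm
    exact (hc.tendsto (t₀, u)).eventually (gt_mem_nhds (by simpa using hε))
  obtain ⟨T, hTS, hT⟩ := hS.elim_nhds_subcover _ (fun t₀ ht₀ => interior_mem_nhds.2 (hW t₀ ht₀))
  let p : Fin T.card → Gσ := fun i => (T.equivFin.symm i : Gσ)
  have hcov : S ⊆ ⋃ i, interior {t | ∀ u ∈ (fun p : Gσ × Gσ => p.1 * p.2) '' (S ×ˢ tsupport f.1),
      ∀ k l, ‖σ.kernel f k l (p i) u - σ.kernel f k l t u‖ < ε} := fun t ht => by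
    obtain ⟨t₀, ht₀, h⟩ := Set.mem_iUnion₂.1 (hT ht)
    refine Set.mem_iUnion.2 ⟨T.equivFin ⟨t₀, ht₀⟩, ?_⟩
    simpa [p] using h
  obtain ⟨φ, h1, h2, h3, h4⟩ := exists_continuous_sum_one_of_isOpen_isCompact
    (fun i => isOpen_interior) hS hcov
  have hp : ∀ i, p i ∈ S := fun i => hTS _ (T.equivFin.symm i).2
  refine ⟨T.card, p, φ, hp, fun i x => (h3 i x).1, h4, fun t ht => ?_, fun t ht u i k l h => ?_⟩
  · simpa using h2 ht
  -- Outside this compact set both kernel values vanish, since `p i` and `t` lie in `S`.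
  · by_cases hu : u ∈ (fun p : Gσ × Gσ => p.1 * p.2) '' (S ×ˢ tsupport f.1)
    · exact (interior_subset (h1 i (subset_tsupport _ h)) u hu k l).le
    · have h0 : ∀ s ∈ S, σ.kernel f k l s u = 0 := fun s hs =>
        σ.kernel_eq_zero f k l fun h' => hu ⟨(s, s⁻¹ * u), ⟨hs, h'⟩, by simp⟩
      rw [h0 _ (hp i), h0 t ht, sub_zero, norm_zero]
      exact hε.le

theorem norm_average_le (k : Fin 2) {φ : Gσ → ℂ} {t : Gσ} {C : ℝ}
    (h : ∀ z, ‖φ (t * σ.ι z)‖ ≤ C) : ‖σ.average k φ t‖ ≤ C := by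
  refine (norm_integral_le_of_norm_le_const (C := C) (Eventually.of_forall fun z => ?_)).trans ?_
  · rw [norm_mul, norm_star, norm_char, one_mul]
    exact h z
  · simp

theorem average_sub_sum (k : Fin 2) {n : ℕ} {φ : Fin n → Gσ → ℂ} (hφ : ∀ i, Continuous (φ i))
    {ψ : Gσ → ℂ} (hψ : Continuous ψ) (c : Fin n → ℂ) (t : Gσ) :
    σ.average k (fun s => ∑ i, φ i s * c i - ψ s) t =
      ∑ i, σ.average k (φ i) t * c i - σ.average k ψ t := by
  have hi : ∀ {χ : Gσ → ℂ}, Continuous χ → Integrable (fun z : Circle =>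
      star (![1, (z : ℂ)] k) * χ (t * σ.ι z)) circleHaar := fun hχ =>
    ((σ.continuous_average_integrand k hχ).comp
      (continuous_const.prodMk continuous_id)).integrable_of_hasCompactSupport
      (HasCompactSupport.of_compactSpace _)
  simp only [average, ← integral_mul_const]
  rw [← integral_finsetSum _ fun i _ => (hi (hφ i)).mul_const _,
    ← integral_sub (integrable_finsetSum _ fun i _ => (hi (hφ i)).mul_const _) (hi hψ)]
  refine integral_congr_ae (Eventually.of_forall fun z => ?_)
  simp only [mul_sub, Finset.mul_sum, mul_assoc]

/-- The functions of the partition must be averaged to become equivariant. The kernel is already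
equivariant in its first variable, so it equals its own average. The error is then the average of
the unaveraged error along the coset of `t`, which stays inside `S`. -/
theorem norm_sum_average_sub_kernel_le {S : Set Gσ} (hSι : ∀ t ∈ S, ∀ z, t * σ.ι z ∈ S) {ε : ℝ}
    {n : ℕ} {p : Fin n → Gσ} {φ : Fin n → C(Gσ, ℝ)} (h0 : ∀ i x, 0 ≤ φ i x)
    (h1 : ∀ t ∈ S, ∑ i, φ i t = 1)
    (h : ∀ t ∈ S, ∀ u i k l, φ i t ≠ 0 → ‖σ.kernel f k l (p i) u - σ.kernel f k l t u‖ ≤ ε)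
    {t : Gσ} (ht : t ∈ S) (u : Gσ) (k l : Fin 2) :
    ‖∑ i, σ.average k (fun s => (φ i s : ℂ)) t * σ.kernel f k l (p i) u - σ.kernel f k l t u‖ ≤ ε := by
  have hψ : Continuous fun s => σ.kernel f k l s u := by
    simpa only [Function.comp_def] using
      (σ.continuous_kernel f k l).comp (f := fun s : Gσ => (s, u)) (by fun_prop)
  rw [← σ.average_of_equivariant k (φ := fun s => σ.kernel f k l s u)
    (fun s z => σ.kernel_mul_ι_left f k l s u z) t,
    ← σ.average_sub_sum k (φ := fun i s => (φ i s : ℂ))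
      (fun i => Complex.continuous_ofReal.comp (φ i).continuous) hψ]
  · refine σ.norm_average_le k fun z => ?_
    have hs := hSι t ht z
    set s := t * σ.ι z
    have h2 : ∑ i, (φ i s : ℂ) * σ.kernel f k l (p i) u - σ.kernel f k l s u =
        ∑ i, (φ i s : ℂ) * (σ.kernel f k l (p i) u - σ.kernel f k l s u) := by
      simp only [mul_sub, Finset.sum_sub_distrib, ← Finset.sum_mul]
      rw [← Complex.ofReal_sum, h1 s hs, Complex.ofReal_one, one_mul]
    rw [h2]
    refine (norm_sum_le_of_le (n := fun i => φ i s * ε) _ fun i _ => ?_).trans ?_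
    · rw [norm_mul, Complex.norm_real, Real.norm_of_nonneg (h0 i s)]
      by_cases hz : φ i s = 0
      · rw [hz, zero_mul, zero_mul]
      · exact mul_le_mul_of_nonneg_left (h s hs u i k l hz) (h0 i s)
    · rw [← Finset.sum_mul, h1 s hs, one_mul]

/-- Equivalence of norms in finite dimension: estimates are made entrywise, while the C*-norm of the
linking algebra is the operator norm of matrices. -/
theorem exists_norm_matrix_le : ∃ C : ℝ, 0 < C ∧ ∀ (M : Matrix (Fin 2) (Fin 2) ℂ) (δ : ℝ), 0 ≤ δ →
    (∀ k l, ‖M k l‖ ≤ δ) → ‖M‖ ≤ C * δ := by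
  let T := LinearMap.toContinuousLinearMap
    ((Matrix.ofLinearEquiv ℂ : (Fin 2 → Fin 2 → ℂ) ≃ₗ[ℂ] Matrix (Fin 2) (Fin 2) ℂ) :
      (Fin 2 → Fin 2 → ℂ) →ₗ[ℂ] Matrix (Fin 2) (Fin 2) ℂ)
  refine ⟨‖T‖ + 1, by positivity, fun M δ hδ h => ?_⟩
  have h1 : ‖(fun k l => M k l : Fin 2 → Fin 2 → ℂ)‖ ≤ δ :=
    (pi_norm_le_iff_of_nonneg hδ).2 fun k => (pi_norm_le_iff_of_nonneg hδ).2 fun l => h k l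
  calc ‖M‖ = ‖T fun k l => M k l‖ := rfl
    _ ≤ ‖T‖ * δ := T.le_opNorm_of_le h1
    _ ≤ (‖T‖ + 1) * δ := by nlinarith

/-- The image of `f` is compact in `L`, and each of its values vanishes at infinity, so finitely
many values control the decay uniformly in `g`. -/
theorem exists_isCompact_norm_le {ε : ℝ} (hε : 0 < ε) :
    ∃ k : Set Gσ, IsCompact k ∧ ∀ g, ∀ t ∉ k, ‖(f.1 g).1 t‖ ≤ ε := by
  have h := IsCompact.induction_on (s := tsupport f.1) (f.1.hasCompactSupport)
    (p := fun S => ∃ k : Set Gσ, IsCompact k ∧ ∀ g ∈ S, ∀ t ∉ k, ‖(f.1 g).1 t‖ ≤ ε)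
    ⟨∅, isCompact_empty, by simp⟩
    (fun S T hST ⟨k, hk, h⟩ => ⟨k, hk, fun g hg => h g (hST hg)⟩)
    (fun S T ⟨k, hk, h⟩ ⟨k', hk', h'⟩ => ⟨k ∪ k', hk.union hk', fun g hg t ht => by
      rw [Set.mem_union, not_or] at ht
      exact hg.elim (fun hg => h g hg t ht.1) fun hg => h' g hg t ht.2⟩)
    (fun g₀ _ => by
      have h1 : ∀ᶠ g in 𝓝 g₀, ‖f.1 g - f.1 g₀‖ < ε / 2 := by
        have hc : Continuous fun g => ‖f.1 g - f.1 g₀‖ := (f.1.continuous.sub continuous_const).norm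
        exact (hc.tendsto g₀).eventually (gt_mem_nhds (by simpa using hε))
      have h2 : ∀ᶠ t in cocompact Gσ, ‖(f.1 g₀).1 t‖ < ε / 2 := by
        have := (zero_at_infty (f.1 g₀).1).norm
        rw [norm_zero] at this
        exact this.eventually (gt_mem_nhds (half_pos hε))
      obtain ⟨k, hk, hk'⟩ := mem_cocompact.1 h2
      refine ⟨_, mem_nhdsWithin_of_mem_nhds h1, k, hk, fun g hg t ht => ?_⟩
      have h3 : ‖(f.1 g).1 t - (f.1 g₀).1 t‖ ≤ ‖f.1 g - f.1 g₀‖ :=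
        norm_apply_le_C0 (f.1 g - f.1 g₀).1 t
      have h4 : ‖(f.1 g₀).1 t‖ < ε / 2 := hk' ht
      have h5 : ‖f.1 g - f.1 g₀‖ < ε / 2 := hg
      calc ‖(f.1 g).1 t‖ = ‖((f.1 g).1 t - (f.1 g₀).1 t) + (f.1 g₀).1 t‖ := by rw [sub_add_cancel]
        _ ≤ _ := norm_add_le _ _
        _ ≤ ε := by linarith)
  obtain ⟨k, hk, h⟩ := h
  refine ⟨k, hk, fun g t ht => ?_⟩
  by_cases hg : g ∈ tsupport f.1
  · exact h g hg t ht
  · rw [image_eq_zero_of_notMem_tsupport hg]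
    exact (norm_zero (E := Matrix (Fin 2) (Fin 2) ℂ)).le.trans hε.le

end Twist

/-! ### The approximation in the `L¹`-norm -/

namespace Twist

variable {G Gσ : Type*}
  [TopologicalSpace G] [Group G] [IsTopologicalGroup G] [LocallyCompactSpace G] [T2Space G]
  [TopologicalSpace Gσ] [Group Gσ] [IsTopologicalGroup Gσ] [LocallyCompactSpace Gσ] [T2Space Gσ]
  (σ : Twist G Gσ)

theorem isCompact_preimage_q {k : Set G} (hk : IsCompact k) : IsCompact (σ.q ⁻¹' k) := by
  obtain ⟨k', hk', h⟩ := mem_cocompact.1 (σ.tendsto_q hk.compl_mem_cocompact)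
  exact hk'.of_isClosed_subset (hk.isClosed.preimage σ.continuous_q)
    (Set.compl_subset_compl.1 h)

theorem hasCompactSupport_comp_q {E : Type*} [Zero E] {φ : G → E} (hφ : HasCompactSupport φ) :
    HasCompactSupport fun s => φ (σ.q s) :=
  HasCompactSupport.intro (σ.isCompact_preimage_q hφ) fun _ hs =>
    image_eq_zero_of_notMem_tsupport hs

variable [MeasurableSpace Gσ] [BorelSpace Gσ] {μ : Measure Gσ} [IsHaarMeasure μ]

/-- Evaluation of a matrix entry on the twisted convolution algebra. -/
def evalConv (s t : Gσ) (k l : Fin 2) : σ.linkingTwisted.twistedConv μ →ₗ[ℂ] ℂ where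
  toFun f := (f.1 s).1 t k l
  map_add' _ _ := rfl
  map_smul' _ _ := rfl

/-- The equivariant pair with `k`-th component `(χ ∘ q) · φ_k`, where `φ_k` is the average of `φ`,
and other component zero. -/
def averagePair (χ : C(G, ℝ)) (hχ : HasCompactSupport χ) (φ : C(Gσ, ℝ)) (k : Fin 2) : σ.equivPair :=
  ⟨fun k' => if k' = k then ⟨fun t => (χ (σ.q t) : ℂ) * σ.average k (fun s => (φ s : ℂ)) t,
      (Complex.continuous_ofReal.comp (χ.continuous.comp σ.continuous_q)).mul
        (σ.continuous_average k (Complex.continuous_ofReal.comp φ.continuous)),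
      HasCompactSupport.mul_right
        (hasCompactSupport_ofReal (σ.hasCompactSupport_comp_q hχ))⟩ else 0,
  fun k' s z => by
    dsimp only
    split_ifs with h
    · change (χ (σ.q (s * σ.ι z)) : ℂ) * σ.average k (fun s => (φ s : ℂ)) (s * σ.ι z) =
        _ * ((χ (σ.q s) : ℂ) * σ.average k (fun s => (φ s : ℂ)) s)
      rw [h, average_mul_ι, map_mul, σ.q_ι, mul_one, mul_left_comm]
    · simp⟩

theorem averagePair_apply (χ : C(G, ℝ)) (hχ : HasCompactSupport χ) (φ : C(Gσ, ℝ)) (k k' : Fin 2)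
    (t : Gσ) : ((σ.averagePair χ hχ φ k).1 k').1 t =
      if k' = k then (χ (σ.q t) : ℂ) * σ.average k (fun s => (φ s : ℂ)) t else 0 := by
  unfold averagePair
  dsimp only
  split_ifs <;> rfl

/-- The pair `u ↦ K(t, u)* e_k`, where `K` is the kernel of `f`. -/
def kernelPair (f : σ.linkingTwisted.twistedConv μ) (k : Fin 2) (t : Gσ) : σ.equivPair :=
  ⟨fun l => ⟨fun u => star (σ.kernel f k l t u), by
      simpa only [Function.comp_def] using
        ((σ.continuous_kernel f k l).comp (f := fun u : Gσ => (t, u)) (by fun_prop)).star,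
      (σ.hasCompactSupport_kernel f k l t).comp_left (star_zero ℂ)⟩,
  fun l s z => by
    dsimp only
    rw [kernel_mul_ι_right, star_mul, star_star]⟩

theorem kernelPair_apply (f : σ.linkingTwisted.twistedConv μ) (k l : Fin 2) (t u : Gσ) :
    ((σ.kernelPair f k t).1 l).1 u = star (σ.kernel f k l t u) := rfl

theorem sum_rankConv_apply (f : σ.linkingTwisted.twistedConv μ) (χ : C(G, ℝ))
    (hχ : HasCompactSupport χ) {n : ℕ} (φ : Fin n → C(Gσ, ℝ)) (p : Fin n → Gσ) (g t : Gσ)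
    (k l : Fin 2) :
    ((∑ i, ∑ k, σ.rankConv μ (σ.averagePair χ hχ (φ i) k) (σ.kernelPair f k (p i)) :
      σ.linkingTwisted.twistedConv μ).1 g).1 t k l =
      ((modularΔ g ^ (-1 / 2 : ℝ) : ℝ) : ℂ) * ((χ (σ.q t) : ℂ) *
        ∑ i, σ.average k (fun s => (φ i s : ℂ)) t * σ.kernel f k l (p i) (t * g)) := by
  change σ.evalConv g t k l _ = _
  rw [_root_.map_sum, Finset.mul_sum, Finset.mul_sum]
  refine Finset.sum_congr rfl fun i _ => ?_
  rw [_root_.map_sum]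
  rw [Finset.sum_eq_single k]
  · change ((σ.rankConv μ _ _).1 g).1 t k l = _
    rw [rankConv_apply, averagePair_apply, if_pos rfl, kernelPair_apply, star_star, mul_assoc]
  · intro k' _ hk
    change ((σ.rankConv μ _ _).1 g).1 t k l = _
    rw [rankConv_apply, averagePair_apply, if_neg hk.symm, zero_mul, mul_zero]
  · simp

theorem entry_eq_kernel (f : σ.linkingTwisted.twistedConv μ) (g t : Gσ) (k l : Fin 2) :
    (f.1 g).1 t k l = ((modularΔ g ^ (-1 / 2 : ℝ) : ℝ) : ℂ) * σ.kernel f k l t (t * g) := by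
  rw [kernel, inv_mul_cancel_left, ← mul_assoc, ← Complex.ofReal_mul,
    ← Real.rpow_add (modularΔ_pos g)]
  norm_num

set_option maxHeartbeats 1000000 in
-- Write `f(g)(t) = Δ(g)^{-1/2} K(t, tg)`. A cutoff `χ ∘ q` restricts `t` to a compact set `S`, and
-- there `K(t, u)` is replaced by `∑ᵢ φᵢ(t) K(pᵢ, u)` with averaged `φᵢ`. Each summand is a rank one
-- element, whose second vector is the conjugate of `K(pᵢ, ·)`.
theorem dense_span_rankConv (f : σ.linkingTwisted.twistedConv μ) {ε : ℝ} (hε : 0 < ε) :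
    ∃ y ∈ RankOneSystem.span (σ.rankConv μ), σ.linkingTwisted.l1Norm μ (f - y) < ε := by
  obtain ⟨m, hm⟩ : ∃ m, m = μ.real (tsupport f.1) := ⟨_, rfl⟩
  have hm0 : 0 ≤ m := hm ▸ measureReal_nonneg
  -- The part of `f` removed by the cutoff has norm at most this constant on the support of `f`, of
  -- measure `m`, so it costs at most `ε / 3`. The added 1 avoids division by zero.
  obtain ⟨k, hk, hkf⟩ := σ.exists_isCompact_norm_le f (ε := ε / (3 * (m + 1))) (by positivity)
  obtain ⟨χ, hχ1, -, hχ, hχI⟩ := exists_continuous_one_zero_of_isCompact (hk.image σ.continuous_q)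
    isClosed_empty (Set.disjoint_empty _)
  obtain ⟨S, hSdef⟩ : ∃ S, S = σ.q ⁻¹' tsupport χ := ⟨_, rfl⟩
  have hS : IsCompact S := hSdef ▸ σ.isCompact_preimage_q hχ
  have hSι : ∀ t ∈ S, ∀ z, t * σ.ι z ∈ S := fun t ht z => by
    rw [hSdef, Set.mem_preimage] at ht ⊢
    rwa [map_mul, σ.q_ι, mul_one]
  -- If `t` is in `S` and `g` is outside `Kg = S⁻¹ S supp f`, then `K(s, tg) = 0` for every `s` in
  -- `S`. So the kernel error is supported in this compact set, on which `Δ^{-1/2}` is bounded by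
  -- `B`.
  obtain ⟨Kg, hKg⟩ : ∃ Kg, Kg = (fun p : Gσ × Gσ × Gσ => p.1⁻¹ * p.2.1 * p.2.2) ''
      (S ×ˢ S ×ˢ tsupport f.1) := ⟨_, rfl⟩
  have hKgc : IsCompact Kg := hKg ▸ (hS.prod (hS.prod f.1.hasCompactSupport)).image (by fun_prop)
  obtain ⟨B, hB⟩ := hKgc.exists_bound_of_continuousOn
    (continuous_rpow_modularΔ (H := Gσ) (-1 / 2)).continuousOn
  obtain ⟨C, hC, hCM⟩ := exists_norm_matrix_le
  obtain ⟨m', hm'⟩ : ∃ m', m' = μ.real Kg := ⟨_, rfl⟩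
  have hm'0 : 0 ≤ m' := hm' ▸ measureReal_nonneg
  have hB0 : (0 : ℝ) < |B| + 1 := by positivity
  -- Chosen so that the kernel error, multiplied by the matrix constant `C`, the modular bound and
  -- the measure `m'` of `Kg`, is at most `ε / 3`.
  obtain ⟨ε', hε'⟩ : ∃ ε', ε' = ε / (3 * (C * (|B| + 1) * (m' + 1))) := ⟨_, rfl⟩
  have hε'0 : 0 < ε' := hε' ▸ by positivity
  obtain ⟨n, p, φ, hp, hφ0, hφc, hφ1, hφ⟩ := σ.exists_kernel_partition f hS hε'0
  obtain ⟨y, hy⟩ : ∃ y : σ.linkingTwisted.twistedConv μ, y =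
    ∑ i, ∑ k, σ.rankConv μ (σ.averagePair χ hχ (φ i) k) (σ.kernelPair f k (p i)) := ⟨_, rfl⟩
  refine ⟨y, hy ▸ Submodule.sum_mem _ fun i _ => Submodule.sum_mem _ fun k _ =>
    RankOneSystem.mem_span _ _, ?_⟩
  have hcut : ∀ g t, ‖((1 - χ (σ.q t) : ℝ) : ℂ) • (f.1 g).1 t‖ ≤
      (tsupport f.1).indicator (fun _ => ε / (3 * (m + 1))) g := fun g t => by
    by_cases hg : g ∈ tsupport f.1
    · rw [Set.indicator_of_mem hg, norm_smul, Complex.norm_real]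
      by_cases ht : t ∈ k
      · have h1 : χ (σ.q t) = 1 := hχ1 ⟨t, ht, rfl⟩
        rw [h1, sub_self, norm_zero, zero_mul]
        positivity
      · refine (mul_le_of_le_one_left (norm_nonneg _) ?_).trans (hkf g t ht)
        have := hχI (σ.q t)
        rw [Real.norm_eq_abs, abs_le]
        constructor <;> linarith [this.1, this.2]
    · rw [Set.indicator_of_notMem hg, image_eq_zero_of_notMem_tsupport hg]
      change ‖_ • (0 : Matrix (Fin 2) (Fin 2) ℂ)‖ ≤ 0
      rw [smul_zero, norm_zero]
  have hent : ∀ g t k l, ‖(((χ (σ.q t) : ℝ) : ℂ) • (f.1 g).1 t - (y.1 g).1 t) k l‖ ≤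
      Kg.indicator (fun _ => (|B| + 1) * ε') g := fun g t k l => by
    have he : (((χ (σ.q t) : ℝ) : ℂ) • (f.1 g).1 t - (y.1 g).1 t) k l =
        -(((modularΔ g ^ (-1 / 2 : ℝ) : ℝ) : ℂ) * ((χ (σ.q t) : ℂ) *
          (∑ i, σ.average k (fun s => (φ i s : ℂ)) t * σ.kernel f k l (p i) (t * g) -
            σ.kernel f k l t (t * g)))) := by
      rw [Matrix.sub_apply, Matrix.smul_apply, smul_eq_mul, hy, sum_rankConv_apply,
        entry_eq_kernel]
      ring
    rw [he, norm_neg, norm_mul, norm_mul, Complex.norm_real, Complex.norm_real]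
    by_cases ht : t ∈ S
    · by_cases hg : g ∈ Kg
      · rw [Set.indicator_of_mem hg]
        have h1 := σ.norm_sum_average_sub_kernel_le f hSι hφ0 hφ1 hφ ht (t * g) k l
        have h2 : ‖χ (σ.q t)‖ ≤ 1 := by
          have := hχI (σ.q t)
          rw [Real.norm_eq_abs, abs_le]
          constructor <;> linarith [this.1, this.2]
        refine mul_le_mul ((hB g hg).trans ((le_abs_self B).trans (by linarith)))
          ((mul_le_of_le_one_left (norm_nonneg _) h2).trans h1) (by positivity) hB0.le
      · have h0 : ∀ s ∈ S, σ.kernel f k l s (t * g) = 0 := fun s hs =>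
          σ.kernel_eq_zero f k l fun h => hg (hKg ▸ ⟨(t, s, s⁻¹ * (t * g)), ⟨ht, hs, h⟩, by
            simp only; group⟩)
        rw [h0 t ht, Finset.sum_eq_zero fun i _ => by rw [h0 _ (hp i), mul_zero]]
        simp [hg]
    · have h0 : χ (σ.q t) = 0 := image_eq_zero_of_notMem_tsupport fun h => ht (hSdef ▸ h)
      rw [h0, norm_zero, zero_mul, mul_zero]
      exact Set.indicator_nonneg (fun _ _ => by positivity) g
  have hpt : ∀ g, ‖(f - y).1 g‖ ≤ (tsupport f.1).indicator (fun _ => ε / (3 * (m + 1))) g +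
      C * Kg.indicator (fun _ => (|B| + 1) * ε') g := fun g => by
    have hi1 : 0 ≤ (tsupport f.1).indicator (fun _ => ε / (3 * (m + 1))) g :=
      Set.indicator_nonneg (fun _ _ => by positivity) g
    have hi2 : 0 ≤ Kg.indicator (fun _ => (|B| + 1) * ε') g :=
      Set.indicator_nonneg (fun _ _ => by positivity) g
    refine norm_le_C0 (F := ((f - y).1 g).1) (by positivity) fun t => ?_
    -- The first summand is the cutoff error, the second the error of the kernel approximation.
    have hsplit : ((f - y).1 g).1 t = ((1 - χ (σ.q t) : ℝ) : ℂ) • (f.1 g).1 t +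
        (((χ (σ.q t) : ℝ) : ℂ) • (f.1 g).1 t - (y.1 g).1 t) := by
      have : ((f - y).1 g).1 t = (f.1 g).1 t - (y.1 g).1 t := rfl
      rw [this, Complex.ofReal_sub, Complex.ofReal_one, sub_smul, one_smul]
      abel
    rw [hsplit]
    exact (norm_add_le _ _).trans (add_le_add (hcut g t) (hCM _ _ hi2 (hent g t)))
  have hint1 : Integrable ((tsupport f.1).indicator fun _ => ε / (3 * (m + 1))) μ :=
    (integrable_indicator_iff (isClosed_tsupport _).measurableSet).2
      (integrableOn_const (f.1.hasCompactSupport.isCompact.measure_lt_top.ne))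
  have hint2 : Integrable (fun g => C * Kg.indicator (fun _ => (|B| + 1) * ε') g) μ :=
    ((integrable_indicator_iff hKgc.measurableSet).2
      (integrableOn_const hKgc.measure_lt_top.ne)).const_mul C
  calc σ.linkingTwisted.l1Norm μ (f - y) = ∫ g, ‖(f - y).1 g‖ ∂μ := rfl
    _ ≤ ∫ g, (tsupport f.1).indicator (fun _ => ε / (3 * (m + 1))) g +
        C * Kg.indicator (fun _ => (|B| + 1) * ε') g ∂μ :=
      integral_mono (Conv.integrable_norm _) (hint1.add hint2) hpt
    _ = m * (ε / (3 * (m + 1))) + C * (m' * ((|B| + 1) * ε')) := by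
      rw [integral_add hint1 hint2, integral_const_mul,
        integral_indicator_const _ (isClosed_tsupport _).measurableSet,
        integral_indicator_const _ hKgc.measurableSet, smul_eq_mul, smul_eq_mul, ← hm, ← hm']
    _ ≤ ε / 3 + ε / 3 := by
      refine add_le_add ?_ ?_
      · have : m * (ε / (3 * (m + 1))) = ε / 3 * (m / (m + 1)) := by field_simp
        rw [this]
        exact mul_le_of_le_one_right (by positivity) ((div_le_one (by positivity)).2 (by linarith))
      · have : C * (m' * ((|B| + 1) * ε')) = ε / 3 * (m' / (m' + 1)) := by
          rw [hε']; field_simp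
        rw [this]
        exact mul_le_of_le_one_right (by positivity) ((div_le_one (by positivity)).2 (by linarith))
    _ < ε := by linarith

variable (μ) [μ.Regular]

/-- This is where the full crossed product is seen to be represented faithfully: the rank one
relations and `L¹`-density together pin down the universal norm. -/
theorem envSeminorm_linking (f : σ.linkingTwisted.twistedConv μ) :
    envSeminorm (σ.linkingTwisted.l1Norm μ) f = ‖σ.linkingHom μ f‖ :=
  (σ.rankOneSystem μ).envSeminorm_eq (σ.norm_linkingHom_le μ)
    (fun f _ hε => σ.dense_span_rankConv f hε) f

end Twist

/-! ## Corners of the convolution algebra of the linking algebra -/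

namespace Twist

variable {G Gσ : Type*}
  [TopologicalSpace G] [Group G] [IsTopologicalGroup G] [LocallyCompactSpace G] [T2Space G]
  [TopologicalSpace Gσ] [Group Gσ] [IsTopologicalGroup Gσ] [LocallyCompactSpace Gσ] [T2Space Gσ]
  (σ : Twist G Gσ)

theorem single_mul_mul_single (k l : Fin 2) (M : Matrix (Fin 2) (Fin 2) ℂ) :
    Matrix.single k k (1 : ℂ) * M * Matrix.single l l (1 : ℂ) = Matrix.single k l (M k l) := by
  rw [Matrix.single_mul_mul_single, one_mul, mul_one]

/-- The bounded linear map of the linking algebra that keeps only one matrix entry. -/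
def compressLinking (k l : Fin 2) : σ.linking →L[ℂ] σ.linking :=
  LinearMap.mkContinuous
    { toFun := fun F => ⟨⟨⟨fun s => Matrix.single k k (1 : ℂ) * F.1 s * Matrix.single l l (1 : ℂ),
          by fun_prop⟩, by
          simpa using ((zero_at_infty F.1).const_mul (Matrix.single k k (1 : ℂ))).mul_const
            (Matrix.single l l (1 : ℂ))⟩, fun s z => by
        change Matrix.single k k (1 : ℂ) * F.1 (s * σ.ι z) * Matrix.single l l (1 : ℂ) =
          diagMat z * (Matrix.single k k (1 : ℂ) * F.1 s * Matrix.single l l (1 : ℂ)) *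
            star (diagMat z)
        rw [F.2 s z, single_mul_mul_single, single_mul_mul_single, single_conj]
        congr 1
        rw [star_diagMat, diagMat, diagMat, Matrix.mul_diagonal, Matrix.diagonal_mul]⟩
      map_add' := fun F F' => by
        apply Subtype.ext; ext1 s
        change Matrix.single k k (1 : ℂ) * (F.1 s + F'.1 s) * Matrix.single l l (1 : ℂ) =
          Matrix.single k k (1 : ℂ) * F.1 s * Matrix.single l l (1 : ℂ) +
          Matrix.single k k (1 : ℂ) * F'.1 s * Matrix.single l l (1 : ℂ)
        rw [mul_add, add_mul]
      map_smul' := fun c F => by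
        apply Subtype.ext; ext1 s
        change Matrix.single k k (1 : ℂ) * (c • F.1 s) * Matrix.single l l (1 : ℂ) =
          c • (Matrix.single k k (1 : ℂ) * F.1 s * Matrix.single l l (1 : ℂ))
        rw [mul_smul_comm, smul_mul_assoc] }
    (‖(Matrix.single k k 1 : Matrix (Fin 2) (Fin 2) ℂ)‖ *
      ‖(Matrix.single l l 1 : Matrix (Fin 2) (Fin 2) ℂ)‖)
    fun F => norm_le_C0 (by positivity) fun s => (norm_mul_le _ _).trans (by
      rw [mul_right_comm]
      exact mul_le_mul_of_nonneg_right ((norm_mul_le _ _).trans (mul_le_mul_of_nonneg_left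
        (norm_apply_le_C0 F.1 s) (norm_nonneg _))) (norm_nonneg _))

theorem compressLinking_apply (k l : Fin 2) (F : σ.linking) (s : Gσ) :
    (σ.compressLinking k l F).1 s = Matrix.single k l (F.1 s k l) :=
  single_mul_mul_single k l (F.1 s)

variable [MeasurableSpace Gσ] [BorelSpace Gσ] {μ : Measure Gσ} [IsHaarMeasure μ]

/-- The map of the convolution algebra of the linking algebra that keeps only one matrix entry. -/
def compressConv (k l : Fin 2) :
    σ.linkingTwisted.twistedConv μ →ₗ[ℂ] σ.linkingTwisted.twistedConv μ where
  toFun f := ⟨Conv.mk (fun s => σ.compressLinking k l (f.1 s))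
    ((σ.compressLinking k l).continuous.comp f.1.continuous)
    (f.1.hasCompactSupport.comp_left (map_zero (σ.compressLinking k l))), fun z s => by
      have h : f.1 (σ.ι z * s) = (σ.diagMul z⁻¹).snd (f.1 s) := f.2 z s
      change σ.compressLinking k l (f.1 (σ.ι z * s)) =
        (σ.diagMul z⁻¹).snd (σ.compressLinking k l (f.1 s))
      refine σ.linking_ext fun t => ?_
      rw [h, diagMul_snd, compressLinking_apply, compressLinking_apply, diagMul_snd,
        single_mul_diagMat, diagMat, Matrix.mul_diagonal]⟩
  map_add' f g := Subtype.ext (Conv.ext fun s => map_add (σ.compressLinking k l) (f.1 s) (g.1 s))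
  map_smul' c f := Subtype.ext (Conv.ext fun s => map_smul (σ.compressLinking k l) c (f.1 s))

theorem compressConv_apply (k l : Fin 2) (f : σ.linkingTwisted.twistedConv μ) (s t : Gσ) :
    ((σ.compressConv k l f).1 s).1 t = Matrix.single k l ((f.1 s).1 t k l) :=
  σ.compressLinking_apply k l (f.1 s) t

theorem l1Norm_compressConv_le (k l : Fin 2) (f : σ.linkingTwisted.twistedConv μ) :
    σ.linkingTwisted.l1Norm μ (σ.compressConv k l f) ≤
      ‖σ.compressLinking k l‖ * σ.linkingTwisted.l1Norm μ f := by
  rw [TwistedAction.l1Norm_apply, TwistedAction.l1Norm_apply, Conv.l1Norm_apply,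
    Conv.l1Norm_apply, ← integral_const_mul]
  exact integral_mono (Conv.integrable_norm _) ((Conv.integrable_norm _).const_mul _)
    fun s => (σ.compressLinking k l).le_opNorm (f.1 s)

/-- The projection of equivariant pairs onto one component. -/
def compPair (k : Fin 2) (ξ : σ.equivPair) : σ.equivPair :=
  ⟨fun k' => if k' = k then ξ.1 k' else 0, fun k' s z => by
    dsimp only
    split_ifs with h
    · exact ξ.2 k' s z
    · simp⟩

theorem compPair_apply (k k' : Fin 2) (ξ : σ.equivPair) :
    (σ.compPair k ξ).1 k' = if k' = k then ξ.1 k' else 0 := rfl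

/-- Keeping one matrix entry amounts to keeping one component of each vector, so compression
preserves the class of rank one elements and density passes to corners. -/
theorem compressConv_rankConv (k l : Fin 2) (ξ η : σ.equivPair) :
    σ.compressConv k l (σ.rankConv μ ξ η) = σ.rankConv μ (σ.compPair k ξ) (σ.compPair l η) := by
  refine σ.twistedConv_ext μ fun s t i j => ?_
  rw [compressConv_apply, rankConv_apply, Matrix.single_apply, rankConv_apply, compPair_apply,
    compPair_apply]
  by_cases h1 : i = k
  · by_cases h2 : j = l
    · rw [if_pos ⟨h1.symm, h2.symm⟩, if_pos h1, if_pos h2, h1, h2]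
    · rw [if_neg fun h => h2 h.2.symm, if_neg h2]; simp
  · rw [if_neg fun h => h1 h.1.symm, if_neg h1]; simp

/-- The rank one elements in the corner `(k, l)`. -/
def cornerConv (μ : Measure Gσ) [IsHaarMeasure μ] (k l : Fin 2) (ξ η : σ.equivPair) :
    σ.linkingTwisted.twistedConv μ := σ.rankConv μ (σ.compPair k ξ) (σ.compPair l η)

theorem compressConv_cornerConv (k l : Fin 2) (ξ η : σ.equivPair) :
    σ.compressConv k l (σ.cornerConv μ k l ξ η) = σ.cornerConv μ k l ξ η := by
  rw [cornerConv, compressConv_rankConv]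
  congr 1 <;>
  · refine Subtype.ext (funext fun i => ?_)
    simp only [compPair_apply]
    split_ifs <;> rfl

theorem dense_span_cornerConv {k l : Fin 2} {f : σ.linkingTwisted.twistedConv μ}
    (hf : σ.compressConv k l f = f) {ε : ℝ} (hε : 0 < ε) :
    ∃ y ∈ RankOneSystem.span (σ.cornerConv μ k l), σ.linkingTwisted.l1Norm μ (f - y) < ε := by
  obtain ⟨y, hy, hlt⟩ := σ.dense_span_rankConv f
    (ε := ε / (‖σ.compressLinking k l‖ + 1)) (by positivity)
  refine ⟨σ.compressConv k l y, ?_, ?_⟩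
  · refine RankOneSystem.span_induction
      (P := fun y => σ.compressConv k l y ∈ RankOneSystem.span (σ.cornerConv μ k l))
      (fun ξ η => ?_) ?_ (fun x y hx hy => ?_) (fun c x hx => ?_) hy
    · rw [compressConv_rankConv]; exact RankOneSystem.mem_span (e := σ.cornerConv μ k l) ξ η
    · rw [map_zero]; exact zero_mem _
    · rw [map_add]; exact add_mem hx hy
    · rw [map_smul]; exact Submodule.smul_mem _ _ hx
  · rw [← hf, ← map_sub]
    refine (σ.l1Norm_compressConv_le k l _).trans_lt ?_
    rw [lt_div_iff₀ (by positivity)] at hlt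
    have h0 : 0 ≤ σ.linkingTwisted.l1Norm μ (f - y) := apply_nonneg _ _
    linarith [hlt]

variable [μ.Regular]

/-- A priori the universal norm of a corner could exceed the norm it inherits from `L ⋊ G`, because
a C*-seminorm of the corner need not extend. The rank one elements of the corner, pulled back along
`φ`, form a rank one system with dense span, which determines the universal norm of `𝒜`
independently. -/
theorem corner_envSeminorm_eq {𝒜 : Type*} [NonUnitalRing 𝒜] [StarRing 𝒜] [Module ℂ 𝒜]
    [StarModule ℂ 𝒜] [IsScalarTower ℂ 𝒜 𝒜] [SMulCommClass ℂ 𝒜 𝒜] {N : Seminorm ℂ 𝒜} (i : Fin 2)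
    (φ : 𝒜 →⋆ₙₐ[ℂ] σ.linkingTwisted.twistedConv μ) (hinj : Function.Injective φ)
    (hN : ∀ x, σ.linkingTwisted.l1Norm μ (φ x) = N x)
    (hφ : ∀ x, σ.compressConv i i (φ x) = φ x)
    (hsurj : ∀ f, σ.compressConv i i f = f → ∃ x, φ x = f) (x : 𝒜) :
    envSeminorm N x = ‖σ.linkingHom μ (φ x)‖ := by
  choose e he using fun ξ η => hsurj _ (σ.compressConv_cornerConv (μ := μ) i i ξ η)
  have hsys : RankOneSystem ((σ.linkingHom μ).comp φ)
      (fun ξ : σ.equivPair => pairL2 μ (σ.compPair i ξ).1) e :=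
    { star_eq := fun ξ η => hinj (by
        exact (map_star φ (e ξ η)).trans ((congrArg star (he ξ η)).trans
          ((σ.star_rankConv μ _ _).trans (he η ξ).symm)))
      mul_eq := fun ξ η ξ' η' => hinj (by
        refine (map_mul φ (e ξ η) (e ξ' η')).trans (Eq.trans ?_ (map_smul φ _ (e ξ η')).symm)
        rw [he, he, he]
        exact σ.rankConv_mul μ _ _ _ _)
      map_eq := fun ξ η => by
        rw [NonUnitalStarAlgHom.comp_apply, he]; exact σ.linkingHom_rankConv μ _ _ }
  refine hsys.envSeminorm_eq (fun x => ?_) (fun x ε hε => ?_) x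
  · rw [← hN]; exact σ.norm_linkingHom_le μ _
  · obtain ⟨y, hy, hlt⟩ := σ.dense_span_cornerConv (hφ x) hε
    have : ∃ z ∈ RankOneSystem.span e, φ z = y := by
      refine RankOneSystem.span_induction (P := fun y => ∃ z ∈ RankOneSystem.span e, φ z = y)
        (fun ξ η => ⟨e ξ η, RankOneSystem.mem_span ξ η, he ξ η⟩) ⟨0, zero_mem _, map_zero φ⟩ ?_ ?_ hy
      · rintro _ _ ⟨z, hz, rfl⟩ ⟨w, hw, rfl⟩
        exact ⟨z + w, add_mem hz hw, map_add φ z w⟩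
      · rintro c _ ⟨z, hz, rfl⟩
        exact ⟨c • z, Submodule.smul_mem _ c hz, map_smul φ c z⟩
    obtain ⟨z, hz, rfl⟩ := this
    refine ⟨z, hz, ?_⟩
    have hsub : φ (x - z) = φ x - φ z := map_sub φ x z
    exact ((hN (x - z)).symm.trans (congrArg (σ.linkingTwisted.l1Norm μ) hsub)).trans_lt hlt

end Twist

/-! ## Functions on the quotient -/

namespace Twist

variable {G Gσ : Type*}
  [TopologicalSpace G] [Group G] [IsTopologicalGroup G] [LocallyCompactSpace G] [T2Space G]
  [TopologicalSpace Gσ] [Group Gσ] [IsTopologicalGroup Gσ] [LocallyCompactSpace Gσ] [T2Space Gσ]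
  (σ : Twist G Gσ)

theorem exists_mul_ι_eq {s t : Gσ} (h : σ.q s = σ.q t) : ∃ z, t = s * σ.ι z := by
  have h2 : s⁻¹ * t ∈ σ.q.ker := by
    rw [MonoidHom.mem_ker, map_mul, map_inv, h, inv_mul_cancel]
  rw [σ.ker_q] at h2
  obtain ⟨z, hz⟩ := h2
  exact ⟨z, by rw [hz, mul_inv_cancel_left]⟩

/-- The fibres of `q` are the `𝕋`-cosets, and `q` is a quotient map, so continuity may be checked
after composing with `q`. -/
theorem exists_descend {E : Type*} [TopologicalSpace E] {F : Gσ → E} (hF : Continuous F)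
    (h : ∀ s z, F (s * σ.ι z) = F s) : ∃ a : G → E, Continuous a ∧ ∀ s, a (σ.q s) = F s := by
  have hs := Function.surjInv_eq σ.isOpenQuotientMap_q.surjective
  have key : ∀ s, F (Function.surjInv σ.isOpenQuotientMap_q.surjective (σ.q s)) = F s := fun s => by
    obtain ⟨z, hz⟩ := σ.exists_mul_ι_eq (hs (σ.q s))
    conv_rhs => rw [hz]
    rw [h]
  refine ⟨fun g => F (Function.surjInv σ.isOpenQuotientMap_q.surjective g), ?_, key⟩
  refine σ.isOpenQuotientMap_q.isQuotientMap.continuous_iff.2 (hF.congr fun s => ?_)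
  exact (key s).symm

theorem hasCompactSupport_of_comp_q {E : Type*} [Zero E] {a : G → E} {F : Gσ → E}
    (h : ∀ s, a (σ.q s) = F s) (hF : HasCompactSupport F) : HasCompactSupport a :=
  HasCompactSupport.intro (hF.isCompact.image σ.continuous_q) fun g hg => by
    obtain ⟨s, rfl⟩ := σ.isOpenQuotientMap_q.surjective g
    rw [h]
    exact image_eq_zero_of_notMem_tsupport fun hs => hg ⟨s, hs, rfl⟩

theorem exists_pull_eq (F : C₀(Gσ, ℂ)) (h : ∀ s z, F (s * σ.ι z) = F s) :
    ∃ a : C₀(G, ℂ), σ.pull a = F := by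
  obtain ⟨a, ha, hF⟩ := σ.exists_descend F.continuous h
  refine ⟨⟨⟨a, ha⟩, fun U hU => ?_⟩, DFunLike.ext _ _ hF⟩
  obtain ⟨k, hk, hkU⟩ := mem_cocompact.1 (zero_at_infty F hU)
  refine mem_cocompact.2 ⟨_, hk.image σ.continuous_q, fun g hg => ?_⟩
  obtain ⟨s, rfl⟩ := σ.isOpenQuotientMap_q.surjective g
  change a (σ.q s) ∈ U
  rw [hF]
  exact hkU fun hs => hg ⟨s, hs, rfl⟩

/-- Surjectivity of `q` preserves suprema. Being an embedding, `pull` reflects continuity of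
functions with values in `C₀(G)`. -/
theorem isometry_pull : Isometry σ.pull := by
  refine Isometry.of_dist_eq fun a b => ?_
  rw [← ZeroAtInftyContinuousMap.dist_toBCF_eq_dist, ← ZeroAtInftyContinuousMap.dist_toBCF_eq_dist]
  apply le_antisymm
  · exact (BoundedContinuousFunction.dist_le dist_nonneg).2 fun s =>
      BoundedContinuousFunction.dist_coe_le_dist (f := a.toBCF) (g := b.toBCF) (σ.q s)
  · refine (BoundedContinuousFunction.dist_le dist_nonneg).2 fun g => ?_
    obtain ⟨s, rfl⟩ := σ.isOpenQuotientMap_q.surjective g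
    exact BoundedContinuousFunction.dist_coe_le_dist (f := (σ.pull a).toBCF)
      (g := (σ.pull b).toBCF) s

theorem continuous_entry (k l : Fin 2) :
    Continuous (entry k l : C₀(Gσ, Matrix (Fin 2) (Fin 2) ℂ) → C₀(Gσ, ℂ)) := by
  let T : Matrix (Fin 2) (Fin 2) ℂ →L[ℂ] ℂ := LinearMap.toContinuousLinearMap
    (Matrix.entryLinearMap ℂ ℂ k l)
  let L : C₀(Gσ, Matrix (Fin 2) (Fin 2) ℂ) →ₗ[ℂ] C₀(Gσ, ℂ) :=
    { toFun := entry k l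
      map_add' := fun _ _ => rfl
      map_smul' := fun _ _ => rfl }
  exact AddMonoidHomClass.continuous_of_bound L ‖T‖ fun F =>
    norm_le_C0 (by positivity) fun s => (T.le_opNorm (F s)).trans
      (mul_le_mul_of_nonneg_left (norm_apply_le_C0 F s) (norm_nonneg _))

variable [MeasurableSpace Gσ] [BorelSpace Gσ] {μ : Measure Gσ} [IsHaarMeasure μ]

theorem entry_invariant (F : σ.linking) (k : Fin 2) (s : Gσ) (z : Circle) :
    entry k k F.1 (s * σ.ι z) = entry k k F.1 s := by
  rw [entry_apply, entry_apply, linking_mul_ι]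
  linear_combination (F.1 s k k) * star_char_mul k z

variable [MeasurableSpace G] [BorelSpace G]

theorem exists_jBConv_eq (f : σ.linkingTwisted.twistedConv μ) (hf : σ.compressConv 1 1 f = f) :
    ∃ b, σ.jBConv μ b = f := by
  choose b hb using fun s => σ.exists_pull_eq (entry 1 1 (f.1 s).1) (σ.entry_invariant (f.1 s) 1)
  have hbc : Continuous b := σ.isometry_pull.isEmbedding.continuous_iff.2
    (((continuous_entry 1 1).comp (continuous_subtype_val.comp f.1.continuous)).congr
      fun s => (hb s).symm)
  have hb0 : HasCompactSupport b := HasCompactSupport.intro f.1.hasCompactSupport fun s hs => by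
    refine σ.isometry_pull.injective ?_
    rw [hb, image_eq_zero_of_notMem_tsupport hs]
    rfl
  refine ⟨⟨Conv.mk b hbc hb0, fun z s => ?_⟩, ?_⟩
  · rw [rtTwisted_τ_snd]
    refine σ.isometry_pull.injective (DFunLike.ext _ _ fun t => ?_)
    change σ.pull (b (σ.ι z * s)) t = (z⁻¹ : Circle) * σ.pull (b s) t
    rw [hb, hb, entry_apply, entry_apply, twistedConv_ι_mul, mul_comm, Circle.coe_inv_eq_conj]
    rfl
  · refine Eq.trans (Subtype.ext (Conv.ext fun s => σ.linking_ext fun t => ?_)) hf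
    exact (congrArg (Matrix.single 1 1) (DFunLike.congr_fun (hb s) t)).trans
      (σ.compressConv_apply 1 1 f s t).symm

theorem exists_jXConv_eq (f : σ.linkingTwisted.twistedConv μ) (hf : σ.compressConv 0 1 f = f) :
    ∃ x, σ.jXConv μ x = f := by
  have hmem : ∀ F : σ.linking, entry 0 1 F.1 ∈ σ.C0iota := fun F s z => by
    rw [entry_apply, entry_apply, linking_mul_ι]
    simp [mul_comm]
  refine ⟨⟨fun s => ⟨entry 0 1 (f.1 s).1, hmem (f.1 s)⟩,
    ((continuous_entry 0 1).comp (continuous_subtype_val.comp f.1.continuous)).subtype_mk _,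
    HasCompactSupport.intro f.1.hasCompactSupport fun s hs => ?_, fun z s => ?_⟩, ?_⟩
  · refine Subtype.ext ?_
    rw [image_eq_zero_of_notMem_tsupport hs]
    rfl
  · refine Subtype.ext (DFunLike.ext _ _ fun t => ?_)
    change (f.1 (σ.ι z * s)).1 t 0 1 = star (z : ℂ) * (f.1 s).1 t 0 1
    exact (σ.twistedConv_ι_mul μ f s t z 0 1).trans (mul_comm _ _)
  · refine Eq.trans (Subtype.ext (Conv.ext fun s => σ.linking_ext fun t => ?_)) hf
    exact (σ.offCorner_apply _ t).trans (σ.compressConv_apply 0 1 f s t).symm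

variable {ν : Measure G} [IsHaarMeasure ν]

/-- In the upper left entry both characters are trivial. Hence `f(g)(t)` is invariant under `𝕋` in
`t` and in `g`, and descends in both variables; in the lower right entry only the variable `t`
descends. -/
theorem exists_jAConv_eq (hq : MeasurePreserving σ.q μ ν) (f : σ.linkingTwisted.twistedConv μ)
    (hf : σ.compressConv 0 0 f = f) : ∃ a, σ.jAConv μ ν hq a = f := by
  choose b hb using fun s => σ.exists_pull_eq (entry 0 0 (f.1 s).1) (σ.entry_invariant (f.1 s) 0)
  have hbc : Continuous b := σ.isometry_pull.isEmbedding.continuous_iff.2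
    (((continuous_entry 0 0).comp (continuous_subtype_val.comp f.1.continuous)).congr
      fun s => (hb s).symm)
  have hb0 : HasCompactSupport b := HasCompactSupport.intro f.1.hasCompactSupport fun s hs => by
    refine σ.isometry_pull.injective ?_
    rw [hb, image_eq_zero_of_notMem_tsupport hs]
    rfl
  obtain ⟨a, ha, hab⟩ := σ.exists_descend hbc fun s z => by
    refine σ.isometry_pull.injective (DFunLike.ext _ _ fun t => ?_)
    rw [hb, hb, entry_apply, entry_apply, ← σ.central, twistedConv_ι_mul]
    simp
  refine ⟨Conv.mk a ha (σ.hasCompactSupport_of_comp_q hab hb0), ?_⟩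
  refine Eq.trans (Subtype.ext (Conv.ext fun s => σ.linking_ext fun t => ?_)) hf
  refine Eq.trans ?_ ((congrArg (Matrix.single 0 0) (DFunLike.congr_fun (hb s) t)).trans
    (σ.compressConv_apply 0 0 f s t).symm)
  change Matrix.single 0 0 (a (σ.q s) (σ.q t)) = _
  rw [hab]
  rfl

theorem corner_injective (i : Fin 2) : Function.Injective (σ.corner i) := fun a b h => by
  ext g
  obtain ⟨s, rfl⟩ := σ.isOpenQuotientMap_q.surjective g
  have h1 : (σ.corner i a).1 s i i = (σ.corner i b).1 s i i := by rw [h]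
  simpa [corner_apply] using h1

theorem norm_corner (i : Fin 2) (a : C₀(G, ℂ)) : ‖σ.corner i a‖ = ‖a‖ :=
  NonUnitalStarAlgHom.norm_map (σ.corner i) (σ.corner_injective i) a

theorem jAConv_apply (hq : MeasurePreserving σ.q μ ν) (a : Conv (rtAction G ℂ) ν) (s : Gσ) :
    (σ.jAConv μ ν hq a).1 s = σ.corner 0 (a (σ.q s)) := rfl

theorem jBConv_apply (b : σ.rtTwisted.twistedConv μ) (s : Gσ) :
    (σ.jBConv μ b).1 s = σ.corner 1 (b.1 s) := rfl

theorem jXConv_apply (x : σ.ccIota) (s : Gσ) :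
    (σ.jXConv μ x).1 s = σ.offCorner (x.1 s) := rfl

theorem jAConv_injective (hq : MeasurePreserving σ.q μ ν) :
    Function.Injective (σ.jAConv μ ν hq) := fun a b h => by
  refine Conv.ext fun g => ?_
  obtain ⟨s, rfl⟩ := σ.isOpenQuotientMap_q.surjective g
  exact σ.corner_injective 0 (congrArg (fun f : σ.linkingTwisted.twistedConv μ => f.1 s) h)

theorem jBConv_injective : Function.Injective (σ.jBConv μ) := fun a b h => by
  refine Subtype.ext (Conv.ext fun s => ?_)
  exact σ.corner_injective 1 (congrArg (fun f : σ.linkingTwisted.twistedConv μ => f.1 s) h)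

theorem compressConv_eq_self {k l : Fin 2} {f : σ.linkingTwisted.twistedConv μ} {c : Gσ → Gσ → ℂ}
    (h : ∀ s t, (f.1 s).1 t = Matrix.single k l (c s t)) : σ.compressConv k l f = f := by
  refine Subtype.ext (Conv.ext fun s => σ.linking_ext fun t => ?_)
  rw [compressConv_apply, h, Matrix.single_apply_same]

theorem l1Norm_jAConv (hq : MeasurePreserving σ.q μ ν) (a : Conv (rtAction G ℂ) ν) :
    σ.linkingTwisted.l1Norm μ (σ.jAConv μ ν hq a) = Conv.l1Norm (rtAction G ℂ) ν a := by
  have h := integral_map (μ := μ) (φ := σ.q) hq.measurable.aemeasurable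
    (f := fun t => ‖a t‖) a.continuous.norm.aestronglyMeasurable
  rw [hq.map_eq] at h
  rw [TwistedAction.l1Norm_apply, Conv.l1Norm_apply, Conv.l1Norm_apply, h]
  simp only [jAConv_apply, norm_corner]

theorem l1Norm_jBConv (b : σ.rtTwisted.twistedConv μ) :
    σ.linkingTwisted.l1Norm μ (σ.jBConv μ b) = σ.rtTwisted.l1Norm μ b := by
  rw [TwistedAction.l1Norm_apply, TwistedAction.l1Norm_apply, Conv.l1Norm_apply, Conv.l1Norm_apply]
  simp only [jBConv_apply, norm_corner]

variable [μ.Regular]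

theorem envSeminorm_A (hq : MeasurePreserving σ.q μ ν) (a : Conv (rtAction G ℂ) ν) :
    envSeminorm (Conv.l1Norm (rtAction G ℂ) ν) a = ‖σ.linkingHom μ (σ.jAConv μ ν hq a)‖ :=
  σ.corner_envSeminorm_eq 0 (σ.jAConv μ ν hq) (σ.jAConv_injective hq) (σ.l1Norm_jAConv hq)
    (fun _ => σ.compressConv_eq_self fun _ _ => rfl) (σ.exists_jAConv_eq hq) a

theorem envSeminorm_B (b : σ.rtTwisted.twistedConv μ) :
    envSeminorm (σ.rtTwisted.l1Norm μ) b = ‖σ.linkingHom μ (σ.jBConv μ b)‖ :=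
  σ.corner_envSeminorm_eq 1 (σ.jBConv μ) σ.jBConv_injective σ.l1Norm_jBConv
    (fun _ => σ.compressConv_eq_self fun _ _ => rfl) σ.exists_jBConv_eq b

theorem jA_of (hq : MeasurePreserving σ.q μ ν) (a : Conv (rtAction G ℂ) ν) :
    σ.jA μ ν hq (Env.of _ a) = Env.of _ (σ.jAConv μ ν hq a) := Env.map_of _ _ a

theorem jB_of (b : σ.rtTwisted.twistedConv μ) :
    σ.jB μ (Env.of _ b) = Env.of _ (σ.jBConv μ b) := Env.map_of _ _ b

/-- On the dense convolution algebra both universal norms equal the norm of the same operator on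
`L²(G_σ) ⊕ L²(G_σ)`. -/
theorem norm_jA (hq : MeasurePreserving σ.q μ ν) (a : CrossedProduct (rtAction G ℂ) ν) :
    ‖σ.jA μ ν hq a‖ = ‖a‖ :=
  isClosed_property Env.denseRange_of
    (isClosed_eq (Env.continuous_starHom (σ.jA μ ν hq)).norm continuous_norm)
    (fun x => by
      rw [jA_of, Env.norm_of, Env.norm_of, σ.envSeminorm_A hq, σ.envSeminorm_linking]) a

theorem norm_jB (b : σ.TwistedCP μ) : ‖σ.jB μ b‖ = ‖b‖ :=
  isClosed_property Env.denseRange_of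
    (isClosed_eq (Env.continuous_starHom (σ.jB μ)).norm continuous_norm)
    (fun x => by
      rw [jB_of, Env.norm_of, Env.norm_of, σ.envSeminorm_B, σ.envSeminorm_linking]) b

end Twist

/-! ## Corners of algebras of compact operators -/

section CornerBlocks

open InnerProductSpace

variable {K H H' Y : Type*} [NormedAddCommGroup K] [InnerProductSpace ℂ K] [CompleteSpace K]
  [NormedAddCommGroup H] [InnerProductSpace ℂ H] [CompleteSpace H]
  [NormedAddCommGroup H'] [InnerProductSpace ℂ H'] [CompleteSpace H']
  [NormedAddCommGroup Y] [NormedSpace ℂ Y]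

/-- The map `T ↦ I* T I'`. -/
def compression (I : H →L[ℂ] K) (I' : H' →L[ℂ] K) : (K →L[ℂ] K) →L[ℂ] (H' →L[ℂ] H) :=
  (ContinuousLinearMap.compL ℂ H' K H I.adjoint) ∘L (ContinuousLinearMap.compL ℂ H' K K).flip I'

theorem compression_apply (I : H →L[ℂ] K) (I' : H' →L[ℂ] K) (T : K →L[ℂ] K) :
    compression I I' T = I.adjoint ∘L T ∘L I' := rfl

/-- The map `T ↦ I T I'*`. -/
def expansion (I : H →L[ℂ] K) (I' : H' →L[ℂ] K) : (H' →L[ℂ] H) →L[ℂ] (K →L[ℂ] K) :=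
  (ContinuousLinearMap.compL ℂ K H K I) ∘L (ContinuousLinearMap.compL ℂ K H' H).flip I'.adjoint

theorem expansion_apply (I : H →L[ℂ] K) (I' : H' →L[ℂ] K) (T : H' →L[ℂ] H) :
    expansion I I' T = I ∘L T ∘L I'.adjoint := rfl

theorem expansion_rankOne (I : H →L[ℂ] K) (I' : H' →L[ℂ] K) (x : H) (y : H') :
    expansion I I' (rankOne ℂ x y) = rankOne ℂ (I x) (I' y) := by
  ext ζ
  simp [expansion_apply, ContinuousLinearMap.adjoint_inner_right]

theorem compression_expansion {I : H →L[ℂ] K} {I' : H' →L[ℂ] K} (hI : I.adjoint ∘L I = 1)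
    (hI' : I'.adjoint ∘L I' = 1) (T : H' →L[ℂ] H) : compression I I' (expansion I I' T) = T := by
  ext x
  have h1 : ∀ y, I.adjoint (I y) = y := fun y => DFunLike.congr_fun hI y
  have h2 : ∀ y, I'.adjoint (I' y) = y := fun y => DFunLike.congr_fun hI' y
  simp [compression_apply, expansion_apply, h1, h2]

theorem norm_compression_le {I : H →L[ℂ] K} {I' : H' →L[ℂ] K} (hI : ‖I‖ ≤ 1) (hI' : ‖I'‖ ≤ 1)
    (T : K →L[ℂ] K) : ‖compression I I' T‖ ≤ ‖T‖ := by
  rw [compression_apply]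
  calc ‖I.adjoint ∘L T ∘L I'‖ ≤ ‖I.adjoint‖ * (‖T‖ * ‖I'‖) :=
        (ContinuousLinearMap.opNorm_comp_le _ _).trans
          (mul_le_mul_of_nonneg_left (ContinuousLinearMap.opNorm_comp_le _ _) (norm_nonneg _))
    _ ≤ 1 * (‖T‖ * 1) := by
        rw [LinearIsometryEquiv.norm_map]
        gcongr
    _ = ‖T‖ := by ring

theorem norm_expansion_le {I : H →L[ℂ] K} {I' : H' →L[ℂ] K} (hI : ‖I‖ ≤ 1) (hI' : ‖I'‖ ≤ 1)
    (T : H' →L[ℂ] H) : ‖expansion I I' T‖ ≤ ‖T‖ := by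
  rw [expansion_apply]
  calc ‖I ∘L T ∘L I'.adjoint‖ ≤ ‖I‖ * (‖T‖ * ‖I'.adjoint‖) :=
        (ContinuousLinearMap.opNorm_comp_le _ _).trans
          (mul_le_mul_of_nonneg_left (ContinuousLinearMap.opNorm_comp_le _ _) (norm_nonneg _))
    _ ≤ 1 * (‖T‖ * 1) := by
        rw [LinearIsometryEquiv.norm_map]
        gcongr
    _ = ‖T‖ := by ring

theorem norm_le_one_of_adjoint_comp {I : H →L[ℂ] K} (hI : I.adjoint ∘L I = 1) : ‖I‖ ≤ 1 :=
  ContinuousLinearMap.opNorm_le_bound _ zero_le_one fun x => by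
    rw [one_mul, (ContinuousLinearMap.norm_map_iff_adjoint_comp_self I).2 hI x]

/-- A space `Y` with a norm preserving map `Φ` into the operators on `K` which is generated by the
rank one operators of total families of vectors in the range of isometries `I` and `I'`. -/
structure IsCompactCorner (Φ : Y →ₗ[ℂ] (K →L[ℂ] K)) (I : H →L[ℂ] K) (I' : H' →L[ℂ] K) (D : Set H)
    (D' : Set H') (S : Set Y) : Prop where
  norm_eq : ∀ y, ‖Φ y‖ = ‖y‖
  isometry : I.adjoint ∘L I = 1
  isometry' : I'.adjoint ∘L I' = 1
  dense : Dense (Submodule.span ℂ D : Set H)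
  dense' : Dense (Submodule.span ℂ D' : Set H')
  dense_span : Dense (Submodule.span ℂ S : Set Y)
  map_eq : ∀ y ∈ S, ∃ x x', Φ y = rankOne ℂ (I x) (I' x')
  exists_eq : ∀ x ∈ D, ∀ x' ∈ D', ∃ y, Φ y = rankOne ℂ (I x) (I' x')

namespace IsCompactCorner

variable {Φ : Y →ₗ[ℂ] (K →L[ℂ] K)} {I : H →L[ℂ] K} {I' : H' →L[ℂ] K} {D : Set H}
    {D' : Set H'} {S : Set Y} (h : IsCompactCorner Φ I I' D D' S)
include h

theorem continuous : Continuous Φ :=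
  AddMonoidHomClass.continuous_of_bound Φ 1 fun y => by rw [one_mul, h.norm_eq]

/-- Rank one operators between the ranges of `I` and `I'` are unchanged by compressing and
expanding; continuity extends this from the generators. -/
theorem eq_expansion (y : Y) : Φ y = expansion I I' (compression I I' (Φ y)) := by
  let F : Y →L[ℂ] (K →L[ℂ] K) := ⟨Φ, h.continuous⟩
  have hF : F = expansion I I' ∘L compression I I' ∘L F := by
    refine ContinuousLinearMap.ext_on h.dense_span fun y hy => ?_
    obtain ⟨x, x', hx⟩ := h.map_eq y hy
    change Φ y = expansion I I' (compression I I' (Φ y))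
    rw [hx, ← expansion_rankOne, compression_expansion h.isometry h.isometry']
  exact DFunLike.congr_fun hF y

theorem norm_compression (y : Y) : ‖compression I I' (Φ y)‖ = ‖y‖ := by
  have h1 := norm_le_one_of_adjoint_comp h.isometry
  have h2 := norm_le_one_of_adjoint_comp h.isometry'
  apply le_antisymm
  · rw [← h.norm_eq]; exact norm_compression_le h1 h2 _
  · rw [← h.norm_eq]
    conv_lhs => rw [h.eq_expansion]
    exact norm_expansion_le h1 h2 _

theorem isCompactOperator (y : Y) : IsCompactOperator (compression I I' (Φ y)) := by
  let F : Y →L[ℂ] (H' →L[ℂ] H) := compression I I' ∘L ⟨Φ, h.continuous⟩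
  have hc : IsClosed {y | IsCompactOperator (F y)} :=
    (isClosed_setOfPred_isCompactOperator (σ₁₂ := RingHom.id ℂ) (M₁ := H') (M₂ := H)).preimage
      F.continuous
  have hle : Submodule.span ℂ S ≤ (compactOperator (RingHom.id ℂ) H' H).comap
      (F : Y →ₗ[ℂ] (H' →L[ℂ] H)) := by
    refine Submodule.span_le.2 fun y hy => ?_
    obtain ⟨x, x', hx⟩ := h.map_eq y hy
    change IsCompactOperator (compression I I' (Φ y))
    rw [hx, ← expansion_rankOne, compression_expansion h.isometry h.isometry']
    exact isCompactOperator_rankOne x x'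
  exact hc.closure_subset_iff.2 hle (h.dense_span y)

/-- The compressed map is isometric on a complete space, so its range is closed; it contains the
rank one operators of two total families, hence all compact operators. -/
theorem exists_compression_eq [CompleteSpace Y] {T : H' →L[ℂ] H} (hT : IsCompactOperator T) :
    ∃ y, compression I I' (Φ y) = T := by
  let F : Y →ₗᵢ[ℂ] (H' →L[ℂ] H) :=
    ⟨(compression I I' : (K →L[ℂ] K) →ₗ[ℂ] (H' →L[ℂ] H)) ∘ₗ Φ, h.norm_compression⟩
  have hc : IsClosed (LinearMap.range F.toLinearMap : Set (H' →L[ℂ] H)) :=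
    F.isometry.isClosedEmbedding.isClosed_range
  refine mem_of_isCompactOperator hc h.dense h.dense' (fun x hx x' hx' => ?_) hT
  obtain ⟨y, hy⟩ := h.exists_eq x hx x' hx'
  refine ⟨y, ?_⟩
  change compression I I' (Φ y) = _
  rw [hy, ← expansion_rankOne, compression_expansion h.isometry h.isometry']

theorem range_compression [CompleteSpace Y] :
    Set.range (fun y => compression I I' (Φ y)) = {T : H' →L[ℂ] H | IsCompactOperator T} := by
  ext T
  exact ⟨fun ⟨y, hy⟩ => hy ▸ h.isCompactOperator y, fun hT => h.exists_compression_eq hT⟩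

end IsCompactCorner

/-- A *-homomorphism into operators on `K` which lives on the range of an isometry `I`, as a
*-homomorphism into operators on the domain of `I`. -/
def compressHom {A : Type*} [NonUnitalCStarAlgebra A] (Φ : A →⋆ₙₐ[ℂ] (K →L[ℂ] K)) (I : H →L[ℂ] K)
    (hI : I.adjoint ∘L I = 1) (h : ∀ a, Φ a = expansion I I (compression I I (Φ a))) :
    A →⋆ₙₐ[ℂ] (H →L[ℂ] H) where
  toFun a := compression I I (Φ a)
  map_smul' c a := by rw [map_smul, map_smul]; rfl
  map_zero' := by rw [map_zero, map_zero]
  map_add' a b := by rw [map_add, map_add]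
  map_mul' a b := by
    rw [map_mul]
    conv_lhs => rw [h b]
    ext x
    have h1 : ∀ y, I.adjoint (I y) = y := fun y => DFunLike.congr_fun hI y
    simp [compression_apply, expansion_apply, h1]
  map_star' a := by
    rw [map_star, ContinuousLinearMap.star_eq_adjoint, ContinuousLinearMap.star_eq_adjoint,
      compression_apply, compression_apply, ContinuousLinearMap.adjoint_comp,
      ContinuousLinearMap.adjoint_comp, ContinuousLinearMap.adjoint_adjoint]
    rfl

end CornerBlocks

/-! ## The Hilbert spaces of equivariant functions -/

namespace Twist

variable {G Gσ : Type*}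
  [TopologicalSpace G] [Group G] [IsTopologicalGroup G] [LocallyCompactSpace G] [T2Space G]
  [TopologicalSpace Gσ] [Group Gσ] [IsTopologicalGroup Gσ] [LocallyCompactSpace Gσ] [T2Space Gσ]
  (σ : Twist G Gσ)
  [MeasurableSpace Gσ] [BorelSpace Gσ] (μ : Measure Gσ) [IsHaarMeasure μ] [μ.Regular]

theorem continuous_char_smul_rho (k : Fin 2) (ξ : Lp ℂ 2 μ) :
    Continuous fun z : Circle => star (![1, (z : ℂ)] k) • rho μ (σ.ι z) ξ :=
  (continuous_char k).star.smul ((continuous_rho μ ξ).comp σ.continuous_ι)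

theorem integrable_char_smul_rho (k : Fin 2) (ξ : Lp ℂ 2 μ) :
    Integrable (fun z : Circle => star (![1, (z : ℂ)] k) • rho μ (σ.ι z) ξ) circleHaar :=
  (σ.continuous_char_smul_rho μ k ξ).integrable_of_hasCompactSupport
    (HasCompactSupport.of_compactSpace _)

theorem rho_ι_ccL2 (z : Circle) (φ : ccSubmodule Gσ ℂ) :
    (ccTranslate (σ.ι z) φ).1 = fun t => φ.1 (t * σ.ι z) := by
  ext t
  change ((modularΔ (σ.ι z) ^ (1 / 2 : ℝ) : ℝ) : ℂ) * φ.1 (t * σ.ι z) = _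
  rw [TwistedAction.modularΔ_ι σ.toCentralCircle, Real.one_rpow, Complex.ofReal_one, one_mul]

/-- Averaging in `L²` and averaging pointwise agree, as one sees by pairing with compactly supported
functions and exchanging the integrals. -/
theorem integral_char_smul_rho_ccL2 (k : Fin 2) (φ : ccSubmodule Gσ ℂ) :
    ∫ z : Circle, star (![1, (z : ℂ)] k) • rho μ (σ.ι z) (ccL2 μ φ) ∂circleHaar =
      ccL2 μ (σ.ccAverage k φ) := by
  refine (denseRange_ccL2 μ).equalizer (g := fun ω => inner ℂ ω _) (h := fun ω => inner ℂ ω _)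
    (by fun_prop) (by fun_prop) ?_ |> fun h => ext_inner_left ℂ fun ω => congrFun h ω
  ext ψ
  simp only [Function.comp_apply]
  rw [← integral_inner (σ.integrable_char_smul_rho μ k _), inner_ccL2]
  let F : Circle → Gσ → ℂ := fun z t =>
    star (ψ.1 t) * (star (![1, (z : ℂ)] k) * φ.1 (t * σ.ι z))
  have hF : Continuous (Function.uncurry F) :=
    (ψ.2.1.comp continuous_snd).star.mul
      ((σ.continuous_average_integrand k φ.2.1).comp continuous_swap)
  have hFc : HasCompactSupport (Function.uncurry F) := by
    refine HasCompactSupport.intro (isCompact_univ.prod ψ.2.2.isCompact) fun ⟨z, t⟩ hs => ?_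
    have h0 : ψ.1 t = 0 := image_eq_zero_of_notMem_tsupport fun h => hs ⟨Set.mem_univ _, h⟩
    simp [F, h0]
  calc ∫ z : Circle, inner ℂ (ccL2 μ ψ) (star (![1, (z : ℂ)] k) • rho μ (σ.ι z) (ccL2 μ φ))
        ∂circleHaar = ∫ z, ∫ t, F z t ∂μ ∂circleHaar := by
        refine integral_congr_ae (Eventually.of_forall fun z => ?_)
        simp only [F]
        rw [inner_smul_right, rho_ccL2, inner_ccL2, ← integral_const_mul, rho_ι_ccL2]
        congr 1 with t
        ring
    _ = ∫ t, ∫ z, F z t ∂circleHaar ∂μ := integral_integral_swap_of_hasCompactSupport hF hFc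
    _ = _ := by
        congr 1 with t
        simp only [F]
        rw [integral_const_mul]
        rfl

/-- The averaging projection is contractive and fixes `ξ`, so averaging any approximant in
`C_c(G_σ)` makes it equivariant without increasing its distance to `ξ`. -/
theorem exists_equivariant_near (k : Fin 2) {ξ : Lp ℂ 2 μ}
    (hξ : ∀ z, rho μ (σ.ι z) ξ = ![1, (z : ℂ)] k • ξ) {ε : ℝ} (hε : 0 < ε) :
    ∃ φ : ccSubmodule Gσ ℂ, (∀ s z, φ.1 (s * σ.ι z) = ![1, (z : ℂ)] k * φ.1 s) ∧
      ‖ξ - ccL2 μ φ‖ < ε := by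
  obtain ⟨_, ⟨φ, rfl⟩, hφ⟩ := Metric.mem_closure_iff.1 (denseRange_ccL2 μ ξ) ε hε
  rw [dist_eq_norm] at hφ
  refine ⟨σ.ccAverage k φ, σ.average_mul_ι k φ.1, lt_of_le_of_lt ?_ hφ⟩
  have h1 : ξ = ∫ z : Circle, star (![1, (z : ℂ)] k) • rho μ (σ.ι z) ξ ∂circleHaar := by
    simp only [hξ, smul_smul, star_char_mul, one_smul]
    simp
  have h2 : ξ - ccL2 μ (σ.ccAverage k φ) =
      ∫ z : Circle, star (![1, (z : ℂ)] k) • rho μ (σ.ι z) (ξ - ccL2 μ φ) ∂circleHaar := by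
    simp only [map_sub, smul_sub]
    rw [integral_sub (σ.integrable_char_smul_rho μ k _) (σ.integrable_char_smul_rho μ k _), ← h1,
      integral_char_smul_rho_ccL2]
  rw [h2]
  refine (norm_integral_le_of_norm_le_const (C := ‖ξ - ccL2 μ φ‖)
    (Eventually.of_forall fun z => ?_)).trans (by simp)
  rw [norm_smul, norm_star, norm_char, one_mul, norm_rho]

variable [MeasurableSpace G] [BorelSpace G] {ν : Measure G} [IsHaarMeasure ν]
  (hq : MeasurePreserving σ.q μ ν)

/-- The isometry `L²(G) → L²(G_σ)`, `η ↦ η ∘ q`. -/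
def pullL2 : Lp ℂ 2 ν →ₗᵢ[ℂ] Lp ℂ 2 μ := Lp.compMeasurePreservingₗᵢ ℂ σ.q hq

theorem pullL2_ae (η : Lp ℂ 2 ν) : σ.pullL2 μ hq η =ᵐ[μ] fun s => η (σ.q s) :=
  Lp.coeFn_compMeasurePreserving η hq

/-- Pull-back of continuous compactly supported functions. -/
def ccPull (ψ : ccSubmodule G ℂ) : ccSubmodule Gσ ℂ :=
  ⟨fun s => ψ.1 (σ.q s), ψ.2.1.comp σ.continuous_q, σ.hasCompactSupport_comp_q ψ.2.2⟩

theorem pullL2_ccL2 (ψ : ccSubmodule G ℂ) : σ.pullL2 μ hq (ccL2 ν ψ) = ccL2 μ (σ.ccPull ψ) := by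
  refine Lp.ext ?_
  filter_upwards [σ.pullL2_ae μ hq (ccL2 ν ψ), ccL2_ae μ (σ.ccPull ψ),
    hq.quasiMeasurePreserving.ae (ccL2_ae ν ψ)] with s h1 h2 h3
  rw [h1, h2, h3]
  rfl

theorem exists_ccPull_eq {φ : ccSubmodule Gσ ℂ} (h : ∀ s z, φ.1 (s * σ.ι z) = φ.1 s) :
    ∃ ψ, σ.ccPull ψ = φ := by
  obtain ⟨a, ha, haφ⟩ := σ.exists_descend φ.2.1 h
  exact ⟨⟨a, ha, σ.hasCompactSupport_of_comp_q haφ φ.2.2⟩, Subtype.ext (funext haφ)⟩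

/-- An invariant `L²`-class is approximated by invariant continuous functions, which descend to `G`;
the range of the isometry is closed. -/
theorem exists_pullL2_eq {ξ : Lp ℂ 2 μ} (hξ : ∀ z, rho μ (σ.ι z) ξ = ξ) :
    ∃ η, σ.pullL2 μ hq η = ξ := by
  have hc : IsClosed (Set.range (σ.pullL2 μ hq)) :=
    (σ.pullL2 μ hq).isometry.isClosedEmbedding.isClosed_range
  refine hc.closure_subset_iff.2 subset_rfl (Metric.mem_closure_iff.2 fun ε hε => ?_)
  obtain ⟨φ, hφ, hlt⟩ := σ.exists_equivariant_near μ 0 (ξ := ξ) (by simpa using hξ) hε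
  obtain ⟨ψ, rfl⟩ := σ.exists_ccPull_eq (φ := φ) (by simpa using hφ)
  exact ⟨_, ⟨ccL2 ν ψ, σ.pullL2_ccL2 μ hq ψ⟩, by rwa [dist_eq_norm]⟩

variable [ν.Regular]

/-- Under translation by `ι(z)` the function `f` acquires `z̄` and `ξ` acquires `z`, so `fξ` is
invariant and lies in the range of the isometry, where the adjoint used to define `Lsigma` is a
genuine inverse. -/
theorem pullL2_Lsigma (f : σ.C0iota) (ξ : σ.L2iota μ) :
    σ.pullL2 μ hq (σ.Lsigma μ ν hq f ξ) = mulOp μ f.1 ξ := by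
  have hinv : ∀ z, rho μ (σ.ι z) (mulOp μ f.1 ξ) = mulOp μ f.1 ξ := fun z => by
    rw [rho_mulOp, (σ.mem_L2iota_iff μ).1 ξ.2 z, map_smul]
    have h : rtHom Gσ ℂ (σ.ι z) f.1 = star (z : ℂ) • f.1 := DFunLike.ext _ _ fun s => f.2 s z
    rw [h, ← mulHom_apply, map_smul, _root_.smul_apply, smul_smul, mul_comm, star_mul_circle,
      one_smul, mulHom_apply]
  obtain ⟨η, hη⟩ := σ.exists_pullL2_eq μ hq hinv
  have h1 : σ.Lsigma μ ν hq f ξ = (σ.pullL2 μ hq).toContinuousLinearMap.adjoint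
      (mulOp μ f.1 ξ) := rfl
  rw [h1, ← hη]
  congr 1
  exact DFunLike.congr_fun (ContinuousLinearMap.norm_map_iff_adjoint_comp_self
    (σ.pullL2 μ hq).toContinuousLinearMap |>.1 (σ.pullL2 μ hq).norm_map) η

theorem Lsigma_ae (f : σ.C0iota) (ξ : σ.L2iota μ) :
    (fun s => σ.Lsigma μ ν hq f ξ (σ.q s)) =ᵐ[μ] fun s => f.1 s * (ξ : Lp ℂ 2 μ) s := by
  have h1 := σ.pullL2_ae μ hq (σ.Lsigma μ ν hq f ξ)
  rw [pullL2_Lsigma] at h1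
  exact h1.symm.trans (mulOp_ae μ f.1 ξ)

end Twist

/-! ### Embedding `L²(G)` and `L²(G_σ, ι)` into `L²(G_σ) ⊕ L²(G_σ)` -/

section CoordinateInclusion

variable {E : Type*} [NormedAddCommGroup E] [InnerProductSpace ℂ E] [CompleteSpace E]

/-- The inclusion of `E` as a summand of `E ⊕ E`. -/
def coordIncl (k : Fin 2) : E →L[ℂ] PiLp 2 (fun _ : Fin 2 => E) :=
  ((PiLp.continuousLinearEquiv 2 ℂ (fun _ : Fin 2 => E)).symm :
    (Fin 2 → E) →L[ℂ] PiLp 2 (fun _ : Fin 2 => E)) ∘L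
    ContinuousLinearMap.pi fun i => if i = k then ContinuousLinearMap.id ℂ E else 0

theorem coordIncl_apply (k : Fin 2) (ξ : E) (i : Fin 2) :
    coordIncl k ξ i = if i = k then ξ else 0 := by
  have h : coordIncl k ξ i = (if i = k then ContinuousLinearMap.id ℂ E else 0) ξ := rfl
  rw [h]
  split_ifs <;> rfl

theorem inner_coordIncl (k : Fin 2) (ξ : E) (ζ : PiLp 2 (fun _ : Fin 2 => E)) :
    inner ℂ (coordIncl k ξ) ζ = inner ℂ ξ (ζ k) := by
  rw [PiLp.inner_apply, Finset.sum_eq_single k]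
  · rw [coordIncl_apply, if_pos rfl]
  · intro i _ hi
    rw [coordIncl_apply, if_neg hi, inner_zero_left]
  · simp

theorem norm_coordIncl (k : Fin 2) (ξ : E) : ‖coordIncl k ξ‖ = ‖ξ‖ := by
  have h : inner ℂ (coordIncl k ξ) (coordIncl k ξ) = inner ℂ ξ ξ := by
    rw [inner_coordIncl, coordIncl_apply, if_pos rfl]
  rw [inner_self_eq_norm_sq_to_K, inner_self_eq_norm_sq_to_K] at h
  norm_cast at h
  exact (sq_eq_sq₀ (norm_nonneg _) (norm_nonneg _)).1 h

end CoordinateInclusion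

namespace Twist

variable {G Gσ : Type*}
  [TopologicalSpace G] [Group G] [IsTopologicalGroup G] [LocallyCompactSpace G] [T2Space G]
  [TopologicalSpace Gσ] [Group Gσ] [IsTopologicalGroup Gσ] [LocallyCompactSpace Gσ] [T2Space Gσ]
  (σ : Twist G Gσ)
  [MeasurableSpace Gσ] [BorelSpace Gσ] (μ : Measure Gσ) [IsHaarMeasure μ]

theorem pairL2_compPair (k : Fin 2) (ξ : σ.equivPair) :
    pairL2 μ (σ.compPair k ξ).1 = coordIncl k (ccL2 μ (ξ.1 k)) := by
  refine PiLp.ext fun i => ?_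
  rw [pairL2_apply, compPair_apply, coordIncl_apply]
  split_ifs with h
  · rw [h]
  · exact map_zero _

theorem matMul_coordIncl (F : C₀(Gσ, Matrix (Fin 2) (Fin 2) ℂ)) (l : Fin 2) (ζ : Lp ℂ 2 μ)
    (i : Fin 2) : matMul μ F (coordIncl l ζ) i = mulOp μ (entry i l F) ζ := by
  rw [matMul_apply, Finset.sum_eq_single l]
  · rw [coordIncl_apply, if_pos rfl]
  · intro j _ hj
    rw [coordIncl_apply, if_neg hj, map_zero]
  · simp

variable [μ.Regular]

theorem rhoPair_coordIncl (s : Gσ) (l : Fin 2) (ζ : Lp ℂ 2 μ) :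
    rhoPair μ s (coordIncl l ζ) = coordIncl l (rho μ s ζ) := by
  refine PiLp.ext fun i => ?_
  rw [rhoPair_apply, coordIncl_apply, coordIncl_apply]
  split_ifs
  · rfl
  · exact map_zero _

/-- An isometry onto the subspace of equivariant vectors in one summand of `L²(G_σ) ⊕ L²(G_σ)`. -/
structure IsComponent {H : Type*} [NormedAddCommGroup H] [InnerProductSpace ℂ H] [CompleteSpace H]
    (k : Fin 2) (I : H →L[ℂ] L2Pair μ) : Prop where
  isometry : I.adjoint ∘L I = 1
  exists_eq : ∀ ξ, ∃ x, I x = pairL2 μ (σ.compPair k ξ).1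
  dense : Dense {x | ∃ ξ, I x = pairL2 μ (σ.compPair k ξ).1}

theorem exists_pair (k : Fin 2) (φ : ccSubmodule Gσ ℂ)
    (h : ∀ s z, φ.1 (s * σ.ι z) = ![1, (z : ℂ)] k * φ.1 s) : ∃ ξ : σ.equivPair, ξ.1 k = φ := by
  refine ⟨⟨fun i => if i = k then φ else 0, fun i s z => ?_⟩, if_pos rfl⟩
  dsimp only
  split_ifs with hi
  · rw [hi]; exact h s z
  · simp

/-- The embedding of `L²(G_σ, ι)` into the second summand of `L²(G_σ) ⊕ L²(G_σ)`. -/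
def inclB : σ.L2iota μ →L[ℂ] L2Pair μ := coordIncl 1 ∘L (σ.L2iota μ).subtypeL

theorem inclB_apply (x : σ.L2iota μ) : σ.inclB μ x = coordIncl 1 (x : Lp ℂ 2 μ) := rfl

variable [MeasurableSpace G] [BorelSpace G]

theorem isComponent_inclB : σ.IsComponent μ 1 (σ.inclB μ) where
  isometry := (ContinuousLinearMap.norm_map_iff_adjoint_comp_self _).1 fun x => norm_coordIncl 1 _
  exists_eq ξ := by
    refine ⟨⟨ccL2 μ (ξ.1 1), (σ.mem_L2iota_iff μ).2 fun z => ?_⟩, (σ.pairL2_compPair μ 1 ξ).symm⟩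
    rw [rho_ccL2, ← map_smul]
    congr 1
    refine Subtype.ext ((σ.rho_ι_ccL2 z (ξ.1 1)).trans (funext fun t => ?_))
    exact ξ.2 1 t z
  dense x := Metric.mem_closure_iff.2 fun ε hε => by
    obtain ⟨φ, hφ, hlt⟩ := σ.exists_equivariant_near μ 1 (ξ := x) ((σ.mem_L2iota_iff μ).1 x.2) hε
    have hmem : ccL2 μ φ ∈ σ.L2iota μ := (σ.mem_L2iota_iff μ).2 fun z => by
      rw [rho_ccL2, ← map_smul]
      congr 1
      exact Subtype.ext ((σ.rho_ι_ccL2 z φ).trans (funext fun t => hφ t z))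
    obtain ⟨ξ, hξ⟩ := σ.exists_pair 1 φ hφ
    refine ⟨⟨ccL2 μ φ, hmem⟩, ⟨ξ, ?_⟩, ?_⟩
    · rw [pairL2_compPair, hξ]; rfl
    · rw [dist_eq_norm]; exact hlt

variable {ν : Measure G} [IsHaarMeasure ν] [ν.Regular] (hq : MeasurePreserving σ.q μ ν)

/-- The embedding of `L²(G)` into the first summand of `L²(G_σ) ⊕ L²(G_σ)`. -/
def inclA : Lp ℂ 2 ν →L[ℂ] L2Pair μ := coordIncl 0 ∘L (σ.pullL2 μ hq).toContinuousLinearMap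

theorem inclA_apply (x : Lp ℂ 2 ν) : σ.inclA μ hq x = coordIncl 0 (σ.pullL2 μ hq x) := rfl

theorem isComponent_inclA : σ.IsComponent μ 0 (σ.inclA μ hq) where
  isometry := (ContinuousLinearMap.norm_map_iff_adjoint_comp_self _).1 fun x =>
    (norm_coordIncl 0 _).trans ((σ.pullL2 μ hq).norm_map x)
  exists_eq ξ := by
    obtain ⟨ψ, hψ⟩ := σ.exists_ccPull_eq (φ := ξ.1 0) fun s z => by simpa using ξ.2 0 s z
    exact ⟨ccL2 ν ψ, by rw [inclA_apply, pullL2_ccL2, hψ, pairL2_compPair]⟩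
  dense := (denseRange_ccL2 ν).mono (by
    rintro _ ⟨ψ, rfl⟩
    obtain ⟨ξ, hξ⟩ := σ.exists_pair 0 (σ.ccPull ψ) fun s z => by
      change ψ.1 (σ.q (s * σ.ι z)) = _ * ψ.1 (σ.q s)
      rw [map_mul, σ.q_ι]; simp
    exact ⟨ξ, by rw [inclA_apply, pullL2_ccL2, pairL2_compPair, hξ]⟩)

theorem adjoint_inclA_comp_inclB : (σ.inclA μ hq).adjoint ∘L σ.inclB μ = 0 := by
  ext1 x
  refine ext_inner_left ℂ fun y => ?_
  rw [ContinuousLinearMap.comp_apply, ContinuousLinearMap.adjoint_inner_right, inclA_apply,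
    inclB_apply, inner_coordIncl, coordIncl_apply, if_neg (by decide)]
  simp

theorem adjoint_inclB_comp_inclA : (σ.inclB μ).adjoint ∘L σ.inclA μ hq = 0 := by
  ext1 x
  refine ext_inner_left ℂ fun y => ?_
  rw [ContinuousLinearMap.comp_apply, ContinuousLinearMap.adjoint_inner_right, inclA_apply,
    inclB_apply, inner_coordIncl, coordIncl_apply, if_neg (by decide)]
  simp

/-- A common criterion for the three corners. Here `𝒜` is the algebra or space of functions, `Y` its
completion, and `φ` identifies `𝒜` with the elements supported in the matrix entry `(k, l)`.
Domination of the norm of `Y` by the `L¹`-norm transfers the density of the rank one elements. -/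
theorem isCompactCorner {H H' 𝒜 Y : Type*} [NormedAddCommGroup H] [InnerProductSpace ℂ H]
    [CompleteSpace H] [NormedAddCommGroup H'] [InnerProductSpace ℂ H'] [CompleteSpace H']
    [AddCommGroup 𝒜] [Module ℂ 𝒜] [NormedAddCommGroup Y] [NormedSpace ℂ Y]
    {k l : Fin 2} {I : H →L[ℂ] L2Pair μ} {I' : H' →L[ℂ] L2Pair μ} (hI : σ.IsComponent μ k I)
    (hI' : σ.IsComponent μ l I') (j : 𝒜 →ₗ[ℂ] Y) (hj : DenseRange j)
    (φ : 𝒜 →ₗ[ℂ] σ.linkingTwisted.twistedConv μ)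
    (hjφ : ∀ x, ‖j x‖ ≤ σ.linkingTwisted.l1Norm μ (φ x))
    (hφ : ∀ x, σ.compressConv k l (φ x) = φ x)
    (hsurj : ∀ f, σ.compressConv k l f = f → ∃ x, φ x = f)
    (Φ : Y →ₗ[ℂ] (L2Pair μ →L[ℂ] L2Pair μ)) (hΦ : ∀ x, Φ (j x) = σ.linkingHom μ (φ x))
    (hnorm : ∀ y, ‖Φ y‖ = ‖y‖) :
    IsCompactCorner Φ I I' {x | ∃ ξ, I x = pairL2 μ (σ.compPair k ξ).1}
      {x | ∃ ξ, I' x = pairL2 μ (σ.compPair l ξ).1}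
      {y | ∃ x ξ η, φ x = σ.cornerConv μ k l ξ η ∧ j x = y} where
  norm_eq := hnorm
  isometry := hI.isometry
  isometry' := hI'.isometry
  dense := hI.dense.mono Submodule.subset_span
  dense' := hI'.dense.mono Submodule.subset_span
  dense_span := by
    refine fun y => closure_minimal ?_ isClosed_closure (hj y)
    rintro _ ⟨x, rfl⟩
    refine Metric.mem_closure_iff.2 fun ε hε => ?_
    obtain ⟨f, hf, hlt⟩ := σ.dense_span_cornerConv (hφ x) hε
    have : ∃ z, j z ∈ Submodule.span ℂ {y | ∃ x ξ η, φ x = σ.cornerConv μ k l ξ η ∧ j x = y} ∧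
        φ z = f := by
      refine RankOneSystem.span_induction (P := fun f => ∃ z, j z ∈ Submodule.span ℂ
        {y | ∃ x ξ η, φ x = σ.cornerConv μ k l ξ η ∧ j x = y} ∧ φ z = f) (fun ξ η => ?_)
        ⟨0, by rw [map_zero]; exact zero_mem _, map_zero φ⟩ ?_ ?_ hf
      · obtain ⟨z, hz⟩ := hsurj _ (σ.compressConv_cornerConv k l ξ η)
        exact ⟨z, Submodule.subset_span ⟨z, ξ, η, hz, rfl⟩, hz⟩
      · rintro _ _ ⟨z, hz, rfl⟩ ⟨w, hw, rfl⟩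
        exact ⟨z + w, by rw [map_add]; exact add_mem hz hw, map_add φ z w⟩
      · rintro c _ ⟨z, hz, rfl⟩
        exact ⟨c • z, by rw [map_smul]; exact Submodule.smul_mem _ c hz, map_smul φ c z⟩
    obtain ⟨z, hz, rfl⟩ := this
    refine ⟨j z, hz, ?_⟩
    have hsub : φ (x - z) = φ x - φ z := map_sub φ x z
    rw [dist_eq_norm, ← map_sub]
    exact (hjφ (x - z)).trans_lt
      ((congrArg (σ.linkingTwisted.l1Norm μ) hsub).trans_lt hlt)
  map_eq := by
    rintro _ ⟨x, ξ, η, hx, rfl⟩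
    obtain ⟨a, ha⟩ := hI.exists_eq ξ
    obtain ⟨b, hb⟩ := hI'.exists_eq η
    refine ⟨a, b, ?_⟩
    rw [hΦ, hx, ha, hb]
    exact σ.linkingHom_rankConv μ _ _
  exists_eq := by
    rintro a ⟨ξ, ha⟩ b ⟨η, hb⟩
    obtain ⟨z, hz⟩ := hsurj _ (σ.compressConv_cornerConv k l ξ η)
    refine ⟨j z, ?_⟩
    rw [hΦ, hz, ha, hb]
    exact σ.linkingHom_rankConv μ _ _

end Twist

/-! ### Decomposing operators into four blocks -/

section BlockDecomposition

theorem IsCompactCorner.injective_compression {K H H' Y : Type*} [NormedAddCommGroup K]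
    [InnerProductSpace ℂ K] [CompleteSpace K] [NormedAddCommGroup H] [InnerProductSpace ℂ H]
    [CompleteSpace H] [NormedAddCommGroup H'] [InnerProductSpace ℂ H'] [CompleteSpace H']
    [NormedAddCommGroup Y] [NormedSpace ℂ Y] {Φ : Y →ₗ[ℂ] (K →L[ℂ] K)} {I : H →L[ℂ] K}
    {I' : H' →L[ℂ] K} {D : Set H} {D' : Set H'} {S : Set Y} (h : IsCompactCorner Φ I I' D D' S) :
    Function.Injective fun y => compression I I' (Φ y) := fun x y hxy => by
  have h1 : compression I I' (Φ (x - y)) = 0 := by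
    rw [map_sub, map_sub]; exact sub_eq_zero.2 hxy
  rw [← sub_eq_zero, ← norm_eq_zero, ← h.norm_compression, h1, norm_zero]

variable {K H H' : Type*} [NormedAddCommGroup K] [InnerProductSpace ℂ K] [CompleteSpace K]
  [NormedAddCommGroup H] [InnerProductSpace ℂ H] [CompleteSpace H]
  [NormedAddCommGroup H'] [InnerProductSpace ℂ H'] [CompleteSpace H']

theorem adjoint_expansion (I : H →L[ℂ] K) (I' : H' →L[ℂ] K) (T : H' →L[ℂ] H) :
    (expansion I I' T).adjoint = expansion I' I T.adjoint := by
  rw [expansion_apply, expansion_apply, ContinuousLinearMap.adjoint_comp,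
    ContinuousLinearMap.adjoint_comp, ContinuousLinearMap.adjoint_adjoint]
  rfl

theorem adjoint_compression (I : H →L[ℂ] K) (I' : H' →L[ℂ] K) (T : K →L[ℂ] K) :
    (compression I I' T).adjoint = compression I' I T.adjoint := by
  rw [compression_apply, compression_apply, ContinuousLinearMap.adjoint_comp,
    ContinuousLinearMap.adjoint_comp, ContinuousLinearMap.adjoint_adjoint]
  rfl

theorem expansion_mul_expansion {H'' : Type*} [NormedAddCommGroup H''] [InnerProductSpace ℂ H'']
    [CompleteSpace H''] {I : H →L[ℂ] K} {I' : H' →L[ℂ] K} {I'' : H'' →L[ℂ] K}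
    (hI' : I'.adjoint ∘L I' = 1) (T : H' →L[ℂ] H) (S : H'' →L[ℂ] H') :
    expansion I I' T * expansion I' I'' S = expansion I I'' (T ∘L S) := by
  ext x
  have h1 : ∀ y, I'.adjoint (I' y) = y := fun y => DFunLike.congr_fun hI' y
  change I (T (I'.adjoint (I' (S (I''.adjoint x))))) = I (T (S (I''.adjoint x)))
  rw [h1]

/-- With `P = I I* + I' I'*`, expand `T = P T P`. -/
theorem eq_sum_expansion {I : H →L[ℂ] K} {I' : H' →L[ℂ] K} {T : K →L[ℂ] K}
    (hl : (I ∘L I.adjoint + I' ∘L I'.adjoint) ∘L T = T)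
    (hr : T ∘L (I ∘L I.adjoint + I' ∘L I'.adjoint) = T) :
    T = expansion I I (compression I I T) + expansion I I' (compression I I' T) +
      expansion I' I (compression I' I T) + expansion I' I' (compression I' I' T) := by
  conv_lhs => rw [← hr, ← hl]
  ext x
  simp only [expansion_apply, compression_apply, ContinuousLinearMap.comp_apply,
    _root_.add_apply, map_add]
  abel

/-- The identification of three corners, represented on the same Hilbert space, with compact
operators. -/
def CompactTriple.ofCorners {A X B : Type*} [NonUnitalCStarAlgebra A] [NormedAddCommGroup X]
    [NormedSpace ℂ X] [CompleteSpace X] [NonUnitalCStarAlgebra B]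
    {ΦA : A →⋆ₙₐ[ℂ] (K →L[ℂ] K)} {ΦX : X →ₗ[ℂ] (K →L[ℂ] K)} {ΦB : B →⋆ₙₐ[ℂ] (K →L[ℂ] K)}
    {I : H →L[ℂ] K} {I' : H' →L[ℂ] K}
    (hA : ∃ D D' S, IsCompactCorner (ΦA : A →ₗ[ℂ] (K →L[ℂ] K)) I I D D' S)
    (hX : ∃ D D' S, IsCompactCorner ΦX I I' D D' S)
    (hB : ∃ D D' S, IsCompactCorner (ΦB : B →ₗ[ℂ] (K →L[ℂ] K)) I' I' D D' S) :
    CompactTriple A X B H H' where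
  πA := compressHom ΦA I (by obtain ⟨_, _, _, h⟩ := hA; exact h.isometry)
    (by obtain ⟨_, _, _, h⟩ := hA; exact h.eq_expansion)
  πX := (compression I I' : (K →L[ℂ] K) →ₗ[ℂ] (H' →L[ℂ] H)) ∘ₗ ΦX
  πB := compressHom ΦB I' (by obtain ⟨_, _, _, h⟩ := hB; exact h.isometry)
    (by obtain ⟨_, _, _, h⟩ := hB; exact h.eq_expansion)
  injective_A := by obtain ⟨_, _, _, h⟩ := hA; exact h.injective_compression
  norm_X := by obtain ⟨_, _, _, h⟩ := hX; exact h.norm_compression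
  injective_B := by obtain ⟨_, _, _, h⟩ := hB; exact h.injective_compression
  range_A := by obtain ⟨_, _, _, h⟩ := hA; exact h.range_compression
  range_X := by obtain ⟨_, _, _, h⟩ := hX; exact h.range_compression
  range_B := by obtain ⟨_, _, _, h⟩ := hB; exact h.range_compression

theorem Env.dense_span_of {𝒜 : Type*} [NonUnitalRing 𝒜] [StarRing 𝒜] [Module ℂ 𝒜]
    [StarModule ℂ 𝒜] [IsScalarTower ℂ 𝒜 𝒜] [SMulCommClass ℂ 𝒜 𝒜] {N : Seminorm ℂ 𝒜} {V : Type*}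
    {e : V → V → 𝒜} (h : ∀ x, ∀ ε > 0, ∃ y ∈ RankOneSystem.span e, N (x - y) < ε) :
    Dense (Submodule.span ℂ {x | ∃ ξ η, x = Env.of N (e ξ η)} : Set (Env N)) := by
  refine fun x => closure_minimal ?_ isClosed_closure (Env.denseRange_of x)
  rintro _ ⟨f, rfl⟩
  refine Metric.mem_closure_iff.2 fun ε hε => ?_
  obtain ⟨g, hg, hlt⟩ := h f ε hε
  refine ⟨Env.of N g, ?_, ?_⟩
  · refine RankOneSystem.span_induction (P := fun g => Env.of N g ∈
      Submodule.span ℂ {x | ∃ ξ η, x = Env.of N (e ξ η)})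
      (fun ξ η => Submodule.subset_span ⟨ξ, η, rfl⟩) ?_ ?_ ?_ hg
    · rw [map_zero]; exact zero_mem _
    · intro x y hx hy
      rw [map_add]; exact add_mem hx hy
    · intro c x hx
      rw [map_smul]; exact Submodule.smul_mem _ c hx
  · rw [dist_eq_norm, ← map_sub, Env.norm_of]
    exact (envSeminorm_le _).trans_lt hlt

end BlockDecomposition

/-! ### The crossed product of the linking algebra and its corners as compact operators -/

namespace Twist

variable {G Gσ : Type*}
  [TopologicalSpace G] [Group G] [IsTopologicalGroup G] [LocallyCompactSpace G] [T2Space G]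
  [TopologicalSpace Gσ] [Group Gσ] [IsTopologicalGroup Gσ] [LocallyCompactSpace Gσ] [T2Space Gσ]
  (σ : Twist G Gσ) [MeasurableSpace G] [BorelSpace G]
  [MeasurableSpace Gσ] [BorelSpace Gσ] (μ : Measure Gσ) [IsHaarMeasure μ] [μ.Regular]

/-- The representation of `L ⋊ G` on `L²(G_σ) ⊕ L²(G_σ)`. -/
def linkingOp : σ.LinkingCP μ →⋆ₙₐ[ℂ] (L2Pair μ →L[ℂ] L2Pair μ) :=
  Env.lift (σ.linkingHom μ) (σ.norm_linkingHom_le μ)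

theorem linkingOp_of (f : σ.linkingTwisted.twistedConv μ) :
    σ.linkingOp μ (Env.of _ f) = σ.linkingHom μ f := Env.lift_of _ _ f

theorem norm_linkingOp (e : σ.LinkingCP μ) : ‖σ.linkingOp μ e‖ = ‖e‖ :=
  Env.norm_lift _ _ (σ.envSeminorm_linking μ) e

theorem linkingOp_mul (x y : σ.LinkingCP μ) :
    σ.linkingOp μ (x * y) = σ.linkingOp μ x * σ.linkingOp μ y := (σ.linkingOp μ).map_mul' x y

theorem linkingOp_add (x y : σ.LinkingCP μ) :
    σ.linkingOp μ (x + y) = σ.linkingOp μ x + σ.linkingOp μ y := (σ.linkingOp μ).map_add' x y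

theorem linkingOp_star (x : σ.LinkingCP μ) :
    σ.linkingOp μ (star x) = (σ.linkingOp μ x).adjoint := (σ.linkingOp μ).map_star' x

theorem linkingOp_injective : Function.Injective (σ.linkingOp μ) :=
  (injective_iff_map_eq_zero _).2 fun e he => by
    rw [← norm_eq_zero, ← norm_linkingOp, he, norm_zero]

variable {ν : Measure G} [IsHaarMeasure ν] [ν.Regular] (hq : MeasurePreserving σ.q μ ν)

/-- The representation of the diagonal corner `C₀(G) ⋊ G` of `L ⋊ G`. -/
def cornerOpA : CrossedProduct (rtAction G ℂ) ν →⋆ₙₐ[ℂ] (L2Pair μ →L[ℂ] L2Pair μ) :=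
  (σ.linkingOp μ).comp (σ.jA μ ν hq)

/-- The representation of the upper right corner `C₀(G_σ, ῑ) ⋊ G` of `L ⋊ G`. -/
def cornerOpX : σ.bimoduleCP μ →ₗ[ℂ] (L2Pair μ →L[ℂ] L2Pair μ) :=
  (σ.linkingOp μ : σ.LinkingCP μ →ₗ[ℂ] (L2Pair μ →L[ℂ] L2Pair μ)) ∘ₗ (σ.bimoduleCP μ).subtype

/-- The representation of the diagonal corner `C₀(G) ⋊_{(rt,ι^σ)} G` of `L ⋊ G`. -/
def cornerOpB : σ.TwistedCP μ →⋆ₙₐ[ℂ] (L2Pair μ →L[ℂ] L2Pair μ) :=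
  (σ.linkingOp μ).comp (σ.jB μ)

theorem exists_isCompactCorner_A : ∃ D D' S, IsCompactCorner
    (σ.cornerOpA μ hq : CrossedProduct (rtAction G ℂ) ν →ₗ[ℂ] (L2Pair μ →L[ℂ] L2Pair μ))
    (σ.inclA μ hq) (σ.inclA μ hq) D D' S :=
  ⟨_, _, _, σ.isCompactCorner μ (σ.isComponent_inclA μ hq) (σ.isComponent_inclA μ hq)
    (Env.of (Conv.l1Norm (rtAction G ℂ) ν) : Conv (rtAction G ℂ) ν →ₗ[ℂ] _) Env.denseRange_of
    (σ.jAConv μ ν hq : Conv (rtAction G ℂ) ν →ₗ[ℂ] σ.linkingTwisted.twistedConv μ)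
    (fun x => ((Env.norm_of x).trans_le (envSeminorm_le x)).trans (σ.l1Norm_jAConv hq x).ge)
    (fun _ => σ.compressConv_eq_self fun _ _ => rfl) (σ.exists_jAConv_eq hq) _
    (fun x => (congrArg (σ.linkingOp μ) (σ.jA_of hq x)).trans (σ.linkingOp_of μ _))
    (fun a => (σ.norm_linkingOp μ _).trans (σ.norm_jA hq a))⟩

theorem exists_isCompactCorner_B : ∃ D D' S, IsCompactCorner
    (σ.cornerOpB μ : σ.TwistedCP μ →ₗ[ℂ] (L2Pair μ →L[ℂ] L2Pair μ))
    (σ.inclB μ) (σ.inclB μ) D D' S :=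
  ⟨_, _, _, σ.isCompactCorner μ (σ.isComponent_inclB μ) (σ.isComponent_inclB μ)
    (Env.of (σ.rtTwisted.l1Norm μ) : σ.rtTwisted.twistedConv μ →ₗ[ℂ] _) Env.denseRange_of
    (σ.jBConv μ : σ.rtTwisted.twistedConv μ →ₗ[ℂ] σ.linkingTwisted.twistedConv μ)
    (fun x => ((Env.norm_of x).trans_le (envSeminorm_le x)).trans (σ.l1Norm_jBConv x).ge)
    (fun _ => σ.compressConv_eq_self fun _ _ => rfl) σ.exists_jBConv_eq _
    (fun x => (congrArg (σ.linkingOp μ) (σ.jB_of x)).trans (σ.linkingOp_of μ _))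
    (fun b => (σ.norm_linkingOp μ _).trans (σ.norm_jB b))⟩

theorem denseRange_ofX : DenseRange (σ.ofX μ) := fun x => by
  refine Metric.mem_closure_iff.2 fun ε hε => ?_
  obtain ⟨_, ⟨f, rfl⟩, hlt⟩ := Metric.mem_closure_iff.1 x.2 ε hε
  exact ⟨_, ⟨f, rfl⟩, hlt⟩

theorem exists_isCompactCorner_X : ∃ D D' S, IsCompactCorner
    (σ.cornerOpX μ) (σ.inclA μ hq) (σ.inclB μ) D D' S :=
  ⟨_, _, _, σ.isCompactCorner μ (σ.isComponent_inclA μ hq) (σ.isComponent_inclB μ)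
    (σ.ofX μ) (σ.denseRange_ofX μ) (σ.jXConv μ)
    (fun x => (Env.norm_of (σ.jXConv μ x)).trans_le (envSeminorm_le _))
    (fun _ => σ.compressConv_eq_self fun _ _ => rfl) σ.exists_jXConv_eq _
    (fun x => σ.linkingOp_of μ (σ.jXConv μ x))
    (fun x => σ.norm_linkingOp μ x)⟩

theorem linkingOp_jA (a : CrossedProduct (rtAction G ℂ) ν) : σ.linkingOp μ (σ.jA μ ν hq a) =
    expansion (σ.inclA μ hq) (σ.inclA μ hq)
      (compression (σ.inclA μ hq) (σ.inclA μ hq) (σ.linkingOp μ (σ.jA μ ν hq a))) := by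
  obtain ⟨D, D', S, h⟩ := σ.exists_isCompactCorner_A μ hq
  exact h.eq_expansion a

theorem linkingOp_jB (b : σ.TwistedCP μ) : σ.linkingOp μ (σ.jB μ b) =
    expansion (σ.inclB μ) (σ.inclB μ)
      (compression (σ.inclB μ) (σ.inclB μ) (σ.linkingOp μ (σ.jB μ b))) := by
  obtain ⟨D, D', S, h⟩ := σ.exists_isCompactCorner_B μ
  exact h.eq_expansion b

theorem linkingOp_coe (x : σ.bimoduleCP μ) : σ.linkingOp μ x =
    expansion (σ.inclA μ hq) (σ.inclB μ)
      (compression (σ.inclA μ hq) (σ.inclB μ) (σ.linkingOp μ x)) := by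
  obtain ⟨D, D', S, h⟩ := σ.exists_isCompactCorner_X μ hq
  exact h.eq_expansion x

/-- The identification of the corners of `L ⋊ G` with the compact operators between `L²(G_σ, ι)`
and `L²(G)`. -/
def compactTriple : CompactTriple (CrossedProduct (rtAction G ℂ) ν) (σ.bimoduleCP μ)
    (σ.TwistedCP μ) (Lp ℂ 2 ν) (σ.L2iota μ) :=
  CompactTriple.ofCorners (σ.exists_isCompactCorner_A μ hq) (σ.exists_isCompactCorner_X μ hq)
    (σ.exists_isCompactCorner_B μ)

theorem linkingOp_jA_eq (a : CrossedProduct (rtAction G ℂ) ν) : σ.linkingOp μ (σ.jA μ ν hq a) =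
    expansion (σ.inclA μ hq) (σ.inclA μ hq) ((σ.compactTriple μ hq).πA a) :=
  σ.linkingOp_jA μ hq a

theorem linkingOp_jB_eq (b : σ.TwistedCP μ) : σ.linkingOp μ (σ.jB μ b) =
    expansion (σ.inclB μ) (σ.inclB μ) ((σ.compactTriple μ hq).πB b) :=
  σ.linkingOp_jB μ b

theorem linkingOp_coe_eq (x : σ.bimoduleCP μ) : σ.linkingOp μ x =
    expansion (σ.inclA μ hq) (σ.inclB μ) ((σ.compactTriple μ hq).πX x) :=
  σ.linkingOp_coe μ hq x

theorem linkingOp_star_coe_eq (x : σ.bimoduleCP μ) : σ.linkingOp μ (star (x : σ.LinkingCP μ)) =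
    expansion (σ.inclB μ) (σ.inclA μ hq) ((σ.compactTriple μ hq).πX x).adjoint :=
  (σ.linkingOp_star μ _).trans ((congrArg _ (σ.linkingOp_coe_eq μ hq x)).trans
    (adjoint_expansion _ _ _))

/-- The action was defined by composing operators. Expanding to `L²(G_σ) ⊕ L²(G_σ)` turns this
composition into a product in the image of `L ⋊ G`, and injectivity of `linkingOp` gives the
identity in `L ⋊ G`. The right action and the inner products are treated in the same way. -/
theorem coe_lsmul (a : CrossedProduct (rtAction G ℂ) ν) (x : σ.bimoduleCP μ) :
    ((σ.compactTriple μ hq).lsmul a x : σ.LinkingCP μ) = σ.jA μ ν hq a * x := by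
  apply σ.linkingOp_injective μ
  exact (σ.linkingOp_coe_eq μ hq _).trans <|
    (congrArg _ ((σ.compactTriple μ hq).πX_lsmul a x)).trans <|
    (expansion_mul_expansion (σ.isComponent_inclA μ hq).isometry _ _).symm.trans <|
    (congrArg₂ (· * ·) (σ.linkingOp_jA_eq μ hq a) (σ.linkingOp_coe_eq μ hq x)).symm.trans
      (σ.linkingOp_mul μ _ _).symm

theorem coe_rsmul (x : σ.bimoduleCP μ) (b : σ.TwistedCP μ) :
    ((σ.compactTriple μ hq).rsmul x b : σ.LinkingCP μ) = x * σ.jB μ b := by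
  apply σ.linkingOp_injective μ
  exact (σ.linkingOp_coe_eq μ hq _).trans <|
    (congrArg _ ((σ.compactTriple μ hq).πX_rsmul x b)).trans <|
    (expansion_mul_expansion (σ.isComponent_inclB μ).isometry _ _).symm.trans <|
    (congrArg₂ (· * ·) (σ.linkingOp_coe_eq μ hq x) (σ.linkingOp_jB_eq μ hq b)).symm.trans
      (σ.linkingOp_mul μ _ _).symm

theorem jA_linner (x y : σ.bimoduleCP μ) : σ.jA μ ν hq ((σ.compactTriple μ hq).linner x y) =
    (x : σ.LinkingCP μ) * star (y : σ.LinkingCP μ) := by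
  apply σ.linkingOp_injective μ
  exact (σ.linkingOp_jA_eq μ hq _).trans <|
    (congrArg _ ((σ.compactTriple μ hq).πA_linner x y)).trans <|
    (expansion_mul_expansion (σ.isComponent_inclB μ).isometry _ _).symm.trans <|
    (congrArg₂ (· * ·) (σ.linkingOp_coe_eq μ hq x) (σ.linkingOp_star_coe_eq μ hq y)).symm.trans
      (σ.linkingOp_mul μ _ _).symm

theorem jB_rinner (x y : σ.bimoduleCP μ) : σ.jB μ ((σ.compactTriple μ hq).rinner x y) =
    star (x : σ.LinkingCP μ) * (y : σ.LinkingCP μ) := by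
  apply σ.linkingOp_injective μ
  exact (σ.linkingOp_jB_eq μ hq _).trans <|
    (congrArg _ ((σ.compactTriple μ hq).πB_rinner x y)).trans <|
    (expansion_mul_expansion (σ.isComponent_inclA μ hq).isometry _ _).symm.trans <|
    (congrArg₂ (· * ·) (σ.linkingOp_star_coe_eq μ hq x) (σ.linkingOp_coe_eq μ hq y)).symm.trans
      (σ.linkingOp_mul μ _ _).symm

theorem dense_span_of_rankConv : Dense (Submodule.span ℂ
    {x : σ.LinkingCP μ | ∃ ξ η, x = Env.of _ (σ.rankConv μ ξ η)} : Set (σ.LinkingCP μ)) :=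
  Env.dense_span_of fun f _ hε => σ.dense_span_rankConv f hε

/-- The rank one elements span a dense subspace, and the compact operators are norm closed. -/
theorem isCompactOperator_linkingOp (e : σ.LinkingCP μ) : IsCompactOperator (σ.linkingOp μ e) := by
  have hc : IsClosed {e | IsCompactOperator (σ.linkingOp μ e)} :=
    (isClosed_setOfPred_isCompactOperator (σ₁₂ := RingHom.id ℂ) (M₁ := L2Pair μ)
      (M₂ := L2Pair μ)).preimage (Env.continuous_starHom (σ.linkingOp μ))
  have hle : Submodule.span ℂ {e : σ.LinkingCP μ | ∃ ξ η, e = Env.of _ (σ.rankConv μ ξ η)} ≤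
      (compactOperator (RingHom.id ℂ) (L2Pair μ) (L2Pair μ)).comap
        (σ.linkingOp μ : σ.LinkingCP μ →ₗ[ℂ] (L2Pair μ →L[ℂ] L2Pair μ)) := by
    refine Submodule.span_le.2 ?_
    rintro _ ⟨ξ, η, rfl⟩
    change IsCompactOperator (σ.linkingOp μ (Env.of _ (σ.rankConv μ ξ η)))
    rw [linkingOp_of, linkingHom_rankConv]
    exact isCompactOperator_rankOne _ _
  exact hc.closure_subset_iff.2 hle (σ.dense_span_of_rankConv μ e)

/-- The projection of `L²(G_σ) ⊕ L²(G_σ)` onto the equivariant vectors. -/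
def equivProj : L2Pair μ →L[ℂ] L2Pair μ :=
  σ.inclA μ hq ∘L (σ.inclA μ hq).adjoint + σ.inclB μ ∘L (σ.inclB μ).adjoint

theorem equivProj_pairL2 (ξ : σ.equivPair) :
    σ.equivProj μ hq (pairL2 μ ξ.1) = pairL2 μ ξ.1 := by
  obtain ⟨a, ha⟩ := (σ.isComponent_inclA μ hq).exists_eq ξ
  obtain ⟨b, hb⟩ := (σ.isComponent_inclB μ).exists_eq ξ
  have h : pairL2 μ ξ.1 = σ.inclA μ hq a + σ.inclB μ b := by
    rw [ha, hb, pairL2_compPair, pairL2_compPair]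
    refine PiLp.ext fun i => ?_
    rw [PiLp.add_apply, coordIncl_apply, coordIncl_apply, pairL2_apply]
    fin_cases i <;> simp
  have h1 : (σ.inclA μ hq).adjoint (σ.inclA μ hq a) = a :=
    DFunLike.congr_fun (σ.isComponent_inclA μ hq).isometry a
  have h2 : (σ.inclB μ).adjoint (σ.inclB μ b) = b :=
    DFunLike.congr_fun (σ.isComponent_inclB μ).isometry b
  have h3 : (σ.inclA μ hq).adjoint (σ.inclB μ b) = 0 :=
    DFunLike.congr_fun (σ.adjoint_inclA_comp_inclB μ hq) b
  have h4 : (σ.inclB μ).adjoint (σ.inclA μ hq a) = 0 :=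
    DFunLike.congr_fun (σ.adjoint_inclB_comp_inclA μ hq) a
  rw [h, equivProj, _root_.add_apply, ContinuousLinearMap.comp_apply,
    ContinuousLinearMap.comp_apply, map_add, map_add (σ.inclB μ).adjoint, h1, h2, h3, h4, add_zero,
    zero_add]

/-- The projection fixes every equivariant pair, and the represented operators are norm limits of
combinations of rank one operators between such pairs. So `L ⋊ G` lives on the equivariant vectors.
-/
theorem equivProj_comp_linkingOp (e : σ.LinkingCP μ) :
    σ.equivProj μ hq ∘L σ.linkingOp μ e = σ.linkingOp μ e := by
  let F : σ.LinkingCP μ →L[ℂ] (L2Pair μ →L[ℂ] L2Pair μ) :=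
    ⟨(σ.linkingOp μ : σ.LinkingCP μ →ₗ[ℂ] _), Env.continuous_starHom (σ.linkingOp μ)⟩
  have hF : ContinuousLinearMap.compL ℂ (L2Pair μ) (L2Pair μ) (L2Pair μ) (σ.equivProj μ hq) ∘L F =
      F := by
    refine ContinuousLinearMap.ext_on (σ.dense_span_of_rankConv μ) ?_
    rintro _ ⟨ξ, η, rfl⟩
    change σ.equivProj μ hq ∘L σ.linkingOp μ (Env.of _ (σ.rankConv μ ξ η)) =
      σ.linkingOp μ (Env.of _ (σ.rankConv μ ξ η))
    rw [linkingOp_of, linkingHom_rankConv]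
    ext1 ζ
    rw [ContinuousLinearMap.comp_apply, InnerProductSpace.rankOne_apply, map_smul,
      equivProj_pairL2]
  exact DFunLike.congr_fun hF e

theorem adjoint_equivProj : (σ.equivProj μ hq).adjoint = σ.equivProj μ hq := by
  rw [equivProj, map_add, ContinuousLinearMap.adjoint_comp, ContinuousLinearMap.adjoint_comp,
    ContinuousLinearMap.adjoint_adjoint, ContinuousLinearMap.adjoint_adjoint]

theorem linkingOp_comp_equivProj (e : σ.LinkingCP μ) :
    σ.linkingOp μ e ∘L σ.equivProj μ hq = σ.linkingOp μ e := by
  apply ContinuousLinearMap.adjoint.injective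
  rw [ContinuousLinearMap.adjoint_comp, adjoint_equivProj, ← linkingOp_star,
    equivProj_comp_linkingOp]

set_option maxHeartbeats 1000000 in
theorem exists_eq_corners (e : σ.LinkingCP μ) : ∃ a x y b,
    e = σ.jA μ ν hq a + (x : σ.bimoduleCP μ) + star ((y : σ.bimoduleCP μ) : σ.LinkingCP μ) +
      σ.jB μ b := by
  have hc := σ.isCompactOperator_linkingOp μ
  obtain ⟨a, ha⟩ := (σ.compactTriple μ hq).exists_A
    (compression (σ.inclA μ hq) (σ.inclA μ hq) (σ.linkingOp μ e))
    (((hc e).comp_clm (σ.inclA μ hq)).clm_comp (σ.inclA μ hq).adjoint)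
  obtain ⟨x, hx⟩ := (σ.compactTriple μ hq).exists_X
    (compression (σ.inclA μ hq) (σ.inclB μ) (σ.linkingOp μ e))
    (((hc e).comp_clm (σ.inclB μ)).clm_comp (σ.inclA μ hq).adjoint)
  -- The lower left block of `e` is the adjoint of the upper right block of `star e`, so `y` is
  -- found from the latter.
  obtain ⟨y, hy⟩ := (σ.compactTriple μ hq).exists_X
    (compression (σ.inclA μ hq) (σ.inclB μ) (σ.linkingOp μ (star e)))
    (((hc (star e)).comp_clm (σ.inclB μ)).clm_comp (σ.inclA μ hq).adjoint)
  obtain ⟨b, hb⟩ := (σ.compactTriple μ hq).exists_B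
    (compression (σ.inclB μ) (σ.inclB μ) (σ.linkingOp μ e))
    (((hc e).comp_clm (σ.inclB μ)).clm_comp (σ.inclB μ).adjoint)
  have ha' := (σ.linkingOp_jA_eq μ hq a).trans (congrArg _ ha)
  have hx' := (σ.linkingOp_coe_eq μ hq x).trans (congrArg _ hx)
  have hb' := (σ.linkingOp_jB_eq μ hq b).trans (congrArg _ hb)
  have he : (σ.linkingOp μ (star e)).adjoint = σ.linkingOp μ e :=
    (congrArg _ (σ.linkingOp_star μ e)).trans (ContinuousLinearMap.adjoint_adjoint _)
  have hy' := (σ.linkingOp_star_coe_eq μ hq y).trans (congrArg _ ((congrArg _ hy).trans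
    ((adjoint_compression _ _ _).trans (congrArg _ he))))
  refine ⟨a, x, y, b, σ.linkingOp_injective μ ?_⟩
  refine (eq_sum_expansion (σ.equivProj_comp_linkingOp μ hq e)
    (σ.linkingOp_comp_equivProj μ hq e)).trans (Eq.symm ?_)
  exact (σ.linkingOp_add μ _ _).trans (congrArg₂ (· + ·) ((σ.linkingOp_add μ _ _).trans
    (congrArg₂ (· + ·) ((σ.linkingOp_add μ _ _).trans (congrArg₂ (· + ·) ha' hx')) hy')) hb')

end Twist

/-! ### Integral formulas and nontriviality of the Hilbert spaces -/

namespace Twist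

variable {G Gσ : Type*}
  [TopologicalSpace G] [Group G] [IsTopologicalGroup G] [LocallyCompactSpace G] [T2Space G]
  [TopologicalSpace Gσ] [Group Gσ] [IsTopologicalGroup Gσ] [LocallyCompactSpace Gσ] [T2Space Gσ]
  (σ : Twist G Gσ) [MeasurableSpace G] [BorelSpace G]
  [MeasurableSpace Gσ] [BorelSpace Gσ] (μ : Measure Gσ) [IsHaarMeasure μ] [μ.Regular]
  {ν : Measure G} [IsHaarMeasure ν] [ν.Regular] (hq : MeasurePreserving σ.q μ ν)

theorem pullL2_mulOp (a : C₀(G, ℂ)) (η : Lp ℂ 2 ν) :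
    σ.pullL2 μ hq (mulOp ν a η) = mulOp μ (σ.pull a) (σ.pullL2 μ hq η) := by
  refine Lp.ext ?_
  filter_upwards [σ.pullL2_ae μ hq (mulOp ν a η), mulOp_ae μ (σ.pull a) (σ.pullL2 μ hq η),
    σ.pullL2_ae μ hq η, hq.quasiMeasurePreserving.ae (mulOp_ae ν a η)] with s h1 h2 h3 h4
  rw [h1, h2, h3, h4]
  rfl

theorem pullL2_rho (s : Gσ) (η : Lp ℂ 2 ν) :
    σ.pullL2 μ hq (rho ν (σ.q s) η) = rho μ s (σ.pullL2 μ hq η) := by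
  refine Lp.ext ?_
  filter_upwards [σ.pullL2_ae μ hq (rho ν (σ.q s) η), rho_ae μ s (σ.pullL2 μ hq η),
    (quasiMeasurePreserving_mul_right' μ s).ae (σ.pullL2_ae μ hq η),
    hq.quasiMeasurePreserving.ae (rho_ae ν (σ.q s) η)] with t h1 h2 h3 h4
  rw [h1, h2, h3, h4, modularΔ_comp σ.q σ.continuous_q σ.tendsto_q hq, map_mul]

theorem adjoint_inclA (ζ : L2Pair μ) : (σ.inclA μ hq).adjoint ζ =
    (σ.pullL2 μ hq).toContinuousLinearMap.adjoint (ζ 0) :=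
  ext_inner_left ℂ fun ξ => by
    rw [ContinuousLinearMap.adjoint_inner_right, ContinuousLinearMap.adjoint_inner_right,
      inclA_apply, inner_coordIncl]
    rfl

theorem adjoint_pullL2 (η : Lp ℂ 2 ν) :
    (σ.pullL2 μ hq).toContinuousLinearMap.adjoint (σ.pullL2 μ hq η) = η :=
  ext_inner_left ℂ fun ξ => by
    rw [ContinuousLinearMap.adjoint_inner_right]
    exact (σ.pullL2 μ hq).inner_map_map ξ η

theorem adjoint_inclB (ζ : L2Pair μ) (η : σ.L2iota μ) (h : ζ 1 = η) :
    (σ.inclB μ).adjoint ζ = η :=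
  ext_inner_left ℂ fun ξ => by
    rw [ContinuousLinearMap.adjoint_inner_right, inclB_apply, inner_coordIncl, h]
    rfl

theorem compression_linkingHom {H H' : Type*} [NormedAddCommGroup H] [InnerProductSpace ℂ H]
    [CompleteSpace H] [NormedAddCommGroup H'] [InnerProductSpace ℂ H'] [CompleteSpace H']
    (I : H →L[ℂ] L2Pair μ) (I' : H' →L[ℂ] L2Pair μ) (f : σ.linkingTwisted.twistedConv μ) (ξ : H') :
    compression I I' (σ.linkingHom μ f) ξ =
      ∫ s, I.adjoint (matMul μ (f.1 s).1 (rhoPair μ s (I' ξ))) ∂μ := by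
  rw [ContinuousLinearMap.integral_comp_comm _ (σ.integrable_linkingHom μ f (I' ξ)),
    ← linkingHom_apply]
  rfl

theorem integrable_mulOp_rho (f : Conv (rtAction G ℂ) ν) (ξ : Lp ℂ 2 ν) :
    Integrable (fun g => mulOp ν (f g) (rho ν g ξ)) ν :=
  (((Env.continuous_starHom (mulHom ν)).comp f.continuous).clm_apply
    (continuous_rho ν ξ)).integrable_of_hasCompactSupport
    (HasCompactSupport.intro f.hasCompactSupport fun g hg => by
      change mulHom ν (f g) (rho ν g ξ) = 0
      rw [image_eq_zero_of_notMem_tsupport hg, map_zero, _root_.zero_apply])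

/-- The isometry `η ↦ η ∘ q` intertwines multiplication and translation on `G` with those on `G_σ`,
and `q` carries the integral over `G_σ` to the one over `G`. -/
theorem compactTriple_πA (f : Conv (rtAction G ℂ) ν) (ξ : Lp ℂ 2 ν) :
    (σ.compactTriple μ hq).πA (Env.of (Conv.l1Norm (rtAction G ℂ) ν) f) ξ =
      ∫ s, mulOp ν (f s) (rho ν s ξ) ∂ν := by
  have h1 : (σ.compactTriple μ hq).πA (Env.of (Conv.l1Norm (rtAction G ℂ) ν) f) =
      compression (σ.inclA μ hq) (σ.inclA μ hq) (σ.linkingHom μ (σ.jAConv μ ν hq f)) :=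
    congrArg (compression (σ.inclA μ hq) (σ.inclA μ hq))
      ((congrArg (σ.linkingOp μ) (σ.jA_of hq f)).trans (σ.linkingOp_of μ _))
  have h2 := integral_map (μ := μ) (φ := σ.q) hq.measurable.aemeasurable
    (f := fun g => mulOp ν (f g) (rho ν g ξ)) (by
      rw [hq.map_eq]; exact (integrable_mulOp_rho f ξ).aestronglyMeasurable)
  rw [hq.map_eq] at h2
  rw [h1, compression_linkingHom, h2]
  refine integral_congr_ae (Eventually.of_forall fun s => ?_)
  dsimp only
  rw [inclA_apply, rhoPair_coordIncl, adjoint_inclA, matMul_coordIncl, jAConv_apply, ← pullL2_rho]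
  have h3 : entry 0 0 (σ.corner 0 (f (σ.q s))).1 = σ.pull (f (σ.q s)) :=
    DFunLike.ext _ _ fun t => by
      rw [entry_apply, corner_apply, Matrix.single_apply_same]; rfl
  rw [h3, ← pullL2_mulOp, adjoint_pullL2]

/-- The integrand is invariant under `s ↦ ι(z)s`, because `f` contributes `z̄` and the translation
of `η` contributes `z`. Since `q` preserves measure, the integral over `G_σ` stands for the one over
`G`. -/
theorem compactTriple_πX (f : σ.ccIota) (η : σ.L2iota μ) :
    (σ.compactTriple μ hq).πX (σ.ofX μ f) η =
      ∫ s, σ.Lsigma μ ν hq (f.1 s) (σ.rhoSigma μ s η) ∂μ := by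
  have h1 : (σ.compactTriple μ hq).πX (σ.ofX μ f) =
      compression (σ.inclA μ hq) (σ.inclB μ) (σ.linkingHom μ (σ.jXConv μ f)) :=
    congrArg (compression (σ.inclA μ hq) (σ.inclB μ)) (σ.linkingOp_of μ _)
  rw [h1, compression_linkingHom]
  refine integral_congr_ae (Eventually.of_forall fun s => ?_)
  dsimp only
  rw [inclB_apply, rhoPair_coordIncl, adjoint_inclA, matMul_coordIncl, jXConv_apply]
  have h3 : entry 0 1 (σ.offCorner (f.1 s)).1 = (f.1 s).1 :=
    DFunLike.ext _ _ fun t => by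
      rw [entry_apply, offCorner_apply, Matrix.single_apply_same]
  rw [h3]
  rfl

theorem compactTriple_πB (f : σ.rtTwisted.twistedConv μ) (η : σ.L2iota μ) :
    (σ.compactTriple μ hq).πB (Env.of (σ.rtTwisted.l1Norm μ) f) η =
      ∫ s, σ.Msigma μ (f.1 s) (σ.rhoSigma μ s η) ∂μ := by
  have h1 : (σ.compactTriple μ hq).πB (Env.of (σ.rtTwisted.l1Norm μ) f) =
      compression (σ.inclB μ) (σ.inclB μ) (σ.linkingHom μ (σ.jBConv μ f)) :=
    congrArg (compression (σ.inclB μ) (σ.inclB μ))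
      ((congrArg (σ.linkingOp μ) (σ.jB_of f)).trans (σ.linkingOp_of μ _))
  rw [h1, compression_linkingHom]
  refine integral_congr_ae (Eventually.of_forall fun s => ?_)
  dsimp only
  refine σ.adjoint_inclB μ _ _ ?_
  rw [inclB_apply, rhoPair_coordIncl, matMul_coordIncl, jBConv_apply]
  have h3 : entry 1 1 (σ.corner 1 (f.1 s)).1 = σ.pull (f.1 s) :=
    DFunLike.ext _ _ fun t => by
      rw [entry_apply, corner_apply, Matrix.single_apply_same]; rfl
  rw [h3]
  rfl

theorem ccL2_ne_zero {H : Type*} [TopologicalSpace H] [Group H] [IsTopologicalGroup H]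
    [LocallyCompactSpace H] [T2Space H] [MeasurableSpace H] [BorelSpace H] (μ : Measure H)
    [IsHaarMeasure μ] {φ : ccSubmodule H ℂ} {s : H} (h : φ.1 s ≠ 0) : ccL2 μ φ ≠ 0 := fun h0 => by
  have h1 : φ.1 =ᵐ[μ] fun _ => 0 := (ccL2_ae μ φ).symm.trans (by
    rw [h0]; exact Lp.coeFn_zero ℂ 2 μ)
  exact h (congrFun ((Continuous.ae_eq_iff_eq μ φ.2.1 continuous_const).1 h1) s)

theorem nontrivial_L2 (ν : Measure G) [IsHaarMeasure ν] : Nontrivial (Lp ℂ 2 ν) := by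
  obtain ⟨f, hf, -, hf1⟩ := exists_continuous_nonneg_pos (1 : G)
  let φ : ccSubmodule G ℂ := ⟨fun s => (f s : ℂ), Complex.continuous_ofReal.comp f.continuous,
    hasCompactSupport_ofReal hf⟩
  exact ⟨ccL2 ν φ, 0, ccL2_ne_zero ν (s := 1) (Complex.ofReal_ne_zero.2 hf1)⟩

/-- Averaging a function against a nontrivial character could give zero. Starting from a function
which is 1 at the identity and vanishes on `ι(z)` whenever `Re z ≤ 0`, the real part of the average
at 1 is the integral of a nonnegative function that is positive at `z = 1`. -/
theorem nontrivial_L2iota : Nontrivial (σ.L2iota μ) := by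
  have hcre : Continuous fun z : Circle => (z : ℂ).re := by fun_prop
  have hclosed : IsClosed (σ.ι '' {z : Circle | (z : ℂ).re ≤ 0}) :=
    ((isClosed_le hcre continuous_const).isCompact.image σ.continuous_ι).isClosed
  -- Injectivity of `ι` enters here: only `z = 1` is mapped to the identity.
  have hdisj : Disjoint {1} (σ.ι '' {z : Circle | (z : ℂ).re ≤ 0}) := by
    rw [Set.disjoint_singleton_left]
    rintro ⟨z, hz, h1⟩
    have h2 : z = 1 := σ.injective_ι (by rw [h1, map_one])
    subst h2
    norm_num at hz
  obtain ⟨f, hf1, hf0, hfc, hfI⟩ :=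
    exists_continuous_one_zero_of_isCompact isCompact_singleton hclosed hdisj
  let φ : ccSubmodule Gσ ℂ := ⟨fun s => (f s : ℂ), Complex.continuous_ofReal.comp f.continuous,
    hasCompactSupport_ofReal hfc⟩
  have hint : Integrable (fun z : Circle => star (![1, (z : ℂ)] 1) * φ.1 (1 * σ.ι z)) circleHaar :=
    ((σ.continuous_average_integrand 1 φ.2.1).comp
      (Continuous.prodMk_right (1 : Gσ))).integrable_of_hasCompactSupport
      (HasCompactSupport.of_compactSpace _)
  have hre : (σ.average 1 φ.1 1).re = ∫ z : Circle, (z : ℂ).re * f (σ.ι z) ∂circleHaar := by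
    refine (integral_re hint).symm.trans (integral_congr_ae (Eventually.of_forall fun z => ?_))
    simp [φ]
  have hpos : 0 < (σ.average 1 φ.1 1).re := by
    rw [hre]
    refine Continuous.integral_pos_of_hasCompactSupport_nonneg_nonzero
      (hcre.mul (f.continuous.comp σ.continuous_ι))
      (HasCompactSupport.of_compactSpace _) (fun z => ?_) (x := 1) ?_
    · rcases le_or_gt (z : ℂ).re 0 with hz | hz
      · simp [hf0 ⟨z, hz, rfl⟩]
      · exact mul_nonneg hz.le (hfI _).1
    · simp [hf1 rfl]
  have hne : ccL2 μ (σ.ccAverage 1 φ) ≠ 0 := ccL2_ne_zero μ (s := 1) fun h => by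
    change σ.average 1 φ.1 1 = 0 at h
    rw [h] at hpos
    exact lt_irrefl _ hpos
  refine ⟨⟨ccL2 μ (σ.ccAverage 1 φ), (σ.mem_L2iota_iff μ).2 fun z => ?_⟩, 0, fun h =>
    hne (congrArg Subtype.val h)⟩
  rw [rho_ccL2, ← map_smul]
  congr 1
  exact Subtype.ext ((σ.rho_ι_ccL2 z _).trans (funext fun t => σ.average_mul_ι 1 φ.1 t z))

theorem isCornerBimodule [Nontrivial (Lp ℂ 2 ν)] [Nontrivial (σ.L2iota μ)] :
    σ.IsCornerBimodule μ ν hq (σ.compactTriple μ hq).bimodule where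
  coe_lsmul := σ.coe_lsmul μ hq
  coe_rsmul := σ.coe_rsmul μ hq
  jA_linner := σ.jA_linner μ hq
  jB_rinner := σ.jB_rinner μ hq
  injective_jA := (injective_iff_map_eq_zero _).2 fun a ha => by
    rw [← norm_eq_zero, ← σ.norm_jA hq, ha, norm_zero]
  injective_jB := (injective_iff_map_eq_zero _).2 fun b hb => by
    rw [← norm_eq_zero, ← σ.norm_jB, hb, norm_zero]
  exists_eq := σ.exists_eq_corners μ hq

end Twist

end TwistCP

end

theorem mainTheorem3 {G Gσ : Type*}
    [TopologicalSpace G] [Group G] [IsTopologicalGroup G] [LocallyCompactSpace G] [T2Space G]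
    [MeasurableSpace G] [BorelSpace G]
    [TopologicalSpace Gσ] [Group Gσ] [IsTopologicalGroup Gσ] [LocallyCompactSpace Gσ] [T2Space Gσ]
    [MeasurableSpace Gσ] [BorelSpace Gσ]
    (σ : TwistCP.Twist G Gσ)
    (ν : MeasureTheory.Measure G) [ν.IsHaarMeasure] [ν.Regular]
    (μ : MeasureTheory.Measure Gσ) [μ.IsHaarMeasure] [μ.Regular]
    (hq : MeasureTheory.MeasurePreserving σ.q μ ν) :
    (∀ (f : σ.C0iota) (ξ : σ.L2iota μ),
      (fun s => σ.Lsigma μ ν hq f ξ (σ.q s)) =ᵐ[μ]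
        fun s => f.1 s * (ξ : MeasureTheory.Lp ℂ 2 μ) s) ∧
    ∃ (𝒳 : TwistCP.ImprimitivityBimodule
          (TwistCP.CrossedProduct (TwistCP.rtAction G ℂ) ν) (σ.bimoduleCP μ) (σ.TwistedCP μ))
      (R : 𝒳.Rep (MeasureTheory.Lp ℂ 2 ν) (σ.L2iota μ)),
      σ.IsCornerBimodule μ ν hq 𝒳 ∧
      (∀ (f : TwistCP.Conv (TwistCP.rtAction G ℂ) ν) (ξ : MeasureTheory.Lp ℂ 2 ν),
        R.πA (TwistCP.Env.of (TwistCP.Conv.l1Norm (TwistCP.rtAction G ℂ) ν) f) ξ =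
          ∫ s, TwistCP.mulOp ν (f s) (TwistCP.rho ν s ξ) ∂ν) ∧
      (∀ (f : σ.ccIota) (η : σ.L2iota μ),
        R.πX (σ.ofX μ f) η = ∫ s, σ.Lsigma μ ν hq (f.1 s) (σ.rhoSigma μ s η) ∂μ) ∧
      (∀ (f : σ.rtTwisted.twistedConv μ) (η : σ.L2iota μ),
        R.πB (TwistCP.Env.of (σ.rtTwisted.l1Norm μ) f) η =
          ∫ s, σ.Msigma μ (f.1 s) (σ.rhoSigma μ s η) ∂μ) ∧
      R.IsIsoCompacts ∧ R.ExtendsToMultipliers := by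
  -- Both Hilbert spaces must be nonzero for the two inner products of the transported bimodule to
  -- be full.
  have := TwistCP.Twist.nontrivial_L2 ν
  have := σ.nontrivial_L2iota μ
  exact ⟨σ.Lsigma_ae μ hq, (σ.compactTriple μ hq).bimodule, (σ.compactTriple μ hq).rep,
    σ.isCornerBimodule μ hq, σ.compactTriple_πA μ hq, σ.compactTriple_πX μ hq,
    σ.compactTriple_πB μ hq, (σ.compactTriple μ hq).isIsoCompacts_rep,
    (σ.compactTriple μ hq).extendsToMultipliers_rep⟩
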